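/- **Setting.** Let $\mathcal C$ be a bicategory and $W$ a class of $1$-morphisms such that $(\mathcal C,W)$ admits a right bicalculus of fractions (associators and unitors of $\mathcal C$ are omitted from the formulas): - (BF1) all identities are in $W$; (BF2) $W$ is closed under composition; (BF5) if $w\in W$ and there is an invertible $v\Rightarrow w$, then $v\in W$; - (BF3) for $w:A\to B$ in $W$ and $f:C\to B$ there are $w':D\to C$ in $W$, $f':D\to A$ and an invertible $\alpha:f\circ w'\Rightarrow w\circ f'$; - (BF4) for $w:B\to A$ in $W$, $f^1,f^2:C\to B$ and $\alpha:w\circ f^1\Rightarrow w\circ f^2$ there are $v:D\to C$ in $W$ and $\beta:f^1\circ v\Rightarrow f^2\circ v$ with $\alpha\circ v=w\circ\beta$, with $\beta$ invertible if $\alpha$ is; and for any two such pairs $(v,\beta)$, $(v',\beta')$, $v:D\to C$, $v':D'\to C$ in $W$, there are $u:E\to D$, $u':E\to D'$ and an invertible $\zeta:v\circ u\Rightarrow v'\circ u'$ with $v\circ u\in W$ and $(\beta'\circ u')\cdot(f^1\circ\zeta)=(f^2\circ\zeta)\cdot(\beta\circ u)$. A *set of choices* $c$ assigns to each pair $(f:A'\to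 B,\ v:B'\to B)$ with $v\in W$ data $(A'',v',f',\rho)$ as in (BF3): $v':A''\to A'$ in $W$, $f':A''\to B'$, $\rho:f\circ v'\Rightarrow v\circ f'$ invertible (for instance chosen pullbacks or chosen iso-comma squares). **The bicategory $\mathcal C[W^{-1}]$ for $c$.** Objects are those of $\mathcal C$. A $1$-morphism $A\to B$ is a triple $(A',w,f)$ with $w:A'\to A$ in $W$ and $f:A'\to B$; the identity of $A$ is $(A,\mathrm{id},\mathrm{id})$; the composite of $(A',w,f):A\to B$ and $(B',v,g):B\to C$ is $(A'',w\circ v',g\circ f')$, where $(A'',v',f',\rho)=c(f,v)$. A $2$-morphism $(A^1,w^1,f^1)\Rightarrow(A^2,w^2,f^2)$ is a class $[A^3,v^1,v^2,\alpha,\beta]$ with $v^m:A^3\to A^m$, $w^1\circ v^1\in W$, $\alpha:w^1\circ v^1\Rightarrow w^2\circ v^2$ invertible and $\beta:f^1\circ v^1\Rightarrow f^2\circ v^2$; such data are identified with $(A'^3,v'^1,v'^2,\alpha',\beta')$ if there are $z:A^4\to A^3$, $z':A^4\to A'^3$ and invertible $\sigma^1:v'^1\circ z'\Rightarrow v^1\circ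 z$, $\sigma^2:v^2\circ z\Rightarrow v'^2\circ z'$ with $w^1\circ v^1\circ z\in W$, $(w^2\sigma^2)(\alpha z)(w^1\sigma^1)=\alpha'z'$ and $(f^2\sigma^2)(\beta z)(f^1\sigma^1)=\beta'z'$. The identity $2$-morphism of $(A',w,f)$ is $[A',\mathrm{id},\mathrm{id},\mathrm{id},\mathrm{id}]$. The unitors of $\underline f=(A',w,f)$ are $[A'',\mathrm{id},f',\rho,\mathrm{id}]:\underline f\circ\mathrm{id}\Rightarrow\underline f$ for $(A'',v',f',\rho)=c(\mathrm{id},w)$ and $[A'',\mathrm{id},v',\mathrm{id},\rho^{-1}]:\mathrm{id}\circ\underline f\Rightarrow\underline f$ for $(A'',v',f',\rho)=c(f,\mathrm{id})$. The remaining operations are described by auxiliary data in $\mathcal C$ (all $2$-morphisms below are invertible except $\beta,\beta^m,\lambda$ and those built from them): - *Vertical composition* of $[A^4,u^1,u^2,\alpha^1,\beta^1]:\underline f^1\Rightarrow\underline f^2$ and $[A^5,u^3,u^4,\alpha^2,\beta^2]:\underline f^2\Rightarrow\underline f^3$: take $t^1:E\to A^4$ in $W$, $t^2:E\to A^5$,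 $\rho:u^2t^1\Rightarrow u^3t^2$; the result is $[E,u^1t^1,u^4t^2,(\alpha^2t^2)(w^2\rho)(\alpha^1t^1),(\beta^2t^2)(f^2\rho)(\beta^1t^1)]$. - *$\Delta\circ\underline f$*, for $\underline f=(A',w,f)$, $\Delta=[B^3,u^1,u^2,\alpha,\beta]:(B^1,v^1,g^1)\Rightarrow(B^2,v^2,g^2)$ and $c(f,v^m)=(D^m,w^m,f^m,\rho^m)$: take $t^1:D^3\to D^1$, $t^2:D^4\to D^2$, $t^3:D^5\to D^3$ in $W$, $h^1:D^3\to B^3$, $h^2:D^4\to B^3$, $t^4:D^5\to D^4$, $\sigma^1:f^1t^1\Rightarrow u^1h^1$, $\sigma^2:f^2t^2\Rightarrow u^2h^2$, $\varphi:w^1t^1t^3\Rightarrow w^2t^2t^4$ and $\delta:h^1t^3\Rightarrow h^2t^4$ with $v^1u^1\delta=(\alpha^{-1}h^2t^4)(v^2\sigma^2t^4)(\rho^2t^2t^4)(f\varphi)((\rho^1)^{-1}t^1t^3)(v^1(\sigma^1)^{-1}t^3)$; the result is $[D^5,t^1t^3,t^2t^4,w\varphi,(g^2(\sigma^2)^{-1}t^4)(\beta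 h^2t^4)(g^1u^1\delta)(g^1\sigma^1t^3)]$. - *$\underline g\circ\Gamma$*, for $\underline g=(B',u,g)$, $\Gamma=[A^3,v^1,v^2,\alpha,\beta]:(A^1,w^1,f^1)\Rightarrow(A^2,w^2,f^2)$ and $c(f^m,u)=(D^m,u^m,h^m,\rho^m)$: take $u^3:D^3\to A^3$, $u^5:D^4\to A^3$, $u^7:D^5\to D^3$ in $W$, $u^4:D^3\to D^1$, $u^6:D^4\to D^2$, $u^8:D^5\to D^4$, $\eta^1:v^1u^3\Rightarrow u^1u^4$, $\eta^2:v^2u^5\Rightarrow u^2u^6$, $\eta^3:u^3u^7\Rightarrow u^5u^8$ and $\lambda:h^1u^4u^7\Rightarrow h^2u^6u^8$ with $u\lambda=(\rho^2u^6u^8)(f^2\eta^2u^8)(\beta u^5u^8)(f^1v^1\eta^3)(f^1(\eta^1)^{-1}u^7)((\rho^1)^{-1}u^4u^7)$; the result is $[D^5,u^4u^7,u^6u^8,(w^2\eta^2u^8)(\alpha u^5u^8)(w^1v^1\eta^3)(w^1(\eta^1)^{-1}u^7),g\lambda]$. - *Associator* $\underline h\circ(\underline g\circ\underline f)\Rightarrow(\underline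 h\circ\underline g)\circ\underline f$, for $\underline f=(A',u,f)$, $\underline g=(B',v,g)$, $\underline h=(C',w,h)$, $c(f,v)=(A^1,u^1,f^1,\delta)$, $c(gf^1,w)=(A^2,u^2,l,\sigma)$, $c(g,w)=(B^2,v^1,g^1,\xi)$, $c(f,vv^1)=(A^3,u^3,f^2,\eta)$: take $u^4:A^4\to A^2$ with $uu^1u^2u^4\in W$, $u^5:A^4\to A^3$, $\gamma:u^1u^2u^4\Rightarrow u^3u^5$, $\omega:f^1u^2u^4\Rightarrow v^1f^2u^5$ with $v\omega=(\eta u^5)(f\gamma)(\delta^{-1}u^2u^4)$, and $\rho:lu^4\Rightarrow g^1f^2u^5$ with $w\rho=(\xi f^2u^5)(g\omega)(\sigma^{-1}u^4)$; the result is $[A^4,u^4,u^5,u\gamma,h\rho]$. **Statement.** The construction of $\mathcal C[W^{-1}]$ does not depend on the axiom of choice as soon as a set of choices $c$ is given (canonical choice) or is unique. Precisely: (1) *(Canonical choice.)* There is a fixed finite family $\Phi$ of first-order formulas without parameters, in the one-sorted language whose symbols are the primitive notions of a bicategory (source, target, identities, compositions, whiskerings, associators, unitors), a predicate for $W$ and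 a relation symbol for the graph of $c$, such that for every $(\mathcal C,W)$ satisfying (BF1)–(BF5) and every set of choices $c$: the above relation on data representing $2$-morphisms is an equivalence relation; for all representatives the auxiliary data above exist; and there are operations (identities, vertical composition, whiskerings with $1$-morphisms on both sides, associators, unitors) on these classes such that - (a) they are given by the above recipes for *any* representatives and *any* auxiliary data, and they make $\mathcal C[W^{-1}]$ a bicategory; - (b) any operations whose identities and unitors are as above and each of whose other values is obtained from *some* representatives and *some* auxiliary data (i.e. by making all further choices in whatever way) coincide with them; - (c) the formulas $\Phi$, interpreted in the cells of $\mathcal C$, define the $1$-morphisms of $\mathcal C[W^{-1}]$ and their identities and compositions, the representatives of $2$-morphisms and their equivalence, and the graphs (on representatives) of all the operations. Thus every ingredient of $\mathcal C[W^{-1}]$ is explicitly defined, not chosen. (2) *(Unique choice.)* There is likewise a fixed family $\Phi$ of formulas in the same language without the symbol for $c$, such that for every $(\mathcal C,W)$ satisfying (BF1)–(BF5) for which each pair $(f,v)$ with $v\in W$ has exactly one $(A'',v',f',\rho)$ as above, there is exactly one set of choices $c$, and the conclusions of (1) hold for it with this $\Phi$. -/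

import Mathlib

open CategoryTheory Bicategory

universe w v u

namespace BicatFrac

/-! Mathlib composes in diagrammatic order: the composite `g ∘ f` is written `f ≫ g`, and the
composites of 2-cells written with `⊗≫`, `≪⊗≫` have the associators and unitors of the bicategory
inserted wherever they are needed. -/

section Axioms

variable {C : Type u} [Bicategory.{w, v} C]

/-- `(D, v, β)` lifts the 2-cell `α : w ∘ f₁ ⇒ w ∘ f₂` if `α ∘ v = w ∘ β`. -/
def IsLift {A B X D : C} {w : B ⟶ A} {f₁ f₂ : X ⟶ B} (α : f₁ ≫ w ⟶ f₂ ≫ w)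
    (v : D ⟶ X) (β : v ≫ f₁ ⟶ v ≫ f₂) : Prop :=
  v ◁ α = (α_ v f₁ w).inv ≫ β ▷ w ≫ (α_ v f₂ w).hom

/-- The pair `(C, W)` admits a (right) bicalculus of fractions. -/
structure Bicalculus (W : MorphismProperty C) : Prop where
  /-- BF1 -/
  id_mem : ∀ A : C, W (𝟙 A)
  /-- BF2 -/
  comp_mem : ∀ {A B D : C} (f : A ⟶ B) (g : B ⟶ D), W f → W g → W (f ≫ g)
  /-- BF3 -/
  square : ∀ {A B X : C} (w : A ⟶ B) (f : X ⟶ B), W w →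
    ∃ (D : C) (w' : D ⟶ X) (f' : D ⟶ A), W w' ∧ Nonempty (w' ≫ f ≅ f' ≫ w)
  /-- BF4a and BF4b -/
  lift : ∀ {A B X : C} (w : B ⟶ A) (f₁ f₂ : X ⟶ B) (α : f₁ ≫ w ⟶ f₂ ≫ w), W w →
    ∃ (D : C) (v : D ⟶ X) (β : v ≫ f₁ ⟶ v ≫ f₂), W v ∧ IsLift α v β ∧ (IsIso α → IsIso β)
  /-- BF4c -/
  lift_unique : ∀ {A B X : C} (w : B ⟶ A) (f₁ f₂ : X ⟶ B) (α : f₁ ≫ w ⟶ f₂ ≫ w), W w →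
    ∀ (D D' : C) (v : D ⟶ X) (v' : D' ⟶ X) (β : v ≫ f₁ ⟶ v ≫ f₂) (β' : v' ≫ f₁ ⟶ v' ≫ f₂),
      W v → IsLift α v β → W v' → IsLift α v' β' →
      ∃ (E : C) (u : E ⟶ D) (u' : E ⟶ D') (ζ : u ≫ v ≅ u' ≫ v'), W (u ≫ v) ∧
        ζ.hom ▷ f₁ ≫ (α_ u' v' f₁).hom ≫ u' ◁ β' =
          (α_ u v f₁).hom ≫ u ◁ β ≫ (α_ u v f₂).inv ≫ ζ.hom ▷ f₂ ≫ (α_ u' v' f₂).hom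
  /-- BF5 -/
  iso_mem : ∀ {A B : C} {v w : A ⟶ B}, (v ≅ w) → W w → W v

/-- Data as in BF3 for the pair `(f, v)`. -/
structure Square (W : MorphismProperty C) {A' B B' : C} (f : A' ⟶ B) (v : B' ⟶ B) where
  obj : C
  v' : obj ⟶ A'
  f' : obj ⟶ B'
  mem : W v'
  ρ : v' ≫ f ≅ f' ≫ v

/-- A set of choices `C(W)`: data as in BF3 for each pair `(f, v)` with `v` in `W`. -/
def Choices (W : MorphismProperty C) : Type _ :=
  ∀ ⦃A' B B' : C⦄ (f : A' ⟶ B) (v : B' ⟶ B), W v → Square W f v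

end Axioms

section Cells

variable {C : Type u} [Bicategory.{w, v} C] {W : MorphismProperty C}

/-- 1-morphisms `A ⟵ obj ⟶ B` of the bicategory of fractions. -/
structure Frac (W : MorphismProperty C) (A B : C) where
  obj : C
  w : obj ⟶ A
  mem : W w
  f : obj ⟶ B

/-- Data representing a 2-morphism of the bicategory of fractions. -/
structure Rep {A B : C} (F G : Frac W A B) where
  obj : C
  v₁ : obj ⟶ F.obj
  v₂ : obj ⟶ G.obj
  mem : W (v₁ ≫ F.w)
  α : v₁ ≫ F.w ≅ v₂ ≫ G.w
  β : v₁ ≫ F.f ⟶ v₂ ≫ G.f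

/-- Two sets of data represent the same 2-morphism. -/
def Rep.Equiv {A B : C} {F G : Frac W A B} (r r' : Rep F G) : Prop :=
  ∃ (E : C) (z : E ⟶ r.obj) (z' : E ⟶ r'.obj)
    (σ₁ : z' ≫ r'.v₁ ≅ z ≫ r.v₁) (σ₂ : z ≫ r.v₂ ≅ z' ≫ r'.v₂),
    W (z ≫ r.v₁ ≫ F.w) ∧
    σ₁.hom ▷ F.w ⊗≫ z ◁ r.α.hom ⊗≫ σ₂.hom ▷ G.w =
      (α_ z' r'.v₁ F.w).hom ≫ z' ◁ r'.α.hom ≫ (α_ z' r'.v₂ G.w).inv ∧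
    σ₁.hom ▷ F.f ⊗≫ z ◁ r.β ⊗≫ σ₂.hom ▷ G.f =
      (α_ z' r'.v₁ F.f).hom ≫ z' ◁ r'.β ≫ (α_ z' r'.v₂ G.f).inv

/-- 2-morphisms of the bicategory of fractions. -/
def Hom₂ {A B : C} (F G : Frac W A B) : Type _ := Quot (Rep.Equiv (F := F) (G := G))

/-- The 2-morphism represented by given data. -/
def Rep.cls {A B : C} {F G : Frac W A B} (r : Rep F G) : Hom₂ F G := Quot.mk _ r

/-- The identity 1-morphisms. -/
def Frac.id (hW : Bicalculus W) (A : C) : Frac W A A where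
  obj := A
  w := 𝟙 A
  mem := hW.id_mem A
  f := 𝟙 A

/-- The composite of `F` followed by `G`, for the fixed choices `c`. -/
def Frac.comp (hW : Bicalculus W) (c : Choices W) {A B D : C} (F : Frac W A B) (G : Frac W B D) :
    Frac W A D where
  obj := (c F.f G.w G.mem).obj
  w := (c F.f G.w G.mem).v' ≫ F.w
  mem := hW.comp_mem _ _ (c F.f G.w G.mem).mem F.mem
  f := (c F.f G.w G.mem).f' ≫ G.f

/-- The data representing an identity 2-morphism. -/
def Rep.id (hW : Bicalculus W) {A B : C} (F : Frac W A B) : Rep F F where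
  obj := F.obj
  v₁ := 𝟙 _
  v₂ := 𝟙 _
  mem := hW.comp_mem _ _ (hW.id_mem _) F.mem
  α := Iso.refl _
  β := 𝟙 _

/-- The data representing the unitor `F ∘ id ⇒ F`. -/
def Rep.leftUnitor (hW : Bicalculus W) (c : Choices W) {A B : C} (F : Frac W A B) :
    Rep ((Frac.id hW A).comp hW c F) F where
  obj := (c (𝟙 A) F.w F.mem).obj
  v₁ := 𝟙 _
  v₂ := (c (𝟙 A) F.w F.mem).f'
  mem := hW.comp_mem _ _ (hW.id_mem _) ((Frac.id hW A).comp hW c F).mem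
  α := λ_ ((c (𝟙 A) F.w F.mem).v' ≫ 𝟙 A) ≪≫ (c (𝟙 A) F.w F.mem).ρ
  β := (λ_ ((c (𝟙 A) F.w F.mem).f' ≫ F.f)).hom

/-- The data representing the unitor `id ∘ F ⇒ F`. -/
def Rep.rightUnitor (hW : Bicalculus W) (c : Choices W) {A B : C} (F : Frac W A B) :
    Rep (F.comp hW c (Frac.id hW B)) F where
  obj := (c F.f (𝟙 B) (hW.id_mem B)).obj
  v₁ := 𝟙 _
  v₂ := (c F.f (𝟙 B) (hW.id_mem B)).v'
  mem := hW.comp_mem _ _ (hW.id_mem _) (F.comp hW c (Frac.id hW B)).mem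
  α := λ_ ((c F.f (𝟙 B) (hW.id_mem B)).v' ≫ F.w)
  β := (λ_ ((c F.f (𝟙 B) (hW.id_mem B)).f' ≫ 𝟙 B)).hom ≫ (c F.f (𝟙 B) (hW.id_mem B)).ρ.inv

/-- Auxiliary data for computing a vertical composition. -/
structure VertData {A B : C} {F₁ F₂ F₃ : Frac W A B} (r : Rep F₁ F₂) (s : Rep F₂ F₃) where
  obj : C
  t₁ : obj ⟶ r.obj
  t₂ : obj ⟶ s.obj
  mem : W t₁
  ρ : t₁ ≫ r.v₂ ≅ t₂ ≫ s.v₁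

/-- The diagram obtained from representatives `r`, `s` and auxiliary data. -/
def VertData.rep (hW : Bicalculus W) {A B : C} {F₁ F₂ F₃ : Frac W A B} {r : Rep F₁ F₂}
    {s : Rep F₂ F₃} (d : VertData r s) : Rep F₁ F₃ where
  obj := d.obj
  v₁ := d.t₁ ≫ r.v₁
  v₂ := d.t₂ ≫ s.v₂
  mem := hW.iso_mem (α_ _ _ _) (hW.comp_mem _ _ d.mem r.mem)
  α := α_ d.t₁ r.v₁ F₁.w ≪≫ whiskerLeftIso d.t₁ r.α ≪⊗≫ whiskerRightIso d.ρ F₂.w ≪⊗≫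
    whiskerLeftIso d.t₂ s.α ≪≫ (α_ d.t₂ s.v₂ F₃.w).symm
  β := (α_ d.t₁ r.v₁ F₁.f).hom ≫ d.t₁ ◁ r.β ⊗≫ d.ρ.hom ▷ F₂.f ⊗≫
    d.t₂ ◁ s.β ≫ (α_ d.t₂ s.v₂ F₃.f).inv

/-- Auxiliary data for computing `Θ ∘ F`, where `r` represents `Θ : G₁ ⇒ G₂` and the composites
`G₁ ∘ F`, `G₂ ∘ F` are formed with the squares `s₁`, `s₂`. -/
structure WhiskerLeftData {A B D : C} (F : Frac W A B) {G₁ G₂ : Frac W B D} (r : Rep G₁ G₂)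
    (s₁ : Square W F.f G₁.w) (s₂ : Square W F.f G₂.w) where
  obj₃ : C
  t₁ : obj₃ ⟶ s₁.obj
  mem₁ : W t₁
  h₁ : obj₃ ⟶ r.obj
  σ₁ : t₁ ≫ s₁.f' ≅ h₁ ≫ r.v₁
  obj₄ : C
  t₂ : obj₄ ⟶ s₂.obj
  mem₂ : W t₂
  h₂ : obj₄ ⟶ r.obj
  σ₂ : t₂ ≫ s₂.f' ≅ h₂ ≫ r.v₂
  obj₅ : C
  t₃ : obj₅ ⟶ obj₃
  mem₃ : W t₃
  t₄ : obj₅ ⟶ obj₄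
  φ : t₃ ≫ t₁ ≫ s₁.v' ≅ t₄ ≫ t₂ ≫ s₂.v'
  δ : t₃ ≫ h₁ ≅ t₄ ≫ h₂
  δ_eq : δ.hom ▷ (r.v₁ ≫ G₁.w) =
    𝟙 _ ⊗≫ t₃ ◁ (σ₁.inv ▷ G₁.w) ⊗≫ (t₃ ≫ t₁) ◁ s₁.ρ.inv ⊗≫ φ.hom ▷ F.f ⊗≫
      (t₄ ≫ t₂) ◁ s₂.ρ.hom ⊗≫ t₄ ◁ (σ₂.hom ▷ G₂.w) ⊗≫ (t₄ ≫ h₂) ◁ r.α.inv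

namespace WhiskerLeftData

variable {A B D : C} {F : Frac W A B} {G₁ G₂ : Frac W B D} {r : Rep G₁ G₂}
  {s₁ : Square W F.f G₁.w} {s₂ : Square W F.f G₂.w}

/-- The left part of the diagram below. -/
def α (d : WhiskerLeftData F r s₁ s₂) :
    (d.t₃ ≫ d.t₁) ≫ s₁.v' ≫ F.w ≅ (d.t₄ ≫ d.t₂) ≫ s₂.v' ≫ F.w :=
  Iso.refl _ ≪⊗≫ whiskerRightIso d.φ F.w ≪⊗≫ Iso.refl _

/-- The right part of the diagram below. -/
def β (d : WhiskerLeftData F r s₁ s₂) :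
    (d.t₃ ≫ d.t₁) ≫ s₁.f' ≫ G₁.f ⟶ (d.t₄ ≫ d.t₂) ≫ s₂.f' ≫ G₂.f :=
  𝟙 _ ⊗≫ d.t₃ ◁ (d.σ₁.hom ▷ G₁.f) ⊗≫ d.δ.hom ▷ (r.v₁ ≫ G₁.f) ⊗≫
    (d.t₄ ≫ d.h₂) ◁ r.β ⊗≫ d.t₄ ◁ (d.σ₂.inv ▷ G₂.f) ⊗≫ 𝟙 _

/-- The diagram obtained from a representative `r` and auxiliary data. -/
def rep (hW : Bicalculus W) {c : Choices W}
    (d : WhiskerLeftData F r (c F.f G₁.w G₁.mem) (c F.f G₂.w G₂.mem)) :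
    Rep (F.comp hW c G₁) (F.comp hW c G₂) where
  obj := d.obj₅
  v₁ := d.t₃ ≫ d.t₁
  v₂ := d.t₄ ≫ d.t₂
  mem := hW.comp_mem _ _ (hW.comp_mem _ _ d.mem₃ d.mem₁) (F.comp hW c G₁).mem
  α := d.α
  β := d.β

end WhiskerLeftData

/-- Auxiliary data for computing `G ∘ Γ`, where `r` represents `Γ : F₁ ⇒ F₂` and the composites
`G ∘ F₁`, `G ∘ F₂` are formed with the squares `s₁`, `s₂`. -/
structure WhiskerRightData {A B D : C} {F₁ F₂ : Frac W A B} (r : Rep F₁ F₂) (G : Frac W B D)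
    (s₁ : Square W F₁.f G.w) (s₂ : Square W F₂.f G.w) where
  obj₃ : C
  u₃ : obj₃ ⟶ r.obj
  mem₃ : W u₃
  u₄ : obj₃ ⟶ s₁.obj
  η₁ : u₃ ≫ r.v₁ ≅ u₄ ≫ s₁.v'
  obj₄ : C
  u₅ : obj₄ ⟶ r.obj
  mem₅ : W u₅
  u₆ : obj₄ ⟶ s₂.obj
  η₂ : u₅ ≫ r.v₂ ≅ u₆ ≫ s₂.v'
  obj₅ : C
  u₇ : obj₅ ⟶ obj₃
  mem₇ : W u₇
  u₈ : obj₅ ⟶ obj₄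
  η₃ : u₇ ≫ u₃ ≅ u₈ ≫ u₅
  l : u₇ ≫ u₄ ≫ s₁.f' ⟶ u₈ ≫ u₆ ≫ s₂.f'
  l_eq : l ▷ G.w =
    𝟙 _ ⊗≫ (u₇ ≫ u₄) ◁ s₁.ρ.inv ⊗≫ u₇ ◁ (η₁.inv ▷ F₁.f) ⊗≫ η₃.hom ▷ (r.v₁ ≫ F₁.f) ⊗≫
      (u₈ ≫ u₅) ◁ r.β ⊗≫ u₈ ◁ (η₂.hom ▷ F₂.f) ⊗≫ (u₈ ≫ u₆) ◁ s₂.ρ.hom ⊗≫ 𝟙 _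

namespace WhiskerRightData

variable {A B D : C} {F₁ F₂ : Frac W A B} {r : Rep F₁ F₂} {G : Frac W B D}
  {s₁ : Square W F₁.f G.w} {s₂ : Square W F₂.f G.w}

/-- The left part of the diagram below. -/
def α (d : WhiskerRightData r G s₁ s₂) :
    (d.u₇ ≫ d.u₄) ≫ s₁.v' ≫ F₁.w ≅ (d.u₈ ≫ d.u₆) ≫ s₂.v' ≫ F₂.w :=
  Iso.refl _ ≪⊗≫ whiskerLeftIso d.u₇ (whiskerRightIso d.η₁.symm F₁.w) ≪⊗≫
    whiskerRightIso d.η₃ (r.v₁ ≫ F₁.w) ≪⊗≫ whiskerLeftIso (d.u₈ ≫ d.u₅) r.α ≪⊗≫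
    whiskerLeftIso d.u₈ (whiskerRightIso d.η₂ F₂.w) ≪⊗≫ Iso.refl _

/-- The right part of the diagram below. -/
def β (d : WhiskerRightData r G s₁ s₂) :
    (d.u₇ ≫ d.u₄) ≫ s₁.f' ≫ G.f ⟶ (d.u₈ ≫ d.u₆) ≫ s₂.f' ≫ G.f :=
  𝟙 _ ⊗≫ d.l ▷ G.f ⊗≫ 𝟙 _

/-- The diagram obtained from a representative `r` and auxiliary data. -/
def rep (hW : Bicalculus W) {c : Choices W}
    (d : WhiskerRightData r G (c F₁.f G.w G.mem) (c F₂.f G.w G.mem)) :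
    Rep (F₁.comp hW c G) (F₂.comp hW c G) where
  obj := d.obj₅
  v₁ := d.u₇ ≫ d.u₄
  v₂ := d.u₈ ≫ d.u₆
  mem := by
    have h := hW.comp_mem _ _ d.mem₇ (hW.comp_mem _ _ d.mem₃ r.mem)
    refine hW.iso_mem ?_ h
    exact α_ _ _ _ ≪≫ whiskerLeftIso d.u₇ ((α_ _ _ _).symm ≪≫
      whiskerRightIso d.η₁.symm F₁.w ≪≫ α_ _ _ _)
  α := d.α
  β := d.β

end WhiskerRightData

/-- Auxiliary data for computing the associator `H ∘ (G ∘ F) ⇒ (H ∘ G) ∘ F`, where `s₁` is the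
square used for `G ∘ F`, `s₂` the one for `H ∘ (G ∘ F)`, `s₃` the one for `H ∘ G` and `s₄` the one
for `(H ∘ G) ∘ F`. -/
structure AssocData {A B D E : C} (F : Frac W A B) (G : Frac W B D) (H : Frac W D E)
    (s₁ : Square W F.f G.w) (s₂ : Square W (s₁.f' ≫ G.f) H.w) (s₃ : Square W G.f H.w)
    (s₄ : Square W F.f (s₃.v' ≫ G.w)) where
  obj : C
  u₄ : obj ⟶ s₂.obj
  u₅ : obj ⟶ s₄.obj
  mem : W (u₄ ≫ s₂.v' ≫ s₁.v' ≫ F.w)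
  γ : u₄ ≫ s₂.v' ≫ s₁.v' ≅ u₅ ≫ s₄.v'
  ω : u₄ ≫ s₂.v' ≫ s₁.f' ≅ u₅ ≫ s₄.f' ≫ s₃.v'
  ω_eq : ω.hom ▷ G.w =
    𝟙 _ ⊗≫ (u₄ ≫ s₂.v') ◁ s₁.ρ.inv ⊗≫ γ.hom ▷ F.f ⊗≫ u₅ ◁ s₄.ρ.hom ⊗≫ 𝟙 _
  ρ : u₄ ≫ s₂.f' ≅ u₅ ≫ s₄.f' ≫ s₃.f'
  ρ_eq : ρ.hom ▷ H.w =
    𝟙 _ ⊗≫ u₄ ◁ s₂.ρ.inv ⊗≫ ω.hom ▷ G.f ⊗≫ (u₅ ≫ s₄.f') ◁ s₃.ρ.hom ⊗≫ 𝟙 _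

namespace AssocData

variable {A B D E : C} {F : Frac W A B} {G : Frac W B D} {H : Frac W D E}
  {s₁ : Square W F.f G.w} {s₂ : Square W (s₁.f' ≫ G.f) H.w} {s₃ : Square W G.f H.w}
  {s₄ : Square W F.f (s₃.v' ≫ G.w)}

/-- The left part of the diagram below. -/
def α (d : AssocData F G H s₁ s₂ s₃ s₄) :
    d.u₄ ≫ s₂.v' ≫ s₁.v' ≫ F.w ≅ d.u₅ ≫ s₄.v' ≫ F.w :=
  Iso.refl _ ≪⊗≫ whiskerRightIso d.γ F.w ≪⊗≫ Iso.refl _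

/-- The right part of the diagram below. -/
def β (d : AssocData F G H s₁ s₂ s₃ s₄) :
    d.u₄ ≫ s₂.f' ≫ H.f ⟶ d.u₅ ≫ s₄.f' ≫ s₃.f' ≫ H.f :=
  𝟙 _ ⊗≫ d.ρ.hom ▷ H.f ⊗≫ 𝟙 _

end AssocData

/-- The auxiliary data for the associator, for the four squares prescribed by `c`. -/
abbrev AssocDataC (hW : Bicalculus W) (c : Choices W) {A B D E : C} (F : Frac W A B)
    (G : Frac W B D) (H : Frac W D E) : Type _ :=
  AssocData F G H (c F.f G.w G.mem) (c (F.comp hW c G).f H.w H.mem) (c G.f H.w H.mem)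
    (c F.f (G.comp hW c H).w (G.comp hW c H).mem)

/-- The diagram obtained from auxiliary data. -/
def AssocDataC.rep {hW : Bicalculus W} {c : Choices W} {A B D E : C} {F : Frac W A B}
    {G : Frac W B D} {H : Frac W D E} (d : AssocDataC hW c F G H) :
    Rep ((F.comp hW c G).comp hW c H) (F.comp hW c (G.comp hW c H)) where
  obj := d.obj
  v₁ := d.u₄
  v₂ := d.u₅
  mem := d.mem
  α := d.α
  β := d.β

end Cells

section Operations

variable {C : Type u} [Bicategory.{w, v} C] {W : MorphismProperty C}

/-- The operations on 2-morphisms that, together with the objects, the 1-morphisms, their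
identities and composites for `c`, and the 2-morphisms, make up a bicategory of fractions. -/
structure Ops (hW : Bicalculus W) (c : Choices W) where
  id₂ : ∀ {A B : C} (F : Frac W A B), Hom₂ F F
  vcomp : ∀ {A B : C} {F G H : Frac W A B}, Hom₂ F G → Hom₂ G H → Hom₂ F H
  whiskerLeft : ∀ {A B D : C} (F : Frac W A B) {G₁ G₂ : Frac W B D}, Hom₂ G₁ G₂ →
    Hom₂ (F.comp hW c G₁) (F.comp hW c G₂)
  whiskerRight : ∀ {A B D : C} {F₁ F₂ : Frac W A B}, Hom₂ F₁ F₂ → ∀ G : Frac W B D,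
    Hom₂ (F₁.comp hW c G) (F₂.comp hW c G)
  associator : ∀ {A B D E : C} (F : Frac W A B) (G : Frac W B D) (H : Frac W D E),
    Hom₂ ((F.comp hW c G).comp hW c H) (F.comp hW c (G.comp hW c H))
  leftUnitor : ∀ {A B : C} (F : Frac W A B), Hom₂ ((Frac.id hW A).comp hW c F) F
  rightUnitor : ∀ {A B : C} (F : Frac W A B), Hom₂ (F.comp hW c (Frac.id hW B)) F

namespace Ops

variable {hW : Bicalculus W} {c : Choices W} (S : Ops hW c)

/-- Invertibility for the vertical composition. -/
def IsInvertible {A B : C} {F G : Frac W A B} (Γ : Hom₂ F G) : Prop :=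
  ∃ Θ : Hom₂ G F, S.vcomp Γ Θ = S.id₂ F ∧ S.vcomp Θ Γ = S.id₂ G

/-- The operations satisfy the axioms of a bicategory. -/
structure IsBicategory : Prop where
  id_vcomp : ∀ {A B : C} {F G : Frac W A B} (Γ : Hom₂ F G), S.vcomp (S.id₂ F) Γ = Γ
  vcomp_id : ∀ {A B : C} {F G : Frac W A B} (Γ : Hom₂ F G), S.vcomp Γ (S.id₂ G) = Γ
  vcomp_assoc : ∀ {A B : C} {F G H K : Frac W A B} (Γ : Hom₂ F G) (Θ : Hom₂ G H) (Ψ : Hom₂ H K),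
    S.vcomp (S.vcomp Γ Θ) Ψ = S.vcomp Γ (S.vcomp Θ Ψ)
  whiskerLeft_id : ∀ {A B D : C} (F : Frac W A B) (G : Frac W B D),
    S.whiskerLeft F (S.id₂ G) = S.id₂ (F.comp hW c G)
  whiskerLeft_vcomp : ∀ {A B D : C} (F : Frac W A B) {G H K : Frac W B D} (Γ : Hom₂ G H)
    (Θ : Hom₂ H K),
    S.whiskerLeft F (S.vcomp Γ Θ) = S.vcomp (S.whiskerLeft F Γ) (S.whiskerLeft F Θ)
  id_whiskerRight : ∀ {A B D : C} (F : Frac W A B) (G : Frac W B D),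
    S.whiskerRight (S.id₂ F) G = S.id₂ (F.comp hW c G)
  vcomp_whiskerRight : ∀ {A B D : C} {F G H : Frac W A B} (Γ : Hom₂ F G) (Θ : Hom₂ G H)
    (K : Frac W B D),
    S.whiskerRight (S.vcomp Γ Θ) K = S.vcomp (S.whiskerRight Γ K) (S.whiskerRight Θ K)
  whisker_exchange : ∀ {A B D : C} {F G : Frac W A B} {H K : Frac W B D} (Γ : Hom₂ F G)
    (Θ : Hom₂ H K),
    S.vcomp (S.whiskerLeft F Θ) (S.whiskerRight Γ K) =
      S.vcomp (S.whiskerRight Γ H) (S.whiskerLeft G Θ)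
  associator_invertible : ∀ {A B D E : C} (F : Frac W A B) (G : Frac W B D) (H : Frac W D E),
    S.IsInvertible (S.associator F G H)
  leftUnitor_invertible : ∀ {A B : C} (F : Frac W A B), S.IsInvertible (S.leftUnitor F)
  rightUnitor_invertible : ∀ {A B : C} (F : Frac W A B), S.IsInvertible (S.rightUnitor F)
  associator_natural_left : ∀ {A B D E : C} {F F' : Frac W A B} (Γ : Hom₂ F F') (G : Frac W B D)
    (H : Frac W D E),
    S.vcomp (S.whiskerRight (S.whiskerRight Γ G) H) (S.associator F' G H) =
      S.vcomp (S.associator F G H) (S.whiskerRight Γ (G.comp hW c H))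
  associator_natural_middle : ∀ {A B D E : C} (F : Frac W A B) {G G' : Frac W B D} (Γ : Hom₂ G G')
    (H : Frac W D E),
    S.vcomp (S.whiskerRight (S.whiskerLeft F Γ) H) (S.associator F G' H) =
      S.vcomp (S.associator F G H) (S.whiskerLeft F (S.whiskerRight Γ H))
  associator_natural_right : ∀ {A B D E : C} (F : Frac W A B) (G : Frac W B D) {H H' : Frac W D E}
    (Γ : Hom₂ H H'),
    S.vcomp (S.whiskerLeft (F.comp hW c G) Γ) (S.associator F G H') =
      S.vcomp (S.associator F G H) (S.whiskerLeft F (S.whiskerLeft G Γ))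
  leftUnitor_natural : ∀ {A B : C} {F G : Frac W A B} (Γ : Hom₂ F G),
    S.vcomp (S.whiskerLeft (Frac.id hW A) Γ) (S.leftUnitor G) = S.vcomp (S.leftUnitor F) Γ
  rightUnitor_natural : ∀ {A B : C} {F G : Frac W A B} (Γ : Hom₂ F G),
    S.vcomp (S.whiskerRight Γ (Frac.id hW B)) (S.rightUnitor G) = S.vcomp (S.rightUnitor F) Γ
  pentagon : ∀ {A B D E X : C} (F : Frac W A B) (G : Frac W B D) (H : Frac W D E) (K : Frac W E X),
    S.vcomp (S.whiskerRight (S.associator F G H) K)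
        (S.vcomp (S.associator F (G.comp hW c H) K) (S.whiskerLeft F (S.associator G H K))) =
      S.vcomp (S.associator (F.comp hW c G) H K) (S.associator F G (H.comp hW c K))
  triangle : ∀ {A B D : C} (F : Frac W A B) (G : Frac W B D),
    S.vcomp (S.associator F (Frac.id hW B) G) (S.whiskerLeft F (S.leftUnitor G)) =
      S.whiskerRight (S.rightUnitor F) G

/-- The identities and unitors are the prescribed ones; for all representatives there are auxiliary
data as needed for the other operations, and the values of these operations are represented by the
diagrams obtained from *any* representatives and *any* auxiliary data. -/
structure IsGivenByAnyData : Prop where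
  id₂ : ∀ {A B : C} (F : Frac W A B), S.id₂ F = (Rep.id hW F).cls
  leftUnitor : ∀ {A B : C} (F : Frac W A B), S.leftUnitor F = (Rep.leftUnitor hW c F).cls
  rightUnitor : ∀ {A B : C} (F : Frac W A B), S.rightUnitor F = (Rep.rightUnitor hW c F).cls
  vcomp : ∀ {A B : C} {F G H : Frac W A B} (r : Rep F G) (s : Rep G H),
    Nonempty (VertData r s) ∧ ∀ d : VertData r s, S.vcomp r.cls s.cls = (d.rep hW).cls
  whiskerLeft : ∀ {A B D : C} (F : Frac W A B) {G₁ G₂ : Frac W B D} (r : Rep G₁ G₂),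
    Nonempty (WhiskerLeftData F r (c F.f G₁.w G₁.mem) (c F.f G₂.w G₂.mem)) ∧
      ∀ d : WhiskerLeftData F r (c F.f G₁.w G₁.mem) (c F.f G₂.w G₂.mem),
        S.whiskerLeft F r.cls = (d.rep hW).cls
  whiskerRight : ∀ {A B D : C} {F₁ F₂ : Frac W A B} (r : Rep F₁ F₂) (G : Frac W B D),
    Nonempty (WhiskerRightData r G (c F₁.f G.w G.mem) (c F₂.f G.w G.mem)) ∧
      ∀ d : WhiskerRightData r G (c F₁.f G.w G.mem) (c F₂.f G.w G.mem),
        S.whiskerRight r.cls G = (d.rep hW).cls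
  associator : ∀ {A B D E : C} (F : Frac W A B) (G : Frac W B D) (H : Frac W D E),
    Nonempty (AssocDataC hW c F G H) ∧
      ∀ d : AssocDataC hW c F G H, S.associator F G H = (AssocDataC.rep d).cls

/-- The identities and unitors are the prescribed ones, and each value of the other operations is
represented by the diagram obtained from *some* representatives and *some* auxiliary data. This is
the result of making, in whatever way, all the choices beyond `c`. -/
structure IsGivenBySomeData : Prop where
  id₂ : ∀ {A B : C} (F : Frac W A B), S.id₂ F = (Rep.id hW F).cls
  leftUnitor : ∀ {A B : C} (F : Frac W A B), S.leftUnitor F = (Rep.leftUnitor hW c F).cls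
  rightUnitor : ∀ {A B : C} (F : Frac W A B), S.rightUnitor F = (Rep.rightUnitor hW c F).cls
  vcomp : ∀ {A B : C} {F G H : Frac W A B} (Γ : Hom₂ F G) (Θ : Hom₂ G H),
    ∃ (r : Rep F G) (s : Rep G H) (d : VertData r s),
      r.cls = Γ ∧ s.cls = Θ ∧ S.vcomp Γ Θ = (d.rep hW).cls
  whiskerLeft : ∀ {A B D : C} (F : Frac W A B) {G₁ G₂ : Frac W B D} (Θ : Hom₂ G₁ G₂),
    ∃ (r : Rep G₁ G₂) (d : WhiskerLeftData F r (c F.f G₁.w G₁.mem) (c F.f G₂.w G₂.mem)),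
      r.cls = Θ ∧ S.whiskerLeft F Θ = (d.rep hW).cls
  whiskerRight : ∀ {A B D : C} {F₁ F₂ : Frac W A B} (Γ : Hom₂ F₁ F₂) (G : Frac W B D),
    ∃ (r : Rep F₁ F₂) (d : WhiskerRightData r G (c F₁.f G.w G.mem) (c F₂.f G.w G.mem)),
      r.cls = Γ ∧ S.whiskerRight Γ G = (d.rep hW).cls
  associator : ∀ {A B D E : C} (F : Frac W A B) (G : Frac W B D) (H : Frac W D E),
    ∃ d : AssocDataC hW c F G H, S.associator F G H = (AssocDataC.rep d).cls

end Ops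

end Operations

/-! ### First-order definitions -/

/-- The objects, 1-morphisms and 2-morphisms of a bicategory, as elements of one domain. -/
inductive Cell (C : Type u) [Bicategory.{w, v} C] : Type (max u v w)
  | obj (A : C) : Cell C
  | one {A B : C} (f : A ⟶ B) : Cell C
  | two {A B : C} {f g : A ⟶ B} (η : f ⟶ g) : Cell C

/-- The primitive notions of a bicategory with a class of 1-morphisms. -/
inductive Symb : ℕ → Type
  | src : Symb 2
  | tgt : Symb 2
  | id₁ : Symb 2
  | comp : Symb 3
  | id₂ : Symb 2
  | vcomp : Symb 3
  | whiskerLeft : Symb 3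
  | whiskerRight : Symb 3
  | associator : Symb 4
  | leftUnitor : Symb 2
  | rightUnitor : Symb 2
  | inW : Symb 1

/-- The primitive notions of a bicategory with a class of 1-morphisms and a set of choices. -/
inductive SymbC : ℕ → Type
  | base {n : ℕ} (s : Symb n) : SymbC n
  | choice : SymbC 5

/-- The first-order language of bicategories with a class of 1-morphisms. -/
def Lang : FirstOrder.Language.{0, 0} := ⟨fun _ => Empty, Symb⟩

/-- The same language with a symbol for a set of choices. -/
def LangC : FirstOrder.Language.{0, 0} := ⟨fun _ => Empty, SymbC⟩

section Interpretation

variable {C : Type u} [Bicategory.{w, v} C]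

/-- The interpretation of the primitive notions. -/
inductive Symb.Holds (W : MorphismProperty C) : ∀ {n : ℕ}, Symb n → (Fin n → Cell C) → Prop
  | src₁ {A B : C} (f : A ⟶ B) : Holds W .src ![.one f, .obj A]
  | tgt₁ {A B : C} (f : A ⟶ B) : Holds W .tgt ![.one f, .obj B]
  | src₂ {A B : C} {f g : A ⟶ B} (η : f ⟶ g) : Holds W .src ![.two η, .one f]
  | tgt₂ {A B : C} {f g : A ⟶ B} (η : f ⟶ g) : Holds W .tgt ![.two η, .one g]
  | id₁ (A : C) : Holds W .id₁ ![.obj A, .one (𝟙 A)]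
  | comp {A B D : C} (f : A ⟶ B) (g : B ⟶ D) : Holds W .comp ![.one f, .one g, .one (f ≫ g)]
  | id₂ {A B : C} (f : A ⟶ B) : Holds W .id₂ ![.one f, .two (𝟙 f)]
  | vcomp {A B : C} {f g h : A ⟶ B} (η : f ⟶ g) (θ : g ⟶ h) :
      Holds W .vcomp ![.two η, .two θ, .two (η ≫ θ)]
  | whiskerLeft {A B D : C} (f : A ⟶ B) {g h : B ⟶ D} (η : g ⟶ h) :
      Holds W .whiskerLeft ![.one f, .two η, .two (f ◁ η)]
  | whiskerRight {A B D : C} {f g : A ⟶ B} (η : f ⟶ g) (h : B ⟶ D) :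
      Holds W .whiskerRight ![.two η, .one h, .two (η ▷ h)]
  | associator {A B D E : C} (f : A ⟶ B) (g : B ⟶ D) (h : D ⟶ E) :
      Holds W .associator ![.one f, .one g, .one h, .two (α_ f g h).hom]
  | leftUnitor {A B : C} (f : A ⟶ B) : Holds W .leftUnitor ![.one f, .two (λ_ f).hom]
  | rightUnitor {A B : C} (f : A ⟶ B) : Holds W .rightUnitor ![.one f, .two (ρ_ f).hom]
  | inW {A B : C} (f : A ⟶ B) (h : W f) : Holds W .inW ![.one f]

/-- The interpretation of the primitive notions, including the choices. -/
inductive SymbC.Holds {W : MorphismProperty C} (c : Choices W) :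
    ∀ {n : ℕ}, SymbC n → (Fin n → Cell C) → Prop
  | base {n : ℕ} (s : Symb n) (x : Fin n → Cell C) (h : s.Holds W x) : Holds c (.base s) x
  | choice {A' B B' : C} (f : A' ⟶ B) (v : B' ⟶ B) (h : W v) :
      Holds c .choice
        ![.one f, .one v, .one (c f v h).v', .one (c f v h).f', .two (c f v h).ρ.hom]

/-- The cells of `C` as a first-order structure, with `W`. -/
abbrev str (W : MorphismProperty C) : Lang.Structure (Cell C) where
  funMap := fun f _ => f.elim
  RelMap := fun s x => Symb.Holds W s x

/-- The cells of `C` as a first-order structure, with `W` and the choices. -/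
abbrev strC {W : MorphismProperty C} (c : Choices W) : LangC.Structure (Cell C) where
  funMap := fun f _ => f.elim
  RelMap := fun s x => SymbC.Holds c s x

variable {W : MorphismProperty C}

/-- The cells of `C` that make up a 1-morphism of the bicategory of fractions. -/
def Frac.code {A B : C} (F : Frac W A B) : Fin 2 → Cell C := ![.one F.w, .one F.f]

/-- The cells of `C` that make up a representative of a 2-morphism. -/
def Rep.code {A B : C} {F G : Frac W A B} (r : Rep F G) : Fin 4 → Cell C :=
  ![.one r.v₁, .one r.v₂, .two r.α.hom, .two r.β]

end Interpretation

/-- The notions that make up a bicategory of fractions. -/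
inductive Notion
  /-- being a 1-morphism -/
  | one
  /-- being a representative of a 2-morphism -/
  | two
  /-- representing the same 2-morphism -/
  | same
  | id₁
  | comp
  | id₂
  | vcomp
  | whiskerLeft
  | whiskerRight
  | associator
  | leftUnitor
  | rightUnitor

/-- The variables of the relation on cells of `C` corresponding to a notion: one for an object,
two for a 1-morphism and four for a representative of a 2-morphism. -/
abbrev Notion.Var : Notion → Type
  | one => Fin 1 ⊕ Fin 1 ⊕ Fin 2
  | two => Fin 2 ⊕ Fin 2 ⊕ Fin 4
  | same => Fin 2 ⊕ Fin 2 ⊕ Fin 4 ⊕ Fin 4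
  | id₁ => Fin 1 ⊕ Fin 2
  | comp => Fin 2 ⊕ Fin 2 ⊕ Fin 2
  | id₂ => Fin 2 ⊕ Fin 4
  | vcomp => Fin 2 ⊕ Fin 2 ⊕ Fin 2 ⊕ Fin 4 ⊕ Fin 4 ⊕ Fin 4
  | whiskerLeft => Fin 2 ⊕ Fin 2 ⊕ Fin 2 ⊕ Fin 4 ⊕ Fin 4
  | whiskerRight => Fin 2 ⊕ Fin 2 ⊕ Fin 2 ⊕ Fin 4 ⊕ Fin 4
  | associator => Fin 2 ⊕ Fin 2 ⊕ Fin 2 ⊕ Fin 4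
  | leftUnitor => Fin 2 ⊕ Fin 4
  | rightUnitor => Fin 2 ⊕ Fin 4

section Graphs

variable {C : Type u} [Bicategory.{w, v} C] {W : MorphismProperty C}

/-- Juxtaposition of tuples. -/
local infixr:65 " ⧺ " => Sum.elim

/-- The relation on cells of `C` corresponding to a notion, for the bicategory of fractions with
operations `S`. -/
def Ops.Graph {hW : Bicalculus W} {c : Choices W} (S : Ops hW c) :
    ∀ k : Notion, (k.Var → Cell C) → Prop
  | .one => fun x => ∃ (A B : C) (F : Frac W A B), x = ![.obj A] ⧺ ![.obj B] ⧺ F.code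
  | .two => fun x => ∃ (A B : C) (F G : Frac W A B) (r : Rep F G), x = F.code ⧺ G.code ⧺ r.code
  | .same => fun x => ∃ (A B : C) (F G : Frac W A B) (r s : Rep F G),
      x = F.code ⧺ G.code ⧺ r.code ⧺ s.code ∧ r.cls = s.cls
  | .id₁ => fun x => ∃ A : C, x = ![.obj A] ⧺ (Frac.id hW A).code
  | .comp => fun x => ∃ (A B D : C) (F : Frac W A B) (G : Frac W B D),
      x = F.code ⧺ G.code ⧺ (F.comp hW c G).code
  | .id₂ => fun x => ∃ (A B : C) (F : Frac W A B) (r : Rep F F),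
      x = F.code ⧺ r.code ∧ S.id₂ F = r.cls
  | .vcomp => fun x => ∃ (A B : C) (F G H : Frac W A B) (r : Rep F G) (s : Rep G H) (t : Rep F H),
      x = F.code ⧺ G.code ⧺ H.code ⧺ r.code ⧺ s.code ⧺ t.code ∧ S.vcomp r.cls s.cls = t.cls
  | .whiskerLeft => fun x => ∃ (A B D : C) (F : Frac W A B) (G₁ G₂ : Frac W B D) (r : Rep G₁ G₂)
      (s : Rep (F.comp hW c G₁) (F.comp hW c G₂)),
      x = F.code ⧺ G₁.code ⧺ G₂.code ⧺ r.code ⧺ s.code ∧ S.whiskerLeft F r.cls = s.cls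
  | .whiskerRight => fun x => ∃ (A B D : C) (F₁ F₂ : Frac W A B) (G : Frac W B D) (r : Rep F₁ F₂)
      (s : Rep (F₁.comp hW c G) (F₂.comp hW c G)),
      x = F₁.code ⧺ F₂.code ⧺ G.code ⧺ r.code ⧺ s.code ∧ S.whiskerRight r.cls G = s.cls
  | .associator => fun x => ∃ (A B D E : C) (F : Frac W A B) (G : Frac W B D) (H : Frac W D E)
      (r : Rep ((F.comp hW c G).comp hW c H) (F.comp hW c (G.comp hW c H))),
      x = F.code ⧺ G.code ⧺ H.code ⧺ r.code ∧ S.associator F G H = r.cls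
  | .leftUnitor => fun x => ∃ (A B : C) (F : Frac W A B)
      (r : Rep ((Frac.id hW A).comp hW c F) F),
      x = F.code ⧺ r.code ∧ S.leftUnitor F = r.cls
  | .rightUnitor => fun x => ∃ (A B : C) (F : Frac W A B)
      (r : Rep (F.comp hW c (Frac.id hW B)) F),
      x = F.code ⧺ r.code ∧ S.rightUnitor F = r.cls

/-- In the first-order structure `I` on the cells of `C`, the formulas `Φ` define all the notions
that make up the bicategory of fractions with operations `S`. -/
def DefinedBy {L : FirstOrder.Language.{0, 0}} (I : L.Structure (Cell C))
    (Φ : ∀ k : Notion, L.Formula k.Var) {hW : Bicalculus W} {c : Choices W} (S : Ops hW c) : Prop :=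
  ∀ (k : Notion) (x : k.Var → Cell C), (Φ k).Realize x ↔ S.Graph k x

end Graphs

/-- The construction of the bicategory of fractions for `(C, W)` and `c` involves no choice beyond
`c`, and is carried out by the formulas `Φ` in the structure `I` on the cells of `C`. -/
structure ConstructedBy {C : Type u} [Bicategory.{w, v} C] {W : MorphismProperty C}
    {L : FirstOrder.Language.{0, 0}} (I : L.Structure (Cell C))
    (Φ : ∀ k : Notion, L.Formula k.Var) (hW : Bicalculus W) (c : Choices W) : Prop where
  equivalence : ∀ {A B : C} (F G : Frac W A B), Equivalence (Rep.Equiv (F := F) (G := G))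
  exists_ops : ∃ S : Ops hW c, S.IsBicategory ∧ S.IsGivenByAnyData ∧
    (∀ S' : Ops hW c, S'.IsGivenBySomeData → S' = S) ∧ DefinedBy I Φ S

end BicatFrac

/-! Each recipe passes to refinements at every step, so different outcomes are hard to compare
directly. Three ideas remove the difficulty.

Germs. By BF4, whiskering with a 1-morphism of `W` is bijective on 2-cells of `C` only up to
precomposition with further 1-morphisms of `W`. Replacing 2-cells `f ⟶ g` by germs of 2-cells `t ≫ f
⟶ t ≫ g` with `t` in `W` gives a bicategory `Loc hW` with the same objects and 1-morphisms, in which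
whiskering on either side with a 1-morphism of the closure of `W` under isomorphism is honestly
bijective (`Loc.strong`). Equivalence of representatives is preserved and reflected by the passage
to germs (`Rep.Equiv.map`, `Rep.Equiv.of_map`), so comparisons may be made there.

Values. A fraction `(w, f)` from `A` to `B` behaves like a functor that is defined locally and up to
isomorphism: a point (`Pt`) over `e : E ⟶ A` is a lift `a` of `e` through `w`, and `a ≫ f` is the
value. Since whiskering with `w` is bijective, a 2-cell between arguments induces exactly one 2-cell
between values (`Over`). A representative of a 2-morphism likewise sends each 2-cell between
arguments to exactly one 2-cell between values (`Force.exists_of`, `Force.unique`), and two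
representatives with a common value at points over one `e` in `W` are equivalent (`Force.equiv`).
Thus a 2-morphism is known from one value. A point of a composite consists of a point of each
factor, and the value of the diagram given by a recipe is expressed by values of the inputs, without
the auxiliary data (the lemmas named `force_repSq`). This yields the equivalence relation, the
independence of all data, and the axioms of a bicategory, each of which becomes an equality of
2-cells that holds by uniqueness of values.

Definability. Auxiliary data exist and all yield one class, so "the value of the operation is the
class of `t`" means "some auxiliary data give a diagram equivalent to `t`", a first-order condition
on cells. Its formula is assembled from the shape of the condition (`Elt` for cells, `Defines` for
propositions) and does not depend on the bicategory. If squares are unique, "these cells form a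
square" replaces the symbol for `c`. -/

namespace BicatFrac

/-! ### Local equality of 2-cells and restriction to refinements. -/

section Germs

variable {C : Type u} [Bicategory.{w, v} C] {W : MorphismProperty C}

/-- Two 2-cells agree after precomposition with some 1-morphism in `W`. -/
def LocEq (W : MorphismProperty C) {X Y : C} {f g : X ⟶ Y} (φ ψ : f ⟶ g) : Prop :=
  ∃ (D : C) (a : D ⟶ X), W a ∧ a ◁ φ = a ◁ ψ

/-- Two 1-morphisms in `W` with the same target have a common refinement in `W`. -/
theorem Bicalculus.common (hW : Bicalculus W) {X D D' : C} (t : D ⟶ X) (t' : D' ⟶ X) (ht : W t)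
    (ht' : W t') :
    ∃ (E : C) (s : E ⟶ X) (u : E ⟶ D) (u' : E ⟶ D'), W s ∧ Nonempty (s ≅ u ≫ t) ∧
      Nonempty (s ≅ u' ≫ t') := by
  obtain ⟨E, u', u, hu', ⟨ρ⟩⟩ := hW.square t t' ht
  exact ⟨E, u' ≫ t', u, u', hW.comp_mem _ _ hu' ht', ⟨ρ⟩, ⟨Iso.refl _⟩⟩

theorem whiskerLeft_eq_of_iso {X Y D : C} {f g : X ⟶ Y} {φ ψ : f ⟶ g} {a b : D ⟶ X} (i : a ≅ b)
    (h : a ◁ φ = a ◁ ψ) : b ◁ φ = b ◁ ψ := by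
  have h' : ∀ χ : f ⟶ g, b ◁ χ = i.inv ▷ f ≫ a ◁ χ ≫ i.hom ▷ g := fun χ => by
    rw [whisker_exchange, ← comp_whiskerRight_assoc]; simp
  rw [h', h', h]

theorem whiskerLeft_comp_eq {X Y D E : C} {f g : X ⟶ Y} {φ ψ : f ⟶ g} {a : D ⟶ X} (b : E ⟶ D)
    (h : a ◁ φ = a ◁ ψ) : (b ≫ a) ◁ φ = (b ≫ a) ◁ ψ := by
  rw [comp_whiskerLeft, comp_whiskerLeft, h]

namespace LocEq

theorem of_eq (hW : Bicalculus W) {X Y : C} {f g : X ⟶ Y} {φ ψ : f ⟶ g} (h : φ = ψ) :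
    LocEq W φ ψ := ⟨X, 𝟙 X, hW.id_mem X, by rw [h]⟩

theorem symm {X Y : C} {f g : X ⟶ Y} {φ ψ : f ⟶ g} (h : LocEq W φ ψ) : LocEq W ψ φ := by
  obtain ⟨D, a, ha, h⟩ := h
  exact ⟨D, a, ha, h.symm⟩

/-- Two local equalities hold after one refinement. -/
theorem and (hW : Bicalculus W) {X Y Y' : C} {f g : X ⟶ Y} {φ ψ : f ⟶ g} {f' g' : X ⟶ Y'}
    {φ' ψ' : f' ⟶ g'} (h : LocEq W φ ψ) (h' : LocEq W φ' ψ') :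
    ∃ (D : C) (a : D ⟶ X), W a ∧ a ◁ φ = a ◁ ψ ∧ a ◁ φ' = a ◁ ψ' := by
  obtain ⟨D, a, ha, h⟩ := h
  obtain ⟨D', a', ha', h'⟩ := h'
  obtain ⟨E, s, u, u', hs, ⟨i⟩, ⟨i'⟩⟩ := hW.common a a' ha ha'
  exact ⟨E, s, hs, whiskerLeft_eq_of_iso i.symm (whiskerLeft_comp_eq u h),
    whiskerLeft_eq_of_iso i'.symm (whiskerLeft_comp_eq u' h')⟩

theorem trans (hW : Bicalculus W) {X Y : C} {f g : X ⟶ Y} {φ ψ χ : f ⟶ g} (h : LocEq W φ ψ)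
    (h' : LocEq W ψ χ) : LocEq W φ χ := by
  obtain ⟨D, a, ha, h, h'⟩ := h.and hW h'
  exact ⟨D, a, ha, h.trans h'⟩

theorem of_whiskerLeft (hW : Bicalculus W) {X Y D : C} {f g : X ⟶ Y} {φ ψ : f ⟶ g} {a : D ⟶ X}
    (ha : W a) (h : LocEq W (a ◁ φ) (a ◁ ψ)) : LocEq W φ ψ := by
  obtain ⟨E, b, hb, h⟩ := h
  refine ⟨E, b ≫ a, hW.comp_mem _ _ hb ha, ?_⟩
  rw [comp_whiskerLeft, comp_whiskerLeft, h]

/-- BF3 moves the refinement `a` of `X` back along `b` to a refinement `a'` of `D`; there `b`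
factors through `a`, where the two 2-cells agree. -/
theorem whiskerLeft (hW : Bicalculus W) {X Y D : C} {f g : X ⟶ Y} {φ ψ : f ⟶ g} (b : D ⟶ X)
    (h : LocEq W φ ψ) : LocEq W (b ◁ φ) (b ◁ ψ) := by
  obtain ⟨E, a, ha, h⟩ := h
  obtain ⟨E', a', b', ha', ⟨ρ⟩⟩ := hW.square a b ha
  refine ⟨E', a', ha', ?_⟩
  have := whiskerLeft_eq_of_iso ρ.symm (whiskerLeft_comp_eq b' h)
  rw [comp_whiskerLeft, comp_whiskerLeft] at this
  simpa using this

theorem comp (hW : Bicalculus W) {X Y : C} {f g k : X ⟶ Y} {φ ψ : f ⟶ g} {φ' ψ' : g ⟶ k}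
    (h : LocEq W φ ψ) (h' : LocEq W φ' ψ') : LocEq W (φ ≫ φ') (ψ ≫ ψ') := by
  obtain ⟨D, a, ha, h, h'⟩ := h.and hW h'
  exact ⟨D, a, ha, by rw [Bicategory.whiskerLeft_comp, Bicategory.whiskerLeft_comp, h, h']⟩

theorem comp_left (hW : Bicalculus W) {X Y : C} {f g k : X ⟶ Y} (φ : f ⟶ g) {φ' ψ' : g ⟶ k}
    (h' : LocEq W φ' ψ') : LocEq W (φ ≫ φ') (φ ≫ ψ') := (of_eq hW rfl).comp hW h'

theorem comp_right (hW : Bicalculus W) {X Y : C} {f g k : X ⟶ Y} {φ ψ : f ⟶ g} (φ' : g ⟶ k)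
    (h : LocEq W φ ψ) : LocEq W (φ ≫ φ') (ψ ≫ φ') := h.comp hW (of_eq hW rfl)

theorem whiskerRight {X Y Z : C} {f g : X ⟶ Y} {φ ψ : f ⟶ g} (h : LocEq W φ ψ) (k : Y ⟶ Z) :
    LocEq W (φ ▷ k) (ψ ▷ k) := by
  obtain ⟨D, a, ha, h⟩ := h
  refine ⟨D, a, ha, ?_⟩
  have := congrArg (fun χ => (α_ _ _ _).inv ≫ χ ▷ k ≫ (α_ _ _ _).hom) h
  simpa using this

theorem conj_iff (hW : Bicalculus W) {X Y : C} {f g f' g' : X ⟶ Y} (i : f' ≅ f) (j : g ≅ g')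
    {φ ψ : f ⟶ g} : LocEq W (i.hom ≫ φ ≫ j.hom) (i.hom ≫ ψ ≫ j.hom) ↔ LocEq W φ ψ := by
  refine ⟨fun h => ?_, fun h => (h.comp_right hW _).comp_left hW _⟩
  have := (h.comp_right hW j.inv).comp_left hW i.inv
  simpa using this

end LocEq

/-- The restriction of a 2-cell defined over `t` to a 1-morphism that factors through `t`. -/
def res {X Y D T : C} {f g : X ⟶ Y} {t : T ⟶ X} (θ : t ≫ f ⟶ t ≫ g) {s : D ⟶ X} {u : D ⟶ T}
    (ζ : s ≅ u ≫ t) : s ≫ f ⟶ s ≫ g :=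
  ζ.hom ▷ f ≫ (α_ u t f).hom ≫ u ◁ θ ≫ (α_ u t g).inv ≫ ζ.inv ▷ g

section

variable {X Y D T : C} {f g k : X ⟶ Y} {t : T ⟶ X} {s : D ⟶ X} {u : D ⟶ T}

theorem res_id (ζ : s ≅ u ≫ t) : res (𝟙 (t ≫ f)) ζ = 𝟙 _ := by
  simp [res, ← comp_whiskerRight]

theorem res_comp (θ : t ≫ f ⟶ t ≫ g) (θ' : t ≫ g ⟶ t ≫ k) (ζ : s ≅ u ≫ t) :
    res (θ ≫ θ') ζ = res θ ζ ≫ res θ' ζ := by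
  simp [res, inv_hom_whiskerRight_assoc]

theorem res_whiskerLeft (η : f ⟶ g) (ζ : s ≅ u ≫ t) : res (t ◁ η) ζ = s ◁ η := by
  have : res (t ◁ η) ζ = ζ.hom ▷ f ≫ (u ≫ t) ◁ η ≫ ζ.inv ▷ g := by simp [res]
  rw [this, whisker_exchange, hom_inv_whiskerRight_assoc]

theorem res_res (θ : t ≫ f ⟶ t ≫ g) (ζ : s ≅ u ≫ t) {D' : C} {s' : D' ⟶ X} {v : D' ⟶ D}
    (ξ : s' ≅ v ≫ s) :
    res (res θ ζ) ξ = res θ (ξ ≪≫ whiskerLeftIso v ζ ≪≫ (α_ v u t).symm) := by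
  simp [res]

theorem whiskerLeft_res (θ : t ≫ f ⟶ t ≫ g) (ζ : s ≅ u ≫ t) {D' : C} (a : D' ⟶ D) :
    a ◁ res θ ζ =
      (α_ a s f).inv ≫ res θ (whiskerLeftIso a ζ ≪≫ (α_ a u t).symm) ≫ (α_ a s g).hom := by
  simp [res]

theorem LocEq.res (hW : Bicalculus W) {θ θ' : t ≫ f ⟶ t ≫ g} (h : LocEq W θ θ')
    (ζ : s ≅ u ≫ t) : LocEq W (res θ ζ) (res θ' ζ) := by
  unfold BicatFrac.res
  exact (((h.whiskerLeft hW u).comp_right hW _).comp_left hW _).comp_left hW _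

/-- Up to invertible 2-cells, restriction along `ζ` is left whiskering with `u`. As `u` is in `W`,
it may be absorbed into the refinement. -/
theorem LocEq.of_res (hW : Bicalculus W) {φ ψ : t ≫ f ⟶ t ≫ g} (hu : W u) (ζ : s ≅ u ≫ t)
    (h : LocEq W (BicatFrac.res φ ζ) (BicatFrac.res ψ ζ)) : LocEq W φ ψ := by
  refine LocEq.of_whiskerLeft hW hu ?_
  rw [← LocEq.conj_iff hW (whiskerRightIso ζ f ≪≫ α_ u t f)
    ((α_ u t g).symm ≪≫ whiskerRightIso ζ.symm g)]
  simpa [BicatFrac.res] using h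

/-- The restriction does not depend on the factorization, locally. -/
theorem res_unique (hW : Bicalculus W) (ht : W t) (θ : t ≫ f ⟶ t ≫ g) {u' : D ⟶ T}
    (ζ : s ≅ u ≫ t) (ζ' : s ≅ u' ≫ t) : LocEq W (res θ ζ) (res θ ζ') := by
  -- The comparison of the two factorizations is an automorphism-like 2-cell `u ≫ t ≅ u' ≫ t`; BF4
  -- lifts it, over `a`, to an invertible `β` between `u` and `u'`. The interchange law for `β` and
  -- `θ` then identifies both restrictions over `a`.
  obtain ⟨E, a, β, ha, hβ, hiso⟩ := hW.lift t u u' (ζ.inv ≫ ζ'.hom) ht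
  have := hiso inferInstance
  refine ⟨E, a, ha, ?_⟩
  have h1 : a ◁ ζ'.hom = a ◁ ζ.hom ≫ (α_ a u t).inv ≫ β ▷ t ≫ (α_ a u' t).hom := by
    rw [← hβ, Bicategory.whiskerLeft_comp]; simp
  have h2 : a ◁ ζ'.inv = (α_ a u' t).inv ≫ inv β ▷ t ≫ (α_ a u t).hom ≫ a ◁ ζ.inv := by
    rw [← cancel_epi (a ◁ ζ'.hom), whiskerLeft_hom_inv, h1]
    simp [← comp_whiskerRight_assoc]
  rw [whiskerLeft_res, whiskerLeft_res]
  congr 2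
  simp only [res, Iso.trans_hom, Iso.trans_inv, whiskerLeftIso_hom, whiskerLeftIso_inv,
    Iso.symm_hom, Iso.symm_inv, h1, h2]
  have key : (a ≫ u) ◁ θ = β ▷ (t ≫ f) ≫ (a ≫ u') ◁ θ ≫ inv β ▷ (t ≫ g) := by
    rw [← whisker_exchange_assoc, ← comp_whiskerRight]; simp
  rw [key]
  simp

end

end Germs

/-! ### Germs of 2-cells, their composition and their whiskerings. -/

section Germs

variable {C : Type u} [Bicategory.{w, v} C] {W : MorphismProperty C}

/-- Data representing a germ of 2-cells from `f` to `g`. -/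
structure PreGerm (W : MorphismProperty C) {X Y : C} (f g : X ⟶ Y) where
  obj : C
  t : obj ⟶ X
  mem : W t
  θ : t ≫ f ⟶ t ≫ g

/-- Two 2-cells defined over 1-morphisms in `W` agree locally. -/
def PreGerm.Rel {X Y : C} {f g : X ⟶ Y} (x y : PreGerm W f g) : Prop :=
  ∀ ⦃D : C⦄ (k : D ⟶ X) (u : D ⟶ x.obj) (u' : D ⟶ y.obj) (ζ : k ≅ u ≫ x.t) (ζ' : k ≅ u' ≫ y.t),
    LocEq W (res x.θ ζ) (res y.θ ζ')

theorem PreGerm.rel_equivalence (hW : Bicalculus W) {X Y : C} (f g : X ⟶ Y) :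
    Equivalence (PreGerm.Rel (W := W) (f := f) (g := g)) where
  refl x _ _ _ _ ζ ζ' := res_unique hW x.mem x.θ ζ ζ'
  symm h _ k u u' ζ ζ' := (h k u' u ζ' ζ).symm
  trans {x y z} h h' D k u u' ζ ζ' := by
    -- The 1-morphism `k` need not factor through the middle refinement `y.t`. It does so after
    -- precomposition with some `a` in `W`, and local equality descends along `a`.
    obtain ⟨E, a, b, ha, ⟨ρ⟩⟩ := hW.square y.t k y.mem
    refine LocEq.of_res hW ha (Iso.refl (a ≫ k)) ?_
    rw [res_res, res_res]
    exact (h _ _ _ _ ρ).trans hW (h' _ _ _ ρ _)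

/-- Germs of 2-cells from `f` to `g`. -/
def Germ (W : MorphismProperty C) {X Y : C} (f g : X ⟶ Y) : Type _ :=
  Quot (PreGerm.Rel (W := W) (f := f) (g := g))

namespace Germ

section

variable {X Y : C} {f g k : X ⟶ Y}

/-- The germ of a 2-cell defined over a 1-morphism in `W`. -/
def mk {D : C} (t : D ⟶ X) (h : W t) (θ : t ≫ f ⟶ t ≫ g) : Germ W f g := Quot.mk _ ⟨D, t, h, θ⟩

theorem exists_rep (x : Germ W f g) : ∃ (D : C) (t : D ⟶ X) (h : W t) (θ : t ≫ f ⟶ t ≫ g),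
    x = mk t h θ := by
  obtain ⟨x⟩ := x
  exact ⟨_, x.t, x.mem, x.θ, rfl⟩

theorem mk_eq_iff (hW : Bicalculus W) {D D' : C} {t : D ⟶ X} {h : W t} {θ : t ≫ f ⟶ t ≫ g}
    {t' : D' ⟶ X} {h' : W t'} {θ' : t' ≫ f ⟶ t' ≫ g} : mk t h θ = mk t' h' θ' ↔
    ∀ ⦃E : C⦄ (k : E ⟶ X) (u : E ⟶ D) (u' : E ⟶ D') (ζ : k ≅ u ≫ t) (ζ' : k ≅ u' ≫ t'),
      LocEq W (res θ ζ) (res θ' ζ') := by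
  refine ⟨fun e => ?_, fun e => Quot.sound e⟩
  exact (PreGerm.rel_equivalence hW f g).eqvGen_iff.1 (Quot.eqvGen_exact e)

/-- Equalities of germs are proved by bringing both sides over one refinement and applying this
criterion. -/
theorem mk_eq_same_iff (hW : Bicalculus W) {D : C} {t : D ⟶ X} {h h' : W t}
    {θ θ' : t ≫ f ⟶ t ≫ g} : mk t h θ = mk t h' θ' ↔ LocEq W θ θ' := by
  rw [mk_eq_iff hW]
  refine ⟨fun e => ?_, fun e E k u u' ζ ζ' => (res_unique hW h _ _ _).trans hW (e.res hW _)⟩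
  exact LocEq.of_res hW (hW.id_mem D) (λ_ t).symm (e _ _ _ _ _)

theorem mk_res (hW : Bicalculus W) {D E : C} {t : D ⟶ X} (h : W t) (θ : t ≫ f ⟶ t ≫ g)
    {s : E ⟶ X} (hs : W s) {u : E ⟶ D} (ζ : s ≅ u ≫ t) : mk t h θ = mk s hs (res θ ζ) := by
  rw [mk_eq_iff hW]
  intro E k u u' ζ ζ'
  rw [res_res]
  exact res_unique hW h _ _ _

theorem exists_mk_mk (hW : Bicalculus W) (x : Germ W f g) {Y' : C} {f' g' : X ⟶ Y'}
    (y : Germ W f' g') : ∃ (D : C) (t : D ⟶ X) (h : W t) (θ : t ≫ f ⟶ t ≫ g)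
    (θ' : t ≫ f' ⟶ t ≫ g'), x = mk t h θ ∧ y = mk t h θ' := by
  obtain ⟨D, t, h, θ, rfl⟩ := x.exists_rep
  obtain ⟨D', t', h', θ', rfl⟩ := y.exists_rep
  obtain ⟨E, s, u, u', hs, ⟨ζ⟩, ⟨ζ'⟩⟩ := hW.common t t' h h'
  exact ⟨E, s, hs, _, _, mk_res hW h θ hs ζ, mk_res hW h' θ' hs ζ'⟩

/-- Allows a further germ to be brought over a refinement already shared by others, as in the proof
of associativity. -/
theorem exists_mk_over (hW : Bicalculus W) (x : Germ W f g) {D : C} (t : D ⟶ X) (ht : W t) :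
    ∃ (E : C) (s : E ⟶ D) (hs : W s) (θ : (s ≫ t) ≫ f ⟶ (s ≫ t) ≫ g),
      x = mk (s ≫ t) (hW.comp_mem _ _ hs ht) θ := by
  obtain ⟨D', t', h', θ', rfl⟩ := x.exists_rep
  obtain ⟨E, s, u, hs, ⟨ρ⟩⟩ := hW.square t' t h'
  exact ⟨E, s, hs, _, mk_res hW h' θ' _ ρ⟩

/-- The germ of a 2-cell. -/
def of (hW : Bicalculus W) (η : f ⟶ g) : Germ W f g := mk (𝟙 X) (hW.id_mem X) (𝟙 X ◁ η)

theorem of_eq_mk (hW : Bicalculus W) (η : f ⟶ g) {D : C} (t : D ⟶ X) (h : W t) :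
    of hW η = mk t h (t ◁ η) := by
  rw [of, mk_res hW _ _ h (ρ_ t).symm, res_whiskerLeft]

theorem of_eq_of_iff (hW : Bicalculus W) {η θ : f ⟶ g} : of hW η = of hW θ ↔ LocEq W η θ := by
  rw [of, of, mk_eq_same_iff hW]
  exact ⟨LocEq.of_whiskerLeft hW (hW.id_mem X), LocEq.whiskerLeft hW _⟩

theorem comp_wd (hW : Bicalculus W) {D D' : C} {t : D ⟶ X} {h : W t} {θ : t ≫ f ⟶ t ≫ g}
    {θ' : t ≫ g ⟶ t ≫ k} {t' : D' ⟶ X} {h' : W t'} {φ : t' ≫ f ⟶ t' ≫ g} {φ' : t' ≫ g ⟶ t' ≫ k}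
    (e : mk t h θ = mk t' h' φ) (e' : mk t h θ' = mk t' h' φ') :
    mk t h (θ ≫ θ') = mk t' h' (φ ≫ φ') := by
  rw [mk_eq_iff hW] at *
  intro E k u u' ζ ζ'
  rw [res_comp, res_comp]
  exact (e k u u' ζ ζ').comp hW (e' k u u' ζ ζ')

/-- Vertical composition of germs. -/
noncomputable def comp (hW : Bicalculus W) (x : Germ W f g) (y : Germ W g k) : Germ W f k :=
  mk (exists_mk_mk hW x y).choose_spec.choose (exists_mk_mk hW x y).choose_spec.choose_spec.choose
    ((exists_mk_mk hW x y).choose_spec.choose_spec.choose_spec.choose ≫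
      (exists_mk_mk hW x y).choose_spec.choose_spec.choose_spec.choose_spec.choose)

theorem mk_comp_mk (hW : Bicalculus W) {D : C} (t : D ⟶ X) (h : W t) (θ : t ≫ f ⟶ t ≫ g)
    (θ' : t ≫ g ⟶ t ≫ k) : comp hW (mk t h θ) (mk t h θ') = mk t h (θ ≫ θ') := by
  have := (exists_mk_mk hW (mk t h θ) (mk t h θ')).choose_spec.choose_spec.choose_spec.choose_spec.choose_spec
  exact (comp_wd hW this.1 this.2).symm

end

section

variable {X Y Z : C} {f g : X ⟶ Y}

/-- Right whiskering of a germ. -/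
def whiskerRight (hW : Bicalculus W) (x : Germ W f g) (k : Y ⟶ Z) : Germ W (f ≫ k) (g ≫ k) :=
  Quot.map (fun x => ⟨x.obj, x.t, x.mem, (α_ _ _ _).inv ≫ x.θ ▷ k ≫ (α_ _ _ _).hom⟩)
    (fun x y h D m u u' ζ ζ' => by
      have key : ∀ {T : C} {t : T ⟶ X} {u : D ⟶ T} (ζ : m ≅ u ≫ t) (θ : t ≫ f ⟶ t ≫ g),
        res ((α_ _ _ _).inv ≫ θ ▷ k ≫ (α_ _ _ _).hom) ζ =
          (α_ _ _ _).inv ≫ res θ ζ ▷ k ≫ (α_ _ _ _).hom := fun ζ θ => by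
        simp [res]
      rw [key, key]
      exact (((h m u u' ζ ζ').whiskerRight k).comp_right hW _).comp_left hW _) x

theorem mk_whiskerRight (hW : Bicalculus W) {D : C} (t : D ⟶ X) (h : W t) (θ : t ≫ f ⟶ t ≫ g)
    (k : Y ⟶ Z) : whiskerRight hW (mk t h θ) k =
      mk t h ((α_ _ _ _).inv ≫ θ ▷ k ≫ (α_ _ _ _).hom) := rfl

end

section

variable {X' X Y : C} {f g : X ⟶ Y}

theorem exists_whiskerLeft (hW : Bicalculus W) (k : X' ⟶ X) (x : Germ W f g) :
    ∃ (D : C) (t : D ⟶ X) (h : W t) (θ : t ≫ f ⟶ t ≫ g) (D' : C) (t' : D' ⟶ X') (_ : W t')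
      (u : D' ⟶ D) (_ : t' ≫ k ≅ u ≫ t), x = mk t h θ := by
  obtain ⟨D, t, h, θ, rfl⟩ := x.exists_rep
  obtain ⟨D', t', u, h', ⟨ρ⟩⟩ := hW.square t k h
  exact ⟨D, t, h, θ, D', t', h', u, ρ, rfl⟩

/-- The square `ρ` that carries `t` back along `k` is a choice. Restricted to a common `s`, the
outcome of each choice is the restriction of the germ to `s ≫ k`, and restrictions of equal germs
agree locally. -/
theorem whiskerLeft_wd (hW : Bicalculus W) (k : X' ⟶ X) {D D₁ D' D₁' : C} {t : D ⟶ X} {h : W t}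
    {θ : t ≫ f ⟶ t ≫ g} {t' : D' ⟶ X'} (h' : W t') {u : D' ⟶ D} (ρ : t' ≫ k ≅ u ≫ t)
    {t₁ : D₁ ⟶ X} {h₁ : W t₁} {θ₁ : t₁ ≫ f ⟶ t₁ ≫ g} {t₁' : D₁' ⟶ X'} (h₁' : W t₁')
    {u₁ : D₁' ⟶ D₁} (ρ₁ : t₁' ≫ k ≅ u₁ ≫ t₁) (e : mk t h θ = mk t₁ h₁ θ₁) :
    mk t' h' ((α_ _ _ _).inv ≫ res θ ρ ≫ (α_ _ _ _).hom) =
      mk t₁' h₁' ((α_ _ _ _).inv ≫ res θ₁ ρ₁ ≫ (α_ _ _ _).hom) := by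
  rw [mk_eq_iff hW] at *
  intro E s v v₁ ξ ξ₁
  have key : ∀ {D D' : C} {t : D ⟶ X} (θ : t ≫ f ⟶ t ≫ g) {t' : D' ⟶ X'} {u : D' ⟶ D}
      (ρ : t' ≫ k ≅ u ≫ t) {v : E ⟶ D'} (ξ : s ≅ v ≫ t'),
      res ((α_ _ _ _).inv ≫ res θ ρ ≫ (α_ _ _ _).hom) ξ = (α_ _ _ _).inv ≫
        res θ (whiskerRightIso ξ k ≪≫ α_ _ _ _ ≪≫ whiskerLeftIso v ρ ≪≫ (α_ _ _ _).symm) ≫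
          (α_ _ _ _).hom := by
    intro D D' t θ t' u ρ v ξ
    simp [res]
  rw [key, key]
  exact ((e _ _ _ _ _).comp_right hW _).comp_left hW _

/-- Left whiskering of a germ. -/
noncomputable def whiskerLeft (hW : Bicalculus W) (k : X' ⟶ X) (x : Germ W f g) :
    Germ W (k ≫ f) (k ≫ g) :=
  let H := (exists_whiskerLeft hW k x).choose_spec.choose_spec.choose_spec
  let K := H.choose_spec.choose_spec
  mk K.choose K.choose_spec.choose
    ((α_ _ _ _).inv ≫ res H.choose K.choose_spec.choose_spec.choose_spec.choose ≫ (α_ _ _ _).hom)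

theorem whiskerLeft_mk (hW : Bicalculus W) (k : X' ⟶ X) {D D' : C} (t : D ⟶ X) (h : W t)
    (θ : t ≫ f ⟶ t ≫ g) (t' : D' ⟶ X') (h' : W t') {u : D' ⟶ D} (ρ : t' ≫ k ≅ u ≫ t) :
    whiskerLeft hW k (mk t h θ) = mk t' h' ((α_ _ _ _).inv ≫ res θ ρ ≫ (α_ _ _ _).hom) := by
  let H := (exists_whiskerLeft hW k (mk t h θ)).choose_spec.choose_spec.choose_spec
  let K := H.choose_spec.choose_spec
  exact whiskerLeft_wd hW k K.choose_spec.choose _ h' ρ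
    K.choose_spec.choose_spec.choose_spec.choose_spec.symm

end

end Germ

end Germs

/-! ### The laws of a bicategory for germs. -/

section Germs

variable {C : Type u} [Bicategory.{w, v} C] {W : MorphismProperty C}

namespace Germ

variable {X Y Z X' X'' : C} {f g h k : X ⟶ Y}

theorem id_comp (hW : Bicalculus W) (x : Germ W f g) : comp hW (of hW (𝟙 f)) x = x := by
  obtain ⟨D, t, m, θ, rfl⟩ := x.exists_rep
  rw [of_eq_mk hW _ t m, mk_comp_mk]
  simp

theorem comp_id (hW : Bicalculus W) (x : Germ W f g) : comp hW x (of hW (𝟙 g)) = x := by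
  obtain ⟨D, t, m, θ, rfl⟩ := x.exists_rep
  rw [of_eq_mk hW _ t m, mk_comp_mk]
  simp

theorem comp_assoc (hW : Bicalculus W) (x : Germ W f g) (y : Germ W g h) (z : Germ W h k) :
    comp hW (comp hW x y) z = comp hW x (comp hW y z) := by
  obtain ⟨D, t, m, θ, θ', rfl, rfl⟩ := exists_mk_mk hW x y
  obtain ⟨E, s, hs, φ, rfl⟩ := exists_mk_over hW z t m
  have m' := hW.comp_mem _ _ hs m
  rw [mk_res hW m θ m' (Iso.refl _), mk_res hW m θ' m' (Iso.refl _)]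
  simp only [mk_comp_mk, Category.assoc]

theorem of_comp (hW : Bicalculus W) (η : f ⟶ g) (θ : g ⟶ h) :
    of hW (η ≫ θ) = comp hW (of hW η) (of hW θ) := by
  rw [of, of, of, mk_comp_mk]
  simp

theorem of_whiskerRight (hW : Bicalculus W) (η : f ⟶ g) (k : Y ⟶ Z) :
    of hW (η ▷ k) = whiskerRight hW (of hW η) k := by
  rw [of, of, mk_whiskerRight]
  simp

theorem of_whiskerLeft (hW : Bicalculus W) (k : X' ⟶ X) (η : f ⟶ g) :
    of hW (k ◁ η) = whiskerLeft hW k (of hW η) := by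
  rw [of, of, whiskerLeft_mk hW k (𝟙 X) _ _ (𝟙 X') (hW.id_mem X') (λ_ k ≪≫ (ρ_ k).symm),
    res_whiskerLeft]
  simp

theorem whiskerLeft_comp (hW : Bicalculus W) (m : X' ⟶ X) (x : Germ W f g) (y : Germ W g h) :
    whiskerLeft hW m (comp hW x y) = comp hW (whiskerLeft hW m x) (whiskerLeft hW m y) := by
  obtain ⟨D, t, ht, θ, θ', rfl, rfl⟩ := exists_mk_mk hW x y
  obtain ⟨D', t', u, h', ⟨ρ⟩⟩ := hW.square t m ht
  rw [mk_comp_mk, whiskerLeft_mk hW m t ht _ t' h' ρ, whiskerLeft_mk hW m t ht _ t' h' ρ,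
    whiskerLeft_mk hW m t ht _ t' h' ρ, mk_comp_mk, res_comp]
  simp

theorem id_whiskerLeft (hW : Bicalculus W) (x : Germ W f g) :
    whiskerLeft hW (𝟙 X) x = comp hW (of hW (λ_ f).hom) (comp hW x (of hW (λ_ g).inv)) := by
  obtain ⟨D, t, ht, θ, rfl⟩ := x.exists_rep
  rw [whiskerLeft_mk hW (𝟙 X) t ht _ t ht (ρ_ t ≪≫ (λ_ t).symm), of_eq_mk hW _ t ht,
    of_eq_mk hW _ t ht, mk_comp_mk, mk_comp_mk]
  simp [res]

theorem comp_whiskerLeft (hW : Bicalculus W) (m : X'' ⟶ X') (n : X' ⟶ X) (x : Germ W f g) :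
    whiskerLeft hW (m ≫ n) x = comp hW (of hW (α_ m n f).hom)
      (comp hW (whiskerLeft hW m (whiskerLeft hW n x)) (of hW (α_ m n g).inv)) := by
  obtain ⟨D, t, ht, θ, rfl⟩ := x.exists_rep
  obtain ⟨D', t', u, h', ⟨ρ⟩⟩ := hW.square t n ht
  obtain ⟨E, s, v, hs, ⟨ξ⟩⟩ := hW.square t' m h'
  rw [whiskerLeft_mk hW n t ht _ t' h' ρ, whiskerLeft_mk hW m t' h' _ s hs ξ,
    whiskerLeft_mk hW (m ≫ n) t ht _ s hs ((α_ _ _ _).symm ≪≫ whiskerRightIso ξ n ≪≫ α_ _ _ _ ≪≫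
      whiskerLeftIso v ρ ≪≫ (α_ _ _ _).symm), of_eq_mk hW _ s hs,
    of_eq_mk hW _ s hs, mk_comp_mk, mk_comp_mk]
  simp [res]

theorem comp_whiskerRight (hW : Bicalculus W) (x : Germ W f g) (y : Germ W g h) (m : Y ⟶ Z) :
    whiskerRight hW (comp hW x y) m = comp hW (whiskerRight hW x m) (whiskerRight hW y m) := by
  obtain ⟨D, t, ht, θ, θ', rfl, rfl⟩ := exists_mk_mk hW x y
  rw [mk_comp_mk, mk_whiskerRight, mk_whiskerRight, mk_whiskerRight, mk_comp_mk]
  simp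

theorem whiskerRight_id (hW : Bicalculus W) (x : Germ W f g) :
    whiskerRight hW x (𝟙 Y) = comp hW (of hW (ρ_ f).hom) (comp hW x (of hW (ρ_ g).inv)) := by
  obtain ⟨D, t, ht, θ, rfl⟩ := x.exists_rep
  rw [mk_whiskerRight, of_eq_mk hW _ t ht, of_eq_mk hW _ t ht, mk_comp_mk, mk_comp_mk]
  simp

theorem whiskerRight_comp (hW : Bicalculus W) (x : Germ W f g) {Z' : C} (m : Y ⟶ Z) (n : Z ⟶ Z') :
    whiskerRight hW x (m ≫ n) = comp hW (of hW (α_ f m n).inv)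
      (comp hW (whiskerRight hW (whiskerRight hW x m) n) (of hW (α_ g m n).hom)) := by
  obtain ⟨D, t, ht, θ, rfl⟩ := x.exists_rep
  rw [mk_whiskerRight, mk_whiskerRight, mk_whiskerRight, of_eq_mk hW _ t ht, of_eq_mk hW _ t ht,
    mk_comp_mk, mk_comp_mk]
  simp

theorem whisker_assoc (hW : Bicalculus W) (m : X' ⟶ X) (x : Germ W f g) (n : Y ⟶ Z) :
    whiskerRight hW (whiskerLeft hW m x) n = comp hW (of hW (α_ m f n).hom)
      (comp hW (whiskerLeft hW m (whiskerRight hW x n)) (of hW (α_ m g n).inv)) := by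
  obtain ⟨D, t, ht, θ, rfl⟩ := x.exists_rep
  obtain ⟨D', t', u, h', ⟨ρ⟩⟩ := hW.square t m ht
  rw [whiskerLeft_mk hW m t ht _ t' h' ρ, mk_whiskerRight, mk_whiskerRight,
    whiskerLeft_mk hW m t ht _ t' h' ρ, of_eq_mk hW _ t' h', of_eq_mk hW _ t' h', mk_comp_mk,
    mk_comp_mk]
  simp [res]

/-- The 2-cells `κ`, `β` form a morphism between two factorizations through `t`. Naturality of
restriction in it is the interchange law for `β` and `θ`, and it does not need `β` to be invertible.
-/
theorem _root_.BicatFrac.res_natural {D T : C} {t : T ⟶ X} (θ : t ≫ f ⟶ t ≫ g) {s s' : D ⟶ X}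
    {u u' : D ⟶ T} (ζ : s ≅ u ≫ t) (ζ' : s' ≅ u' ≫ t) (κ : s ⟶ s') (β : u ⟶ u')
    (h : κ ≫ ζ'.hom = ζ.hom ≫ β ▷ t) : κ ▷ f ≫ res θ ζ' = res θ ζ ≫ κ ▷ g := by
  have h' : ζ.inv ≫ κ = β ▷ t ≫ ζ'.inv := by
    rw [Iso.inv_comp_eq, ← reassoc_of% h]; simp
  have key := Bicategory.whisker_exchange β θ
  simp only [res, Category.assoc, ← Bicategory.comp_whiskerRight, h']
  rw [← Bicategory.comp_whiskerRight_assoc, h]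
  simp only [Bicategory.comp_whiskerRight, Category.assoc, associator_naturality_left_assoc,
    ← reassoc_of% key, associator_inv_naturality_left_assoc]

/-- Over a refinement where both `f` and `g` factor through the domain of definition of `y`, the
germ `x` becomes, after one more refinement, a morphism between these factorizations. The law is
then naturality of the restriction of `y` in that morphism. -/
theorem whisker_exchange (hW : Bicalculus W) (x : Germ W f g) {m n : Y ⟶ Z} (y : Germ W m n) :
    comp hW (whiskerLeft hW f y) (whiskerRight hW x n) =
      comp hW (whiskerRight hW x m) (whiskerLeft hW g y) := by
  obtain ⟨D, t, ht, θ, rfl⟩ := x.exists_rep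
  obtain ⟨D', t', h', φ, rfl⟩ := y.exists_rep
  obtain ⟨E, s, v, hs, ⟨ξ⟩⟩ := hW.square t' (t ≫ f) h'
  obtain ⟨E', s', v', hs', ⟨ξ'⟩⟩ := hW.square t' (s ≫ t ≫ g) h'
  have hd : W (s' ≫ s ≫ t) := hW.comp_mem _ _ hs' (hW.comp_mem _ _ hs ht)
  rw [mk_res hW ht θ hd (u := s' ≫ s) (α_ s' s t).symm]
  -- The squares `ξ`, `ξ'` were chosen one after the other so that over `s' ≫ s ≫ t` both
  -- 1-morphisms factor through `t'`.
  let a : (s' ≫ s ≫ t) ≫ f ≅ (s' ≫ v) ≫ t' :=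
    α_ _ _ _ ≪≫ whiskerLeftIso s' (α_ _ _ _) ≪≫ whiskerLeftIso s' ξ ≪≫ (α_ _ _ _).symm
  let b : (s' ≫ s ≫ t) ≫ g ≅ v' ≫ t' := α_ _ _ _ ≪≫ whiskerLeftIso s' (α_ _ _ _) ≪≫ ξ'
  rw [whiskerLeft_mk hW f t' h' φ _ hd a, whiskerLeft_mk hW g t' h' φ _ hd b, mk_whiskerRight,
    mk_whiskerRight, mk_comp_mk, mk_comp_mk, mk_eq_same_iff hW]
  set Θ := res θ (α_ s' s t).symm
  -- Read through `a` and `b`, the 2-cell `Θ` has the form required by BF4 for `t'`; its lift `β` is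
  -- the morphism of factorizations over `p`.
  obtain ⟨P, p, β, hp, hβ, -⟩ := hW.lift t' (s' ≫ v) v' (a.inv ≫ Θ ≫ b.hom) h'
  have hΘ : p ◁ Θ = p ◁ a.hom ≫ (α_ _ _ _).inv ≫ β ▷ t' ≫ (α_ _ _ _).hom ≫ p ◁ b.inv := by
    have : Θ = a.hom ≫ (a.inv ≫ Θ ≫ b.hom) ≫ b.inv := by simp
    rw [this, Bicategory.whiskerLeft_comp, Bicategory.whiskerLeft_comp, hβ]; simp
  refine ⟨P, p, hp, ?_⟩
  have key : res φ (whiskerLeftIso p a ≪≫ (α_ _ _ _).symm) ≫ (p ◁ Θ) ▷ n =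
      (p ◁ Θ) ▷ m ≫ res φ (whiskerLeftIso p b ≪≫ (α_ _ _ _).symm) :=
    (res_natural φ _ _ _ β (by rw [hΘ]; simp)).symm
  have hΘr : ∀ l : Y ⟶ Z, p ◁ (Θ ▷ l) = (α_ _ _ _).inv ≫ (p ◁ Θ) ▷ l ≫ (α_ _ _ _).hom := by simp
  simp only [Bicategory.whiskerLeft_comp, hΘr, whiskerLeft_res]
  simp only [Category.assoc, whiskerLeft_hom_inv_assoc, Iso.hom_inv_id_assoc, reassoc_of% key]

end Germ

end Germs

/-! ### Fractions in which no refinement of 2-cells is needed. -/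

section Strong

variable {C : Type u} [Bicategory.{w, v} C]

/-- A bicalculus of fractions in which all refinements of 2-cells are superfluous: whiskering on
either side with a 1-morphism in `W` is bijective on 2-cells. -/
structure Strong (W : MorphismProperty C) : Prop where
  id_mem : ∀ A : C, W (𝟙 A)
  comp_mem : ∀ {A B D : C} (f : A ⟶ B) (g : B ⟶ D), W f → W g → W (f ≫ g)
  iso_mem : ∀ {A B : C} {v w : A ⟶ B}, (v ≅ w) → W w → W v
  square : ∀ {A B X : C} (w : A ⟶ B) (f : X ⟶ B), W w →
    ∃ (D : C) (w' : D ⟶ X) (f' : D ⟶ A), W w' ∧ Nonempty (w' ≫ f ≅ f' ≫ w)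
  faithful_right : ∀ {A B D : C} {f g : A ⟶ B} {w : B ⟶ D} (_ : W w) {θ θ' : f ⟶ g},
    θ ▷ w = θ' ▷ w → θ = θ'
  full_right : ∀ {A B D : C} {f g : A ⟶ B} {w : B ⟶ D} (_ : W w) (α : f ≫ w ⟶ g ≫ w),
    ∃ β : f ⟶ g, β ▷ w = α
  faithful_left : ∀ {A B D : C} {f g : A ⟶ B} {t : D ⟶ A} (_ : W t) {θ θ' : f ⟶ g},
    t ◁ θ = t ◁ θ' → θ = θ'
  full_left : ∀ {A B D : C} {f g : A ⟶ B} {t : D ⟶ A} (_ : W t) (α : t ≫ f ⟶ t ≫ g),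
    ∃ β : f ⟶ g, t ◁ β = α

end Strong

/-! ### The bicategory of germs and its strong calculus of fractions. -/

section Localization

variable {C : Type u} [Bicategory.{w, v} C] {W : MorphismProperty C}

/-- The objects of `C`, regarded as the objects of the bicategory with the same 1-morphisms whose
2-morphisms are the germs of 2-cells of `C`. -/
structure Loc {C : Type u} [Bicategory.{w, v} C] {W : MorphismProperty C} (hW : Bicalculus W) :
    Type u where
  /-- An object of `C` in the bicategory of germs. -/
  ob ::
  as : C

/-- The 1-morphisms of the bicategory of germs. -/
structure Loc.Hom {hW : Bicalculus W} (A B : Loc hW) : Type v where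
  /-- A 1-morphism of `C` in the bicategory of germs. -/
  map ::
  as : A.as ⟶ B.as

instance (hW : Bicalculus W) : CategoryStruct (Loc hW) where
  Hom A B := Loc.Hom A B
  id A := ⟨𝟙 A.as⟩
  comp f g := ⟨f.as ≫ g.as⟩

noncomputable instance Loc.homCategory (hW : Bicalculus W) (A B : Loc hW) : Category (A ⟶ B) where
  Hom f g := Germ W f.as g.as
  id f := Germ.of hW (𝟙 f.as)
  comp x y := Germ.comp hW x y
  id_comp := Germ.id_comp hW
  comp_id := Germ.comp_id hW
  assoc := Germ.comp_assoc hW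

/-- A 1-morphism of `C` in the bicategory of germs. -/
abbrev Loc.map (hW : Bicalculus W) {A B : C} (f : A ⟶ B) : (⟨A⟩ : Loc hW) ⟶ ⟨B⟩ := ⟨f⟩

/-- The germ of a 2-morphism of `C`, as a 2-morphism of the bicategory of germs. -/
def Loc.map₂ (hW : Bicalculus W) {A B : C} {f g : A ⟶ B} (η : f ⟶ g) :
    Loc.map hW f ⟶ Loc.map hW g := Germ.of hW η

/-- The germ of an invertible 2-morphism of `C`. -/
noncomputable def Loc.mapIso (hW : Bicalculus W) {A B : C} {f g : A ⟶ B} (η : f ≅ g) :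
    Loc.map hW f ≅ Loc.map hW g where
  hom := Loc.map₂ hW η.hom
  inv := Loc.map₂ hW η.inv
  hom_inv_id := (Germ.of_comp hW _ _).symm.trans (by rw [η.hom_inv_id]; rfl)
  inv_hom_id := (Germ.of_comp hW _ _).symm.trans (by rw [η.inv_hom_id]; rfl)

noncomputable instance (hW : Bicalculus W) : Bicategory (Loc hW) where
  homCategory := Loc.homCategory hW
  whiskerLeft f _ _ x := Germ.whiskerLeft hW f.as x
  whiskerRight x h := Germ.whiskerRight hW x h.as
  associator f g h := Loc.mapIso hW (α_ f.as g.as h.as)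
  leftUnitor f := Loc.mapIso hW (λ_ f.as)
  rightUnitor f := Loc.mapIso hW (ρ_ f.as)
  whiskerLeft_id f g := (Germ.of_whiskerLeft hW f.as (𝟙 g.as)).symm.trans (by
    rw [Bicategory.whiskerLeft_id]; rfl)
  whiskerLeft_comp f _ _ _ x y := Germ.whiskerLeft_comp hW f.as x y
  id_whiskerLeft x := Germ.id_whiskerLeft hW x
  comp_whiskerLeft f g _ _ x := Germ.comp_whiskerLeft hW f.as g.as x
  id_whiskerRight f g := (Germ.of_whiskerRight hW (𝟙 f.as) g.as).symm.trans (by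
    rw [Bicategory.id_whiskerRight]; rfl)
  comp_whiskerRight x y g := Germ.comp_whiskerRight hW x y g.as
  whiskerRight_id x := Germ.whiskerRight_id hW x
  whiskerRight_comp x g h := Germ.whiskerRight_comp hW x g.as h.as
  whisker_assoc f _ _ x h := Germ.whisker_assoc hW f.as x h.as
  whisker_exchange x y := Germ.whisker_exchange hW x y
  pentagon f g h k := by
    have := congrArg (Germ.of hW) (Bicategory.pentagon f.as g.as h.as k.as)
    rw [Germ.of_comp, Germ.of_comp, Germ.of_comp, Germ.of_whiskerLeft, Germ.of_whiskerRight] at this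
    exact this
  triangle f g := by
    have := congrArg (Germ.of hW) (Bicategory.triangle f.as g.as)
    rw [Germ.of_comp, Germ.of_whiskerLeft, Germ.of_whiskerRight] at this
    exact this

namespace Loc

variable (hW : Bicalculus W)

@[simp] theorem map_id (A : C) : map hW (𝟙 A) = 𝟙 _ := rfl
@[simp] theorem map_comp {A B D : C} (f : A ⟶ B) (g : B ⟶ D) :
    map hW (f ≫ g) = map hW f ≫ map hW g := rfl
@[simp] theorem map₂_id {A B : C} (f : A ⟶ B) : map₂ hW (𝟙 f) = 𝟙 _ := rfl
@[simp] theorem map₂_comp {A B : C} {f g h : A ⟶ B} (η : f ⟶ g) (θ : g ⟶ h) :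
    map₂ hW (η ≫ θ) = map₂ hW η ≫ map₂ hW θ := Germ.of_comp hW η θ
@[simp] theorem map₂_whiskerLeft {A B D : C} (f : A ⟶ B) {g h : B ⟶ D} (η : g ⟶ h) :
    map₂ hW (f ◁ η) = map hW f ◁ map₂ hW η := Germ.of_whiskerLeft hW f η
@[simp] theorem map₂_whiskerRight {A B D : C} {f g : A ⟶ B} (η : f ⟶ g) (h : B ⟶ D) :
    map₂ hW (η ▷ h) = map₂ hW η ▷ map hW h := Germ.of_whiskerRight hW η h
@[simp] theorem map₂_associator_hom {A B D E : C} (f : A ⟶ B) (g : B ⟶ D) (h : D ⟶ E) :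
    map₂ hW (α_ f g h).hom = (α_ (map hW f) (map hW g) (map hW h)).hom := rfl
@[simp] theorem map₂_associator_inv {A B D E : C} (f : A ⟶ B) (g : B ⟶ D) (h : D ⟶ E) :
    map₂ hW (α_ f g h).inv = (α_ (map hW f) (map hW g) (map hW h)).inv := rfl
@[simp] theorem map₂_leftUnitor_hom {A B : C} (f : A ⟶ B) :
    map₂ hW (λ_ f).hom = (λ_ (map hW f)).hom := rfl
@[simp] theorem map₂_leftUnitor_inv {A B : C} (f : A ⟶ B) :
    map₂ hW (λ_ f).inv = (λ_ (map hW f)).inv := rfl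
@[simp] theorem map₂_rightUnitor_hom {A B : C} (f : A ⟶ B) :
    map₂ hW (ρ_ f).hom = (ρ_ (map hW f)).hom := rfl
@[simp] theorem map₂_rightUnitor_inv {A B : C} (f : A ⟶ B) :
    map₂ hW (ρ_ f).inv = (ρ_ (map hW f)).inv := rfl
@[simp] theorem mapIso_hom {A B : C} {f g : A ⟶ B} (η : f ≅ g) :
    (mapIso hW η).hom = map₂ hW η.hom := rfl
@[simp] theorem mapIso_inv {A B : C} {f g : A ⟶ B} (η : f ≅ g) :
    (mapIso hW η).inv = map₂ hW η.inv := rfl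

/-- The closure of `W` under invertible germs. -/
def closure : MorphismProperty (Loc hW) :=
  fun _ _ f => ∃ m, W m ∧ Nonempty (f ≅ map hW m)

variable {hW}

theorem closure_map {A B : C} {f : A ⟶ B} (h : W f) : closure hW (map hW f) :=
  ⟨f, h, ⟨Iso.refl _⟩⟩

/-- The germ of a 2-cell defined over a 1-morphism in `W`. -/
def germ {A B D : C} {f g : A ⟶ B} (t : D ⟶ A) (h : W t) (θ : t ≫ f ⟶ t ≫ g) :
    map hW f ⟶ map hW g := Germ.mk t h θ

/-- Over its own refinement a germ is an honest 2-cell. Representatives of germs are read off in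
this way later. -/
theorem whiskerLeft_germ {A B D : C} {f g : A ⟶ B} (t : D ⟶ A) (h : W t) (θ : t ≫ f ⟶ t ≫ g) :
    map hW t ◁ germ (hW := hW) t h θ = map₂ hW θ := by
  refine (Germ.whiskerLeft_mk hW t t h θ (𝟙 D) (hW.id_mem D) (Iso.refl (𝟙 D ≫ t))).trans ?_
  simp [res, map₂, Germ.of]
  rfl

theorem exists_germ {A B : C} {f g : A ⟶ B} (x : map hW f ⟶ map hW g) :
    ∃ (D : C) (t : D ⟶ A) (h : W t) (θ : t ≫ f ⟶ t ≫ g), x = germ t h θ :=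
  Germ.exists_rep (f := f) (g := g) x

theorem map₂_eq_iff {A B : C} {f g : A ⟶ B} {η θ : f ⟶ g} :
    map₂ hW η = map₂ hW θ ↔ LocEq W η θ := Germ.of_eq_of_iff hW

/-- Whiskering with `t` restricts a germ over `s` to some `p` in `W` for which `p ≫ t` factors
through `s`. As `t` is in `W`, `p ≫ t` is itself a refinement, over which the two germs agree. -/
theorem whiskerLeft_germ_inj {A B D : C} {f g : A ⟶ B} {t : D ⟶ A} (h : W t)
    {x y : map hW f ⟶ map hW g} (e : map hW t ◁ x = map hW t ◁ y) : x = y := by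
  obtain ⟨E, s, hs, θ, θ', rfl, rfl⟩ :=
    Germ.exists_mk_mk hW (f := f) (g := g) x (f' := f) (g' := g) y
  obtain ⟨P, p, q, hp, ⟨ρ⟩⟩ := hW.square s t hs
  have e := (Germ.whiskerLeft_mk hW t s hs θ p hp ρ).symm.trans
    (e.trans (Germ.whiskerLeft_mk hW t s hs θ' p hp ρ))
  have e := (LocEq.conj_iff hW (α_ p t f).symm (α_ p t g)).1 ((Germ.mk_eq_same_iff hW).1 e)
  rw [Germ.mk_res hW hs θ (hW.comp_mem _ _ hp h) ρ, Germ.mk_res hW hs θ' (hW.comp_mem _ _ hp h) ρ]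
  exact (Germ.mk_eq_same_iff hW).2 e

/-- By the hypothesis, `φ` and `ψ` are both lifts of the single 2-cell `φ ▷ w`. The uniqueness axiom
BF4c relates them by an invertible `ζ` over a refinement, and the interchange law removes `ζ`. -/
theorem _root_.BicatFrac.LocEq.of_whiskerRight (hW : Bicalculus W) {A B D : C} {f g : A ⟶ B} {w : B ⟶ D} (h : W w) {φ ψ : f ⟶ g}
    (e : φ ▷ w = ψ ▷ w) : LocEq W φ ψ := by
  obtain ⟨E, u, u', ζ, hm, e⟩ := hW.lift_unique w f g (φ ▷ w) h A A (𝟙 A) (𝟙 A) (𝟙 A ◁ φ) (𝟙 A ◁ ψ)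
    (hW.id_mem A) (by simp [IsLift]) (hW.id_mem A) (by rw [e]; simp [IsLift])
  refine ⟨E, u ≫ 𝟙 A, hm, ?_⟩
  have h2 : (α_ u (𝟙 A) f).hom ≫ u ◁ 𝟙 A ◁ φ ≫ (α_ u (𝟙 A) g).inv = (u ≫ 𝟙 A) ◁ φ := by simp
  have h3 : ζ.hom ▷ f ≫ (u' ≫ 𝟙 A) ◁ ψ = (u ≫ 𝟙 A) ◁ ψ ≫ ζ.hom ▷ g :=
    (whisker_exchange _ _).symm
  rw [← cancel_mono (ζ.hom ▷ g), ← h3, ← cancel_mono (α_ u' (𝟙 A) g).hom, ← h2]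
  simpa using e.symm

/-- BF4a lifts a representing 2-cell over a further refinement, and a 2-cell over a refinement is by
definition a germ. -/
theorem full_right_map {A B D : C} {f g : A ⟶ B} {w : B ⟶ D} (h : W w)
    (x : map hW f ≫ map hW w ⟶ map hW g ≫ map hW w) :
    ∃ y : map hW f ⟶ map hW g, y ▷ map hW w = x := by
  obtain ⟨E, t, ht, θ, rfl⟩ := Germ.exists_rep (f := f ≫ w) (g := g ≫ w) x
  obtain ⟨P, p, β, hp, hβ, -⟩ := hW.lift w (t ≫ f) (t ≫ g) ((α_ _ _ _).hom ≫ θ ≫ (α_ _ _ _).inv) h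
  refine ⟨Germ.mk (p ≫ t) (hW.comp_mem _ _ hp ht) ((α_ _ _ _).hom ≫ β ≫ (α_ _ _ _).inv), ?_⟩
  rw [Germ.mk_res hW ht θ (hW.comp_mem _ _ hp ht) (Iso.refl _)]
  refine (Germ.mk_whiskerRight hW _ _ _ _).trans ?_
  congr 1
  have : p ◁ θ = p ◁ (α_ _ _ _).inv ≫ (p ◁ ((α_ _ _ _).hom ≫ θ ≫ (α_ _ _ _).inv)) ≫
    p ◁ (α_ _ _ _).hom := by simp
  rw [res, this, hβ]
  simp

theorem faithful_right_map {A B D : C} {f g : A ⟶ B} {w : B ⟶ D} (h : W w)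
    {x y : map hW f ⟶ map hW g} (e : x ▷ map hW w = y ▷ map hW w) : x = y := by
  obtain ⟨E, t, ht, θ, θ', rfl, rfl⟩ :=
    Germ.exists_mk_mk hW (f := f) (g := g) x (f' := f) (g' := g) y
  have e := (Germ.mk_whiskerRight hW t ht θ w).symm.trans
    (e.trans (Germ.mk_whiskerRight hW t ht θ' w))
  obtain ⟨P, p, hp, e⟩ :=
    (LocEq.conj_iff hW (α_ t f w).symm (α_ t g w)).1 ((Germ.mk_eq_same_iff hW).1 e)
  refine (Germ.mk_eq_same_iff hW).2 (LocEq.of_whiskerLeft hW hp (LocEq.of_whiskerRight hW h ?_))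
  simp only [whisker_assoc, e]

/-- A 2-cell defined over `s` between `t ≫ f` and `t ≫ g` is a 2-cell defined over `s ≫ t` between
`f` and `g`, because `t` counts as a refinement. -/
theorem full_left_map {A B D : C} {f g : A ⟶ B} {t : D ⟶ A} (h : W t)
    (x : map hW t ≫ map hW f ⟶ map hW t ≫ map hW g) :
    ∃ y : map hW f ⟶ map hW g, map hW t ◁ y = x := by
  obtain ⟨E, s, hs, θ, rfl⟩ := Germ.exists_rep (f := t ≫ f) (g := t ≫ g) x
  refine ⟨Germ.mk (s ≫ t) (hW.comp_mem _ _ hs h) ((α_ _ _ _).hom ≫ θ ≫ (α_ _ _ _).inv), ?_⟩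
  refine (Germ.whiskerLeft_mk hW t _ _ _ s hs (u := 𝟙 E) (λ_ _).symm).trans ?_
  simp [res]

/-- Membership in the closure provides an invertible germ to a 1-morphism of `W`. Conjugation by it
reduces each property to the case of a 1-morphism of `W`. -/
theorem strong : Strong (closure hW) where
  id_mem A := closure_map (hW.id_mem A.as)
  comp_mem := by
    rintro A B D f g ⟨m, hm, ⟨i⟩⟩ ⟨n, hn, ⟨j⟩⟩
    exact ⟨m ≫ n, hW.comp_mem _ _ hm hn, ⟨whiskerRightIso i g ≪≫ whiskerLeftIso (map hW m) j⟩⟩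
  iso_mem := by
    rintro A B v w i ⟨m, hm, ⟨j⟩⟩
    exact ⟨m, hm, ⟨i ≪≫ j⟩⟩
  square := by
    rintro A B X w f ⟨m, hm, ⟨i⟩⟩
    obtain ⟨D, w', f', h, ⟨ρ⟩⟩ := hW.square m f.as hm
    exact ⟨⟨D⟩, ⟨w'⟩, ⟨f'⟩, closure_map h, ⟨mapIso hW ρ ≪≫ whiskerLeftIso (map hW f') i.symm⟩⟩
  faithful_right := by
    rintro A B D f g w ⟨m, hm, ⟨i⟩⟩ x y e
    refine faithful_right_map (f := f.as) (g := g.as) hm ?_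
    have : ∀ x : f ⟶ g, x ▷ map hW m = f ◁ i.inv ≫ x ▷ w ≫ g ◁ i.hom := fun x => by
      rw [← whisker_exchange, whiskerLeft_inv_hom_assoc]
    have hx := this x
    rw [e] at hx
    exact hx.trans (this y).symm
  full_right := by
    rintro A B D f g w ⟨m, hm, ⟨i⟩⟩ α
    obtain ⟨y, hy⟩ := full_right_map (f := f.as) (g := g.as) hm (f ◁ i.inv ≫ α ≫ g ◁ i.hom)
    refine ⟨y, ?_⟩
    have : ∀ x : f ⟶ g, x ▷ w = f ◁ i.hom ≫ x ▷ map hW m ≫ g ◁ i.inv := fun x => by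
      rw [← whisker_exchange, whiskerLeft_hom_inv_assoc]
    refine (this y).trans ?_
    have hy : y ▷ map hW m = f ◁ i.inv ≫ α ≫ g ◁ i.hom := hy
    rw [hy]; simp
  faithful_left := by
    rintro A B D f g t ⟨m, hm, ⟨i⟩⟩ x y e
    exact whiskerLeft_germ_inj (f := f.as) (g := g.as) hm (whiskerLeft_eq_of_iso i e)
  full_left := by
    rintro A B D f g t ⟨m, hm, ⟨i⟩⟩ α
    obtain ⟨y, hy⟩ := full_left_map (f := f.as) (g := g.as) hm (i.inv ▷ f ≫ α ≫ i.hom ▷ g)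
    refine ⟨y, ?_⟩
    have hy : map hW m ◁ y = i.inv ▷ f ≫ α ≫ i.hom ▷ g := hy
    rw [← cancel_mono (i.hom ▷ g), whisker_exchange, hy]; simp

end Loc

end Localization

/-! ### Points of fractions and values of 2-morphisms at points. -/

section Points

variable {C : Type u} [Bicategory.{w, v} C] {W : MorphismProperty C}

namespace Strong

theorem lift_iso (hW : Strong W) {A B D : C} {f g : A ⟶ B} {w : B ⟶ D} (h : W w)
    (α : f ≫ w ≅ g ≫ w) : ∃ β : f ≅ g, β.hom ▷ w = α.hom := by
  obtain ⟨β, hβ⟩ := hW.full_right h α.hom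
  obtain ⟨β', hβ'⟩ := hW.full_right h α.inv
  refine ⟨⟨β, β', hW.faithful_right h ?_, hW.faithful_right h ?_⟩, hβ⟩ <;> simp [hβ, hβ']

/-- The 1-morphism `v` need not be in `W`, but whiskering with `v ≫ w` and with `w` is bijective, so
whiskering with `v` is full. It is applied to the first leg of a representative. -/
theorem lift_comp (hW : Strong W) {A X B D : C} {z z' : X ⟶ A} {v : A ⟶ B} {w : B ⟶ D} (h : W w)
    (h' : W (v ≫ w)) (θ : z ≫ v ⟶ z' ≫ v) : ∃ τ : z ⟶ z', τ ▷ v = θ := by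
  obtain ⟨τ, hτ⟩ := hW.full_right h' ((α_ _ _ _).inv ≫ θ ▷ w ≫ (α_ _ _ _).hom)
  refine ⟨τ, hW.faithful_right h ?_⟩
  simpa using hτ

theorem isIso_of_whiskerRight (hW : Strong W) {A B D : C} {f g : A ⟶ B} {w : B ⟶ D} (h : W w)
    (θ : f ⟶ g) [IsIso (θ ▷ w)] : IsIso θ := by
  obtain ⟨β, hβ⟩ := hW.lift_iso h (asIso (θ ▷ w))
  rw [← hW.faithful_right h hβ]
  infer_instance

/-- Every 1-morphism factors locally through `v`, if `v ≫ w` and `w` are in `W`. -/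
theorem exists_factor (hW : Strong W) {A X B D : C} (a : X ⟶ B) {v : A ⟶ B} {w : B ⟶ D} (h : W w)
    (h' : W (v ≫ w)) : ∃ (E : C) (t : E ⟶ X) (z : E ⟶ A), W t ∧ Nonempty (t ≫ a ≅ z ≫ v) := by
  -- A square for `v ≫ w` and `a ≫ w` gives the factorization after composition with `w`, which can
  -- then be cancelled.
  obtain ⟨E, t, z, ht, ⟨ρ⟩⟩ := hW.square (v ≫ w) (a ≫ w) h'
  obtain ⟨β, -⟩ := hW.lift_iso h ((α_ t a w) ≪≫ ρ ≪≫ (α_ z v w).symm)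
  exact ⟨E, t, z, ht, ⟨β⟩⟩

end Strong

/-- A point of the fraction `F` over `e`, with value `x`: a way to exhibit `x` as the image of `e`
under `F`. -/
structure Pt {A B E : C} (F : Frac W A B) (e : E ⟶ A) (x : E ⟶ B) where
  a : E ⟶ F.obj
  κ : a ≫ F.w ≅ e
  ν : a ≫ F.f ≅ x

/-- The restriction of a point. -/
def Pt.pull {A B E D : C} {F : Frac W A B} {e : E ⟶ A} {x : E ⟶ B} (p : Pt F e x) (t : D ⟶ E) :
    Pt F (t ≫ e) (t ≫ x) where
  a := t ≫ p.a
  κ := α_ t p.a F.w ≪≫ whiskerLeftIso t p.κ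
  ν := α_ t p.a F.f ≪≫ whiskerLeftIso t p.ν

/-- There is a morphism of points over `γ` with value `β`. -/
def Over {A B E : C} {F : Frac W A B} {e e' : E ⟶ A} {x x' : E ⟶ B} (p : Pt F e x)
    (q : Pt F e' x') (γ : e ⟶ e') (β : x ⟶ x') : Prop :=
  ∃ l : p.a ⟶ q.a, l ▷ F.w ≫ q.κ.hom = p.κ.hom ≫ γ ∧ l ▷ F.f ≫ q.ν.hom = p.ν.hom ≫ β

namespace Over

variable {A B E D : C} {F : Frac W A B} {e e' e'' : E ⟶ A} {x x' x'' : E ⟶ B} {p : Pt F e x}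
  {q : Pt F e' x'} {r : Pt F e'' x''}

theorem refl (p : Pt F e x) : Over p p (𝟙 e) (𝟙 x) := ⟨𝟙 _, by simp, by simp⟩

theorem comp {γ : e ⟶ e'} {β : x ⟶ x'} {γ' : e' ⟶ e''} {β' : x' ⟶ x''} (h : Over p q γ β)
    (h' : Over q r γ' β') : Over p r (γ ≫ γ') (β ≫ β') := by
  obtain ⟨l, h1, h2⟩ := h
  obtain ⟨l', h1', h2'⟩ := h'
  refine ⟨l ≫ l', ?_, ?_⟩
  · rw [comp_whiskerRight, Category.assoc, h1', reassoc_of% h1]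
  · rw [comp_whiskerRight, Category.assoc, h2', reassoc_of% h2]

/-- Whiskering with `F.w` is full, so `γ` lifts to a morphism between the points; composing it with
`F.f` gives the value. -/
theorem exists_of (hW : Strong W) (p : Pt F e x) (q : Pt F e' x') (γ : e ⟶ e') :
    ∃ β : x ⟶ x', Over p q γ β := by
  obtain ⟨l, hl⟩ := hW.full_right F.mem (p.κ.hom ≫ γ ≫ q.κ.inv)
  exact ⟨p.ν.inv ≫ l ▷ F.f ≫ q.ν.hom, l, by simp [hl], by simp⟩

theorem unique (hW : Strong W) {γ : e ⟶ e'} {β β' : x ⟶ x'} (h : Over p q γ β)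
    (h' : Over p q γ β') : β = β' := by
  obtain ⟨l, h1, h2⟩ := h
  obtain ⟨l', h1', h2'⟩ := h'
  have : l = l' := hW.faithful_right F.mem (by
    rw [← cancel_mono q.κ.hom, h1, h1'])
  subst this
  rw [← cancel_epi p.ν.hom, ← h2, ← h2']

theorem pull {γ : e ⟶ e'} {β : x ⟶ x'} (h : Over p q γ β) (t : D ⟶ E) :
    Over (p.pull t) (q.pull t) (t ◁ γ) (t ◁ β) := by
  obtain ⟨l, h1, h2⟩ := h
  refine ⟨t ◁ l, ?_, ?_⟩
  · simp [Pt.pull, ← Bicategory.whiskerLeft_comp, h1]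
  · simp [Pt.pull, ← Bicategory.whiskerLeft_comp, h2]

end Over

section

variable {A B E D : C} {F G : Frac W A B} {e e' : E ⟶ A} {x x' : E ⟶ B}

/-- The 2-cell `α` of a representative, restricted along `z`. -/
def Rep.αAt (r : Rep F G) (z : E ⟶ r.obj) : (z ≫ r.v₁) ≫ F.w ≅ (z ≫ r.v₂) ≫ G.w :=
  α_ z r.v₁ F.w ≪≫ whiskerLeftIso z r.α ≪≫ (α_ z r.v₂ G.w).symm

/-- The 2-cell `β` of a representative, restricted along `z`. -/
def Rep.βAt (r : Rep F G) (z : E ⟶ r.obj) : (z ≫ r.v₁) ≫ F.f ⟶ (z ≫ r.v₂) ≫ G.f :=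
  (α_ z r.v₁ F.f).hom ≫ z ◁ r.β ≫ (α_ z r.v₂ G.f).inv

theorem Rep.αAt_natural (r : Rep F G) {z z' : E ⟶ r.obj} (τ : z ⟶ z') :
    τ ▷ r.v₁ ▷ F.w ≫ (r.αAt z').hom = (r.αAt z).hom ≫ τ ▷ r.v₂ ▷ G.w := by
  simp only [Rep.αAt, Iso.trans_hom, whiskerLeftIso_hom, Iso.symm_hom, Category.assoc,
    associator_naturality_left_assoc, ← whisker_exchange_assoc, associator_inv_naturality_left]

theorem Rep.βAt_natural (r : Rep F G) {z z' : E ⟶ r.obj} (τ : z ⟶ z') :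
    τ ▷ r.v₁ ▷ F.f ≫ r.βAt z' = r.βAt z ≫ τ ▷ r.v₂ ▷ G.f := by
  simp only [Rep.βAt, Category.assoc, associator_naturality_left_assoc, ← whisker_exchange_assoc,
    associator_inv_naturality_left]

/-- The representative `r`, restricted along `z`, carries the 2-cell `γ` between the arguments `e`,
`e'` to the 2-cell `β` between their images. -/
def ForceAt (r : Rep F G) (z : E ⟶ r.obj) (p : Pt F e x) (q : Pt G e' x') (γ : e ⟶ e')
    (β : x ⟶ x') : Prop :=
  ∃ (s₁ : p.a ≅ z ≫ r.v₁) (s₂ : z ≫ r.v₂ ⟶ q.a),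
    s₁.hom ▷ F.w ≫ (r.αAt z).hom ≫ s₂ ▷ G.w ≫ q.κ.hom = p.κ.hom ≫ γ ∧
    s₁.hom ▷ F.f ≫ r.βAt z ≫ s₂ ▷ G.f ≫ q.ν.hom = p.ν.hom ≫ β

/-- The representative `r` carries the 2-cell `γ` between the arguments `e`, `e'` to the 2-cell `β`
between their images, without refinement. -/
def Force₀ (r : Rep F G) (p : Pt F e x) (q : Pt G e' x') (γ : e ⟶ e') (β : x ⟶ x') : Prop :=
  ∃ z : E ⟶ r.obj, ForceAt r z p q γ β

/-- The representative `r` carries the 2-cell `γ` between the arguments `e`, `e'` to the 2-cell `β`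
between their images. -/
def Force (W : MorphismProperty C) {F G : Frac W A B} (r : Rep F G) (p : Pt F e x) (q : Pt G e' x')
    (γ : e ⟶ e') (β : x ⟶ x') : Prop :=
  ∃ (D : C) (t : D ⟶ E), W t ∧ Force₀ r (p.pull t) (q.pull t) (t ◁ γ) (t ◁ β)

variable {r : Rep F G} {p : Pt F e x} {q : Pt G e' x'} {γ : e ⟶ e'} {β β' : x ⟶ x'}

theorem ForceAt.pull {z : E ⟶ r.obj} (h : ForceAt r z p q γ β) (t : D ⟶ E) :
    ForceAt r (t ≫ z) (p.pull t) (q.pull t) (t ◁ γ) (t ◁ β) := by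
  obtain ⟨s₁, s₂, h1, h2⟩ := h
  refine ⟨whiskerLeftIso t s₁ ≪≫ (α_ _ _ _).symm, (α_ _ _ _).hom ≫ t ◁ s₂, ?_, ?_⟩
  · have := congrArg (fun x => (α_ _ _ _).hom ≫ t ◁ x) h1
    simpa [Pt.pull, Rep.αAt] using this
  · have := congrArg (fun x => (α_ _ _ _).hom ≫ t ◁ x) h2
    simpa [Pt.pull, Rep.βAt] using this

theorem ForceAt.of_iso {z z' : E ⟶ r.obj} (h : ForceAt r z p q γ β) (τ : z ≅ z') :
    ForceAt r z' p q γ β := by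
  obtain ⟨s₁, s₂, h1, h2⟩ := h
  refine ⟨s₁ ≪≫ whiskerRightIso τ _, τ.inv ▷ _ ≫ s₂, ?_, ?_⟩
  · simp only [Iso.trans_hom, whiskerRightIso_hom, comp_whiskerRight, Category.assoc,
      reassoc_of% r.αAt_natural τ.hom]
    rw [← comp_whiskerRight_assoc (τ.hom ▷ _), hom_inv_whiskerRight, id_whiskerRight,
      Category.id_comp, h1]
  · simp only [Iso.trans_hom, whiskerRightIso_hom, comp_whiskerRight, Category.assoc,
      reassoc_of% r.βAt_natural τ.hom]
    rw [← comp_whiskerRight_assoc (τ.hom ▷ _), hom_inv_whiskerRight, id_whiskerRight,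
      Category.id_comp, h2]

theorem Force₀.pull (h : Force₀ r p q γ β) (t : D ⟶ E) :
    Force₀ r (p.pull t) (q.pull t) (t ◁ γ) (t ◁ β) := by
  obtain ⟨z, h⟩ := h
  exact ⟨t ≫ z, h.pull t⟩

/-- Two evaluations use two lifts `z`, `z'` of the point through the first leg. They are connected
by a 2-cell `τ`, which also intertwines the second legs, and naturality of `βAt` makes the values
equal. -/
theorem Force₀.unique (hW : Strong W) (h : Force₀ r p q γ β) (h' : Force₀ r p q γ β') : β = β' := by
  obtain ⟨z, s₁, s₂, h1, h2⟩ := h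
  obtain ⟨z', s₁', s₂', h1', h2'⟩ := h'
  obtain ⟨τ, hτ⟩ := hW.lift_comp F.mem r.mem (s₁.inv ≫ s₁'.hom)
  have e1 : s₁'.hom = s₁.hom ≫ τ ▷ r.v₁ := by rw [hτ]; simp
  -- Whiskering with `G.w` is faithful, and both sides satisfy the same equation over `γ`.
  have e2 : s₂ = τ ▷ r.v₂ ≫ s₂' := by
    refine hW.faithful_right G.mem ?_
    rw [← cancel_mono q.κ.hom, ← cancel_epi (r.αAt z).hom, ← cancel_epi (s₁.hom ▷ F.w)]
    simp only [Category.assoc, comp_whiskerRight]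
    rw [← reassoc_of% r.αAt_natural τ, ← comp_whiskerRight_assoc, ← e1, h1, h1']
  rw [← cancel_epi p.ν.hom, ← h2, ← h2', e1, e2]
  simp only [Category.assoc, comp_whiskerRight]
  rw [← reassoc_of% r.βAt_natural τ]

/-- Change of the points. -/
theorem Force₀.conj (h : Force₀ r p q γ β) {e₁ e₁' : E ⟶ A} {x₁ x₁' : E ⟶ B} {p' : Pt F e₁ x₁}
    {q' : Pt G e₁' x₁'} (i : p'.a ≅ p.a) {γ₁ : e₁ ⟶ e} {β₁ : x₁ ⟶ x}
    (hi : i.hom ▷ F.w ≫ p.κ.hom = p'.κ.hom ≫ γ₁) (hi' : i.hom ▷ F.f ≫ p.ν.hom = p'.ν.hom ≫ β₁)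
    {γ₂ : e' ⟶ e₁'} {β₂ : x' ⟶ x₁'} (h' : Over q q' γ₂ β₂) :
    Force₀ r p' q' (γ₁ ≫ γ ≫ γ₂) (β₁ ≫ β ≫ β₂) := by
  obtain ⟨z, s₁, s₂, h1, h2⟩ := h
  obtain ⟨j, hj, hj'⟩ := h'
  refine ⟨z, i ≪≫ s₁, s₂ ≫ j, ?_, ?_⟩
  · simp only [Iso.trans_hom, comp_whiskerRight, Category.assoc, hj, reassoc_of% h1, reassoc_of% hi]
  · simp only [Iso.trans_hom, comp_whiskerRight, Category.assoc, hj', reassoc_of% h2,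
      reassoc_of% hi']

/-- Change of the refinement. -/
theorem Force₀.of_iso {t u : D ⟶ E} (h : Force₀ r (p.pull t) (q.pull t) (t ◁ γ) (t ◁ β))
    (ζ : u ≅ t) : Force₀ r (p.pull u) (q.pull u) (u ◁ γ) (u ◁ β) := by
  have key : ∀ {Y : C} {m m' : E ⟶ Y} (γ : m ⟶ m'), u ◁ γ = ζ.hom ▷ m ≫ t ◁ γ ≫ ζ.inv ▷ m' := by
    intros
    rw [whisker_exchange, hom_inv_whiskerRight_assoc]
  rw [key γ, key β]
  refine h.conj (whiskerRightIso ζ p.a) ?_ ?_ ⟨ζ.inv ▷ q.a, ?_, ?_⟩ <;>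
    simp [Pt.pull, whisker_exchange]

theorem Force₀.of_comp {D' : C} {t : D ⟶ E} {u : D' ⟶ E} {y : D' ⟶ D}
    (h : Force₀ r (p.pull t) (q.pull t) (t ◁ γ) (t ◁ β)) (ζ : u ≅ y ≫ t) :
    Force₀ r (p.pull u) (q.pull u) (u ◁ γ) (u ◁ β) := by
  refine Force₀.of_iso ?_ ζ
  rw [comp_whiskerLeft, comp_whiskerLeft]
  refine (h.pull y).conj (α_ y t p.a) ?_ ?_ ⟨(α_ y t q.a).inv, ?_, ?_⟩ <;> simp [Pt.pull]

theorem Force₀.toForce (hW : Strong W) (h : Force₀ r p q γ β) : Force W r p q γ β :=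
  ⟨E, 𝟙 E, hW.id_mem E, h.pull _⟩

theorem Strong.common (hW : Strong W) {X D D' : C} (t : D ⟶ X) (t' : D' ⟶ X) (ht : W t)
    (ht' : W t') :
    ∃ (E : C) (s : E ⟶ X) (u : E ⟶ D) (u' : E ⟶ D'), W s ∧ Nonempty (s ≅ u ≫ t) ∧
      Nonempty (s ≅ u' ≫ t') := by
  obtain ⟨E, u', u, hu', ⟨ρ⟩⟩ := hW.square t t' ht
  exact ⟨E, u' ≫ t', u, u', hW.comp_mem _ _ hu' ht', ⟨ρ⟩, ⟨Iso.refl _⟩⟩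

theorem Force.and (hW : Strong W) (h : Force W r p q γ β) {A' B' : C} {F' G' : Frac W A' B'}
    {r' : Rep F' G'} {e₁ e₁' : E ⟶ A'} {x₁ x₁' : E ⟶ B'} {p' : Pt F' e₁ x₁} {q' : Pt G' e₁' x₁'}
    {γ' : e₁ ⟶ e₁'} {β' : x₁ ⟶ x₁'} (h' : Force W r' p' q' γ' β') :
    ∃ (D : C) (t : D ⟶ E), W t ∧ Force₀ r (p.pull t) (q.pull t) (t ◁ γ) (t ◁ β) ∧
      Force₀ r' (p'.pull t) (q'.pull t) (t ◁ γ') (t ◁ β') := by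
  obtain ⟨D, t, ht, h⟩ := h
  obtain ⟨D', t', ht', h'⟩ := h'
  obtain ⟨D'', s, u, u', hs, ⟨ζ⟩, ⟨ζ'⟩⟩ := hW.common t t' ht ht'
  exact ⟨D'', s, hs, h.of_comp ζ, h'.of_comp ζ'⟩

theorem Force.unique (hW : Strong W) (h : Force W r p q γ β) (h' : Force W r p q γ β') :
    β = β' := by
  obtain ⟨D, t, ht, h, h'⟩ := h.and hW h'
  exact hW.faithful_left ht (h.unique hW h')

/-- A 2-cell may be evaluated after any refinement. -/
theorem Force.of_pull (hW : Strong W) {t : D ⟶ E} (ht : W t)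
    (h : Force W r (p.pull t) (q.pull t) (t ◁ γ) (t ◁ β)) : Force W r p q γ β := by
  obtain ⟨D', s, hs, h⟩ := h
  refine ⟨D', s ≫ t, hW.comp_mem _ _ hs ht, ?_⟩
  rw [comp_whiskerLeft, comp_whiskerLeft]
  refine h.conj (α_ s t p.a) ?_ ?_ ⟨(α_ s t q.a).inv, ?_, ?_⟩ <;> simp [Pt.pull]

/-- The point `p` lifts through `r.v₁` after a refinement `t`; the 2-cell to `q` is then forced by
fullness of whiskering with `G.w`. The resulting value lives over `t` and descends to `E` by
fullness of left whiskering. -/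
theorem Force.exists_of (hW : Strong W) (r : Rep F G) (p : Pt F e x) (q : Pt G e' x')
    (γ : e ⟶ e') : ∃ β : x ⟶ x', Force W r p q γ β := by
  obtain ⟨D, t, z, ht, ⟨s₁⟩⟩ := hW.exists_factor p.a F.mem r.mem
  let s₁' : (p.pull t).a ≅ z ≫ r.v₁ := s₁
  obtain ⟨s₂, hs₂⟩ := hW.full_right (f := z ≫ r.v₂) (g := (q.pull t).a) G.mem ((r.αAt z).inv ≫
    s₁'.inv ▷ F.w ≫ (p.pull t).κ.hom ≫ t ◁ γ ≫ (q.pull t).κ.inv)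
  obtain ⟨β, hβ⟩ := hW.full_left ht ((p.pull t).ν.inv ≫ s₁'.hom ▷ F.f ≫ r.βAt z ≫ s₂ ▷ G.f ≫
    (q.pull t).ν.hom)
  exact ⟨β, D, t, ht, z, s₁', s₂, by simp [hs₂], by simp [hβ]⟩

/-- Equivalent representatives carry 2-cells to the same 2-cells. -/
theorem Force.of_equiv (hW : Strong W) {r' : Rep F G} (hr : r.Equiv r') (h : Force W r p q γ β) :
    Force W r' p q γ β := by
  obtain ⟨D, t, ht, h⟩ := h
  refine Force.of_pull hW ht ?_
  generalize p.pull t = p at h ⊢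
  generalize q.pull t = q at h ⊢
  generalize t ◁ γ = γ at h ⊢
  generalize t ◁ β = β at h ⊢
  obtain ⟨z, h⟩ := h
  obtain ⟨E₀, y, y', σ₁, σ₂, hm, e1, e2⟩ := hr
  -- Locally the lift `z` factors through the leg `y` of the equivalence, because `y ≫ r.v₁ ≫ F.w`
  -- is in `W`. The other leg `y'` then provides a lift for `r'`.
  obtain ⟨P, b, k, hb, ⟨ρ⟩⟩ := hW.exists_factor (v := y) (w := r.v₁ ≫ F.w) z r.mem hm
  refine Force.of_pull hW hb (Force₀.toForce hW ⟨k ≫ y', ?_⟩)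
  obtain ⟨s₁, s₂, h1, h2⟩ := (h.pull b).of_iso ρ
  let τ₁ : (k ≫ y') ≫ r'.v₁ ≅ (k ≫ y) ≫ r.v₁ :=
    α_ _ _ _ ≪≫ whiskerLeftIso k σ₁ ≪≫ (α_ _ _ _).symm
  let τ₂ : (k ≫ y) ≫ r.v₂ ≅ (k ≫ y') ≫ r'.v₂ :=
    α_ _ _ _ ≪≫ whiskerLeftIso k σ₂ ≪≫ (α_ _ _ _).symm
  have e1 : τ₁.hom ▷ F.w ≫ (r.αAt (k ≫ y)).hom ≫ τ₂.hom ▷ G.w = (r'.αAt (k ≫ y')).hom := by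
    have := congrArg (fun x => (α_ _ _ _).hom ▷ _ ≫ (α_ _ _ _).hom ≫ k ◁ x ≫ (α_ _ _ _).inv ≫
      (α_ _ _ _).inv ▷ _) e1
    simpa [bicategoricalComp, BicategoricalCoherence.iso, τ₁, τ₂, Rep.αAt] using this
  have e2 : τ₁.hom ▷ F.f ≫ r.βAt (k ≫ y) ≫ τ₂.hom ▷ G.f = r'.βAt (k ≫ y') := by
    have := congrArg (fun x => (α_ _ _ _).hom ▷ _ ≫ (α_ _ _ _).hom ≫ k ◁ x ≫ (α_ _ _ _).inv ≫
      (α_ _ _ _).inv ▷ _) e2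
    simpa [bicategoricalComp, BicategoricalCoherence.iso, τ₁, τ₂, Rep.βAt] using this
  refine ⟨s₁ ≪≫ τ₁.symm, τ₂.inv ≫ s₂, ?_, ?_⟩
  · rw [← h1, ← e1]
    simp only [Iso.trans_hom, Iso.symm_hom, comp_whiskerRight, Category.assoc,
      inv_hom_whiskerRight_assoc, hom_inv_whiskerRight_assoc]
  · rw [← h2, ← e2]
    simp only [Iso.trans_hom, Iso.symm_hom, comp_whiskerRight, Category.assoc,
      inv_hom_whiskerRight_assoc, hom_inv_whiskerRight_assoc]

/-- The equation exhibits `s₂ ▷ G.w` as a composite of invertible 2-cells, and whiskering with `G.w`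
reflects invertibility. -/
theorem exists_iso_of_force (hW : Strong W) {z : E ⟶ r.obj} {s₁ : p.a ≅ z ≫ r.v₁} {s₂ : z ≫ r.v₂ ⟶ q.a}
    [IsIso γ] (h : s₁.hom ▷ F.w ≫ (r.αAt z).hom ≫ s₂ ▷ G.w ≫ q.κ.hom = p.κ.hom ≫ γ) :
    ∃ i : z ≫ r.v₂ ≅ q.a, i.hom = s₂ := by
  have : s₂ ▷ G.w = (r.αAt z).inv ≫ s₁.inv ▷ F.w ≫ p.κ.hom ≫ γ ≫ q.κ.inv := by
    rw [← reassoc_of% h]; simp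
  have : IsIso (s₂ ▷ G.w) := this ▸ inferInstance
  have := hW.isIso_of_whiskerRight G.mem s₂
  exact ⟨asIso s₂, rfl⟩

/-- 2-morphisms that have the same value somewhere are equal. -/
theorem Force.equiv (hW : Strong W) {r' : Rep F G} {e : E ⟶ A} {p : Pt F e x} {q : Pt G e x'}
    (he : W e) (h : Force W r p q (𝟙 e) β) (h' : Force W r' p q (𝟙 e) β) : r.Equiv r' := by
  obtain ⟨D, t, ht, ⟨z, s₁, s₂, h1, h2⟩, ⟨z', s₁', s₂', h1', h2'⟩⟩ := h.and hW h'
  -- The 2-cell between the arguments is an identity, so in both evaluations the comparison with `q`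
  -- is invertible. The two lifts `z`, `z'` are then joined by invertible 2-cells, as the
  -- equivalence requires.
  obtain ⟨i, rfl⟩ := exists_iso_of_force hW h1
  obtain ⟨i', rfl⟩ := exists_iso_of_force hW h1'
  have e1 : (s₁'.inv ≫ s₁.hom) ▷ F.w ≫ (r.αAt z).hom ≫ (i.hom ≫ i'.inv) ▷ G.w = (r'.αAt z').hom := by
    rw [← cancel_epi (s₁'.hom ▷ F.w), ← cancel_mono (i'.hom ▷ G.w), ← cancel_mono (q.pull t).κ.hom]
    simp only [Category.assoc, comp_whiskerRight, hom_inv_whiskerRight_assoc,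
      inv_hom_whiskerRight_assoc, h1, h1']
  have e2 : (s₁'.inv ≫ s₁.hom) ▷ F.f ≫ r.βAt z ≫ (i.hom ≫ i'.inv) ▷ G.f = r'.βAt z' := by
    rw [← cancel_epi (s₁'.hom ▷ F.f), ← cancel_mono (i'.hom ▷ G.f), ← cancel_mono (q.pull t).ν.hom]
    simp only [Category.assoc, comp_whiskerRight, hom_inv_whiskerRight_assoc,
      inv_hom_whiskerRight_assoc, h2, h2']
  refine ⟨D, z, z', s₁'.symm ≪≫ s₁, i ≪≫ i'.symm, ?_, ?_, ?_⟩
  · exact hW.iso_mem ((α_ _ _ _).symm ≪≫ whiskerRightIso s₁.symm F.w ≪≫ (p.pull t).κ)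
      (hW.comp_mem _ _ ht he)
  · simpa [bicategoricalComp, BicategoricalCoherence.iso, Rep.αAt] using e1
  · simpa [bicategoricalComp, BicategoricalCoherence.iso, Rep.βAt] using e2

/-- Every fraction has a point over every 1-morphism, locally. -/
theorem Strong.exists_point (hW : Strong W) (F : Frac W A B) (e : E ⟶ A) :
    ∃ (D : C) (t : D ⟶ E) (x : D ⟶ B), W t ∧ Nonempty (Pt F (t ≫ e) x) := by
  obtain ⟨D, t, a, ht, ⟨ρ⟩⟩ := hW.square F.w e F.mem
  exact ⟨D, t, _, ht, ⟨⟨a, ρ.symm, Iso.refl _⟩⟩⟩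

/-- Finitely many fractions have points over one 1-morphism in `W`. -/
theorem Strong.exists_points (hW : Strong W) (l : List (Frac W A B)) :
    ∃ (E : C) (e : E ⟶ A), W e ∧ ∀ F ∈ l, ∃ x : E ⟶ B, Nonempty (Pt F e x) := by
  induction l with
  | nil => exact ⟨A, 𝟙 A, hW.id_mem A, by simp⟩
  | cons F l ih =>
    obtain ⟨E, e, he, ih⟩ := ih
    obtain ⟨D, t, x, ht, hp⟩ := hW.exists_point F e
    refine ⟨D, t ≫ e, hW.comp_mem _ _ ht he, ?_⟩
    rintro G (_ | ⟨_, hG⟩)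
    · exact ⟨x, hp⟩
    · obtain ⟨y, ⟨q⟩⟩ := ih G hG
      exact ⟨_, ⟨q.pull t⟩⟩

end

end Points

/-! ### Points of composites of fractions. -/

section Composites

variable {C : Type u} [Bicategory.{w, v} C] {W : MorphismProperty C}

/-- The composite of two fractions, formed with a given square. -/
abbrev Frac.compSq (hW : Strong W) {A B D : C} (F : Frac W A B) (G : Frac W B D)
    (s : Square W F.f G.w) : Frac W A D where
  obj := s.obj
  w := s.v' ≫ F.w
  mem := hW.comp_mem _ _ s.mem F.mem
  f := s.f' ≫ G.f

/-- The 2-cell of a square, restricted along `a`. -/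
def Square.ρAt {A B D E : C} {f : A ⟶ B} {v : D ⟶ B} (s : Square W f v) (a : E ⟶ s.obj) :
    (a ≫ s.v') ≫ f ≅ (a ≫ s.f') ≫ v :=
  α_ a s.v' f ≪≫ whiskerLeftIso a s.ρ ≪≫ (α_ a s.f' v).symm

theorem Square.ρAt_natural {A B D E : C} {f : A ⟶ B} {v : D ⟶ B} (s : Square W f v)
    {a b : E ⟶ s.obj} (τ : a ⟶ b) :
    τ ▷ s.v' ▷ f ≫ (s.ρAt b).hom = (s.ρAt a).hom ≫ τ ▷ s.f' ▷ v := by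
  simp only [Square.ρAt, Iso.trans_hom, whiskerLeftIso_hom, Iso.symm_hom, Category.assoc,
    associator_naturality_left_assoc, ← whisker_exchange_assoc, associator_inv_naturality_left]

theorem Square.ρAt_inv_natural {A B D E : C} {f : A ⟶ B} {v : D ⟶ B} (s : Square W f v)
    {a b : E ⟶ s.obj} (τ : a ⟶ b) :
    (s.ρAt a).inv ≫ τ ▷ s.v' ▷ f = τ ▷ s.f' ▷ v ≫ (s.ρAt b).inv := by
  rw [Iso.inv_comp_eq, ← Category.assoc, Iso.eq_comp_inv, s.ρAt_natural]

variable {A B D E : C} {F : Frac W A B} {G : Frac W B D} {s : Square W F.f G.w} {e : E ⟶ A}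
  {y : E ⟶ B} {x : E ⟶ D}

/-- The point `p` of a composite consists of the points `p₁` and `p₂`. -/
def Dec (hW : Strong W) (p : Pt (F.compSq hW G s) e x) (p₁ : Pt F e y) (p₂ : Pt G y x) : Prop :=
  ∃ (i : p₁.a ≅ p.a ≫ s.v') (j : p₂.a ≅ p.a ≫ s.f'),
    i.hom ▷ F.w ≫ (α_ p.a s.v' F.w).hom ≫ p.κ.hom = p₁.κ.hom ∧
    i.hom ▷ F.f ≫ (s.ρAt p.a).hom ≫ j.inv ▷ G.w ≫ p₂.κ.hom = p₁.ν.hom ∧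
    j.hom ▷ G.f ≫ (α_ p.a s.f' G.f).hom ≫ p.ν.hom = p₂.ν.hom

theorem exists_dec (hW : Strong W) (p : Pt (F.compSq hW G s) e x) :
    ∃ (y : E ⟶ B) (p₁ : Pt F e y) (p₂ : Pt G y x), Dec hW p p₁ p₂ := by
  refine ⟨(p.a ≫ s.v') ≫ F.f, ⟨p.a ≫ s.v', (α_ p.a s.v' F.w) ≪≫ p.κ, Iso.refl _⟩,
    ⟨p.a ≫ s.f', (s.ρAt p.a).symm, (α_ p.a s.f' G.f) ≪≫ p.ν⟩, Iso.refl _, Iso.refl _, ?_⟩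
  simp

theorem Dec.pull {hW : Strong W} {p : Pt (F.compSq hW G s) e x} {p₁ : Pt F e y} {p₂ : Pt G y x}
    (h : Dec hW p p₁ p₂) {E' : C} (t : E' ⟶ E) : Dec hW (p.pull t) (p₁.pull t) (p₂.pull t) := by
  obtain ⟨i, j, h1, h2, h3⟩ := h
  refine ⟨whiskerLeftIso t i ≪≫ (α_ _ _ _).symm, whiskerLeftIso t j ≪≫ (α_ _ _ _).symm, ?_, ?_, ?_⟩
  · simp [Pt.pull, ← h1]
  · simp [Pt.pull, ← h2, Square.ρAt]
  · simp [Pt.pull, ← h3]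

end Composites

/-! ### Values of the whiskerings and of the associator. -/

namespace WhiskerLeftData

variable {C : Type u} [Bicategory.{w, v} C] {W : MorphismProperty C}
  {A B D : C} {F : Frac W A B} {G₁ G₂ : Frac W B D} {r : Rep G₁ G₂}
  {s₁ : Square W F.f G₁.w} {s₂ : Square W F.f G₂.w}

/-- The diagram obtained from a representative `r` and auxiliary data. -/
abbrev repSq (hW : Strong W) (d : WhiskerLeftData F r s₁ s₂) :
    Rep (F.compSq hW G₁ s₁) (F.compSq hW G₂ s₂) where
  obj := d.obj₅
  v₁ := d.t₃ ≫ d.t₁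
  v₂ := d.t₄ ≫ d.t₂
  mem := hW.comp_mem _ _ (hW.comp_mem _ _ d.mem₃ d.mem₁) (F.compSq hW G₁ s₁).mem
  α := d.α
  β := d.β

variable (d : WhiskerLeftData F r s₁ s₂) {E : C} (z : E ⟶ d.obj₅)

/-- The 2-cell `σ₁`, restricted along `z`. -/
def σ₁At : (z ≫ d.t₃ ≫ d.t₁) ≫ s₁.f' ≅ (z ≫ d.t₃ ≫ d.h₁) ≫ r.v₁ :=
  α_ _ _ _ ≪≫ whiskerLeftIso z (α_ _ _ _ ≪≫ whiskerLeftIso d.t₃ d.σ₁ ≪≫ (α_ _ _ _).symm) ≪≫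
    (α_ _ _ _).symm

/-- The 2-cell `σ₂`, restricted along `z`. -/
def σ₂At : (z ≫ d.t₄ ≫ d.t₂) ≫ s₂.f' ≅ (z ≫ d.t₄ ≫ d.h₂) ≫ r.v₂ :=
  α_ _ _ _ ≪≫ whiskerLeftIso z (α_ _ _ _ ≪≫ whiskerLeftIso d.t₄ d.σ₂ ≪≫ (α_ _ _ _).symm) ≪≫
    (α_ _ _ _).symm

/-- The 2-cell `φ`, restricted along `z`. -/
def φAt : (z ≫ d.t₃ ≫ d.t₁) ≫ s₁.v' ≅ (z ≫ d.t₄ ≫ d.t₂) ≫ s₂.v' :=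
  α_ _ _ _ ≪≫ whiskerLeftIso z (α_ _ _ _ ≪≫ d.φ ≪≫ (α_ _ _ _).symm) ≪≫ (α_ _ _ _).symm

theorem αAt_repSq (hW : Strong W) : ((d.repSq hW).αAt z).hom =
    (α_ _ _ _).inv ≫ (d.φAt z).hom ▷ F.w ≫ (α_ _ _ _).hom := by
  simp [Rep.αAt, φAt, α, bicategoricalIsoComp, BicategoricalCoherence.iso]

theorem βAt_repSq (hW : Strong W) : (d.repSq hW).βAt z = (α_ _ _ _).inv ≫
    ((d.σ₁At z).hom ▷ G₁.f ≫ r.βAt (z ≫ d.t₃ ≫ d.h₁) ≫ (z ◁ d.δ.hom) ▷ r.v₂ ▷ G₂.f ≫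
      (d.σ₂At z).inv ▷ G₂.f) ≫ (α_ _ _ _).hom := by
  rw [← reassoc_of% r.βAt_natural (z ◁ d.δ.hom)]
  simp [Rep.βAt, σ₁At, σ₂At, β, bicategoricalComp, BicategoricalCoherence.iso]
  bicategory

/-- This is `δ_eq`, restricted along `z` and solved for the composite that occurs when `r` is
evaluated at the second components of the points. -/
theorem coherence : (d.σ₁At z).hom ▷ G₁.w ≫ (r.αAt (z ≫ d.t₃ ≫ d.h₁)).hom ≫
    (z ◁ d.δ.hom) ▷ r.v₂ ▷ G₂.w ≫ (d.σ₂At z).inv ▷ G₂.w =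
      (s₁.ρAt (z ≫ d.t₃ ≫ d.t₁)).inv ≫ (d.φAt z).hom ▷ F.f ≫ (s₂.ρAt (z ≫ d.t₄ ≫ d.t₂)).hom := by
  have h : (z ◁ d.δ.hom) ▷ r.v₁ ▷ G₁.w = (d.σ₁At z).inv ▷ G₁.w ≫
      (s₁.ρAt (z ≫ d.t₃ ≫ d.t₁)).inv ≫ (d.φAt z).hom ▷ F.f ≫ (s₂.ρAt (z ≫ d.t₄ ≫ d.t₂)).hom ≫
        (d.σ₂At z).hom ▷ G₂.w ≫ (r.αAt (z ≫ d.t₄ ≫ d.h₂)).inv := by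
    have h : (z ◁ d.δ.hom) ▷ r.v₁ ▷ G₁.w = (α_ _ _ _).hom ≫ (α_ _ _ _).hom ≫
        z ◁ (d.δ.hom ▷ (r.v₁ ≫ G₁.w)) ≫ (α_ _ _ _).inv ≫ (α_ _ _ _).inv := by
      simp
    rw [h, d.δ_eq]
    simp [Rep.αAt, σ₁At, σ₂At, φAt, Square.ρAt, bicategoricalComp, BicategoricalCoherence.iso]
    bicategory
  rw [← reassoc_of% r.αAt_natural (z ◁ d.δ.hom), h]
  simp

variable {d} {hW : Strong W} {e e' : E ⟶ A} {y y' : E ⟶ B} {x x' : E ⟶ D}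
  {p : Pt (F.compSq hW G₁ s₁) e x} {q : Pt (F.compSq hW G₂ s₂) e' x'} {p₁ : Pt F e y}
  {p₂ : Pt G₁ y x} {q₁ : Pt F e' y'} {q₂ : Pt G₂ y' x'} {γ : e ⟶ e'} {δ : y ⟶ y'} {β : x ⟶ x'}

/-- The data `σ₁`, `δ`, `σ₂` turn an evaluation of the diagram into an evaluation of `r`; the
condition on arguments is `coherence`, the condition on values is the definition of the right part
of the diagram. -/
theorem force₀_of_repSq (h : Force₀ (d.repSq hW) p q γ β) (hp : Dec hW p p₁ p₂)
    (hq : Dec hW q q₁ q₂) (ho : Over p₁ q₁ γ δ) : Force₀ r p₂ q₂ δ β := by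
  obtain ⟨z, S₁, S₂, E1, E2⟩ := h
  obtain ⟨i, j, h1, h2, h3⟩ := hp
  obtain ⟨i', j', h1', h2', h3'⟩ := hq
  obtain ⟨l, o1, o2⟩ := ho
  -- A morphism of points over `γ` is unique, so the given one must be the one built from `φ`.
  have hl : l = i.hom ≫ S₁.hom ▷ s₁.v' ≫ (d.φAt z).hom ≫ S₂ ▷ s₂.v' ≫ i'.inv := by
    refine hW.faithful_right F.mem ?_
    rw [← cancel_mono q₁.κ.hom, o1, ← h1, Category.assoc, Category.assoc, ← E1, αAt_repSq, ← h1']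
    simp
  refine ⟨z ≫ d.t₃ ≫ d.h₁, j ≪≫ whiskerRightIso S₁ s₁.f' ≪≫ d.σ₁At z,
    (z ◁ d.δ.hom) ▷ r.v₂ ≫ (d.σ₂At z).inv ≫ S₂ ▷ s₂.f' ≫ j'.inv, ?_, ?_⟩
  · have key := d.coherence z
    have hκ : p₂.κ.hom = j.hom ▷ G₁.w ≫ (s₁.ρAt p.a).inv ≫ i.inv ▷ F.f ≫ p₁.ν.hom := by
      rw [← h2]; simp
    have e1 : (s₁.ρAt p.a).inv ≫ S₁.hom ▷ s₁.v' ▷ F.f = _ := s₁.ρAt_inv_natural S₁.hom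
    have e2 : S₂ ▷ s₂.v' ▷ F.f ≫ (s₂.ρAt q.a).hom = _ := s₂.ρAt_natural S₂
    rw [hκ]
    simp only [Category.assoc]
    rw [← o2, hl, ← h2']
    simp only [Category.assoc, Iso.trans_hom, whiskerRightIso_hom, comp_whiskerRight,
      inv_hom_whiskerRight_assoc, reassoc_of% e1, reassoc_of% e2, reassoc_of% key]
  · rw [← h3, Category.assoc, Category.assoc, ← E2, βAt_repSq, ← h3']
    simp

/-- The diagram has some value `β'`; by `force₀_of_repSq` it is also a value of `r`, and uniqueness
gives `β' = β`. So only one direction has to be computed. -/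
theorem force_repSq (hp : Dec hW p p₁ p₂) (hq : Dec hW q q₁ q₂) (ho : Over p₁ q₁ γ δ)
    (h : Force W r p₂ q₂ δ β) : Force W (d.repSq hW) p q γ β := by
  obtain ⟨β', D, t, ht, h'⟩ := Force.exists_of hW (d.repSq hW) p q γ
  have h'' : Force W r p₂ q₂ δ β' := ⟨D, t, ht, force₀_of_repSq h' (hp.pull t) (hq.pull t) (ho.pull t)⟩
  obtain rfl := h.unique hW h''
  exact ⟨D, t, ht, h'⟩

end WhiskerLeftData

namespace WhiskerRightData

variable {C : Type u} [Bicategory.{w, v} C] {W : MorphismProperty C}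
  {A B D : C} {F₁ F₂ : Frac W A B} {r : Rep F₁ F₂} {G : Frac W B D}
  {s₁ : Square W F₁.f G.w} {s₂ : Square W F₂.f G.w}

/-- The diagram obtained from a representative `r` and auxiliary data. -/
abbrev repSq (hW : Strong W) (d : WhiskerRightData r G s₁ s₂) :
    Rep (F₁.compSq hW G s₁) (F₂.compSq hW G s₂) where
  obj := d.obj₅
  v₁ := d.u₇ ≫ d.u₄
  v₂ := d.u₈ ≫ d.u₆
  mem := hW.iso_mem (α_ _ _ _ ≪≫ whiskerLeftIso d.u₇ ((α_ _ _ _).symm ≪≫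
      whiskerRightIso d.η₁.symm F₁.w ≪≫ α_ _ _ _))
    (hW.comp_mem _ _ d.mem₇ (hW.comp_mem _ _ d.mem₃ r.mem))
  α := d.α
  β := d.β

variable (d : WhiskerRightData r G s₁ s₂) {E : C} (z : E ⟶ d.obj₅)

/-- The 2-cell `η₁`, restricted along `z`. -/
def η₁At : (z ≫ d.u₇ ≫ d.u₃) ≫ r.v₁ ≅ (z ≫ d.u₇ ≫ d.u₄) ≫ s₁.v' :=
  α_ _ _ _ ≪≫ whiskerLeftIso z (α_ _ _ _ ≪≫ whiskerLeftIso d.u₇ d.η₁ ≪≫ (α_ _ _ _).symm) ≪≫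
    (α_ _ _ _).symm

/-- The 2-cell `η₂`, restricted along `z`. -/
def η₂At : (z ≫ d.u₈ ≫ d.u₅) ≫ r.v₂ ≅ (z ≫ d.u₈ ≫ d.u₆) ≫ s₂.v' :=
  α_ _ _ _ ≪≫ whiskerLeftIso z (α_ _ _ _ ≪≫ whiskerLeftIso d.u₈ d.η₂ ≪≫ (α_ _ _ _).symm) ≪≫
    (α_ _ _ _).symm

/-- The 2-cell `l`, restricted along `z`. -/
def lAt : (z ≫ d.u₇ ≫ d.u₄) ≫ s₁.f' ⟶ (z ≫ d.u₈ ≫ d.u₆) ≫ s₂.f' :=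
  (α_ _ _ _).hom ≫ z ◁ ((α_ _ _ _).hom ≫ d.l ≫ (α_ _ _ _).inv) ≫ (α_ _ _ _).inv

theorem αAt_repSq (hW : Strong W) : ((d.repSq hW).αAt z).hom = (α_ _ _ _).inv ≫
    ((d.η₁At z).inv ▷ F₁.w ≫ (r.αAt (z ≫ d.u₇ ≫ d.u₃)).hom ≫ (z ◁ d.η₃.hom) ▷ r.v₂ ▷ F₂.w ≫
      (d.η₂At z).hom ▷ F₂.w) ≫ (α_ _ _ _).hom := by
  rw [← reassoc_of% r.αAt_natural (z ◁ d.η₃.hom)]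
  simp [Rep.αAt, η₁At, η₂At, α, bicategoricalIsoComp, BicategoricalCoherence.iso]
  bicategory

theorem βAt_repSq (hW : Strong W) : (d.repSq hW).βAt z =
    (α_ _ _ _).inv ≫ d.lAt z ▷ G.f ≫ (α_ _ _ _).hom := by
  simp [Rep.βAt, lAt, β, bicategoricalComp, BicategoricalCoherence.iso]

theorem coherence : d.lAt z ▷ G.w = (s₁.ρAt _).inv ≫ (d.η₁At z).inv ▷ F₁.f ≫
    r.βAt (z ≫ d.u₇ ≫ d.u₃) ≫ (z ◁ d.η₃.hom) ▷ r.v₂ ▷ F₂.f ≫ (d.η₂At z).hom ▷ F₂.f ≫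
      (s₂.ρAt _).hom := by
  rw [← reassoc_of% r.βAt_natural (z ◁ d.η₃.hom)]
  have h : d.lAt z ▷ G.w = (α_ _ _ _).hom ▷ G.w ≫ (α_ _ _ _).hom ≫ z ◁ ((α_ _ _ _).hom ▷ G.w) ≫
      z ◁ (d.l ▷ G.w) ≫ z ◁ ((α_ _ _ _).inv ▷ G.w) ≫ (α_ _ _ _).inv ≫ (α_ _ _ _).inv ▷ G.w := by
    simp [lAt]
  rw [h, d.l_eq]
  simp [Rep.βAt, η₁At, η₂At, Square.ρAt, bicategoricalComp, BicategoricalCoherence.iso]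
  bicategory

variable {d} {hW : Strong W} {e e' : E ⟶ A} {y y' : E ⟶ B} {x x' : E ⟶ D}
  {p : Pt (F₁.compSq hW G s₁) e x} {q : Pt (F₂.compSq hW G s₂) e' x'} {p₁ : Pt F₁ e y}
  {p₂ : Pt G y x} {q₁ : Pt F₂ e' y'} {q₂ : Pt G y' x'} {γ : e ⟶ e'} {δ : y ⟶ y'} {β : x ⟶ x'}

/-- The intermediate `δ` is defined as the value of `r` at the first components. The equation
`l_eq`, in the form `coherence`, says that the 2-cell `l` induces a morphism of points of `G` over
this `δ`. -/
theorem force₀_of_repSq (h : Force₀ (d.repSq hW) p q γ β) (hp : Dec hW p p₁ p₂)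
    (hq : Dec hW q q₁ q₂) : ∃ δ : y ⟶ y', Force₀ r p₁ q₁ γ δ ∧ Over p₂ q₂ δ β := by
  obtain ⟨z, S₁, S₂, E1, E2⟩ := h
  obtain ⟨i, j, h1, h2, h3⟩ := hp
  obtain ⟨i', j', h1', h2', h3'⟩ := hq
  let k₁ : p₁.a ≅ (z ≫ d.u₇ ≫ d.u₃) ≫ r.v₁ := i ≪≫ whiskerRightIso S₁ s₁.v' ≪≫ (d.η₁At z).symm
  let k₂ : (z ≫ d.u₇ ≫ d.u₃) ≫ r.v₂ ⟶ q₁.a :=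
    (z ◁ d.η₃.hom) ▷ r.v₂ ≫ (d.η₂At z).hom ≫ S₂ ▷ s₂.v' ≫ i'.inv
  refine ⟨p₁.ν.inv ≫ k₁.hom ▷ F₁.f ≫ r.βAt _ ≫ k₂ ▷ F₂.f ≫ q₁.ν.hom,
    ⟨z ≫ d.u₇ ≫ d.u₃, k₁, k₂, ?_, ?_⟩, j.hom ≫ S₁.hom ▷ s₁.f' ≫ d.lAt z ≫ S₂ ▷ s₂.f' ≫ j'.inv,
    ?_, ?_⟩
  · rw [← h1, Category.assoc, Category.assoc, ← E1, αAt_repSq, ← h1']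
    simp [k₁, k₂]
  · simp
  · have key := d.coherence z
    have hκ : p₂.κ.hom = j.hom ▷ G.w ≫ (s₁.ρAt p.a).inv ≫ i.inv ▷ F₁.f ≫ p₁.ν.hom := by
      rw [← h2]; simp
    have e1 : (s₁.ρAt p.a).inv ≫ S₁.hom ▷ s₁.v' ▷ F₁.f = _ := s₁.ρAt_inv_natural S₁.hom
    have e2 : S₂ ▷ s₂.v' ▷ F₂.f ≫ (s₂.ρAt q.a).hom = _ := s₂.ρAt_natural S₂
    rw [hκ, ← h2']
    simp only [k₁, k₂, Category.assoc, Iso.trans_hom, Iso.symm_hom, whiskerRightIso_hom,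
      comp_whiskerRight, inv_hom_whiskerRight_assoc, Iso.hom_inv_id_assoc, reassoc_of% e1,
      reassoc_of% e2, reassoc_of% key]
  · rw [← h3, Category.assoc, Category.assoc, ← E2, βAt_repSq, ← h3']
    simp

theorem force_repSq (hp : Dec hW p p₁ p₂) (hq : Dec hW q q₁ q₂) (h : Force W r p₁ q₁ γ δ)
    (ho : Over p₂ q₂ δ β) : Force W (d.repSq hW) p q γ β := by
  obtain ⟨β', D, t, ht, h'⟩ := Force.exists_of hW (d.repSq hW) p q γ
  obtain ⟨δ', h'', ho'⟩ := force₀_of_repSq h' (hp.pull t) (hq.pull t)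
  -- The intermediate value lives over the refinement `t`; it must descend to `E` before it can be
  -- compared with `δ`.
  obtain ⟨δ', rfl⟩ := hW.full_left ht δ'
  obtain rfl := h.unique hW ⟨D, t, ht, h''⟩
  obtain rfl := hW.faithful_left ht ((ho.pull t).unique hW ho')
  exact ⟨D, t, ht, h'⟩

end WhiskerRightData

namespace AssocData

variable {C : Type u} [Bicategory.{w, v} C] {W : MorphismProperty C}
  {A B D X : C} {F : Frac W A B} {G : Frac W B D} {H : Frac W D X}
  {s₁ : Square W F.f G.w} {s₂ : Square W (s₁.f' ≫ G.f) H.w} {s₃ : Square W G.f H.w}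
  {s₄ : Square W F.f (s₃.v' ≫ G.w)}

/-- The diagram obtained from auxiliary data. -/
abbrev repSq (hW : Strong W) (d : AssocData F G H s₁ s₂ s₃ s₄) :
    Rep ((F.compSq hW G s₁).compSq hW H s₂) (F.compSq hW (G.compSq hW H s₃) s₄) where
  obj := d.obj
  v₁ := d.u₄
  v₂ := d.u₅
  mem := d.mem
  α := d.α
  β := d.β

variable (d : AssocData F G H s₁ s₂ s₃ s₄) {E : C} (z : E ⟶ d.obj)

/-- The 2-cell `γ`, restricted along `z`. -/
def γAt : ((z ≫ d.u₄) ≫ s₂.v') ≫ s₁.v' ≅ (z ≫ d.u₅) ≫ s₄.v' :=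
  whiskerRightIso (α_ _ _ _) _ ≪≫ α_ _ _ _ ≪≫ whiskerLeftIso z (α_ _ _ _ ≪≫ d.γ) ≪≫
    (α_ _ _ _).symm

/-- The 2-cell `ω`, restricted along `z`. -/
def ωAt : ((z ≫ d.u₄) ≫ s₂.v') ≫ s₁.f' ≅ ((z ≫ d.u₅) ≫ s₄.f') ≫ s₃.v' :=
  whiskerRightIso (α_ _ _ _) _ ≪≫ α_ _ _ _ ≪≫
    whiskerLeftIso z (α_ _ _ _ ≪≫ d.ω ≪≫ (α_ _ _ _).symm) ≪≫ (α_ _ _ _).symm ≪≫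
    whiskerRightIso (α_ _ _ _).symm _

/-- The 2-cell `ρ`, restricted along `z`. -/
def ρAt : (z ≫ d.u₄) ≫ s₂.f' ≅ ((z ≫ d.u₅) ≫ s₄.f') ≫ s₃.f' :=
  α_ _ _ _ ≪≫ whiskerLeftIso z (d.ρ ≪≫ (α_ _ _ _).symm) ≪≫ (α_ _ _ _).symm ≪≫
    whiskerRightIso (α_ _ _ _).symm _

theorem αAt_repSq (hW : Strong W) : ((d.repSq hW).αAt z).hom =
    (α_ _ _ _).inv ≫ (α_ _ _ _).inv ≫ (d.γAt z).hom ▷ F.w ≫ (α_ _ _ _).hom := by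
  simp [Rep.αAt, γAt, α, bicategoricalIsoComp, BicategoricalCoherence.iso]

theorem βAt_repSq (hW : Strong W) : (d.repSq hW).βAt z =
    (α_ _ _ _).inv ≫ (d.ρAt z).hom ▷ H.f ≫ (α_ _ _ _).hom ≫ (α_ _ _ _).hom := by
  simp [Rep.βAt, ρAt, β, bicategoricalComp, BicategoricalCoherence.iso]

theorem ω_coherence : (d.ωAt z).hom ▷ G.w = (s₁.ρAt _).inv ≫ (d.γAt z).hom ▷ F.f ≫
    (s₄.ρAt _).hom ≫ (α_ _ _ _).inv := by
  have h : (d.ωAt z).hom ▷ G.w = 𝟙 _ ⊗≫ z ◁ (d.ω.hom ▷ G.w) ⊗≫ 𝟙 _ := by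
    simp [ωAt, bicategoricalComp, BicategoricalCoherence.iso]
    bicategory
  rw [h, d.ω_eq]
  simp [γAt, Square.ρAt, bicategoricalComp, BicategoricalCoherence.iso]

theorem ρ_coherence : (d.ρAt z).hom ▷ H.w = (s₂.ρAt _).inv ≫ (α_ _ _ _).inv ≫
    (d.ωAt z).hom ▷ G.f ≫ (s₃.ρAt _).hom := by
  have h : (d.ρAt z).hom ▷ H.w = 𝟙 _ ⊗≫ z ◁ (d.ρ.hom ▷ H.w) ⊗≫ 𝟙 _ := by
    simp [ρAt, bicategoricalComp, BicategoricalCoherence.iso]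
    bicategory
  rw [h, d.ρ_eq]
  simp [ωAt, Square.ρAt, bicategoricalComp, BicategoricalCoherence.iso]

variable {d} {hW : Strong W} {e e' : E ⟶ A} {m m' : E ⟶ B} {y y' : E ⟶ D} {x x' : E ⟶ X}
  {p : Pt ((F.compSq hW G s₁).compSq hW H s₂) e x} {p₁ : Pt (F.compSq hW G s₁) e y} {p₂ : Pt H y x}
  {p₁₁ : Pt F e m} {p₁₂ : Pt G m y} {q : Pt (F.compSq hW (G.compSq hW H s₃) s₄) e' x'}
  {q₁ : Pt F e' m'} {q₂ : Pt (G.compSq hW H s₃) m' x'} {q₂₁ : Pt G m' y'} {q₂₂ : Pt H y' x'}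
  {γ : e ⟶ e'} {δ₁ : m ⟶ m'} {δ₂ : y ⟶ y'} {β : x ⟶ x'}

/-- The data `γ`, `ω`, `ρ` induce morphisms `L₁`, `L₂`, `L₃` between the points of `F`, `G`, `H`.
The equations `ω_eq` and `ρ_eq` say that the value of each is the argument of the next. -/
theorem force₀_of_repSq (h : Force₀ (d.repSq hW) p q γ β) (hp : Dec hW p p₁ p₂)
    (hp₁ : Dec hW p₁ p₁₁ p₁₂) (hq : Dec hW q q₁ q₂) (hq₂ : Dec hW q₂ q₂₁ q₂₂) :
    ∃ (δ₁ : m ⟶ m') (δ₂ : y ⟶ y'), Over p₁₁ q₁ γ δ₁ ∧ Over p₁₂ q₂₁ δ₁ δ₂ ∧ Over p₂ q₂₂ δ₂ β := by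
  obtain ⟨z, S₁, S₂, E1, E2⟩ := h
  obtain ⟨i, j, h1, h2, h3⟩ := hp
  obtain ⟨i₁, j₁, h4, h5, h6⟩ := hp₁
  obtain ⟨i', j', h1', h2', h3'⟩ := hq
  obtain ⟨i₂, j₂, h4', h5', h6'⟩ := hq₂
  let L₁ : p₁₁.a ⟶ q₁.a := i₁.hom ≫ i.hom ▷ s₁.v' ≫ S₁.hom ▷ s₂.v' ▷ s₁.v' ≫ (d.γAt z).hom ≫
    S₂ ▷ s₄.v' ≫ i'.inv
  let L₂ : p₁₂.a ⟶ q₂₁.a := j₁.hom ≫ i.hom ▷ s₁.f' ≫ S₁.hom ▷ s₂.v' ▷ s₁.f' ≫ (d.ωAt z).hom ≫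
    S₂ ▷ s₄.f' ▷ s₃.v' ≫ j'.inv ▷ s₃.v' ≫ i₂.inv
  let L₃ : p₂.a ⟶ q₂₂.a := j.hom ≫ S₁.hom ▷ s₂.f' ≫ (d.ρAt z).hom ≫ S₂ ▷ s₄.f' ▷ s₃.f' ≫
    j'.inv ▷ s₃.f' ≫ j₂.inv
  refine ⟨p₁₁.ν.inv ≫ L₁ ▷ F.f ≫ q₁.ν.hom, p₁₂.ν.inv ≫ L₂ ▷ G.f ≫ q₂₁.ν.hom, ⟨L₁, ?_, by simp⟩,
    ⟨L₂, ?_, by simp⟩, ⟨L₃, ?_, ?_⟩⟩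
  · rw [← h4, ← h1, Category.assoc, Category.assoc, Category.assoc, Category.assoc, ← E1, αAt_repSq,
      ← h1']
    simp [L₁]
  · have hκ : p₁₂.κ.hom = j₁.hom ▷ G.w ≫ (s₁.ρAt p₁.a).inv ≫ i₁.inv ▷ F.f ≫ p₁₁.ν.hom := by
      rw [← h5]; simp
    have e0 : (s₁.ρAt p₁.a).inv ≫ i.hom ▷ s₁.v' ▷ F.f = _ := s₁.ρAt_inv_natural i.hom
    have e1 : (s₁.ρAt (p.a ≫ s₂.v')).inv ≫ S₁.hom ▷ s₂.v' ▷ s₁.v' ▷ F.f = _ :=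
      s₁.ρAt_inv_natural (S₁.hom ▷ s₂.v')
    have e2 : S₂ ▷ s₄.v' ▷ F.f ≫ (s₄.ρAt q.a).hom = _ := s₄.ρAt_natural S₂
    rw [hκ, ← h2', ← h4']
    simp only [L₁, L₂, Category.assoc, comp_whiskerRight, inv_hom_whiskerRight_assoc,
      Iso.hom_inv_id_assoc, reassoc_of% e0, reassoc_of% e1, reassoc_of% e2,
      reassoc_of% d.ω_coherence z]
    simp
  · have hκ : p₂.κ.hom = j.hom ▷ H.w ≫ (s₂.ρAt p.a).inv ≫ i.inv ▷ (s₁.f' ≫ G.f) ≫ p₁.ν.hom := by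
      rw [← h2]; simp
    have e1 : (s₂.ρAt p.a).inv ≫ S₁.hom ▷ s₂.v' ▷ (s₁.f' ≫ G.f) = _ := s₂.ρAt_inv_natural S₁.hom
    have e2 : S₂ ▷ s₄.f' ▷ s₃.v' ▷ G.f ≫ (s₃.ρAt (q.a ≫ s₄.f')).hom = _ :=
      s₃.ρAt_natural (S₂ ▷ s₄.f')
    have e3 : j'.inv ▷ s₃.v' ▷ G.f ≫ (s₃.ρAt q₂.a).hom = _ := s₃.ρAt_natural j'.inv
    have e4 : i.inv ▷ (s₁.f' ≫ G.f) ≫ (α_ p₁.a s₁.f' G.f).inv =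
      (α_ _ _ _).inv ≫ i.inv ▷ s₁.f' ▷ G.f := by simp
    have e5 : S₁.hom ▷ s₂.v' ▷ (s₁.f' ≫ G.f) ≫ (α_ _ s₁.f' G.f).inv =
      (α_ _ _ _).inv ≫ S₁.hom ▷ s₂.v' ▷ s₁.f' ▷ G.f := by simp
    have e6 : i.inv ▷ s₁.f' ▷ G.f ≫ i.hom ▷ s₁.f' ▷ G.f = 𝟙 _ := by
      rw [← comp_whiskerRight, inv_hom_whiskerRight, id_whiskerRight]
    have hν : p₁.ν.hom = (α_ p₁.a s₁.f' G.f).inv ≫ j₁.inv ▷ G.f ≫ p₁₂.ν.hom := by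
      rw [← h6]; simp
    rw [hκ, hν, ← h5']
    simp only [L₂, L₃, Category.assoc, comp_whiskerRight, inv_hom_whiskerRight_assoc,
      Iso.hom_inv_id_assoc, reassoc_of% e4, reassoc_of% e2, reassoc_of% e3,
      reassoc_of% d.ρ_coherence z, reassoc_of% e6, ← reassoc_of% e5, reassoc_of% e1]
  · rw [← h3, Category.assoc, Category.assoc, ← E2, βAt_repSq, ← h6', ← h3']
    simp [L₃]

theorem force_repSq (hp : Dec hW p p₁ p₂) (hp₁ : Dec hW p₁ p₁₁ p₁₂) (hq : Dec hW q q₁ q₂)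
    (hq₂ : Dec hW q₂ q₂₁ q₂₂) (h₁ : Over p₁₁ q₁ γ δ₁) (h₂ : Over p₁₂ q₂₁ δ₁ δ₂)
    (h₃ : Over p₂ q₂₂ δ₂ β) : Force W (d.repSq hW) p q γ β := by
  obtain ⟨β', D, t, ht, h⟩ := Force.exists_of hW (d.repSq hW) p q γ
  obtain ⟨δ₁', δ₂', h₁', h₂', h₃'⟩ :=
    force₀_of_repSq h (hp.pull t) (hp₁.pull t) (hq.pull t) (hq₂.pull t)
  obtain rfl := (h₁.pull t).unique hW h₁'
  obtain rfl := (h₂.pull t).unique hW h₂'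
  obtain rfl := hW.faithful_left ht ((h₃.pull t).unique hW h₃')
  exact ⟨D, t, ht, h⟩

end AssocData

/-! ### Values of vertical composites, identities, inverses and unitors. -/

section

variable {C : Type u} [Bicategory.{w, v} C] {W : MorphismProperty C}

namespace VertData

variable {A B E : C} {F₁ F₂ F₃ : Frac W A B} {r : Rep F₁ F₂} {s : Rep F₂ F₃}

/-- The diagram obtained from representatives `r`, `s` and auxiliary data. -/
abbrev repSq (hW : Strong W) (d : VertData r s) : Rep F₁ F₃ where
  obj := d.obj
  v₁ := d.t₁ ≫ r.v₁
  v₂ := d.t₂ ≫ s.v₂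
  mem := hW.iso_mem (α_ _ _ _) (hW.comp_mem _ _ d.mem r.mem)
  α := α_ d.t₁ r.v₁ F₁.w ≪≫ whiskerLeftIso d.t₁ r.α ≪⊗≫ whiskerRightIso d.ρ F₂.w ≪⊗≫
    whiskerLeftIso d.t₂ s.α ≪≫ (α_ d.t₂ s.v₂ F₃.w).symm
  β := (α_ d.t₁ r.v₁ F₁.f).hom ≫ d.t₁ ◁ r.β ⊗≫ d.ρ.hom ▷ F₂.f ⊗≫
    d.t₂ ◁ s.β ≫ (α_ d.t₂ s.v₂ F₃.f).inv

variable (d : VertData r s) (k : E ⟶ d.obj)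

/-- The 2-cell `ρ`, restricted along `k`. -/
def ρAt : (k ≫ d.t₁) ≫ r.v₂ ≅ (k ≫ d.t₂) ≫ s.v₁ :=
  α_ _ _ _ ≪≫ whiskerLeftIso k d.ρ ≪≫ (α_ _ _ _).symm

theorem αAt_repSq (hW : Strong W) : ((d.repSq hW).αAt k).hom = (α_ _ _ _).inv ▷ _ ≫
    (r.αAt (k ≫ d.t₁)).hom ≫ (d.ρAt k).hom ▷ _ ≫ (s.αAt (k ≫ d.t₂)).hom ≫ (α_ _ _ _).hom ▷ _ := by
  simp [Rep.αAt, ρAt, bicategoricalIsoComp, BicategoricalCoherence.iso]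

theorem βAt_repSq (hW : Strong W) : (d.repSq hW).βAt k = (α_ _ _ _).inv ▷ _ ≫
    r.βAt (k ≫ d.t₁) ≫ (d.ρAt k).hom ▷ _ ≫ s.βAt (k ≫ d.t₂) ≫ (α_ _ _ _).hom ▷ _ := by
  simp [Rep.βAt, ρAt, bicategoricalComp, BicategoricalCoherence.iso]

variable {d} {k} {e e' e'' : E ⟶ A} {x x' x'' : E ⟶ B} {p : Pt F₁ e x} {q : Pt F₂ e' x'}
  {q' : Pt F₃ e'' x''} {γ : e ⟶ e'} {γ' : e' ⟶ e''} {β : x ⟶ x'} {β' : x' ⟶ x''}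

/-- The second leg of `r` and the first leg of `s` both map to or from the middle point `q`. The
composite through `q` lifts along `s.v₁` to a 2-cell `τ` between the lifts of the points to `s.obj`,
and naturality in `τ` joins the two evaluations. -/
theorem forceAt_repSq (hW : Strong W) {z : E ⟶ s.obj} (h : ForceAt r (k ≫ d.t₁) p q γ β)
    (h' : ForceAt s z q q' γ' β') : ForceAt (d.repSq hW) k p q' (γ ≫ γ') (β ≫ β') := by
  obtain ⟨s₁, s₂, h1, h2⟩ := h
  obtain ⟨s₁', s₂', h1', h2'⟩ := h'
  obtain ⟨τ, hτ⟩ := hW.lift_comp F₂.mem s.mem ((d.ρAt k).inv ≫ s₂ ≫ s₁'.hom)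
  refine ⟨s₁ ≪≫ α_ _ _ _, (α_ _ _ _).inv ≫ τ ▷ s.v₂ ≫ s₂', ?_, ?_⟩
  · have e1 := s.αAt_natural τ
    rw [hτ] at e1
    rw [αAt_repSq]
    simp only [Iso.trans_hom, comp_whiskerRight, Category.assoc, hom_inv_whiskerRight_assoc,
      ← reassoc_of% e1, ← reassoc_of% h1, h1']
  · have e1 := s.βAt_natural τ
    rw [hτ] at e1
    rw [βAt_repSq]
    simp only [Iso.trans_hom, comp_whiskerRight, Category.assoc, hom_inv_whiskerRight_assoc,
      ← reassoc_of% e1, ← reassoc_of% h2, h2']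

theorem force_repSq (hW : Strong W) (h : Force W r p q γ β) (h' : Force W s q q' γ' β') :
    Force W (d.repSq hW) p q' (γ ≫ γ') (β ≫ β') := by
  obtain ⟨D, t, ht, ⟨z, h⟩, ⟨z', h'⟩⟩ := h.and hW h'
  refine Force.of_pull hW ht ?_
  rw [Bicategory.whiskerLeft_comp, Bicategory.whiskerLeft_comp]
  -- After a refinement the lift `z` used for `r` factors through `t₁`, so that the composite
  -- diagram can be evaluated at `k`.
  obtain ⟨D', y, k, hy, ⟨ρ⟩⟩ := hW.square d.t₁ z d.mem
  refine Force.of_pull hW hy ?_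
  rw [Bicategory.whiskerLeft_comp, Bicategory.whiskerLeft_comp]
  exact Force₀.toForce hW ⟨k, forceAt_repSq hW ((h.pull y).of_iso ρ) (h'.pull y)⟩

end VertData

section

variable {A B E : C} {F G : Frac W A B}

/-- The data representing an identity 2-morphism. -/
abbrev Rep.idSq (hW : Strong W) (F : Frac W A B) : Rep F F where
  obj := F.obj
  v₁ := 𝟙 _
  v₂ := 𝟙 _
  mem := hW.comp_mem _ _ (hW.id_mem _) F.mem
  α := Iso.refl _
  β := 𝟙 _

theorem Over.force_idSq (hW : Strong W) {e e' : E ⟶ A} {x x' : E ⟶ B} {p : Pt F e x} {q : Pt F e' x'}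
    {γ : e ⟶ e'} {β : x ⟶ x'} (h : Over p q γ β) : Force W (Rep.idSq hW F) p q γ β := by
  obtain ⟨l, h1, h2⟩ := h
  refine Force₀.toForce hW ⟨p.a, (ρ_ _).symm, (ρ_ _).hom ≫ l, ?_, ?_⟩
  · simp [Rep.αAt, ← h1]
  · simp [Rep.βAt, ← h2]

/-- The data representing the inverse of a 2-morphism. -/
abbrev Rep.symm (r : Rep F G) (h : W (r.v₂ ≫ G.w)) (b : r.v₂ ≫ G.f ⟶ r.v₁ ≫ F.f) : Rep G F where
  obj := r.obj
  v₁ := r.v₂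
  v₂ := r.v₁
  mem := h
  α := r.α.symm
  β := b

/-- Over an identity of arguments both comparisons in an evaluation are invertible, so the
evaluation can be read backwards; the two values are inverse because `r.β` and `b` are. -/
theorem Force.symm (hW : Strong W) {r : Rep F G} {h : W (r.v₂ ≫ G.w)}
    {b : r.v₂ ≫ G.f ⟶ r.v₁ ≫ F.f} (hb : r.β ≫ b = 𝟙 _) (hb' : b ≫ r.β = 𝟙 _) {e : E ⟶ A}
    {x x' : E ⟶ B} {p : Pt F e x} {q : Pt G e x'} {β : x ⟶ x'} (hr : Force W r p q (𝟙 e) β) :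
    ∃ β' : x' ⟶ x, β ≫ β' = 𝟙 x ∧ β' ≫ β = 𝟙 x' ∧ Force W (r.symm h b) q p (𝟙 e) β' := by
  obtain ⟨D, t, ht, z, s₁, s₂, h1, h2⟩ := hr
  obtain ⟨i, rfl⟩ := exists_iso_of_force hW h1
  have hβ : t ◁ β = (p.pull t).ν.inv ≫ s₁.hom ▷ F.f ≫ r.βAt z ≫ i.hom ▷ G.f ≫ (q.pull t).ν.hom := by
    rw [h2]; simp
  have e1 : r.βAt z ≫ (r.symm h b).βAt z = 𝟙 _ := by
    simp [Rep.βAt, ← Bicategory.whiskerLeft_comp_assoc, hb]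
  have e2 : (r.symm h b).βAt z ≫ r.βAt z = 𝟙 _ := by
    simp [Rep.βAt, ← Bicategory.whiskerLeft_comp_assoc, hb']
  obtain ⟨β', hβ'⟩ := hW.full_left ht ((q.pull t).ν.inv ≫ i.inv ▷ G.f ≫ (r.symm h b).βAt z ≫
    s₁.inv ▷ F.f ≫ (p.pull t).ν.hom)
  refine ⟨β', hW.faithful_left ht ?_, hW.faithful_left ht ?_,
    D, t, ht, z, i.symm, s₁.inv, ?_, ?_⟩
  · rw [Bicategory.whiskerLeft_comp, hβ, hβ']
    simp [reassoc_of% e1]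
  · rw [Bicategory.whiskerLeft_comp, hβ, hβ']
    simp [reassoc_of% e2]
  · have : ((r.symm h b).αAt z).hom = (r.αAt z).inv := by simp [Rep.αAt]
    rw [this, Iso.symm_hom, ← cancel_epi (i.hom ▷ G.w), ← cancel_epi (r.αAt z).hom,
      ← cancel_epi (s₁.hom ▷ F.w), reassoc_of% h1]
    simp
  · rw [hβ']; simp

end

section

variable {A B E : C}

/-- The identity 1-morphisms. -/
abbrev Frac.idSq (hW : Strong W) (A : C) : Frac W A A where
  obj := A
  w := 𝟙 A
  mem := hW.id_mem A
  f := 𝟙 A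

/-- The argument of a point of an identity is isomorphic to its value. -/
def Pt.iso {hW : Strong W} {e e' : E ⟶ A} (p : Pt (Frac.idSq hW A) e e') : e ≅ e' :=
  p.κ.symm ≪≫ p.ν

theorem Over.iso_comp {hW : Strong W} {e₁ x₁ e₂ x₂ : E ⟶ A} {p : Pt (Frac.idSq hW A) e₁ x₁}
    {q : Pt (Frac.idSq hW A) e₂ x₂} {γ : e₁ ⟶ e₂} {β : x₁ ⟶ x₂} (h : Over p q γ β) :
    γ ≫ q.iso.hom = p.iso.hom ≫ β := by
  obtain ⟨l, h1, h2⟩ := h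
  simp only [Pt.iso, Iso.trans_hom, Iso.symm_hom, Category.assoc, Iso.eq_inv_comp, ← h2,
    ← reassoc_of% h1, Iso.hom_inv_id_assoc]

variable {F : Frac W A B}

/-- The data representing the unitor `F ∘ id ⇒ F`. -/
abbrev Rep.leftUnitorSq (hW : Strong W) (s : Square W (𝟙 A) F.w) :
    Rep ((Frac.idSq hW A).compSq hW F s) F where
  obj := s.obj
  v₁ := 𝟙 _
  v₂ := s.f'
  mem := hW.comp_mem _ _ (hW.id_mem _) ((Frac.idSq hW A).compSq hW F s).mem
  α := λ_ (s.v' ≫ 𝟙 A) ≪≫ s.ρ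
  β := (λ_ (s.f' ≫ F.f)).hom

/-- The data representing the unitor `id ∘ F ⇒ F`. -/
abbrev Rep.rightUnitorSq (hW : Strong W) (s : Square W F.f (𝟙 B)) :
    Rep (F.compSq hW (Frac.idSq hW B) s) F where
  obj := s.obj
  v₁ := 𝟙 _
  v₂ := s.v'
  mem := hW.comp_mem _ _ (hW.id_mem _) (F.compSq hW (Frac.idSq hW B) s).mem
  α := λ_ (s.v' ≫ F.w)
  β := (λ_ (s.f' ≫ 𝟙 B)).hom ≫ s.ρ.inv

/-- A point of an identity is only an isomorphism between argument and value. Forgetting it, a point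
of the composite is a point of `F` over an isomorphic argument, which accounts for the factor
`p₁.iso.inv`. -/
theorem force_leftUnitorSq {hW : Strong W} {s : Square W (𝟙 A) F.w} {e e' y : E ⟶ A} {x x' : E ⟶ B}
    {p : Pt ((Frac.idSq hW A).compSq hW F s) e x} {p₁ : Pt (Frac.idSq hW A) e y} {p₂ : Pt F y x}
    {q : Pt F e' x'} {γ : e ⟶ e'} {β : x ⟶ x'} (hp : Dec hW p p₁ p₂)
    (h : Over p₂ q (p₁.iso.inv ≫ γ) β) : Force W (Rep.leftUnitorSq hW s) p q γ β := by
  obtain ⟨i, j, h1, h2, h3⟩ := hp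
  obtain ⟨l, o1, o2⟩ := h
  refine Force₀.toForce hW ⟨p.a, (ρ_ _).symm, j.inv ≫ l, ?_, ?_⟩
  · have hκ : p₂.κ.hom = j.hom ▷ F.w ≫ (s.ρAt p.a).inv ≫ i.inv ▷ 𝟙 A ≫ p₁.ν.hom := by
      rw [← h2]; simp
    have e1 : (j.inv ≫ l) ▷ F.w ≫ q.κ.hom = (s.ρAt p.a).inv ≫ (α_ _ _ _).hom ≫ p.κ.hom ≫ γ := by
      rw [comp_whiskerRight, Category.assoc, o1, hκ]
      simp only [Pt.iso, Iso.trans_inv, Iso.symm_inv, Category.assoc, Iso.hom_inv_id_assoc, ← h1,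
        inv_hom_whiskerRight_assoc]
    rw [e1]
    simp [Rep.αAt, Square.ρAt]
  · rw [comp_whiskerRight, Category.assoc, o2, ← h3]
    simp [Rep.βAt]

theorem force_rightUnitorSq {hW : Strong W} {s : Square W F.f (𝟙 B)} {e e' : E ⟶ A}
    {x x' y : E ⟶ B} {p : Pt (F.compSq hW (Frac.idSq hW B) s) e x} {p₁ : Pt F e y}
    {p₂ : Pt (Frac.idSq hW B) y x} {q : Pt F e' x'} {γ : e ⟶ e'} {δ : y ⟶ x'}
    (hp : Dec hW p p₁ p₂) (h : Over p₁ q γ δ) :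
    Force W (Rep.rightUnitorSq hW s) p q γ (p₂.iso.inv ≫ δ) := by
  obtain ⟨i, j, h1, h2, h3⟩ := hp
  obtain ⟨l, o1, o2⟩ := h
  refine Force₀.toForce hW ⟨p.a, (ρ_ _).symm, i.inv ≫ l, ?_, ?_⟩
  · rw [comp_whiskerRight, Category.assoc, o1, ← h1]
    simp [Rep.αAt]
  · have hν : p.ν.hom = (α_ _ _ _).inv ≫ j.inv ▷ 𝟙 B ≫ p₂.ν.hom := by
      rw [← h3]; simp
    have e1 : p₂.ν.hom ≫ p₂.iso.inv = p₂.κ.hom := by simp [Pt.iso]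
    rw [comp_whiskerRight, Category.assoc, o2, ← h2, hν]
    simp only [Category.assoc, reassoc_of% e1, inv_hom_whiskerRight_assoc]
    simp [Rep.βAt, Square.ρAt]

end

end

/-! ### Comparison of `C` with its bicategory of germs. -/

section Transfer

variable {C : Type u} [Bicategory.{w, v} C] {W : MorphismProperty C}

namespace Loc

variable {hW : Bicalculus W}

/-- The invertible germ `x` is represented by an invertible 2-cell over `s`. -/
def RealizedOver {A B D : C} {f g : A ⟶ B} (s : D ⟶ A) (x : map hW f ≅ map hW g) : Prop :=
  ∃ i : s ≫ f ≅ s ≫ g, map hW s ◁ x.hom = map₂ hW i.hom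

theorem whiskerLeft_eq_map₂_res {A B D E : C} {f g : A ⟶ B} {t : D ⟶ A} {s : E ⟶ A} {u : E ⟶ D}
    {x : map hW f ⟶ map hW g} {θ : t ≫ f ⟶ t ≫ g} (h : map hW t ◁ x = map₂ hW θ) (ζ : s ≅ u ≫ t) :
    map hW s ◁ x = map₂ hW (res θ ζ) := by
  have : map₂ hW ζ.hom ▷ map hW f ≫ map hW (u ≫ t) ◁ x ≫ map₂ hW ζ.inv ▷ map hW g =
      map hW s ◁ x := by
    rw [whisker_exchange, ← comp_whiskerRight_assoc, ← map₂_comp]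
    simp
  rw [← this]
  simp [res, h]

theorem RealizedOver.of_comp {A B D E : C} {f g : A ⟶ B} {t : D ⟶ A} {s : E ⟶ A} {u : E ⟶ D}
    {x : map hW f ≅ map hW g} (h : RealizedOver t x) (ζ : s ≅ u ≫ t) : RealizedOver s x := by
  obtain ⟨i, hi⟩ := h
  refine ⟨⟨res i.hom ζ, res i.inv ζ, ?_, ?_⟩, whiskerLeft_eq_map₂_res hi ζ⟩
  · rw [← res_comp, i.hom_inv_id, res_id]
  · rw [← res_comp, i.inv_hom_id, res_id]

/-- The germ and its inverse are represented over a common refinement. There the representatives are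
inverse up to local equality, and strictly inverse after one more refinement. -/
theorem exists_realizedOver {A B : C} {f g : A ⟶ B} (x : map hW f ≅ map hW g) :
    ∃ (D : C) (s : D ⟶ A), W s ∧ RealizedOver s x := by
  obtain ⟨D, t, ht, θ, hx⟩ := exists_germ x.hom
  obtain ⟨D', t', ht', θ', hx'⟩ := exists_germ x.inv
  have hx : map hW t ◁ x.hom = map₂ hW θ := by rw [hx, whiskerLeft_germ]
  have hx' : map hW t' ◁ x.inv = map₂ hW θ' := by rw [hx', whiskerLeft_germ]
  obtain ⟨E, s, u, u', hs, ⟨ζ⟩, ⟨ζ'⟩⟩ := hW.common t t' ht ht'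
  replace hx := whiskerLeft_eq_map₂_res hx ζ
  replace hx' := whiskerLeft_eq_map₂_res hx' ζ'
  generalize res θ ζ = θ at hx
  generalize res θ' ζ' = θ' at hx'
  have h1 : LocEq W (θ ≫ θ') (𝟙 _) := by
    rw [← map₂_eq_iff (hW := hW), map₂_comp, ← hx, ← hx']; simp
  have h2 : LocEq W (θ' ≫ θ) (𝟙 _) := by
    rw [← map₂_eq_iff (hW := hW), map₂_comp, ← hx, ← hx']; simp
  obtain ⟨P, a, ha, h1, h2⟩ := h1.and hW h2
  let i : a ≫ s ≫ f ≅ a ≫ s ≫ g :=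
    ⟨a ◁ θ, a ◁ θ', by rw [← Bicategory.whiskerLeft_comp, h1]; simp,
      by rw [← Bicategory.whiskerLeft_comp, h2]; simp⟩
  refine ⟨P, a ≫ s, hW.comp_mem _ _ ha hs, α_ _ _ _ ≪≫ i ≪≫ (α_ _ _ _).symm, ?_⟩
  simp [i, ← hx]

/-- Up to refinement, the 1-morphisms in the closure of `W` are in `W`. -/
theorem exists_mem {A B : C} {f : A ⟶ B} (h : closure hW (map hW f)) :
    ∃ (D : C) (s : D ⟶ A), W s ∧ W (s ≫ f) := by
  obtain ⟨m, hm, ⟨x⟩⟩ := h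
  obtain ⟨D, s, hs, i, -⟩ := exists_realizedOver (f := f) (g := m) x
  exact ⟨D, s, hs, hW.iso_mem i (hW.comp_mem _ _ hs hm)⟩

end Loc

variable (hW : Bicalculus W)

/-- A fraction in the bicategory of germs. -/
abbrev Frac.map {A B : C} (F : Frac W A B) :
    Frac (Loc.closure hW) (⟨A⟩ : Loc hW) ⟨B⟩ where
  obj := ⟨F.obj⟩
  w := Loc.map hW F.w
  mem := Loc.closure_map F.mem
  f := Loc.map hW F.f

/-- A square in the bicategory of germs. -/
noncomputable abbrev Square.map {A B D : C} {f : A ⟶ B} {v : D ⟶ B} (s : Square W f v) :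
    Square (Loc.closure hW) (Loc.map hW f) (Loc.map hW v) where
  obj := ⟨s.obj⟩
  v' := Loc.map hW s.v'
  f' := Loc.map hW s.f'
  mem := Loc.closure_map s.mem
  ρ := Loc.mapIso hW s.ρ

/-- A representative of a 2-morphism in the bicategory of germs. -/
noncomputable abbrev Rep.map {A B : C} {F G : Frac W A B} (r : Rep F G) :
    Rep (F.map hW) (G.map hW) where
  obj := ⟨r.obj⟩
  v₁ := Loc.map hW r.v₁
  v₂ := Loc.map hW r.v₂
  mem := Loc.closure_map r.mem
  α := Loc.mapIso hW r.α
  β := Loc.map₂ hW r.β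

/-- Auxiliary data in the bicategory of germs. -/
noncomputable abbrev VertData.map {A B : C} {F₁ F₂ F₃ : Frac W A B} {r : Rep F₁ F₂} {s : Rep F₂ F₃}
    (d : VertData r s) : VertData (r.map hW) (s.map hW) where
  obj := ⟨d.obj⟩
  t₁ := Loc.map hW d.t₁
  t₂ := Loc.map hW d.t₂
  mem := Loc.closure_map d.mem
  ρ := Loc.mapIso hW d.ρ

/-- Auxiliary data in the bicategory of germs. -/
noncomputable abbrev WhiskerLeftData.map {A B D : C} {F : Frac W A B} {G₁ G₂ : Frac W B D}
    {r : Rep G₁ G₂} {s₁ : Square W F.f G₁.w} {s₂ : Square W F.f G₂.w}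
    (d : WhiskerLeftData F r s₁ s₂) :
    WhiskerLeftData (F.map hW) (r.map hW) (s₁.map hW) (s₂.map hW) where
  obj₃ := ⟨d.obj₃⟩
  t₁ := Loc.map hW d.t₁
  mem₁ := Loc.closure_map d.mem₁
  h₁ := Loc.map hW d.h₁
  σ₁ := Loc.mapIso hW d.σ₁
  obj₄ := ⟨d.obj₄⟩
  t₂ := Loc.map hW d.t₂
  mem₂ := Loc.closure_map d.mem₂
  h₂ := Loc.map hW d.h₂
  σ₂ := Loc.mapIso hW d.σ₂
  obj₅ := ⟨d.obj₅⟩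
  t₃ := Loc.map hW d.t₃
  mem₃ := Loc.closure_map d.mem₃
  t₄ := Loc.map hW d.t₄
  φ := Loc.mapIso hW d.φ
  δ := Loc.mapIso hW d.δ
  δ_eq := by
    have := congrArg (Loc.map₂ hW) d.δ_eq
    simpa [bicategoricalComp, BicategoricalCoherence.iso] using this

/-- Auxiliary data in the bicategory of germs. -/
noncomputable abbrev WhiskerRightData.map {A B D : C} {F₁ F₂ : Frac W A B} {r : Rep F₁ F₂}
    {G : Frac W B D} {s₁ : Square W F₁.f G.w} {s₂ : Square W F₂.f G.w}
    (d : WhiskerRightData r G s₁ s₂) :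
    WhiskerRightData (r.map hW) (G.map hW) (s₁.map hW) (s₂.map hW) where
  obj₃ := ⟨d.obj₃⟩
  u₃ := Loc.map hW d.u₃
  mem₃ := Loc.closure_map d.mem₃
  u₄ := Loc.map hW d.u₄
  η₁ := Loc.mapIso hW d.η₁
  obj₄ := ⟨d.obj₄⟩
  u₅ := Loc.map hW d.u₅
  mem₅ := Loc.closure_map d.mem₅
  u₆ := Loc.map hW d.u₆
  η₂ := Loc.mapIso hW d.η₂
  obj₅ := ⟨d.obj₅⟩
  u₇ := Loc.map hW d.u₇
  mem₇ := Loc.closure_map d.mem₇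
  u₈ := Loc.map hW d.u₈
  η₃ := Loc.mapIso hW d.η₃
  l := Loc.map₂ hW d.l
  l_eq := by
    have := congrArg (Loc.map₂ hW) d.l_eq
    simpa [bicategoricalComp, BicategoricalCoherence.iso] using this

/-- Auxiliary data in the bicategory of germs. -/
noncomputable abbrev AssocData.map {A B D E : C} {F : Frac W A B} {G : Frac W B D} {H : Frac W D E}
    {s₁ : Square W F.f G.w} {s₂ : Square W (s₁.f' ≫ G.f) H.w} {s₃ : Square W G.f H.w}
    {s₄ : Square W F.f (s₃.v' ≫ G.w)} (d : AssocData F G H s₁ s₂ s₃ s₄) :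
    AssocData (F.map hW) (G.map hW) (H.map hW) (s₁.map hW) (s₂.map hW) (s₃.map hW)
      (s₄.map hW) where
  obj := ⟨d.obj⟩
  u₄ := Loc.map hW d.u₄
  u₅ := Loc.map hW d.u₅
  mem := Loc.closure_map d.mem
  γ := Loc.mapIso hW d.γ
  ω := Loc.mapIso hW d.ω
  ω_eq := by
    have := congrArg (Loc.map₂ hW) d.ω_eq
    simpa [bicategoricalComp, BicategoricalCoherence.iso] using this
  ρ := Loc.mapIso hW d.ρ
  ρ_eq := by
    have := congrArg (Loc.map₂ hW) d.ρ_eq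
    simpa [bicategoricalComp, BicategoricalCoherence.iso] using this

variable {hW}

theorem Rep.Equiv.map {A B : C} {F G : Frac W A B} {r r' : Rep F G} (h : r.Equiv r') :
    (r.map hW).Equiv (r'.map hW) := by
  obtain ⟨E, z, z', σ₁, σ₂, hm, h1, h2⟩ := h
  refine ⟨⟨E⟩, Loc.map hW z, Loc.map hW z', Loc.mapIso hW σ₁, Loc.mapIso hW σ₂,
    Loc.closure_map hm, ?_, ?_⟩
  · have := congrArg (Loc.map₂ hW) h1
    simpa [bicategoricalComp, BicategoricalCoherence.iso] using this
  · have := congrArg (Loc.map₂ hW) h2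
    simpa [bicategoricalComp, BicategoricalCoherence.iso] using this

/-- The two invertible germs and the membership in the closure are realized in `C` over one
refinement `s`. The two equations then hold up to local equality, hence strictly over a last
refinement `q`, which is absorbed into the legs. -/
theorem Rep.Equiv.of_map {A B : C} {F G : Frac W A B} {r r' : Rep F G}
    (h : (r.map hW).Equiv (r'.map hW)) : r.Equiv r' := by
  obtain ⟨⟨E⟩, ⟨z⟩, ⟨z'⟩, σ₁, σ₂, hm, h1, h2⟩ := h
  obtain ⟨D₁, t₁, ht₁, hi₁⟩ := Loc.exists_realizedOver (f := z' ≫ r'.v₁) (g := z ≫ r.v₁) σ₁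
  obtain ⟨D₂, t₂, ht₂, hi₂⟩ := Loc.exists_realizedOver (f := z ≫ r.v₂) (g := z' ≫ r'.v₂) σ₂
  obtain ⟨D₃, t₃, ht₃, hm⟩ := Loc.exists_mem (f := z ≫ r.v₁ ≫ F.w) hm
  obtain ⟨P, a, u, u', ha, ⟨ζ₁⟩, ⟨ζ₂⟩⟩ := hW.common t₁ t₂ ht₁ ht₂
  replace hi₁ := hi₁.of_comp ζ₁
  replace hi₂ := hi₂.of_comp ζ₂
  obtain ⟨P', b, y, hb, ⟨ζ⟩⟩ := hW.square a t₃ ha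
  obtain ⟨i₁, hi₁⟩ := hi₁.of_comp ζ
  obtain ⟨i₂, hi₂⟩ := hi₂.of_comp ζ
  -- Membership in the closure only holds up to an invertible germ, and `t₃` is the refinement at
  -- which it becomes membership in `W`.
  replace hm : W ((b ≫ t₃) ≫ z ≫ r.v₁ ≫ F.w) :=
    hW.iso_mem (α_ _ _ _) (hW.comp_mem _ _ hb hm)
  generalize b ≫ t₃ = s at i₁ hi₁ i₂ hi₂ hm
  let j₁ : (s ≫ z') ≫ r'.v₁ ≅ (s ≫ z) ≫ r.v₁ := α_ _ _ _ ≪≫ i₁ ≪≫ (α_ _ _ _).symm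
  let j₂ : (s ≫ z) ≫ r.v₂ ≅ (s ≫ z') ≫ r'.v₂ := α_ _ _ _ ≪≫ i₂ ≪≫ (α_ _ _ _).symm
  have e1 : LocEq W (j₁.hom ▷ F.w ⊗≫ (s ≫ z) ◁ r.α.hom ⊗≫ j₂.hom ▷ G.w)
      ((α_ (s ≫ z') r'.v₁ F.w).hom ≫ (s ≫ z') ◁ r'.α.hom ≫ (α_ (s ≫ z') r'.v₂ G.w).inv) := by
    rw [← Loc.map₂_eq_iff (hW := hW)]
    have := congrArg (fun x => (α_ _ _ _).hom ▷ _ ≫ (α_ _ _ _).hom ≫ Loc.map hW s ◁ x ≫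
      (α_ _ _ _).inv ≫ (α_ _ _ _).inv ▷ _) h1
    simpa [bicategoricalComp, BicategoricalCoherence.iso, j₁, j₂, ← hi₁, ← hi₂] using this
  have e2 : LocEq W (j₁.hom ▷ F.f ⊗≫ (s ≫ z) ◁ r.β ⊗≫ j₂.hom ▷ G.f)
      ((α_ (s ≫ z') r'.v₁ F.f).hom ≫ (s ≫ z') ◁ r'.β ≫ (α_ (s ≫ z') r'.v₂ G.f).inv) := by
    rw [← Loc.map₂_eq_iff (hW := hW)]
    have := congrArg (fun x => (α_ _ _ _).hom ▷ _ ≫ (α_ _ _ _).hom ≫ Loc.map hW s ◁ x ≫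
      (α_ _ _ _).inv ≫ (α_ _ _ _).inv ▷ _) h2
    simpa [bicategoricalComp, BicategoricalCoherence.iso, j₁, j₂, ← hi₁, ← hi₂] using this
  obtain ⟨Q, q, hq, e1, e2⟩ := e1.and hW e2
  refine ⟨Q, q ≫ s ≫ z, q ≫ s ≫ z', α_ _ _ _ ≪≫ whiskerLeftIso q j₁ ≪≫ (α_ _ _ _).symm,
    α_ _ _ _ ≪≫ whiskerLeftIso q j₂ ≪≫ (α_ _ _ _).symm, ?_, ?_, ?_⟩
  · exact hW.iso_mem (α_ _ _ _ ≪≫ whiskerLeftIso q (α_ _ _ _)) (hW.comp_mem _ _ hq hm)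
  · have := congrArg (fun x => (α_ _ _ _).hom ▷ _ ≫ (α_ _ _ _).hom ≫ x ≫ (α_ _ _ _).inv ≫
      (α_ _ _ _).inv ▷ _) e1
    simpa [bicategoricalComp, BicategoricalCoherence.iso] using this
  · have := congrArg (fun x => (α_ _ _ _).hom ▷ _ ≫ (α_ _ _ _).hom ≫ x ≫ (α_ _ _ _).inv ≫
      (α_ _ _ _).inv ▷ _) e2
    simpa [bicategoricalComp, BicategoricalCoherence.iso] using this

-- The recipe commutes with the passage to germs, so the values computed for `repSq` in a strong
-- calculus apply to the diagrams in `C`. The same holds for the whiskerings and the associator.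
variable (hW) in
theorem map_vert {A B : C} {F₁ F₂ F₃ : Frac W A B} {r : Rep F₁ F₂} {s : Rep F₂ F₃}
    (d : VertData r s) : (d.rep hW).map hW = (d.map hW).repSq Loc.strong := by
  have h1 : Loc.mapIso hW (d.rep hW).α = ((d.map hW).repSq Loc.strong).α := by
    ext
    simp [VertData.rep, bicategoricalIsoComp, BicategoricalCoherence.iso]
    rfl
  have h2 : Loc.map₂ hW (d.rep hW).β = ((d.map hW).repSq Loc.strong).β := by
    simp [VertData.rep, bicategoricalComp, BicategoricalCoherence.iso]
    rfl
  exact congrArg₂ (Rep.mk _ _ _ _) h1 h2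

variable (hW) in
theorem map_whiskerLeft {c : Choices W} {A B D : C} {F : Frac W A B} {G₁ G₂ : Frac W B D}
    {r : Rep G₁ G₂} (d : WhiskerLeftData F r (c F.f G₁.w G₁.mem) (c F.f G₂.w G₂.mem)) :
    (d.rep hW).map hW = (d.map hW).repSq Loc.strong := by
  have h1 : Loc.mapIso hW d.α = (d.map hW).α := by
    ext
    simp [WhiskerLeftData.α, bicategoricalIsoComp, BicategoricalCoherence.iso]
  have h2 : Loc.map₂ hW d.β = (d.map hW).β := by
    simp [WhiskerLeftData.β, bicategoricalComp, BicategoricalCoherence.iso]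
  exact congrArg₂ (Rep.mk _ _ _ _) h1 h2

variable (hW) in
theorem map_whiskerRight {c : Choices W} {A B D : C} {F₁ F₂ : Frac W A B} {G : Frac W B D}
    {r : Rep F₁ F₂} (d : WhiskerRightData r G (c F₁.f G.w G.mem) (c F₂.f G.w G.mem)) :
    (d.rep hW).map hW = (d.map hW).repSq Loc.strong := by
  have h1 : Loc.mapIso hW d.α = (d.map hW).α := by
    ext
    simp [WhiskerRightData.α, bicategoricalIsoComp, BicategoricalCoherence.iso]
  have h2 : Loc.map₂ hW d.β = (d.map hW).β := by
    simp [WhiskerRightData.β, bicategoricalComp, BicategoricalCoherence.iso]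
  exact congrArg₂ (Rep.mk _ _ _ _) h1 h2

theorem map_assoc {c : Choices W} {A B D E : C} {F : Frac W A B} {G : Frac W B D} {H : Frac W D E}
    (d : AssocDataC hW c F G H) :
    (AssocDataC.rep d).map hW = (AssocData.map hW d).repSq Loc.strong := by
  have h1 : Loc.mapIso hW d.α = (AssocData.map hW d).α := by
    ext
    simp [AssocData.α, bicategoricalIsoComp, BicategoricalCoherence.iso]
  have h2 : Loc.map₂ hW d.β = (AssocData.map hW d).β := by
    simp [AssocData.β, bicategoricalComp, BicategoricalCoherence.iso]
  exact congrArg₂ (Rep.mk _ _ _ _) h1 h2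

end Transfer

/-! ### Existence of auxiliary data. -/

section Existence

variable {C : Type u} [Bicategory.{w, v} C] {W : MorphismProperty C}

theorem IsLift.whiskerRight_eq {A B X D : C} {w : B ⟶ A} {f g : X ⟶ B} {α : f ≫ w ⟶ g ≫ w}
    {t : D ⟶ X} {β : t ≫ f ⟶ t ≫ g} (h : IsLift α t β) :
    β ▷ w = (α_ _ _ _).hom ≫ t ◁ α ≫ (α_ _ _ _).inv := by
  rw [h]; simp

theorem Bicalculus.lift_iso (hW : Bicalculus W) {A B X : C} {w : B ⟶ A} {f g : X ⟶ B} (h : W w)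
    (α : f ≫ w ≅ g ≫ w) : ∃ (D : C) (t : D ⟶ X) (β : t ≫ f ≅ t ≫ g), W t ∧
      β.hom ▷ w = (α_ _ _ _).hom ≫ t ◁ α.hom ≫ (α_ _ _ _).inv := by
  obtain ⟨D, t, β, ht, hβ, hi⟩ := hW.lift w f g α.hom h
  have := hi inferInstance
  exact ⟨D, t, asIso β, ht, hβ.whiskerRight_eq⟩

/-- Every 1-morphism factors locally through `v`, if `v ≫ w` and `w` are in `W`. -/
theorem Bicalculus.exists_factor (hW : Bicalculus W) {A X B D : C} (a : X ⟶ B) {v : A ⟶ B}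
    {w : B ⟶ D} (h : W w) (h' : W (v ≫ w)) :
    ∃ (E : C) (t : E ⟶ X) (z : E ⟶ A), W t ∧ Nonempty (t ≫ a ≅ z ≫ v) := by
  obtain ⟨E, t, z, ht, ⟨ρ⟩⟩ := hW.square (v ≫ w) (a ≫ w) h'
  obtain ⟨E', s, β, hs, -⟩ := hW.lift_iso h ((α_ t a w) ≪≫ ρ ≪≫ (α_ z v w).symm)
  exact ⟨E', s ≫ t, s ≫ z, hW.comp_mem _ _ hs ht, ⟨α_ _ _ _ ≪≫ β ≪≫ (α_ _ _ _).symm⟩⟩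

theorem nonempty_vertData (hW : Bicalculus W) {A B : C} {F₁ F₂ F₃ : Frac W A B} (r : Rep F₁ F₂)
    (s : Rep F₂ F₃) : Nonempty (VertData r s) := by
  obtain ⟨E, t, z, ht, ⟨ρ⟩⟩ := hW.exists_factor r.v₂ F₂.mem s.mem
  exact ⟨⟨E, t, z, ht, ρ⟩⟩

/-- The first leg of `r` is lifted against by `exists_factor`, `φ` comes from BF3, and `δ` is a lift
along `r.v₁ ≫ G₁.w`, which is in `W`. The lift exists only over `q`, which is absorbed into `t₃` and
`t₄`. -/
theorem nonempty_whiskerLeftData (hW : Bicalculus W) {A B D : C} (F : Frac W A B)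
    {G₁ G₂ : Frac W B D} (r : Rep G₁ G₂) (s₁ : Square W F.f G₁.w) (s₂ : Square W F.f G₂.w) :
    Nonempty (WhiskerLeftData F r s₁ s₂) := by
  obtain ⟨obj₃, t₁, h₁, mem₁, ⟨σ₁⟩⟩ := hW.exists_factor s₁.f' G₁.mem r.mem
  obtain ⟨obj₄, t₂, h₂, mem₂, ⟨σ₂⟩⟩ :=
    hW.exists_factor s₂.f' G₂.mem (hW.iso_mem r.α.symm r.mem)
  obtain ⟨P, t₃, t₄, mem₃, ⟨φ⟩⟩ := hW.square (t₂ ≫ s₂.v') (t₁ ≫ s₁.v')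
    (hW.comp_mem _ _ mem₂ s₂.mem)
  obtain ⟨Q, q, δ, hq, hδ⟩ := hW.lift_iso (f := t₃ ≫ h₁) (g := t₄ ≫ h₂) r.mem
    (Iso.refl _ ≪⊗≫ whiskerLeftIso t₃ (whiskerRightIso σ₁.symm G₁.w) ≪⊗≫
      whiskerLeftIso (t₃ ≫ t₁) s₁.ρ.symm ≪⊗≫ whiskerRightIso φ F.f ≪⊗≫
      whiskerLeftIso (t₄ ≫ t₂) s₂.ρ ≪⊗≫ whiskerLeftIso t₄ (whiskerRightIso σ₂ G₂.w) ≪⊗≫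
      whiskerLeftIso (t₄ ≫ h₂) r.α.symm)
  refine ⟨⟨obj₃, t₁, mem₁, h₁, σ₁, obj₄, t₂, mem₂, h₂, σ₂, Q, q ≫ t₃, hW.comp_mem _ _ hq mem₃,
    q ≫ t₄, α_ _ _ _ ≪≫ whiskerLeftIso q φ ≪≫ (α_ _ _ _).symm,
    α_ _ _ _ ≪≫ δ ≪≫ (α_ _ _ _).symm, ?_⟩⟩
  simp only [Iso.trans_hom, comp_whiskerRight, Iso.symm_hom, hδ]
  simp [bicategoricalComp, bicategoricalIsoComp, BicategoricalCoherence.iso]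
  bicategory

/-- The three invertible 2-cells come from BF3. The prescribed 2-cell over `G.w` contains `r.β` and
need not be invertible, so only BF4a is used to lift it. -/
theorem nonempty_whiskerRightData (hW : Bicalculus W) {A B D : C} {F₁ F₂ : Frac W A B}
    (r : Rep F₁ F₂) (G : Frac W B D) (s₁ : Square W F₁.f G.w) (s₂ : Square W F₂.f G.w) :
    Nonempty (WhiskerRightData r G s₁ s₂) := by
  obtain ⟨obj₃, u₃, u₄, mem₃, ⟨η₁⟩⟩ := hW.square s₁.v' r.v₁ s₁.mem
  obtain ⟨obj₄, u₅, u₆, mem₅, ⟨η₂⟩⟩ := hW.square s₂.v' r.v₂ s₂.mem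
  obtain ⟨P, u₇, u₈, mem₇, ⟨η₃⟩⟩ := hW.square u₅ u₃ mem₅
  obtain ⟨Q, q, l, hq, hl, -⟩ := hW.lift G.w (u₇ ≫ u₄ ≫ s₁.f') (u₈ ≫ u₆ ≫ s₂.f')
    (𝟙 _ ⊗≫ (u₇ ≫ u₄) ◁ s₁.ρ.inv ⊗≫ u₇ ◁ (η₁.inv ▷ F₁.f) ⊗≫ η₃.hom ▷ (r.v₁ ≫ F₁.f) ⊗≫
      (u₈ ≫ u₅) ◁ r.β ⊗≫ u₈ ◁ (η₂.hom ▷ F₂.f) ⊗≫ (u₈ ≫ u₆) ◁ s₂.ρ.hom ⊗≫ 𝟙 _) G.mem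
  refine ⟨⟨obj₃, u₃, mem₃, u₄, η₁, obj₄, u₅, mem₅, u₆, η₂, Q, q ≫ u₇, hW.comp_mem _ _ hq mem₇,
    q ≫ u₈, α_ _ _ _ ≪≫ whiskerLeftIso q η₃ ≪≫ (α_ _ _ _).symm,
    (α_ _ _ _).hom ≫ l ≫ (α_ _ _ _).inv, ?_⟩⟩
  simp only [comp_whiskerRight, hl.whiskerRight_eq]
  simp [bicategoricalComp, BicategoricalCoherence.iso]
  bicategory

/-- Two successive lifts: `ω` along `G.w`, then `ρ` along `H.w`, since the equation for `ρ` involves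
`ω`. Both refinements are absorbed into the legs as `k ≫ q`. -/
theorem nonempty_assocData (hW : Bicalculus W) {A B D E : C} (F : Frac W A B) (G : Frac W B D)
    (H : Frac W D E) (s₁ : Square W F.f G.w) (s₂ : Square W (s₁.f' ≫ G.f) H.w)
    (s₃ : Square W G.f H.w) (s₄ : Square W F.f (s₃.v' ≫ G.w)) :
    Nonempty (AssocData F G H s₁ s₂ s₃ s₄) := by
  obtain ⟨P, u₄, u₅, hu₄, ⟨γ⟩⟩ := hW.square s₄.v' (s₂.v' ≫ s₁.v') s₄.mem
  obtain ⟨Q, q, ω, hq, hω⟩ := hW.lift_iso (f := u₄ ≫ s₂.v' ≫ s₁.f') (g := u₅ ≫ s₄.f' ≫ s₃.v') G.mem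
    (Iso.refl _ ≪⊗≫ whiskerLeftIso (u₄ ≫ s₂.v') s₁.ρ.symm ≪⊗≫ whiskerRightIso γ F.f ≪⊗≫
      whiskerLeftIso u₅ s₄.ρ ≪⊗≫ Iso.refl _)
  obtain ⟨R, k, ρ, hk, hρ⟩ := hW.lift_iso (f := q ≫ u₄ ≫ s₂.f') (g := q ≫ u₅ ≫ s₄.f' ≫ s₃.f') H.mem
    (Iso.refl _ ≪⊗≫ whiskerLeftIso (q ≫ u₄) s₂.ρ.symm ≪⊗≫ whiskerRightIso ω G.f ≪⊗≫
      whiskerLeftIso (q ≫ u₅ ≫ s₄.f') s₃.ρ ≪⊗≫ Iso.refl _)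
  refine ⟨⟨R, (k ≫ q) ≫ u₄, (k ≫ q) ≫ u₅, ?_, α_ _ _ _ ≪≫ whiskerLeftIso (k ≫ q) γ ≪≫ (α_ _ _ _).symm,
    α_ _ _ _ ≪≫ α_ _ _ _ ≪≫ whiskerLeftIso k ω ≪≫ (α_ _ _ _).symm ≪≫ (α_ _ _ _).symm, ?_,
    whiskerRightIso (α_ _ _ _) _ ≪≫ α_ _ _ _ ≪≫ whiskerLeftIso k (α_ _ _ _) ≪≫ ρ ≪≫
      whiskerLeftIso k (α_ _ _ _).symm ≪≫ (α_ _ _ _).symm ≪≫ whiskerRightIso (α_ _ _ _).symm _, ?_⟩⟩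
  · exact hW.comp_mem _ _ (hW.comp_mem _ _ (hW.comp_mem _ _ hk hq) hu₄)
      (hW.comp_mem _ _ s₂.mem (hW.comp_mem _ _ s₁.mem F.mem))
  · have : (k ◁ ω.hom) ▷ G.w = (α_ _ _ _).hom ≫ k ◁ (ω.hom ▷ G.w) ≫ (α_ _ _ _).inv := by simp
    simp only [Iso.trans_hom, comp_whiskerRight, Iso.symm_hom, whiskerLeftIso_hom, this, hω]
    simp [bicategoricalComp, bicategoricalIsoComp, BicategoricalCoherence.iso]
    bicategory
  · simp only [Iso.trans_hom, comp_whiskerRight, Iso.symm_hom, whiskerLeftIso_hom,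
      whiskerRightIso_hom, hρ]
    simp [bicategoricalComp, bicategoricalIsoComp, BicategoricalCoherence.iso]
    bicategory

end Existence

/-! ### Morphisms between points of composites. -/

section

variable {C : Type u} [Bicategory.{w, v} C] {W : MorphismProperty C}

/-- A morphism between points of composites consists of morphisms between their components. -/
theorem Over.of_dec {hW : Strong W} {A B D E : C} {F : Frac W A B} {G : Frac W B D}
    {s : Square W F.f G.w} {e e' : E ⟶ A} {y y' : E ⟶ B} {x x' : E ⟶ D}
    {p : Pt (F.compSq hW G s) e x} {q : Pt (F.compSq hW G s) e' x'} {p₁ : Pt F e y} {p₂ : Pt G y x}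
    {q₁ : Pt F e' y'} {q₂ : Pt G y' x'} {γ : e ⟶ e'} {δ : y ⟶ y'} {β : x ⟶ x'}
    (hp : Dec hW p p₁ p₂) (hq : Dec hW q q₁ q₂) (h : Over p₁ q₁ γ δ) (h' : Over p₂ q₂ δ β) :
    Over p q γ β := by
  -- Some morphism over `γ` exists; its components must be the given ones by uniqueness, which
  -- identifies its value with `β`.
  obtain ⟨β', l, e1, e2⟩ := Over.exists_of hW p q γ
  obtain ⟨i, j, h1, h2, h3⟩ := hp
  obtain ⟨i', j', h1', h2', h3'⟩ := hq
  have ho : Over p₁ q₁ γ (p₁.ν.inv ≫ (i.hom ≫ l ▷ s.v' ≫ i'.inv) ▷ F.f ≫ q₁.ν.hom) := by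
    refine ⟨i.hom ≫ l ▷ s.v' ≫ i'.inv, ?_, by simp⟩
    rw [← h1, Category.assoc, Category.assoc, ← e1, ← h1']
    simp
  obtain rfl := h.unique hW ho
  have ho' : Over p₂ q₂ (p₁.ν.inv ≫ (i.hom ≫ l ▷ s.v' ≫ i'.inv) ▷ F.f ≫ q₁.ν.hom) β' := by
    refine ⟨j.hom ≫ l ▷ s.f' ≫ j'.inv, ?_, ?_⟩
    · have hκ : p₂.κ.hom = j.hom ▷ G.w ≫ (s.ρAt p.a).inv ≫ i.inv ▷ F.f ≫ p₁.ν.hom := by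
        rw [← h2]; simp
      have e3 := s.ρAt_natural l
      rw [hκ, ← h2']
      simp only [Category.assoc, comp_whiskerRight, inv_hom_whiskerRight_assoc,
        Iso.hom_inv_id_assoc, reassoc_of% e3, Iso.inv_hom_id_assoc]
    · rw [← h3, Category.assoc, Category.assoc, ← e2, ← h3']
      simp
  obtain rfl := h'.unique hW ho'
  exact ⟨l, e1, e2⟩

end

/-! ### Values of the 2-morphisms of the bicategory of fractions. -/

section Semantics

variable {C : Type u} [Bicategory.{w, v} C] {W : MorphismProperty C} (hW : Bicalculus W)

/-- The points of a fraction in the bicategory of germs. -/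
abbrev Frac.Point {A B : C} (F : Frac W A B) {E : Loc hW} (e : E ⟶ ⟨A⟩) (x : E ⟶ ⟨B⟩) : Type _ :=
  Pt (F.map hW) e x

theorem exists_points {A B : C} (l : List (Frac W A B)) :
    ∃ (E : Loc hW) (e : E ⟶ ⟨A⟩), Loc.closure hW e ∧
      ∀ F ∈ l, ∃ x : E ⟶ ⟨B⟩, Nonempty (F.Point hW e x) := by
  obtain ⟨E, e, he, h⟩ := Loc.strong.exists_points (l.map (Frac.map hW))
  exact ⟨E, e, he, fun F hF => h _ (List.mem_map_of_mem hF)⟩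

/-- The relation between data that represent the same 2-morphism is an equivalence relation. -/
theorem Rep.equivalence (hW : Bicalculus W) {A B : C} (F G : Frac W A B) :
    Equivalence (Rep.Equiv (F := F) (G := G)) := by
  -- All three properties follow by comparing values at one pair of points over a single `e` in the
  -- closure of `W`.
  obtain ⟨E, e, he, h⟩ := exists_points hW [F, G]
  obtain ⟨x, ⟨p⟩⟩ := h F (by simp)
  obtain ⟨y, ⟨q⟩⟩ := h G (by simp)
  refine ⟨fun r => ?_, @fun r r' h => ?_, @fun r r' r'' h h' => ?_⟩
  · obtain ⟨β, hβ⟩ := Force.exists_of Loc.strong (r.map hW) p q (𝟙 e)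
    exact Rep.Equiv.of_map (hβ.equiv Loc.strong he hβ)
  · obtain ⟨β, hβ⟩ := Force.exists_of Loc.strong (r.map hW) p q (𝟙 e)
    exact Rep.Equiv.of_map ((hβ.of_equiv Loc.strong h.map).equiv Loc.strong he hβ)
  · obtain ⟨β, hβ⟩ := Force.exists_of Loc.strong (r.map hW) p q (𝟙 e)
    exact Rep.Equiv.of_map (hβ.equiv Loc.strong he
      ((hβ.of_equiv Loc.strong h.map).of_equiv Loc.strong h'.map))

theorem Rep.cls_eq_cls_iff (hW : Bicalculus W) {A B : C} {F G : Frac W A B} {r r' : Rep F G} :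
    r.cls = r'.cls ↔ r.Equiv r' :=
  ⟨fun h => (Rep.equivalence hW F G).eqvGen_iff.1 (Quot.eqvGen_exact h), Quot.sound⟩

variable {hW}

/-- The 2-morphism `Γ` carries the 2-cell `γ` between the arguments `e`, `e'` to the 2-cell `β`
between their images. -/
def Hom₂.Forces {A B : C} {F G : Frac W A B} (Γ : Hom₂ F G) {E : Loc hW} {e e' : E ⟶ ⟨A⟩}
    {x x' : E ⟶ ⟨B⟩} (p : F.Point hW e x) (q : G.Point hW e' x') (γ : e ⟶ e') (β : x ⟶ x') : Prop :=
  ∃ r : Rep F G, r.cls = Γ ∧ Force (Loc.closure hW) (r.map hW) p q γ β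

/-- The point `p` of a composite consists of the points `p₁` and `p₂`. -/
def Consists {c : Choices W} {A B D : C} {F : Frac W A B} {G : Frac W B D} {E : Loc hW}
    {e : E ⟶ ⟨A⟩} {y : E ⟶ ⟨B⟩} {x : E ⟶ ⟨D⟩} (p : (F.comp hW c G).Point hW e x)
    (p₁ : F.Point hW e y) (p₂ : G.Point hW y x) : Prop :=
  Dec (F := F.map hW) (G := G.map hW) (s := (c F.f G.w G.mem).map hW) Loc.strong p p₁ p₂

theorem exists_consists {c : Choices W} {A B D : C} {F : Frac W A B} {G : Frac W B D} {E : Loc hW}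
    {e : E ⟶ ⟨A⟩} {x : E ⟶ ⟨D⟩} (p : (F.comp hW c G).Point hW e x) :
    ∃ (y : E ⟶ ⟨B⟩) (p₁ : F.Point hW e y) (p₂ : G.Point hW y x), Consists p p₁ p₂ :=
  exists_dec (F := F.map hW) (G := G.map hW) (s := (c F.f G.w G.mem).map hW) Loc.strong p

theorem Consists.over_comp {c : Choices W} {A B D : C} {F : Frac W A B} {G : Frac W B D}
    {E : Loc hW} {e e' : E ⟶ ⟨A⟩} {y y' : E ⟶ ⟨B⟩} {x x' : E ⟶ ⟨D⟩}
    {p : (F.comp hW c G).Point hW e x} {p₁ : F.Point hW e y} {p₂ : G.Point hW y x}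
    {q : (F.comp hW c G).Point hW e' x'} {q₁ : F.Point hW e' y'} {q₂ : G.Point hW y' x'}
    {γ : e ⟶ e'} {δ : y ⟶ y'} {β : x ⟶ x'} (hp : Consists p p₁ p₂) (hq : Consists q q₁ q₂) (h : Over p₁ q₁ γ δ)
    (h' : Over p₂ q₂ δ β) : Over p q γ β := Over.of_dec hp hq h h'

theorem Hom₂.exists_rep {A B : C} {F G : Frac W A B} (Γ : Hom₂ F G) : ∃ r : Rep F G, r.cls = Γ :=
  Quot.exists_rep Γ

theorem Rep.forces_cls {A B : C} {F G : Frac W A B} {r : Rep F G} {E : Loc hW} {e e' : E ⟶ ⟨A⟩}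
    {x x' : E ⟶ ⟨B⟩} {p : F.Point hW e x} {q : G.Point hW e' x'} {γ : e ⟶ e'} {β : x ⟶ x'} :
    r.cls.Forces p q γ β ↔ Force (Loc.closure hW) (r.map hW) p q γ β := by
  refine ⟨?_, fun h => ⟨r, rfl, h⟩⟩
  rintro ⟨r', h, h'⟩
  exact h'.of_equiv Loc.strong ((Rep.cls_eq_cls_iff hW).1 h).map

namespace Hom₂.Forces

variable {A B : C} {F G : Frac W A B} {Γ Γ' : Hom₂ F G} {E : Loc hW} {e e' : E ⟶ ⟨A⟩}
  {x x' : E ⟶ ⟨B⟩} {p : F.Point hW e x} {q : G.Point hW e' x'} {γ : e ⟶ e'} {β β' : x ⟶ x'}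

theorem exists_of (Γ : Hom₂ F G) (p : F.Point hW e x) (q : G.Point hW e' x') (γ : e ⟶ e') :
    ∃ β : x ⟶ x', Γ.Forces p q γ β := by
  obtain ⟨r, rfl⟩ := Γ.exists_rep
  obtain ⟨β, h⟩ := Force.exists_of Loc.strong (r.map hW) p q γ
  exact ⟨β, r, rfl, h⟩

theorem unique {γ' : e ⟶ e'} (h : Γ.Forces p q γ β) (h' : Γ.Forces p q γ' β')
    (hγ : γ = γ' := by simp) : β = β' := by
  subst hγ
  obtain ⟨r, rfl, h⟩ := h
  exact h.unique Loc.strong (Rep.forces_cls.1 h')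

/-- The principle by which the axioms are proved. The default proofs by `simp` absorb identities and
reassociations in the arguments and in the values. -/
theorem ext {q : G.Point hW e x'} {γ γ' : e ⟶ e} (he : Loc.closure hW e) (h : Γ.Forces p q γ β)
    (h' : Γ'.Forces p q γ' β') (hβ : β = β' := by simp) (hγ : γ = 𝟙 e := by simp)
    (hγ' : γ' = 𝟙 e := by simp) : Γ = Γ' := by
  subst hγ hγ' hβ
  obtain ⟨r, rfl, h⟩ := h
  obtain ⟨r', rfl, h'⟩ := h'
  exact (Rep.cls_eq_cls_iff hW).2 (Rep.Equiv.of_map (h.equiv Loc.strong he h'))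

end Hom₂.Forces

theorem forces_vert {A B : C} {F G H : Frac W A B} {r : Rep F G} {s : Rep G H} (d : VertData r s)
    {E : Loc hW} {e e' e'' : E ⟶ ⟨A⟩} {x x' x'' : E ⟶ ⟨B⟩} {p : F.Point hW e x}
    {q : G.Point hW e' x'} {q' : H.Point hW e'' x''} {γ : e ⟶ e'} {β : x ⟶ x'} {γ' : e' ⟶ e''}
    {β' : x' ⟶ x''} (h : r.cls.Forces p q γ β) (h' : s.cls.Forces q q' γ' β') :
    (d.rep hW).cls.Forces p q' (γ ≫ γ') (β ≫ β') := by
  rw [Rep.forces_cls] at h h' ⊢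
  rw [map_vert]
  exact VertData.force_repSq Loc.strong h h'

theorem forces_whiskerLeft {c : Choices W} {A B D : C} {F : Frac W A B} {G₁ G₂ : Frac W B D}
    {r : Rep G₁ G₂} (d : WhiskerLeftData F r (c F.f G₁.w G₁.mem) (c F.f G₂.w G₂.mem)) {E : Loc hW}
    {e e' : E ⟶ ⟨A⟩} {y y' : E ⟶ ⟨B⟩} {x x' : E ⟶ ⟨D⟩} {p : (F.comp hW c G₁).Point hW e x}
    {p₁ : F.Point hW e y} {p₂ : G₁.Point hW y x} {q : (F.comp hW c G₂).Point hW e' x'}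
    {q₁ : F.Point hW e' y'} {q₂ : G₂.Point hW y' x'} {γ : e ⟶ e'} {δ : y ⟶ y'} {β : x ⟶ x'}
    (hp : Consists p p₁ p₂) (hq : Consists q q₁ q₂) (h : Over p₁ q₁ γ δ)
    (h' : r.cls.Forces p₂ q₂ δ β) : (d.rep hW).cls.Forces p q γ β := by
  rw [Rep.forces_cls] at h' ⊢
  rw [map_whiskerLeft]
  exact WhiskerLeftData.force_repSq hp hq h h'

theorem forces_whiskerRight {c : Choices W} {A B D : C} {F₁ F₂ : Frac W A B} {G : Frac W B D}
    {r : Rep F₁ F₂} (d : WhiskerRightData r G (c F₁.f G.w G.mem) (c F₂.f G.w G.mem)) {E : Loc hW}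
    {e e' : E ⟶ ⟨A⟩} {y y' : E ⟶ ⟨B⟩} {x x' : E ⟶ ⟨D⟩} {p : (F₁.comp hW c G).Point hW e x}
    {p₁ : F₁.Point hW e y} {p₂ : G.Point hW y x} {q : (F₂.comp hW c G).Point hW e' x'}
    {q₁ : F₂.Point hW e' y'} {q₂ : G.Point hW y' x'} {γ : e ⟶ e'} {δ : y ⟶ y'} {β : x ⟶ x'}
    (hp : Consists p p₁ p₂) (hq : Consists q q₁ q₂) (h : r.cls.Forces p₁ q₁ γ δ)
    (h' : Over p₂ q₂ δ β) : (d.rep hW).cls.Forces p q γ β := by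
  rw [Rep.forces_cls] at h ⊢
  rw [map_whiskerRight]
  exact WhiskerRightData.force_repSq hp hq h h'

theorem forces_assoc {c : Choices W} {A B D X : C} {F : Frac W A B} {G : Frac W B D}
    {H : Frac W D X} (d : AssocDataC hW c F G H) {E : Loc hW} {e e' : E ⟶ ⟨A⟩} {m m' : E ⟶ ⟨B⟩}
    {y y' : E ⟶ ⟨D⟩} {x x' : E ⟶ ⟨X⟩} {p : ((F.comp hW c G).comp hW c H).Point hW e x}
    {p₁ : (F.comp hW c G).Point hW e y} {p₂ : H.Point hW y x} {p₁₁ : F.Point hW e m}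
    {p₁₂ : G.Point hW m y} {q : (F.comp hW c (G.comp hW c H)).Point hW e' x'}
    {q₁ : F.Point hW e' m'} {q₂ : (G.comp hW c H).Point hW m' x'} {q₂₁ : G.Point hW m' y'}
    {q₂₂ : H.Point hW y' x'} {γ : e ⟶ e'} {δ₁ : m ⟶ m'} {δ₂ : y ⟶ y'} {β : x ⟶ x'}
    (hp : Consists p p₁ p₂) (hp₁ : Consists p₁ p₁₁ p₁₂) (hq : Consists q q₁ q₂)
    (hq₂ : Consists q₂ q₂₁ q₂₂) (h₁ : Over p₁₁ q₁ γ δ₁) (h₂ : Over p₁₂ q₂₁ δ₁ δ₂)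
    (h₃ : Over p₂ q₂₂ δ₂ β) : (AssocDataC.rep d).cls.Forces p q γ β := by
  rw [Rep.forces_cls, map_assoc]
  exact AssocData.force_repSq hp hp₁ hq hq₂ h₁ h₂ h₃

theorem forces_id {A B : C} {F : Frac W A B} {E : Loc hW} {e e' : E ⟶ ⟨A⟩} {x x' : E ⟶ ⟨B⟩}
    {p : F.Point hW e x} {q : F.Point hW e' x'} {γ : e ⟶ e'} {β : x ⟶ x'} (h : Over p q γ β) :
    (Rep.id hW F).cls.Forces p q γ β := by
  rw [Rep.forces_cls]
  exact h.force_idSq Loc.strong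

/-- The argument of a point of an identity is isomorphic to its value. -/
noncomputable def Frac.Point.iso {A : C} {E : Loc hW} {e e' : E ⟶ ⟨A⟩} (p : (Frac.id hW A).Point hW e e') : e ≅ e' :=
  Pt.iso (hW := Loc.strong) p

theorem Frac.Point.over_iso {A : C} {E : Loc hW} {e₁ x₁ e₂ x₂ : E ⟶ ⟨A⟩}
    {p : (Frac.id hW A).Point hW e₁ x₁} {q : (Frac.id hW A).Point hW e₂ x₂} {γ : e₁ ⟶ e₂}
    {β : x₁ ⟶ x₂} (h : Over p q γ β) :
    β ≫ (Frac.Point.iso q).inv = (Frac.Point.iso p).inv ≫ γ := by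
  rw [Iso.comp_inv_eq, Category.assoc, Iso.eq_inv_comp]
  exact (Over.iso_comp (hW := Loc.strong) h).symm

theorem forces_leftUnitor {c : Choices W} {A B : C} {F : Frac W A B} {E : Loc hW}
    {e e' y : E ⟶ ⟨A⟩} {x x' : E ⟶ ⟨B⟩} {p : ((Frac.id hW A).comp hW c F).Point hW e x}
    {p₁ : (Frac.id hW A).Point hW e y} {p₂ : F.Point hW y x} {q : F.Point hW e' x'} {γ : e ⟶ e'}
    {β : x ⟶ x'} (hp : Consists p p₁ p₂) (h : Over p₂ q ((Frac.Point.iso p₁).inv ≫ γ) β) :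
    (Rep.leftUnitor hW c F).cls.Forces p q γ β := by
  have : (Rep.leftUnitor hW c F).map hW =
      Rep.leftUnitorSq (F := F.map hW) Loc.strong ((c (𝟙 A) F.w F.mem).map hW) := by
    have h1 : Loc.mapIso hW (Rep.leftUnitor hW c F).α = (Rep.leftUnitorSq (F := F.map hW) Loc.strong
        ((c (𝟙 A) F.w F.mem).map hW)).α := by
      ext
      exact Loc.map₂_comp hW _ _
    exact congrArg₂ (Rep.mk _ _ _ _) h1 rfl
  rw [Rep.forces_cls, this]
  exact force_leftUnitorSq hp h

theorem forces_rightUnitor {c : Choices W} {A B : C} {F : Frac W A B} {E : Loc hW}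
    {e e' : E ⟶ ⟨A⟩} {x x' y : E ⟶ ⟨B⟩} {p : (F.comp hW c (Frac.id hW B)).Point hW e x}
    {p₁ : F.Point hW e y} {p₂ : (Frac.id hW B).Point hW y x} {q : F.Point hW e' x'} {γ : e ⟶ e'}
    {δ : y ⟶ x'} (hp : Consists p p₁ p₂) (h : Over p₁ q γ δ) :
    (Rep.rightUnitor hW c F).cls.Forces p q γ ((Frac.Point.iso p₂).inv ≫ δ) := by
  have : (Rep.rightUnitor hW c F).map hW = Rep.rightUnitorSq (F := F.map hW) Loc.strong
      ((c F.f (𝟙 B) (hW.id_mem B)).map hW) := by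
    have h2 : Loc.map₂ hW (Rep.rightUnitor hW c F).β = (Rep.rightUnitorSq (F := F.map hW) Loc.strong
        ((c F.f (𝟙 B) (hW.id_mem B)).map hW)).β :=
      Loc.map₂_comp hW _ _
    exact congrArg₂ (Rep.mk _ _ _ _) rfl h2
  rw [Rep.forces_cls, this]
  exact force_rightUnitorSq hp h

end Semantics

/-! ### The operations, their values, and their independence of all data. -/

section Bicat

variable {C : Type u} [Bicategory.{w, v} C] {W : MorphismProperty C}

/-- The operations of the bicategory of fractions. -/
noncomputable def fracOps (hW : Bicalculus W) (c : Choices W) : Ops hW c where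
  id₂ F := (Rep.id hW F).cls
  vcomp Γ Θ := ((nonempty_vertData hW Γ.out Θ.out).some.rep hW).cls
  whiskerLeft F _ _ Γ := (WhiskerLeftData.rep hW
    (nonempty_whiskerLeftData hW F Γ.out (c _ _ _) (c _ _ _)).some).cls
  whiskerRight Γ G := (WhiskerRightData.rep hW
    (nonempty_whiskerRightData hW Γ.out G (c _ _ _) (c _ _ _)).some).cls
  associator F G H := (AssocDataC.rep (hW := hW) (c := c)
    (nonempty_assocData hW F G H (c _ _ _) (c (F.comp hW c G).f H.w H.mem) (c _ _ _)
      (c F.f (G.comp hW c H).w (G.comp hW c H).mem)).some).cls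
  leftUnitor F := (Rep.leftUnitor hW c F).cls
  rightUnitor F := (Rep.rightUnitor hW c F).cls

variable {hW : Bicalculus W} {c : Choices W}

theorem Rep.cls_out {A B : C} {F G : Frac W A B} (Γ : Hom₂ F G) : Rep.cls (Quot.out Γ) = Γ :=
  Quot.out_eq Γ

namespace Hom₂.Forces

theorem vcomp {A B : C} {F G H : Frac W A B} {Γ : Hom₂ F G} {Θ : Hom₂ G H}
    {E : Loc hW} {e e' e'' : E ⟶ ⟨A⟩} {x x' x'' : E ⟶ ⟨B⟩} {p : F.Point hW e x}
    {q : G.Point hW e' x'} {q' : H.Point hW e'' x''} {γ : e ⟶ e'} {β : x ⟶ x'} {γ' : e' ⟶ e''}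
    {β' : x' ⟶ x''} (h : Γ.Forces p q γ β) (h' : Θ.Forces q q' γ' β') :
    ((fracOps hW c).vcomp Γ Θ).Forces p q' (γ ≫ γ') (β ≫ β') := by
  rw [← Rep.cls_out Γ] at h
  rw [← Rep.cls_out Θ] at h'
  exact forces_vert _ h h'

theorem whiskerLeft {A B D : C} {F : Frac W A B} {G₁ G₂ : Frac W B D} {Γ : Hom₂ G₁ G₂} {E : Loc hW}
    {e e' : E ⟶ ⟨A⟩} {y y' : E ⟶ ⟨B⟩} {x x' : E ⟶ ⟨D⟩} {p : (F.comp hW c G₁).Point hW e x}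
    {p₁ : F.Point hW e y} {p₂ : G₁.Point hW y x} {q : (F.comp hW c G₂).Point hW e' x'}
    {q₁ : F.Point hW e' y'} {q₂ : G₂.Point hW y' x'} {γ : e ⟶ e'} {δ : y ⟶ y'} {β : x ⟶ x'}
    (hp : Consists p p₁ p₂) (hq : Consists q q₁ q₂) (h : Over p₁ q₁ γ δ)
    (h' : Γ.Forces p₂ q₂ δ β) : ((fracOps hW c).whiskerLeft F Γ).Forces p q γ β := by
  rw [← Rep.cls_out Γ] at h'
  exact forces_whiskerLeft _ hp hq h h'

theorem whiskerRight {A B D : C} {F₁ F₂ : Frac W A B} {G : Frac W B D}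
    {Γ : Hom₂ F₁ F₂} {E : Loc hW}
    {e e' : E ⟶ ⟨A⟩} {y y' : E ⟶ ⟨B⟩} {x x' : E ⟶ ⟨D⟩} {p : (F₁.comp hW c G).Point hW e x}
    {p₁ : F₁.Point hW e y} {p₂ : G.Point hW y x} {q : (F₂.comp hW c G).Point hW e' x'}
    {q₁ : F₂.Point hW e' y'} {q₂ : G.Point hW y' x'} {γ : e ⟶ e'} {δ : y ⟶ y'} {β : x ⟶ x'}
    (hp : Consists p p₁ p₂) (hq : Consists q q₁ q₂) (h : Γ.Forces p₁ q₁ γ δ)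
    (h' : Over p₂ q₂ δ β) : ((fracOps hW c).whiskerRight Γ G).Forces p q γ β := by
  rw [← Rep.cls_out Γ] at h
  exact forces_whiskerRight _ hp hq h h'

theorem associator {A B D X : C} {F : Frac W A B} {G : Frac W B D}
    {H : Frac W D X} {E : Loc hW} {e e' : E ⟶ ⟨A⟩} {m m' : E ⟶ ⟨B⟩}
    {y y' : E ⟶ ⟨D⟩} {x x' : E ⟶ ⟨X⟩} {p : ((F.comp hW c G).comp hW c H).Point hW e x}
    {p₁ : (F.comp hW c G).Point hW e y} {p₂ : H.Point hW y x} {p₁₁ : F.Point hW e m}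
    {p₁₂ : G.Point hW m y} {q : (F.comp hW c (G.comp hW c H)).Point hW e' x'}
    {q₁ : F.Point hW e' m'} {q₂ : (G.comp hW c H).Point hW m' x'} {q₂₁ : G.Point hW m' y'}
    {q₂₂ : H.Point hW y' x'} {γ : e ⟶ e'} {δ₁ : m ⟶ m'} {δ₂ : y ⟶ y'} {β : x ⟶ x'}
    (hp : Consists p p₁ p₂) (hp₁ : Consists p₁ p₁₁ p₁₂) (hq : Consists q q₁ q₂)
    (hq₂ : Consists q₂ q₂₁ q₂₂) (h₁ : Over p₁₁ q₁ γ δ₁) (h₂ : Over p₁₂ q₂₁ δ₁ δ₂)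
    (h₃ : Over p₂ q₂₂ δ₂ β) : ((fracOps hW c).associator F G H).Forces p q γ β :=
  forces_assoc _ hp hp₁ hq hq₂ h₁ h₂ h₃

end Hom₂.Forces

open Hom₂

theorem fracOps_id_vcomp {A B : C} {F G : Frac W A B} (Γ : Hom₂ F G) :
    (fracOps hW c).vcomp ((fracOps hW c).id₂ F) Γ = Γ := by
  obtain ⟨E, e, he, h⟩ := exists_points hW [F, G]
  obtain ⟨x, ⟨p⟩⟩ := h F (by simp)
  obtain ⟨y, ⟨q⟩⟩ := h G (by simp)
  obtain ⟨β, hβ⟩ := Forces.exists_of Γ p q (𝟙 e)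
  exact Forces.ext he ((forces_id (Over.refl p)).vcomp hβ) hβ

theorem fracOps_vcomp_id {A B : C} {F G : Frac W A B} (Γ : Hom₂ F G) :
    (fracOps hW c).vcomp Γ ((fracOps hW c).id₂ G) = Γ := by
  obtain ⟨E, e, he, h⟩ := exists_points hW [F, G]
  obtain ⟨x, ⟨p⟩⟩ := h F (by simp)
  obtain ⟨y, ⟨q⟩⟩ := h G (by simp)
  obtain ⟨β, hβ⟩ := Forces.exists_of Γ p q (𝟙 e)
  exact Forces.ext he (hβ.vcomp (forces_id (Over.refl q))) hβ

section

variable {A B : C} {F G : Frac W A B} {Γ : Hom₂ F G} {E : Loc hW} {e e' e'' : E ⟶ ⟨A⟩}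
    {x x' x'' : E ⟶ ⟨B⟩} {γ : e ⟶ e'} {β : x ⟶ x'} {γ' : e' ⟶ e''} {β' : x' ⟶ x''}

/-- A morphism of points is a value of the identity 2-morphism, so the unit law allows it to be
composed with any value. This changes the points at which a 2-morphism is evaluated. -/
theorem Over.comp_forces (c : Choices W) {p : F.Point hW e x} {q : F.Point hW e' x'}
    {q' : G.Point hW e'' x''} (h : Over p q γ β) (h' : Γ.Forces q q' γ' β') :
    Γ.Forces p q' (γ ≫ γ') (β ≫ β') := by
  rw [← fracOps_id_vcomp (hW := hW) (c := c) Γ]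
  exact (forces_id h).vcomp h'

theorem Hom₂.Forces.comp_over (c : Choices W) {p : F.Point hW e x} {q : G.Point hW e' x'}
    {q' : G.Point hW e'' x''} (h : Γ.Forces p q γ β) (h' : Over q q' γ' β') :
    Γ.Forces p q' (γ ≫ γ') (β ≫ β') := by
  rw [← fracOps_vcomp_id (hW := hW) (c := c) Γ]
  exact h.vcomp (forces_id h')

end

/-- The inverse is represented by the same data read backwards, and the inverse laws hold because
they hold for the values at one pair of points. -/
theorem fracOps_isInvertible {A B : C} {F G : Frac W A B} (r : Rep F G) [IsIso r.β] :
    (fracOps hW c).IsInvertible r.cls := by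
  obtain ⟨E, e, he, h⟩ := exists_points hW [F, G]
  obtain ⟨x, ⟨p⟩⟩ := h F (by simp)
  obtain ⟨y, ⟨q⟩⟩ := h G (by simp)
  obtain ⟨β, hβ⟩ := Force.exists_of Loc.strong (r.map hW) p q (𝟙 e)
  have hm : W (r.v₂ ≫ G.w) := hW.iso_mem r.α.symm r.mem
  obtain ⟨β', h1, h2, hβ'⟩ := hβ.symm Loc.strong (h := Loc.closure_map hm)
    (b := Loc.map₂ hW (inv r.β)) (by rw [← Loc.map₂_comp]; simp) (by rw [← Loc.map₂_comp]; simp)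
  have f : r.cls.Forces p q (𝟙 e) β := Rep.forces_cls.2 hβ
  have f' : (r.symm hm (inv r.β)).cls.Forces q p (𝟙 e) β' := Rep.forces_cls.2 hβ'
  exact ⟨_, Forces.ext he (f.vcomp f') (forces_id (Over.refl p)) h1,
    Forces.ext he (f'.vcomp f) (forces_id (Over.refl q)) h2⟩

/-- The operations are given by the recipes for any representatives and any auxiliary data. -/
theorem fracOps_isGivenByAnyData : (fracOps hW c).IsGivenByAnyData where
  id₂ _ := rfl
  leftUnitor _ := rfl
  rightUnitor _ := rfl
  vcomp {A B F G H} r s := by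
    -- The value law holds for arbitrary representatives and data, so the diagram chosen inside
    -- `fracOps` and the diagram of `d` have a common value and hence represent the same 2-morphism.
    refine ⟨nonempty_vertData hW r s, fun d => ?_⟩
    obtain ⟨E, e, he, h⟩ := exists_points hW [F, G, H]
    obtain ⟨x, ⟨p⟩⟩ := h F (by simp)
    obtain ⟨y, ⟨q⟩⟩ := h G (by simp)
    obtain ⟨z, ⟨q'⟩⟩ := h H (by simp)
    obtain ⟨β, hβ⟩ := Forces.exists_of r.cls p q (𝟙 e)
    obtain ⟨β', hβ'⟩ := Forces.exists_of s.cls q q' (𝟙 e)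
    exact Forces.ext he (hβ.vcomp hβ') (forces_vert d hβ hβ')
  whiskerLeft {A B D} F G₁ G₂ r := by
    refine ⟨nonempty_whiskerLeftData hW F r _ _, fun d => ?_⟩
    obtain ⟨E, e, he, h⟩ := exists_points hW [F.comp hW c G₁, F.comp hW c G₂]
    obtain ⟨x, ⟨p⟩⟩ := h (F.comp hW c G₁) (by simp)
    obtain ⟨y, ⟨q⟩⟩ := h (F.comp hW c G₂) (by simp)
    obtain ⟨_, p₁, p₂, hp⟩ := exists_consists p
    obtain ⟨_, q₁, q₂, hq⟩ := exists_consists q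
    obtain ⟨δ, hδ⟩ := Over.exists_of Loc.strong p₁ q₁ (𝟙 e)
    obtain ⟨β, hβ⟩ := Forces.exists_of r.cls p₂ q₂ δ
    exact Forces.ext he (hβ.whiskerLeft hp hq hδ) (forces_whiskerLeft d hp hq hδ hβ)
  whiskerRight {A B D F₁ F₂} r G := by
    refine ⟨nonempty_whiskerRightData hW r G _ _, fun d => ?_⟩
    obtain ⟨E, e, he, h⟩ := exists_points hW [F₁.comp hW c G, F₂.comp hW c G]
    obtain ⟨x, ⟨p⟩⟩ := h (F₁.comp hW c G) (by simp)
    obtain ⟨y, ⟨q⟩⟩ := h (F₂.comp hW c G) (by simp)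
    obtain ⟨_, p₁, p₂, hp⟩ := exists_consists p
    obtain ⟨_, q₁, q₂, hq⟩ := exists_consists q
    obtain ⟨δ, hδ⟩ := Forces.exists_of r.cls p₁ q₁ (𝟙 e)
    obtain ⟨β, hβ⟩ := Over.exists_of Loc.strong p₂ q₂ δ
    exact Forces.ext he (hδ.whiskerRight hp hq hβ) (forces_whiskerRight d hp hq hδ hβ)
  associator {A B D X} F G H := by
    refine ⟨nonempty_assocData hW F G H _ _ _ _, fun d => ?_⟩
    obtain ⟨E, e, he, h⟩ := exists_points hW
      [(F.comp hW c G).comp hW c H, F.comp hW c (G.comp hW c H)]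
    obtain ⟨x, ⟨p⟩⟩ := h ((F.comp hW c G).comp hW c H) (by simp)
    obtain ⟨y, ⟨q⟩⟩ := h (F.comp hW c (G.comp hW c H)) (by simp)
    obtain ⟨_, p₁, p₂, hp⟩ := exists_consists p
    obtain ⟨_, p₁₁, p₁₂, hp₁⟩ := exists_consists p₁
    obtain ⟨_, q₁, q₂, hq⟩ := exists_consists q
    obtain ⟨_, q₂₁, q₂₂, hq₂⟩ := exists_consists q₂
    obtain ⟨δ, hδ⟩ := Over.exists_of Loc.strong p₁₁ q₁ (𝟙 e)
    obtain ⟨δ', hδ'⟩ := Over.exists_of Loc.strong p₁₂ q₂₁ δ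
    obtain ⟨β, hβ⟩ := Over.exists_of Loc.strong p₂ q₂₂ δ'
    exact Forces.ext he (Forces.associator hp hp₁ hq hq₂ hδ hδ' hβ)
      (forces_assoc d hp hp₁ hq hq₂ hδ hδ' hβ)

/-- Operations given by some data are determined. -/
theorem Ops.IsGivenBySomeData.eq_of_any {S S' : Ops hW c} (h' : S'.IsGivenBySomeData)
    (h : S.IsGivenByAnyData) : S' = S := by
  have h₁ : @S'.id₂ = @S.id₂ := by
    funext A B F
    rw [h'.id₂, h.id₂]
  have h₂ : @S'.vcomp = @S.vcomp := by
    funext A B F G H Γ Θ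
    obtain ⟨r, s, d, rfl, rfl, e⟩ := h'.vcomp Γ Θ
    rw [e, (h.vcomp r s).2 d]
  have h₃ : @S'.whiskerLeft = @S.whiskerLeft := by
    funext A B D F G₁ G₂ Γ
    obtain ⟨r, d, rfl, e⟩ := h'.whiskerLeft F Γ
    rw [e, (h.whiskerLeft F r).2 d]
  have h₄ : @S'.whiskerRight = @S.whiskerRight := by
    funext A B D F₁ F₂ Γ G
    obtain ⟨r, d, rfl, e⟩ := h'.whiskerRight Γ G
    rw [e, (h.whiskerRight r G).2 d]
  have h₅ : @S'.associator = @S.associator := by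
    funext A B D E F G H
    obtain ⟨d, e⟩ := h'.associator F G H
    rw [e, (h.associator F G H).2 d]
  have h₆ : @S'.leftUnitor = @S.leftUnitor := by
    funext A B F
    rw [h'.leftUnitor, h.leftUnitor]
  have h₇ : @S'.rightUnitor = @S.rightUnitor := by
    funext A B F
    rw [h'.rightUnitor, h.rightUnitor]
  cases S
  cases S'
  simp only [Ops.mk.injEq]
  exact ⟨h₁, h₂, h₃, h₄, h₅, h₆, h₇⟩

end Bicat

/-! ### The axioms of a bicategory. -/

section Bicat

variable {C : Type u} [Bicategory.{w, v} C] {W : MorphismProperty C} {hW : Bicalculus W}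
  {c : Choices W}

open Hom₂

theorem Over.value_eq {A B : C} {F : Frac W A B} {E : Loc hW} {e e' : E ⟶ ⟨A⟩} {x x' : E ⟶ ⟨B⟩}
    {γ γ' : e ⟶ e'} {β β' : x ⟶ x'} {p : F.Point hW e x} {q : F.Point hW e' x'}
    (h : Over p q γ β) (h' : Over p q γ' β') (hγ : γ = γ' := by simp) : β = β' := by
  subst hγ
  exact h.unique Loc.strong h'

theorem exists_over {A B : C} {F : Frac W A B} {E : Loc hW} {e e' : E ⟶ ⟨A⟩} {x x' : E ⟶ ⟨B⟩}
    (p : F.Point hW e x) (q : F.Point hW e' x') (γ : e ⟶ e') : ∃ β, Over p q γ β :=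
  Over.exists_of Loc.strong p q γ

/-- The chain of morphisms between the components of points of `(F ≫ G) ≫ H` and `F ≫ G ≫ H`. -/
theorem exists_over₃ {A B D X : C} {F : Frac W A B} {G : Frac W B D} {H : Frac W D X}
    {E : Loc hW} {e e' : E ⟶ ⟨A⟩} {m m' : E ⟶ ⟨B⟩} {y y' : E ⟶ ⟨D⟩} {x x' : E ⟶ ⟨X⟩}
    (p₁ : F.Point hW e m) (p₂ : G.Point hW m y) (p₃ : H.Point hW y x) (q₁ : F.Point hW e' m')
    (q₂ : G.Point hW m' y') (q₃ : H.Point hW y' x') (γ : e ⟶ e') :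
    ∃ δ₁ δ₂ β, Over p₁ q₁ γ δ₁ ∧ Over p₂ q₂ δ₁ δ₂ ∧ Over p₃ q₃ δ₂ β := by
  obtain ⟨δ₁, h₁⟩ := exists_over p₁ q₁ γ
  obtain ⟨δ₂, h₂⟩ := exists_over p₂ q₂ δ₁
  obtain ⟨β, h₃⟩ := exists_over p₃ q₃ δ₂
  exact ⟨δ₁, δ₂, β, h₁, h₂, h₃⟩

theorem fracOps_vcomp_assoc {A B : C} {F G H K : Frac W A B} (Γ : Hom₂ F G) (Θ : Hom₂ G H)
    (Ψ : Hom₂ H K) : (fracOps hW c).vcomp ((fracOps hW c).vcomp Γ Θ) Ψ =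
      (fracOps hW c).vcomp Γ ((fracOps hW c).vcomp Θ Ψ) := by
  obtain ⟨E, e, he, h⟩ := exists_points hW [F, G, H, K]
  obtain ⟨_, ⟨p⟩⟩ := h F (by simp)
  obtain ⟨_, ⟨q⟩⟩ := h G (by simp)
  obtain ⟨_, ⟨r⟩⟩ := h H (by simp)
  obtain ⟨_, ⟨s⟩⟩ := h K (by simp)
  obtain ⟨_, h₁⟩ := Forces.exists_of Γ p q (𝟙 e)
  obtain ⟨_, h₂⟩ := Forces.exists_of Θ q r (𝟙 e)
  obtain ⟨_, h₃⟩ := Forces.exists_of Ψ r s (𝟙 e)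
  exact Forces.ext he ((h₁.vcomp h₂).vcomp h₃) (h₁.vcomp (h₂.vcomp h₃))

theorem fracOps_whiskerLeft_id {A B D : C} (F : Frac W A B) (G : Frac W B D) :
    (fracOps hW c).whiskerLeft F ((fracOps hW c).id₂ G) = (fracOps hW c).id₂ (F.comp hW c G) := by
  obtain ⟨E, e, he, h⟩ := exists_points hW [F.comp hW c G]
  obtain ⟨_, ⟨p⟩⟩ := h (F.comp hW c G) (by simp)
  obtain ⟨_, p₁, p₂, hp⟩ := exists_consists p
  exact Forces.ext he (Forces.whiskerLeft hp hp (Over.refl p₁) (forces_id (Over.refl p₂)))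
    (forces_id (Over.refl p))

theorem fracOps_id_whiskerRight {A B D : C} (F : Frac W A B) (G : Frac W B D) :
    (fracOps hW c).whiskerRight ((fracOps hW c).id₂ F) G = (fracOps hW c).id₂ (F.comp hW c G) := by
  obtain ⟨E, e, he, h⟩ := exists_points hW [F.comp hW c G]
  obtain ⟨_, ⟨p⟩⟩ := h (F.comp hW c G) (by simp)
  obtain ⟨_, p₁, p₂, hp⟩ := exists_consists p
  exact Forces.ext he (Forces.whiskerRight hp hp (forces_id (Over.refl p₁)) (Over.refl p₂))
    (forces_id (Over.refl p))

theorem fracOps_whiskerLeft_vcomp {A B D : C} (F : Frac W A B) {G H K : Frac W B D} (Γ : Hom₂ G H)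
    (Θ : Hom₂ H K) : (fracOps hW c).whiskerLeft F ((fracOps hW c).vcomp Γ Θ) =
      (fracOps hW c).vcomp ((fracOps hW c).whiskerLeft F Γ) ((fracOps hW c).whiskerLeft F Θ) := by
  obtain ⟨E, e, he, h⟩ := exists_points hW [F.comp hW c G, F.comp hW c H, F.comp hW c K]
  obtain ⟨_, ⟨p⟩⟩ := h (F.comp hW c G) (by simp)
  obtain ⟨_, ⟨q⟩⟩ := h (F.comp hW c H) (by simp)
  obtain ⟨_, ⟨r⟩⟩ := h (F.comp hW c K) (by simp)
  obtain ⟨_, p₁, p₂, hp⟩ := exists_consists p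
  obtain ⟨_, q₁, q₂, hq⟩ := exists_consists q
  obtain ⟨_, r₁, r₂, hr⟩ := exists_consists r
  obtain ⟨_, o₁⟩ := exists_over p₁ q₁ (𝟙 e)
  obtain ⟨_, o₂⟩ := exists_over q₁ r₁ (𝟙 e)
  obtain ⟨_, h₁⟩ := Forces.exists_of Γ p₂ q₂ _
  obtain ⟨_, h₂⟩ := Forces.exists_of Θ q₂ r₂ _
  exact Forces.ext he ((h₁.vcomp h₂).whiskerLeft hp hr (o₁.comp o₂))
    ((h₁.whiskerLeft hp hq o₁).vcomp (h₂.whiskerLeft hq hr o₂))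

theorem fracOps_vcomp_whiskerRight {A B D : C} {F G H : Frac W A B} (Γ : Hom₂ F G) (Θ : Hom₂ G H)
    (K : Frac W B D) : (fracOps hW c).whiskerRight ((fracOps hW c).vcomp Γ Θ) K =
      (fracOps hW c).vcomp ((fracOps hW c).whiskerRight Γ K) ((fracOps hW c).whiskerRight Θ K) := by
  obtain ⟨E, e, he, h⟩ := exists_points hW [F.comp hW c K, G.comp hW c K, H.comp hW c K]
  obtain ⟨_, ⟨p⟩⟩ := h (F.comp hW c K) (by simp)
  obtain ⟨_, ⟨q⟩⟩ := h (G.comp hW c K) (by simp)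
  obtain ⟨_, ⟨r⟩⟩ := h (H.comp hW c K) (by simp)
  obtain ⟨_, p₁, p₂, hp⟩ := exists_consists p
  obtain ⟨_, q₁, q₂, hq⟩ := exists_consists q
  obtain ⟨_, r₁, r₂, hr⟩ := exists_consists r
  obtain ⟨_, h₁⟩ := Forces.exists_of Γ p₁ q₁ (𝟙 e)
  obtain ⟨_, h₂⟩ := Forces.exists_of Θ q₁ r₁ (𝟙 e)
  obtain ⟨_, o₁⟩ := exists_over p₂ q₂ _
  obtain ⟨_, o₂⟩ := exists_over q₂ r₂ _
  exact Forces.ext he ((h₁.vcomp h₂).whiskerRight hp hr (o₁.comp o₂))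
    ((h₁.whiskerRight hp hq o₁).vcomp (h₂.whiskerRight hq hr o₂))

/-- Both sides send the second component of `p` to that of `r`, by `Θ` followed by a change of
points or conversely. These agree once the arguments do, and the arguments are two values of `Γ`
over the identity of `e`. -/
theorem fracOps_whisker_exchange {A B D : C} {F G : Frac W A B} {H K : Frac W B D} (Γ : Hom₂ F G)
    (Θ : Hom₂ H K) :
    (fracOps hW c).vcomp ((fracOps hW c).whiskerLeft F Θ) ((fracOps hW c).whiskerRight Γ K) =
      (fracOps hW c).vcomp ((fracOps hW c).whiskerRight Γ H) ((fracOps hW c).whiskerLeft G Θ) := by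
  obtain ⟨E, e, he, h⟩ := exists_points hW
    [F.comp hW c H, F.comp hW c K, G.comp hW c H, G.comp hW c K]
  obtain ⟨_, ⟨p⟩⟩ := h (F.comp hW c H) (by simp)
  obtain ⟨_, ⟨q⟩⟩ := h (F.comp hW c K) (by simp)
  obtain ⟨_, ⟨s⟩⟩ := h (G.comp hW c H) (by simp)
  obtain ⟨_, ⟨r⟩⟩ := h (G.comp hW c K) (by simp)
  obtain ⟨_, p₁, p₂, hp⟩ := exists_consists p
  obtain ⟨_, q₁, q₂, hq⟩ := exists_consists q
  obtain ⟨_, r₁, r₂, hr⟩ := exists_consists r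
  obtain ⟨_, s₁, s₂, hs⟩ := exists_consists s
  obtain ⟨_, o₁⟩ := exists_over p₁ q₁ (𝟙 e)
  obtain ⟨_, h₁⟩ := Forces.exists_of Θ p₂ q₂ _
  obtain ⟨_, h₂⟩ := Forces.exists_of Γ q₁ r₁ (𝟙 e)
  obtain ⟨_, o₂⟩ := exists_over q₂ r₂ _
  obtain ⟨_, h₃⟩ := Forces.exists_of Γ p₁ s₁ (𝟙 e)
  obtain ⟨_, o₃⟩ := exists_over p₂ s₂ _
  obtain ⟨_, o₄⟩ := exists_over s₁ r₁ (𝟙 e)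
  obtain ⟨_, h₄⟩ := Forces.exists_of Θ s₂ r₂ _
  exact Forces.ext he ((h₁.whiskerLeft hp hq o₁).vcomp (h₂.whiskerRight hq hr o₂))
    ((h₃.whiskerRight hp hs o₃).vcomp (h₄.whiskerLeft hs hr o₄))
    ((h₁.comp_over c o₂).unique (o₃.comp_forces c h₄)
      ((o₁.comp_forces c h₂).unique (h₃.comp_over c o₄)))

theorem fracOps_associator_natural_left {A B D X : C} {F F' : Frac W A B} (Γ : Hom₂ F F')
    (G : Frac W B D) (H : Frac W D X) :
    (fracOps hW c).vcomp ((fracOps hW c).whiskerRight ((fracOps hW c).whiskerRight Γ G) H)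
        ((fracOps hW c).associator F' G H) =
      (fracOps hW c).vcomp ((fracOps hW c).associator F G H)
        ((fracOps hW c).whiskerRight Γ (G.comp hW c H)) := by
  obtain ⟨E, e, he, h⟩ := exists_points hW
    [(F.comp hW c G).comp hW c H, (F'.comp hW c G).comp hW c H,
      F'.comp hW c (G.comp hW c H), F.comp hW c (G.comp hW c H)]
  obtain ⟨_, ⟨p⟩⟩ := h ((F.comp hW c G).comp hW c H) (by simp)
  obtain ⟨_, ⟨q⟩⟩ := h ((F'.comp hW c G).comp hW c H) (by simp)
  obtain ⟨_, ⟨r⟩⟩ := h (F'.comp hW c (G.comp hW c H)) (by simp)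
  obtain ⟨_, ⟨s⟩⟩ := h (F.comp hW c (G.comp hW c H)) (by simp)
  obtain ⟨_, p₁, p₂, hp⟩ := exists_consists p
  obtain ⟨_, p₁₁, p₁₂, hp₁⟩ := exists_consists p₁
  obtain ⟨_, q₁, q₂, hq⟩ := exists_consists q
  obtain ⟨_, q₁₁, q₁₂, hq₁⟩ := exists_consists q₁
  obtain ⟨_, r₁, r₂, hr⟩ := exists_consists r
  obtain ⟨_, r₂₁, r₂₂, hr₂⟩ := exists_consists r₂
  obtain ⟨_, s₁, s₂, hs⟩ := exists_consists s
  obtain ⟨_, s₂₁, s₂₂, hs₂⟩ := exists_consists s₂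
  obtain ⟨_, a₁⟩ := Forces.exists_of Γ p₁₁ q₁₁ (𝟙 e)
  obtain ⟨_, a₂⟩ := exists_over p₁₂ q₁₂ _
  obtain ⟨_, a₃⟩ := exists_over p₂ q₂ _
  obtain ⟨_, _, _, b₁, b₂, b₃⟩ := exists_over₃ q₁₁ q₁₂ q₂ r₁ r₂₁ r₂₂ (𝟙 e)
  obtain ⟨_, _, _, c₁, c₂, c₃⟩ := exists_over₃ p₁₁ p₁₂ p₂ s₁ s₂₁ s₂₂ (𝟙 e)
  obtain ⟨_, d₁⟩ := Forces.exists_of Γ s₁ r₁ (𝟙 e)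
  obtain ⟨_, d₂⟩ := exists_over s₂₁ r₂₁ _
  obtain ⟨_, d₃⟩ := exists_over s₂₂ r₂₂ _
  exact Forces.ext he
    (((a₁.whiskerRight hp₁ hq₁ a₂).whiskerRight hp hq a₃).vcomp
      (Forces.associator hq hq₁ hr hr₂ b₁ b₂ b₃))
    ((Forces.associator hp hp₁ hs hs₂ c₁ c₂ c₃).vcomp
      (d₁.whiskerRight hs hr (hs₂.over_comp hr₂ d₂ d₃)))
    -- Equality is obtained component by component: the values for `F` are the arguments for `G`,
    -- whose values are the arguments for `H`.
    ((a₃.comp b₃).value_eq (c₃.comp d₃) ((a₂.comp b₂).value_eq (c₂.comp d₂)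
      ((a₁.comp_over c b₁).unique (c₁.comp_forces c d₁))))

theorem fracOps_associator_natural_middle {A B D X : C} (F : Frac W A B) {G G' : Frac W B D}
    (Γ : Hom₂ G G') (H : Frac W D X) :
    (fracOps hW c).vcomp ((fracOps hW c).whiskerRight ((fracOps hW c).whiskerLeft F Γ) H)
        ((fracOps hW c).associator F G' H) =
      (fracOps hW c).vcomp ((fracOps hW c).associator F G H)
        ((fracOps hW c).whiskerLeft F ((fracOps hW c).whiskerRight Γ H)) := by
  obtain ⟨E, e, he, h⟩ := exists_points hW
    [(F.comp hW c G).comp hW c H, (F.comp hW c G').comp hW c H,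
      F.comp hW c (G'.comp hW c H), F.comp hW c (G.comp hW c H)]
  obtain ⟨_, ⟨p⟩⟩ := h ((F.comp hW c G).comp hW c H) (by simp)
  obtain ⟨_, ⟨q⟩⟩ := h ((F.comp hW c G').comp hW c H) (by simp)
  obtain ⟨_, ⟨r⟩⟩ := h (F.comp hW c (G'.comp hW c H)) (by simp)
  obtain ⟨_, ⟨s⟩⟩ := h (F.comp hW c (G.comp hW c H)) (by simp)
  obtain ⟨_, p₁, p₂, hp⟩ := exists_consists p
  obtain ⟨_, p₁₁, p₁₂, hp₁⟩ := exists_consists p₁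
  obtain ⟨_, q₁, q₂, hq⟩ := exists_consists q
  obtain ⟨_, q₁₁, q₁₂, hq₁⟩ := exists_consists q₁
  obtain ⟨_, r₁, r₂, hr⟩ := exists_consists r
  obtain ⟨_, r₂₁, r₂₂, hr₂⟩ := exists_consists r₂
  obtain ⟨_, s₁, s₂, hs⟩ := exists_consists s
  obtain ⟨_, s₂₁, s₂₂, hs₂⟩ := exists_consists s₂
  obtain ⟨_, a₁⟩ := exists_over p₁₁ q₁₁ (𝟙 e)
  obtain ⟨_, a₂⟩ := Forces.exists_of Γ p₁₂ q₁₂ _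
  obtain ⟨_, a₃⟩ := exists_over p₂ q₂ _
  obtain ⟨_, _, _, b₁, b₂, b₃⟩ := exists_over₃ q₁₁ q₁₂ q₂ r₁ r₂₁ r₂₂ (𝟙 e)
  obtain ⟨_, _, _, c₁, c₂, c₃⟩ := exists_over₃ p₁₁ p₁₂ p₂ s₁ s₂₁ s₂₂ (𝟙 e)
  obtain ⟨_, d₁⟩ := exists_over s₁ r₁ (𝟙 e)
  obtain ⟨_, d₂⟩ := Forces.exists_of Γ s₂₁ r₂₁ _
  obtain ⟨_, d₃⟩ := exists_over s₂₂ r₂₂ _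
  exact Forces.ext he
    (((a₂.whiskerLeft hp₁ hq₁ a₁).whiskerRight hp hq a₃).vcomp
      (Forces.associator hq hq₁ hr hr₂ b₁ b₂ b₃))
    ((Forces.associator hp hp₁ hs hs₂ c₁ c₂ c₃).vcomp
      ((d₂.whiskerRight hs₂ hr₂ d₃).whiskerLeft hs hr d₁))
    ((a₃.comp b₃).value_eq (c₃.comp d₃) ((a₂.comp_over c b₂).unique (c₂.comp_forces c d₂)
      ((a₁.comp b₁).value_eq (c₁.comp d₁))))

theorem fracOps_associator_natural_right {A B D X : C} (F : Frac W A B) (G : Frac W B D)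
    {H H' : Frac W D X} (Γ : Hom₂ H H') :
    (fracOps hW c).vcomp ((fracOps hW c).whiskerLeft (F.comp hW c G) Γ)
        ((fracOps hW c).associator F G H') =
      (fracOps hW c).vcomp ((fracOps hW c).associator F G H)
        ((fracOps hW c).whiskerLeft F ((fracOps hW c).whiskerLeft G Γ)) := by
  obtain ⟨E, e, he, h⟩ := exists_points hW
    [(F.comp hW c G).comp hW c H, (F.comp hW c G).comp hW c H',
      F.comp hW c (G.comp hW c H'), F.comp hW c (G.comp hW c H)]
  obtain ⟨_, ⟨p⟩⟩ := h ((F.comp hW c G).comp hW c H) (by simp)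
  obtain ⟨_, ⟨q⟩⟩ := h ((F.comp hW c G).comp hW c H') (by simp)
  obtain ⟨_, ⟨r⟩⟩ := h (F.comp hW c (G.comp hW c H')) (by simp)
  obtain ⟨_, ⟨s⟩⟩ := h (F.comp hW c (G.comp hW c H)) (by simp)
  obtain ⟨_, p₁, p₂, hp⟩ := exists_consists p
  obtain ⟨_, p₁₁, p₁₂, hp₁⟩ := exists_consists p₁
  obtain ⟨_, q₁, q₂, hq⟩ := exists_consists q
  obtain ⟨_, q₁₁, q₁₂, hq₁⟩ := exists_consists q₁
  obtain ⟨_, r₁, r₂, hr⟩ := exists_consists r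
  obtain ⟨_, r₂₁, r₂₂, hr₂⟩ := exists_consists r₂
  obtain ⟨_, s₁, s₂, hs⟩ := exists_consists s
  obtain ⟨_, s₂₁, s₂₂, hs₂⟩ := exists_consists s₂
  obtain ⟨_, a₁⟩ := exists_over p₁₁ q₁₁ (𝟙 e)
  obtain ⟨_, a₂⟩ := exists_over p₁₂ q₁₂ _
  obtain ⟨_, a₃⟩ := Forces.exists_of Γ p₂ q₂ _
  obtain ⟨_, _, _, b₁, b₂, b₃⟩ := exists_over₃ q₁₁ q₁₂ q₂ r₁ r₂₁ r₂₂ (𝟙 e)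
  obtain ⟨_, _, _, c₁, c₂, c₃⟩ := exists_over₃ p₁₁ p₁₂ p₂ s₁ s₂₁ s₂₂ (𝟙 e)
  obtain ⟨_, d₁⟩ := exists_over s₁ r₁ (𝟙 e)
  obtain ⟨_, d₂⟩ := exists_over s₂₁ r₂₁ _
  obtain ⟨_, d₃⟩ := Forces.exists_of Γ s₂₂ r₂₂ _
  exact Forces.ext he
    ((a₃.whiskerLeft hp hq (hp₁.over_comp hq₁ a₁ a₂)).vcomp
      (Forces.associator hq hq₁ hr hr₂ b₁ b₂ b₃))
    ((Forces.associator hp hp₁ hs hs₂ c₁ c₂ c₃).vcomp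
      ((d₃.whiskerLeft hs₂ hr₂ d₂).whiskerLeft hs hr d₁))
    ((a₃.comp_over c b₃).unique (c₃.comp_forces c d₃) ((a₂.comp b₂).value_eq (c₂.comp d₂)
      ((a₁.comp b₁).value_eq (c₁.comp d₁))))

theorem fracOps_leftUnitor_natural {A B : C} {F G : Frac W A B} (Γ : Hom₂ F G) :
    (fracOps hW c).vcomp ((fracOps hW c).whiskerLeft (Frac.id hW A) Γ)
        ((fracOps hW c).leftUnitor G) =
      (fracOps hW c).vcomp ((fracOps hW c).leftUnitor F) Γ := by
  obtain ⟨E, e, he, h⟩ := exists_points hW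
    [(Frac.id hW A).comp hW c F, (Frac.id hW A).comp hW c G, F, G]
  obtain ⟨_, ⟨p⟩⟩ := h ((Frac.id hW A).comp hW c F) (by simp)
  obtain ⟨_, ⟨q⟩⟩ := h ((Frac.id hW A).comp hW c G) (by simp)
  obtain ⟨_, ⟨r⟩⟩ := h G (by simp)
  obtain ⟨_, ⟨s⟩⟩ := h F (by simp)
  obtain ⟨_, p₁, p₂, hp⟩ := exists_consists p
  obtain ⟨_, q₁, q₂, hq⟩ := exists_consists q
  obtain ⟨_, a₁⟩ := exists_over p₁ q₁ (𝟙 e)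
  obtain ⟨_, a₂⟩ := Forces.exists_of Γ p₂ q₂ _
  obtain ⟨_, b⟩ := exists_over q₂ r (q₁.iso.inv ≫ 𝟙 e)
  obtain ⟨_, d⟩ := exists_over p₂ s (p₁.iso.inv ≫ 𝟙 e)
  obtain ⟨_, f⟩ := Forces.exists_of Γ s r (𝟙 e)
  refine Forces.ext he ((a₂.whiskerLeft hp hq a₁).vcomp (forces_leftUnitor hq b))
    ((forces_leftUnitor hp d).vcomp f)
    ((a₂.comp_over c b).unique (d.comp_forces c f) ?_)
  -- The arguments differ by the isomorphisms carried by the points of the identity, with which the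
  -- morphism of points `a₁` commutes.
  simpa using Frac.Point.over_iso a₁

theorem fracOps_rightUnitor_natural {A B : C} {F G : Frac W A B} (Γ : Hom₂ F G) :
    (fracOps hW c).vcomp ((fracOps hW c).whiskerRight Γ (Frac.id hW B))
        ((fracOps hW c).rightUnitor G) =
      (fracOps hW c).vcomp ((fracOps hW c).rightUnitor F) Γ := by
  obtain ⟨E, e, he, h⟩ := exists_points hW
    [F.comp hW c (Frac.id hW B), G.comp hW c (Frac.id hW B), F, G]
  obtain ⟨_, ⟨p⟩⟩ := h (F.comp hW c (Frac.id hW B)) (by simp)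
  obtain ⟨_, ⟨q⟩⟩ := h (G.comp hW c (Frac.id hW B)) (by simp)
  obtain ⟨_, ⟨r⟩⟩ := h G (by simp)
  obtain ⟨_, ⟨s⟩⟩ := h F (by simp)
  obtain ⟨_, p₁, p₂, hp⟩ := exists_consists p
  obtain ⟨_, q₁, q₂, hq⟩ := exists_consists q
  obtain ⟨_, a₁⟩ := Forces.exists_of Γ p₁ q₁ (𝟙 e)
  obtain ⟨_, a₂⟩ := exists_over p₂ q₂ _
  obtain ⟨_, b⟩ := exists_over q₁ r (𝟙 e)
  obtain ⟨_, d⟩ := exists_over p₁ s (𝟙 e)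
  obtain ⟨_, f⟩ := Forces.exists_of Γ s r (𝟙 e)
  refine Forces.ext he ((a₁.whiskerRight hp hq a₂).vcomp (forces_rightUnitor hq b))
    ((forces_rightUnitor hp d).vcomp f) ?_
  rw [reassoc_of% Frac.Point.over_iso a₂, (a₁.comp_over c b).unique (d.comp_forces c f),
    Category.assoc]

/-- Associators act on points only by morphisms between the points of `F`, `G`, `H`, `K`. On both
sides these are morphisms over the identity of `e`, so their composites agree for `F` and then
successively for the other factors. -/
theorem fracOps_pentagon {A B D X Y : C} (F : Frac W A B) (G : Frac W B D) (H : Frac W D X)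
    (K : Frac W X Y) :
    (fracOps hW c).vcomp ((fracOps hW c).whiskerRight ((fracOps hW c).associator F G H) K)
        ((fracOps hW c).vcomp ((fracOps hW c).associator F (G.comp hW c H) K)
          ((fracOps hW c).whiskerLeft F ((fracOps hW c).associator G H K))) =
      (fracOps hW c).vcomp ((fracOps hW c).associator (F.comp hW c G) H K)
        ((fracOps hW c).associator F G (H.comp hW c K)) := by
  obtain ⟨E, e, he, h⟩ := exists_points hW
    [((F.comp hW c G).comp hW c H).comp hW c K, (F.comp hW c (G.comp hW c H)).comp hW c K,
      F.comp hW c ((G.comp hW c H).comp hW c K), F.comp hW c (G.comp hW c (H.comp hW c K)),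
      (F.comp hW c G).comp hW c (H.comp hW c K)]
  obtain ⟨_, ⟨p⟩⟩ := h (((F.comp hW c G).comp hW c H).comp hW c K) (by simp)
  obtain ⟨_, p₁, k, hp⟩ := exists_consists p
  obtain ⟨_, p₁₁, l, hp₁⟩ := exists_consists p₁
  obtain ⟨_, f, g, hp₁₁⟩ := exists_consists p₁₁
  obtain ⟨_, ⟨q⟩⟩ := h ((F.comp hW c (G.comp hW c H)).comp hW c K) (by simp)
  obtain ⟨_, q₁, k', hq⟩ := exists_consists q
  obtain ⟨_, f', q₁₂, hq₁⟩ := exists_consists q₁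
  obtain ⟨_, g', l', hq₁₂⟩ := exists_consists q₁₂
  obtain ⟨_, ⟨r⟩⟩ := h (F.comp hW c ((G.comp hW c H).comp hW c K)) (by simp)
  obtain ⟨_, f'', r₂, hr⟩ := exists_consists r
  obtain ⟨_, r₂₁, k'', hr₂⟩ := exists_consists r₂
  obtain ⟨_, g'', l'', hr₂₁⟩ := exists_consists r₂₁
  obtain ⟨_, ⟨s⟩⟩ := h (F.comp hW c (G.comp hW c (H.comp hW c K))) (by simp)
  obtain ⟨_, f₃, s₂, hs⟩ := exists_consists s
  obtain ⟨_, g₃, s₂₂, hs₂⟩ := exists_consists s₂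
  obtain ⟨_, l₃, k₃, hs₂₂⟩ := exists_consists s₂₂
  obtain ⟨_, ⟨t⟩⟩ := h ((F.comp hW c G).comp hW c (H.comp hW c K)) (by simp)
  obtain ⟨_, t₁, t₂, ht⟩ := exists_consists t
  obtain ⟨_, f₄, g₄, ht₁⟩ := exists_consists t₁
  obtain ⟨_, l₄, k₄, ht₂⟩ := exists_consists t₂
  obtain ⟨_, _, _, af, ag, al⟩ := exists_over₃ f g l f' g' l' (𝟙 e)
  obtain ⟨_, ak⟩ := exists_over k k' _
  obtain ⟨_, _, _, bf, bg, bl⟩ := exists_over₃ f' g' l' f'' g'' l'' (𝟙 e)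
  obtain ⟨_, bk⟩ := exists_over k' k'' _
  obtain ⟨_, _, _, cf, cg, cl⟩ := exists_over₃ f'' g'' l'' f₃ g₃ l₃ (𝟙 e)
  obtain ⟨_, ck⟩ := exists_over k'' k₃ _
  obtain ⟨_, _, _, df, dg, dl⟩ := exists_over₃ f g l f₄ g₄ l₄ (𝟙 e)
  obtain ⟨_, dk⟩ := exists_over k k₄ _
  obtain ⟨_, _, _, ef, eg, el⟩ := exists_over₃ f₄ g₄ l₄ f₃ g₃ l₃ (𝟙 e)
  obtain ⟨_, ek⟩ := exists_over k₄ k₃ _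
  exact Forces.ext he
    (((Forces.associator hp₁ hp₁₁ hq₁ hq₁₂ af ag al).whiskerRight hp hq ak).vcomp
      ((Forces.associator hq hq₁ hr hr₂ bf (hq₁₂.over_comp hr₂₁ bg bl) bk).vcomp
        ((Forces.associator hr₂ hr₂₁ hs₂ hs₂₂ cg cl ck).whiskerLeft hr hs cf)))
    ((Forces.associator hp hp₁ ht ht₂ (hp₁₁.over_comp ht₁ df dg) dl dk).vcomp
      (Forces.associator ht ht₁ hs hs₂ ef eg (ht₂.over_comp hs₂₂ el ek)))
    ((ak.comp (bk.comp ck)).value_eq (dk.comp ek)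
      ((al.comp (bl.comp cl)).value_eq (dl.comp el)
        ((ag.comp (bg.comp cg)).value_eq (dg.comp eg)
          ((af.comp (bf.comp cf)).value_eq (df.comp ef)))))

theorem fracOps_triangle {A B D : C} (F : Frac W A B) (G : Frac W B D) :
    (fracOps hW c).vcomp ((fracOps hW c).associator F (Frac.id hW B) G)
        ((fracOps hW c).whiskerLeft F ((fracOps hW c).leftUnitor G)) =
      (fracOps hW c).whiskerRight ((fracOps hW c).rightUnitor F) G := by
  obtain ⟨E, e, he, h⟩ := exists_points hW [(F.comp hW c (Frac.id hW B)).comp hW c G,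
    F.comp hW c ((Frac.id hW B).comp hW c G), F.comp hW c G]
  obtain ⟨_, ⟨p⟩⟩ := h ((F.comp hW c (Frac.id hW B)).comp hW c G) (by simp)
  obtain ⟨_, ⟨q⟩⟩ := h (F.comp hW c ((Frac.id hW B).comp hW c G)) (by simp)
  obtain ⟨_, ⟨r⟩⟩ := h (F.comp hW c G) (by simp)
  obtain ⟨_, p₁, p₂, hp⟩ := exists_consists p
  obtain ⟨_, p₁₁, p₁₂, hp₁⟩ := exists_consists p₁
  obtain ⟨_, q₁, q₂, hq⟩ := exists_consists q
  obtain ⟨_, q₂₁, q₂₂, hq₂⟩ := exists_consists q₂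
  obtain ⟨_, r₁, r₂, hr⟩ := exists_consists r
  obtain ⟨_, _, _, a₁, a₂, a₃⟩ := exists_over₃ p₁₁ p₁₂ p₂ q₁ q₂₁ q₂₂ (𝟙 e)
  obtain ⟨β, b₁⟩ := exists_over q₁ r₁ (𝟙 e)
  obtain ⟨_, b₂⟩ := exists_over q₂₂ r₂ (q₂₁.iso.inv ≫ β)
  obtain ⟨_, c₁⟩ := exists_over p₁₁ r₁ (𝟙 e)
  obtain ⟨_, c₂⟩ := exists_over p₂ r₂ _
  refine Forces.ext he ((Forces.associator hp hp₁ hq hq₂ a₁ a₂ a₃).vcomp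
      (Forces.whiskerLeft hq hr b₁ (forces_leftUnitor hq₂ b₂)))
    (Forces.whiskerRight hp hr (forces_rightUnitor hp₁ c₁) c₂) ((a₃.comp b₂).value_eq c₂ ?_)
  -- The middle factor is an identity, so its points contribute only isomorphisms; these match on
  -- the two sides, leaving composites of morphisms of points of `F`.
  rw [reassoc_of% Frac.Point.over_iso a₂, (a₁.comp b₁).value_eq c₁]

theorem AssocData.isIso_β {A B D E : C} {F : Frac W A B} {G : Frac W B D} {H : Frac W D E}
    {s₁ : Square W F.f G.w} {s₂ : Square W (s₁.f' ≫ G.f) H.w} {s₃ : Square W G.f H.w}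
    {s₄ : Square W F.f (s₃.v' ≫ G.w)} (d : AssocData F G H s₁ s₂ s₃ s₄) : IsIso d.β := by
  simp only [AssocData.β, bicategoricalComp]
  infer_instance

/-- The operations satisfy the axioms of a bicategory. -/
theorem fracOps_isBicategory : (fracOps hW c).IsBicategory where
  id_vcomp := fracOps_id_vcomp
  vcomp_id := fracOps_vcomp_id
  vcomp_assoc := fracOps_vcomp_assoc
  whiskerLeft_id := fracOps_whiskerLeft_id
  whiskerLeft_vcomp := fracOps_whiskerLeft_vcomp
  id_whiskerRight := fracOps_id_whiskerRight
  vcomp_whiskerRight := fracOps_vcomp_whiskerRight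
  whisker_exchange := fracOps_whisker_exchange
  associator_invertible F G H := by
    obtain ⟨d⟩ := (fracOps_isGivenByAnyData.associator F G H).1
    rw [(fracOps_isGivenByAnyData.associator F G H).2 d]
    have : IsIso (AssocDataC.rep d).β := AssocData.isIso_β d
    exact fracOps_isInvertible _
  leftUnitor_invertible F := by
    have : IsIso (Rep.leftUnitor hW c F).β :=
      inferInstanceAs (IsIso (λ_ ((c (𝟙 _) F.w F.mem).f' ≫ F.f)).hom)
    exact fracOps_isInvertible (Rep.leftUnitor hW c F)
  rightUnitor_invertible F := by
    have : IsIso (Rep.rightUnitor hW c F).β :=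
      inferInstanceAs (IsIso ((λ_ ((c F.f (𝟙 _) (hW.id_mem _)).f' ≫ 𝟙 _)).hom ≫
        (c F.f (𝟙 _) (hW.id_mem _)).ρ.inv))
    exact fracOps_isInvertible (Rep.rightUnitor hW c F)
  associator_natural_left := fracOps_associator_natural_left
  associator_natural_middle := fracOps_associator_natural_middle
  associator_natural_right := fracOps_associator_natural_right
  leftUnitor_natural := fracOps_leftUnitor_natural
  rightUnitor_natural := fracOps_rightUnitor_natural
  pentagon := fracOps_pentagon
  triangle := fracOps_triangle

end Bicat

/-! ### The primitive relations on cells as graphs of the operations of `C`. -/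

section Inversion

variable {C : Type u} [Bicategory.{w, v} C] {W : MorphismProperty C} {A B D E : C} {m : Cell C}

namespace Symb

theorem holds_src_iff {f : A ⟶ B} : Holds W .src ![.one f, m] ↔ m = .obj A := by
  refine ⟨fun h => ?_, fun h => h ▸ .src₁ f⟩
  -- Replacing the tuple by a variable permits case analysis on the inductive relation; the
  -- equations between cells are recovered coordinate by coordinate from `hx`.
  generalize hx : ![.one f, m] = x at h
  cases h <;> cases congrFun hx 0
  exact congrFun hx 1

theorem holds_src₂_iff {f g : A ⟶ B} {η : f ⟶ g} : Holds W .src ![.two η, m] ↔ m = .one f := by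
  refine ⟨fun h => ?_, fun h => h ▸ .src₂ η⟩
  generalize hx : ![.two η, m] = x at h
  cases h <;> cases congrFun hx 0
  exact congrFun hx 1

theorem holds_id₁_iff : Holds W .id₁ ![.obj A, m] ↔ m = .one (𝟙 A) := by
  refine ⟨fun h => ?_, fun h => h ▸ .id₁ A⟩
  generalize hx : ![.obj A, m] = x at h
  cases h
  cases congrFun hx 0
  exact congrFun hx 1

theorem holds_comp_iff {f : A ⟶ B} {g : B ⟶ D} :
    Holds W .comp ![.one f, .one g, m] ↔ m = .one (f ≫ g) := by
  refine ⟨fun h => ?_, fun h => h ▸ .comp f g⟩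
  generalize hx : ![.one f, .one g, m] = x at h
  cases h
  cases congrFun hx 0
  cases congrFun hx 1
  exact congrFun hx 2

theorem holds_id₂_iff {f : A ⟶ B} : Holds W .id₂ ![.one f, m] ↔ m = .two (𝟙 f) := by
  refine ⟨fun h => ?_, fun h => h ▸ .id₂ f⟩
  generalize hx : ![.one f, m] = x at h
  cases h
  cases congrFun hx 0
  exact congrFun hx 1

theorem holds_vcomp_iff {f g h : A ⟶ B} {η : f ⟶ g} {θ : g ⟶ h} :
    Holds W .vcomp ![.two η, .two θ, m] ↔ m = .two (η ≫ θ) := by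
  refine ⟨fun h => ?_, fun h => h ▸ .vcomp η θ⟩
  generalize hx : ![.two η, .two θ, m] = x at h
  cases h
  cases congrFun hx 0
  cases congrFun hx 1
  exact congrFun hx 2

theorem holds_whiskerLeft_iff {f : A ⟶ B} {g h : B ⟶ D} {η : g ⟶ h} :
    Holds W .whiskerLeft ![.one f, .two η, m] ↔ m = .two (f ◁ η) := by
  refine ⟨fun h => ?_, fun h => h ▸ .whiskerLeft f η⟩
  generalize hx : ![.one f, .two η, m] = x at h
  cases h
  cases congrFun hx 0
  cases congrFun hx 1
  exact congrFun hx 2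

theorem holds_whiskerRight_iff {f g : A ⟶ B} {η : f ⟶ g} {h : B ⟶ D} :
    Holds W .whiskerRight ![.two η, .one h, m] ↔ m = .two (η ▷ h) := by
  refine ⟨fun h => ?_, fun e => e ▸ .whiskerRight η h⟩
  generalize hx : ![.two η, .one _, m] = x at h
  cases h
  cases congrFun hx 0
  cases congrFun hx 1
  exact congrFun hx 2

theorem holds_associator_iff {f : A ⟶ B} {g : B ⟶ D} {h : D ⟶ E} :
    Holds W .associator ![.one f, .one g, .one h, m] ↔ m = .two (α_ f g h).hom := by
  refine ⟨fun h => ?_, fun e => e ▸ .associator f g h⟩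
  generalize hx : ![.one f, .one g, .one _, m] = x at h
  cases h
  cases congrFun hx 0
  cases congrFun hx 1
  cases congrFun hx 2
  exact congrFun hx 3

theorem holds_leftUnitor_iff {f : A ⟶ B} :
    Holds W .leftUnitor ![.one f, m] ↔ m = .two (λ_ f).hom := by
  refine ⟨fun h => ?_, fun h => h ▸ .leftUnitor f⟩
  generalize hx : ![.one f, m] = x at h
  cases h
  cases congrFun hx 0
  exact congrFun hx 1

theorem holds_inW_iff {f : A ⟶ B} : Holds W .inW ![.one f] ↔ W f := by
  refine ⟨fun h => ?_, fun h => .inW f h⟩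
  generalize hx : ![Cell.one f] = x at h
  cases h
  cases congrFun hx 0
  assumption

theorem exists_obj_iff : (∃ n, Holds W .id₁ ![m, n]) ↔ ∃ A : C, m = .obj A := by
  refine ⟨?_, ?_⟩
  · rintro ⟨n, h⟩
    generalize hx : ![m, n] = x at h
    cases h
    exact ⟨_, congrFun hx 0⟩
  · rintro ⟨A, rfl⟩
    exact ⟨_, .id₁ A⟩

/-- Source and target are relations on 1-cells and on 2-cells alike. That the endpoints are objects
excludes 2-cells. -/
theorem exists_one_iff :
    (Holds W .src ![m, .obj A] ∧ Holds W .tgt ![m, .obj B]) ↔ ∃ f : A ⟶ B, m = .one f := by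
  refine ⟨?_, ?_⟩
  · rintro ⟨h, h'⟩
    generalize hx : ![m, .obj A] = x at h
    cases h <;> cases congrFun hx 1
    cases (show m = _ from congrFun hx 0)
    generalize hx : ![_, Cell.obj B] = x at h'
    cases h' <;> cases congrFun hx 1
    cases congrFun hx 0
    exact ⟨_, rfl⟩
  · rintro ⟨f, rfl⟩
    exact ⟨.src₁ f, .tgt₁ f⟩

theorem exists_two_iff {f g : A ⟶ B} :
    (Holds W .src ![m, .one f] ∧ Holds W .tgt ![m, .one g]) ↔ ∃ η : f ⟶ g, m = .two η := by
  refine ⟨?_, ?_⟩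
  · rintro ⟨h, h'⟩
    generalize hx : ![m, .one f] = x at h
    cases h <;> cases congrFun hx 1
    cases (show m = _ from congrFun hx 0)
    generalize hx : ![_, Cell.one g] = x at h'
    cases h' <;> cases congrFun hx 1
    cases congrFun hx 0
    exact ⟨_, rfl⟩
  · rintro ⟨η, rfl⟩
    exact ⟨.src₂ η, .tgt₂ η⟩

theorem holds_vcomp_right {f g h : A ⟶ B} {η : f ⟶ g} {θ : f ⟶ h}
    (H : Holds W .vcomp ![.two η, m, .two θ]) : ∃ χ : g ⟶ h, m = .two χ ∧ η ≫ χ = θ := by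
  generalize hx : ![.two η, m, .two θ] = x at H
  cases H
  cases congrFun hx 0
  cases (show m = _ from congrFun hx 1)
  cases congrFun hx 2
  exact ⟨_, rfl, rfl⟩

/-- Inverses are not primitive. The inverse of an invertible cell is its unique right factor to the
identity of its source. -/
theorem holds_inv_iff {f g : A ⟶ B} (η : f ≅ g) :
    (∃ k i, Holds W .src ![.two η.hom, k] ∧ Holds W .id₂ ![k, i] ∧
      Holds W .vcomp ![.two η.hom, m, i]) ↔ m = .two η.inv := by
  refine ⟨?_, ?_⟩
  · rintro ⟨k, i, h₁, h₂, h₃⟩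
    obtain rfl := holds_src₂_iff.1 h₁
    obtain rfl := holds_id₂_iff.1 h₂
    obtain ⟨χ, rfl, h⟩ := holds_vcomp_right h₃
    rw [show χ = η.inv by rw [← cancel_epi η.hom, h, η.hom_inv_id]]
  · rintro rfl
    refine ⟨_, _, .src₂ _, .id₂ _, ?_⟩
    rw [holds_vcomp_iff, η.hom_inv_id]

theorem exists_iso_iff {f g : A ⟶ B} :
    ((Holds W .src ![m, .one f] ∧ Holds W .tgt ![m, .one g]) ∧ ∃ n i j, Holds W .id₂ ![.one f, i] ∧
      Holds W .id₂ ![.one g, j] ∧ Holds W .vcomp ![m, n, i] ∧ Holds W .vcomp ![n, m, j]) ↔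
      ∃ η : f ≅ g, m = .two η.hom := by
  rw [exists_two_iff]
  refine ⟨?_, ?_⟩
  · rintro ⟨⟨η, rfl⟩, n, i, j, h₁, h₂, h₃, h₄⟩
    obtain rfl := holds_id₂_iff.1 h₁
    obtain rfl := holds_id₂_iff.1 h₂
    obtain ⟨χ, rfl, h⟩ := holds_vcomp_right h₃
    have h' := holds_vcomp_iff.1 h₄
    simp only [Cell.two.injEq, heq_eq_eq, true_and] at h'
    exact ⟨⟨η, χ, h, h'.symm⟩, rfl⟩
  · rintro ⟨η, rfl⟩
    refine ⟨⟨_, rfl⟩, .two η.inv, _, _, .id₂ _, .id₂ _, ?_, ?_⟩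
    · rw [holds_vcomp_iff, η.hom_inv_id]
    · rw [holds_vcomp_iff, η.inv_hom_id]

end Symb

/-- The graph of a set of choices. -/
def Choices.Graph (c : Choices W) (x : Fin 5 → Cell C) : Prop :=
  ∃ (A' B B' : C) (f : A' ⟶ B) (v : B' ⟶ B) (h : W v),
    x = ![.one f, .one v, .one (c f v h).v', .one (c f v h).f', .two (c f v h).ρ.hom]

theorem Choices.graph_iff (c : Choices W) {f : A ⟶ B} {v : D ⟶ B} (h : W v) {m₁ m₂ m₃ : Cell C} :
    c.Graph ![.one f, .one v, m₁, m₂, m₃] ↔ m₁ = .one (c f v h).v' ∧ m₂ = .one (c f v h).f' ∧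
      m₃ = .two (c f v h).ρ.hom := by
  refine ⟨?_, ?_⟩
  · rintro ⟨A', B, B', f, v, h, hx⟩
    cases congrFun hx 0
    cases congrFun hx 1
    exact ⟨congrFun hx 2, congrFun hx 3, congrFun hx 4⟩
  · rintro ⟨rfl, rfl, rfl⟩
    exact ⟨_, _, _, f, v, h, rfl⟩

end Inversion

/-! ### Quantification and substitution in first-order formulas. -/

section Formulas

open FirstOrder Language

variable {L : FirstOrder.Language.{0, 0}} {α : Type} {M : Type*} [L.Structure M]

/-- Extension of a valuation of variables by the value of one more variable. -/
def push (m : M) (x : α → M) : Option α → M := fun o => o.elim m x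

/-- The formula `∃ m, φ`, where `m` is the variable `none`. -/
noncomputable def exFormula (φ : L.Formula (Option α)) : L.Formula α :=
  (φ.relabel fun o => o.elim (Sum.inr ()) Sum.inl).iExs Unit

theorem realize_exFormula {φ : L.Formula (Option α)} {x : α → M} :
    (exFormula φ).Realize x ↔ ∃ m, φ.Realize (push m x) := by
  rw [exFormula, Formula.realize_iExs]
  simp only [Formula.realize_relabel]
  have key : ∀ i : Unit → M, (Sum.elim x i ∘ fun o : Option α => o.elim (Sum.inr ()) Sum.inl) =
      push (i ()) x := fun i => by
    funext o
    cases o <;> rfl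
  simp only [key]
  exact ⟨fun ⟨i, h⟩ => ⟨_, h⟩, fun ⟨m, h⟩ => ⟨fun _ => m, h⟩⟩

/-- The formula obtained by inserting elements defined by `ψ` into `R`. -/
noncomputable def substFormula {ι : Type} [Finite ι] (R : L.Formula ι)
    (ψ : ι → L.Formula (Option α)) : L.Formula α :=
  ((Formula.iInf fun i => (ψ i).relabel fun o => o.elim (Sum.inr i) Sum.inl) ⊓
    R.relabel Sum.inr).iExs ι

/-- Each `ψ i` has `y i` as its only solution, so quantifying existentially over all solutions
amounts to evaluation at `y`. -/
theorem realize_substFormula {ι : Type} [Finite ι] {R : L.Formula ι} {ψ : ι → L.Formula (Option α)}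
    {x : α → M} {y : ι → M} (h : ∀ i m, (ψ i).Realize (push m x) ↔ m = y i) :
    (substFormula R ψ).Realize x ↔ R.Realize y := by
  rw [substFormula, Formula.realize_iExs]
  simp only [Formula.realize_relabel, Formula.realize_inf, Formula.realize_iInf]
  have key : ∀ (i : ι) (z : ι → M),
      (Sum.elim x z ∘ fun o : Option α => o.elim (Sum.inr i) Sum.inl) = push (z i) x := fun i z => by
    funext o
    cases o <;> rfl
  simp only [key, h]
  constructor
  · rintro ⟨z, hz, h⟩
    rwa [show y = z from funext fun i => (hz i).symm]
  · exact fun h => ⟨y, fun _ => rfl, h⟩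

/-- The formula, with the additional variable `none`, obtained by inserting elements defined by `ψ`
into `R`. -/
noncomputable def substRel {n : ℕ} (R : L.Formula (Option (Fin n)))
    (ψ : Fin n → L.Formula (Option α)) : L.Formula (Option α) :=
  ((Formula.iInf fun i => (ψ i).relabel fun o => o.elim (Sum.inr i) (Sum.inl ∘ some)) ⊓
    R.relabel fun o => o.elim (Sum.inl none) Sum.inr).iExs (Fin n)

theorem realize_substRel {n : ℕ} {R : L.Formula (Option (Fin n))}
    {ψ : Fin n → L.Formula (Option α)} {x : α → M} {y : Fin n → M}
    (h : ∀ i m, (ψ i).Realize (push m x) ↔ m = y i) (m : M) :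
    (substRel R ψ).Realize (push m x) ↔ R.Realize (push m y) := by
  rw [substRel, Formula.realize_iExs]
  simp only [Formula.realize_relabel, Formula.realize_inf, Formula.realize_iInf]
  have key : ∀ (i : Fin n) (z : Fin n → M),
      (Sum.elim (push m x) z ∘ fun o : Option α => o.elim (Sum.inr i) (Sum.inl ∘ some)) =
        push (z i) x := fun i z => by
    funext o
    cases o <;> rfl
  have key' : ∀ z : Fin n → M,
      (Sum.elim (push m x) z ∘ fun o : Option (Fin n) => o.elim (Sum.inl none) Sum.inr) =
        push m z := fun z => by
    funext o
    cases o <;> rfl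
  simp only [key, key', h]
  constructor
  · rintro ⟨z, hz, h⟩
    rwa [show y = z from funext fun i => (hz i).symm]
  · exact fun h => ⟨y, fun _ => rfl, h⟩

theorem comp_vec₁ {β γ : Type*} (f : β → γ) (a : β) : f ∘ ![a] = ![f a] := by
  funext i; fin_cases i; rfl

theorem comp_vec₂ {β γ : Type*} (f : β → γ) (a b : β) : f ∘ ![a, b] = ![f a, f b] := by
  funext i; fin_cases i <;> rfl

theorem comp_vec₃ {β γ : Type*} (f : β → γ) (a b c : β) :
    f ∘ ![a, b, c] = ![f a, f b, f c] := by
  funext i; fin_cases i <;> rfl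

theorem comp_vec₄ {β γ : Type*} (f : β → γ) (a b c d : β) :
    f ∘ ![a, b, c, d] = ![f a, f b, f c, f d] := by
  funext i; fin_cases i <;> rfl

theorem comp_vec₅ {β γ : Type*} (f : β → γ) (a b c d e : β) :
    f ∘ ![a, b, c, d, e] = ![f a, f b, f c, f d, f e] := by
  funext i; fin_cases i <;> rfl

end Formulas

/-! ### Formulas defining cells. -/

section Definability

open FirstOrder Language

/-- Formulas for the primitive notions of a bicategory with a class of 1-morphisms and a set of
choices, in a language `L`. -/
structure Interp (L : FirstOrder.Language.{0, 0}) where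
  rel : ∀ {n : ℕ}, Symb n → L.Formula (Fin n)
  choice : L.Formula (Fin 5)

variable {L : FirstOrder.Language.{0, 0}} (T : Interp L) {C : Type u} [Bicategory.{w, v} C]
  {W : MorphismProperty C} (c : Choices W) [L.Structure (Cell C)] {α : Type}

/-- In the cells of `C`, the formulas `T` have the intended meaning. -/
class Interp.Models : Prop where
  rel : ∀ {n : ℕ} (s : Symb n) (x : Fin n → Cell C), (T.rel s).Realize x ↔ s.Holds W x
  choice : ∀ x : Fin 5 → Cell C, T.choice.Realize x ↔ c.Graph x

/-- The valuation `x'` extends `x` by the value `z` of the variable `none`. -/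
class Extends (x' : Option α → Cell C) (z : outParam (Cell C)) (x : outParam (α → Cell C)) :
    Prop where
  eq : x' = push z x

/-- The cell `y` is the value of the variable `i`. -/
class IsVar (x : α → Cell C) (y : Cell C) (i : outParam α) : Prop where
  eq : x i = y

/-- The priorities make the search try the most recent variable first and pass to older ones last.
-/
instance (priority := 900) IsVar.head {x' : Option α → Cell C} {z : Cell C} {x : α → Cell C}
    [h : Extends x' z x] : IsVar x' z none := ⟨by rw [h.eq]; rfl⟩

instance (priority := 100) IsVar.tail {x' : Option α → Cell C} {y z : Cell C} {x : α → Cell C}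
    [h : Extends x' z x] {i : α} [h' : IsVar x y i] : IsVar x' y (some i) :=
  ⟨by rw [h.eq]; exact h'.eq⟩

instance (priority := 200) IsVar.base (x : α → Cell C) (i : α) : IsVar x (x i) i := ⟨rfl⟩

/-- The formula `ψ` defines the cell `y` in terms of the cells `x`. -/
class Elt (T : Interp L) {C : Type u} [Bicategory.{w, v} C] {W : MorphismProperty C}
    (_c : Choices W) [L.Structure (Cell C)] {α : Type} (x : α → Cell C) (y : Cell C) (ψ : outParam (L.Formula (Option α))) : Prop where
  spec : ∀ m, ψ.Realize (push m x) ↔ m = y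

variable {T c}

theorem Elt.of_substRel {n : ℕ} {R : L.Formula (Option (Fin n))} {x : α → Cell C} {y : Cell C}
    {z : Fin n → Cell C} {ψ : Fin n → L.Formula (Option α)} (h : ∀ i, Elt T c x (z i) (ψ i))
    (hR : ∀ m, R.Realize (push m z) ↔ m = y) : Elt T c x y (substRel R ψ) :=
  ⟨fun m => (realize_substRel (fun i => (h i).spec) m).trans (hR m)⟩

variable {x : α → Cell C}

theorem Interp.Models.realize₂ (hT : T.Models c) (s : Symb 2) {β : Type} {y : β → Cell C} {i j : β} :
    ((T.rel s).relabel ![i, j]).Realize y ↔ s.Holds W ![y i, y j] := by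
  rw [Formula.realize_relabel, comp_vec₂, hT.rel]

theorem Interp.Models.realize₃ (hT : T.Models c) (s : Symb 3) {β : Type} {y : β → Cell C} {i j k : β} :
    ((T.rel s).relabel ![i, j, k]).Realize y ↔ s.Holds W ![y i, y j, y k] := by
  rw [Formula.realize_relabel, comp_vec₃, hT.rel]

theorem Interp.Models.realize₄ (hT : T.Models c) (s : Symb 4) {β : Type} {y : β → Cell C} {i j k l : β} :
    ((T.rel s).relabel ![i, j, k, l]).Realize y ↔ s.Holds W ![y i, y j, y k, y l] := by
  rw [Formula.realize_relabel, comp_vec₄, hT.rel]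

theorem Interp.Models.realize_choice (hT : T.Models c) {β : Type} {y : β → Cell C} {i j k l m : β} :
    (T.choice.relabel ![i, j, k, l, m]).Realize y ↔ c.Graph ![y i, y j, y k, y l, y m] := by
  rw [Formula.realize_relabel, comp_vec₅, hT.choice]

namespace Elt

variable {y y₁ y₂ y₃ : Cell C} {ψ ψ₁ ψ₂ ψ₃ : L.Formula (Option α)}

theorem of_unary (hT : T.Models c) (s : Symb 2) (h : Elt T c x y₁ ψ) (hs : ∀ m, s.Holds W ![y₁, m] ↔ m = y) :
    Elt T c x y (substRel ((T.rel s).relabel ![some 0, none]) ![ψ]) := by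
  refine of_substRel (z := ![y₁]) (Fin.forall_fin_one.2 h) fun m => ?_
  rw [hT.realize₂]
  exact hs m

theorem of_binary (hT : T.Models c) (s : Symb 3) (h₁ : Elt T c x y₁ ψ₁) (h₂ : Elt T c x y₂ ψ₂)
    (hs : ∀ m, s.Holds W ![y₁, y₂, m] ↔ m = y) :
    Elt T c x y (substRel ((T.rel s).relabel ![some 0, some 1, none]) ![ψ₁, ψ₂]) := by
  refine of_substRel (z := ![y₁, y₂]) (Fin.forall_fin_two.2 ⟨h₁, h₂⟩) fun m => ?_
  rw [hT.realize₃]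
  exact hs m

theorem of_ternary (hT : T.Models c) (s : Symb 4) (h₁ : Elt T c x y₁ ψ₁) (h₂ : Elt T c x y₂ ψ₂) (h₃ : Elt T c x y₃ ψ₃)
    (hs : ∀ m, s.Holds W ![y₁, y₂, y₃, m] ↔ m = y) :
    Elt T c x y (substRel ((T.rel s).relabel ![some 0, some 1, some 2, none]) ![ψ₁, ψ₂, ψ₃]) := by
  refine of_substRel (z := ![y₁, y₂, y₃]) (Fin.forall_fin_succ.2 ⟨h₁, Fin.forall_fin_two.2 ⟨h₂, h₃⟩⟩)
    fun m => ?_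
  rw [hT.realize₄]
  exact hs m

theorem lift {x' : Option α → Cell C} {z : Cell C} (h : Elt T c x y ψ) (h' : Extends x' z x) :
    Elt T c x' y (ψ.relabel (Option.map some)) := ⟨fun m => by
  rw [Formula.realize_relabel, ← h.spec, h'.eq]
  have : push m (push z x) ∘ Option.map some = push m x := by
    funext o
    cases o <;> rfl
  rw [this]⟩

instance (priority := 100) of_isVar (i : α) [h : IsVar x y i] :
    Elt T c x y (Term.equal (Term.var none) (Term.var (some i)) : L.Formula _) :=
  ⟨fun m => by simp [Term.equal, Formula.Realize, push, h.eq]⟩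

section

variable [hT : T.Models c] {A B D E : C} {χ ω : L.Formula (Option α)}

/-- The instances from here on compute a defining formula from the way a cell is composed. The
formula is an output of the search and involves only `T` and positions of variables. -/
instance id₁ [h : Elt T c x (.obj A) ψ] :
    Elt T c x (.one (𝟙 A)) (substRel ((T.rel .id₁).relabel ![some 0, none]) ![ψ]) :=
  of_unary hT .id₁ h fun _ => Symb.holds_id₁_iff

instance comp {f : A ⟶ B} {g : B ⟶ D} [h : Elt T c x (.one f) ψ] [h' : Elt T c x (.one g) χ] :
    Elt T c x (.one (f ≫ g)) (substRel ((T.rel .comp).relabel ![some 0, some 1, none]) ![ψ, χ]) :=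
  of_binary hT .comp h h' fun _ => Symb.holds_comp_iff

instance id₂ {f : A ⟶ B} [h : Elt T c x (.one f) ψ] :
    Elt T c x (.two (𝟙 f)) (substRel ((T.rel .id₂).relabel ![some 0, none]) ![ψ]) :=
  of_unary hT .id₂ h fun _ => Symb.holds_id₂_iff

instance vcomp {f g k : A ⟶ B} {η : f ⟶ g} {θ : g ⟶ k} [h : Elt T c x (.two η) ψ]
    [h' : Elt T c x (.two θ) χ] :
    Elt T c x (.two (η ≫ θ)) (substRel ((T.rel .vcomp).relabel ![some 0, some 1, none]) ![ψ, χ]) :=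
  of_binary hT .vcomp h h' fun _ => Symb.holds_vcomp_iff

instance whiskerLeft {f : A ⟶ B} {g k : B ⟶ D} {η : g ⟶ k} [h : Elt T c x (.one f) ψ]
    [h' : Elt T c x (.two η) χ] : Elt T c x (.two (f ◁ η))
      (substRel ((T.rel .whiskerLeft).relabel ![some 0, some 1, none]) ![ψ, χ]) :=
  of_binary hT .whiskerLeft h h' fun _ => Symb.holds_whiskerLeft_iff

instance whiskerRight {f g : A ⟶ B} {η : f ⟶ g} {k : B ⟶ D} [h : Elt T c x (.two η) ψ]
    [h' : Elt T c x (.one k) χ] : Elt T c x (.two (η ▷ k))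
      (substRel ((T.rel .whiskerRight).relabel ![some 0, some 1, none]) ![ψ, χ]) :=
  of_binary hT .whiskerRight h h' fun _ => Symb.holds_whiskerRight_iff

instance associator {f : A ⟶ B} {g : B ⟶ D} {k : D ⟶ E} [h : Elt T c x (.one f) ψ]
    [h' : Elt T c x (.one g) χ] [h'' : Elt T c x (.one k) ω] : Elt T c x (.two (α_ f g k).hom)
      (substRel ((T.rel .associator).relabel ![some 0, some 1, some 2, none]) ![ψ, χ, ω]) :=
  of_ternary hT .associator h h' h'' fun _ => Symb.holds_associator_iff

instance leftUnitor {f : A ⟶ B} [h : Elt T c x (.one f) ψ] : Elt T c x (.two (λ_ f).hom)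
      (substRel ((T.rel .leftUnitor).relabel ![some 0, none]) ![ψ]) :=
  of_unary hT .leftUnitor h fun _ => Symb.holds_leftUnitor_iff

/-- The variable `none` is the inverse of the variable `some 0`. -/
noncomputable def invFormula (T : Interp L) : L.Formula (Option (Fin 1)) :=
  exFormula (exFormula ((T.rel .src).relabel ![some (some (some 0)), some none] ⊓
    (T.rel .id₂).relabel ![some none, none] ⊓
    (T.rel .vcomp).relabel ![some (some (some 0)), some (some none), none]))

instance inv {f g : A ⟶ B} {η : f ≅ g} [h : Elt T c x (.two η.hom) ψ] :
    Elt T c x (.two η.inv) (substRel (invFormula T) ![ψ]) := by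
  refine of_substRel (z := ![.two η.hom]) (Fin.forall_fin_one.2 h) fun m => ?_
  simp only [invFormula, realize_exFormula, Formula.realize_inf, hT.realize₂, hT.realize₃,
    and_assoc]
  exact Symb.holds_inv_iff η

variable {f : A ⟶ B} {k : D ⟶ B} {hk : W k}

instance choice_v' [h : Elt T c x (.one f) ψ] [h' : Elt T c x (.one k) χ] : Elt T c x (.one (c f k hk).v')
    (substRel (exFormula (exFormula (T.choice.relabel
      ![some (some (some 0)), some (some (some 1)), some (some none), some none, none])))
      ![ψ, χ]) := by
  refine of_substRel (z := ![.one f, .one k]) (Fin.forall_fin_two.2 ⟨h, h'⟩) fun m => ?_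
  simp only [realize_exFormula, hT.realize_choice]
  refine (exists_congr fun _ => exists_congr fun _ => c.graph_iff hk).trans ?_
  simp [push]

instance choice_f' [h : Elt T c x (.one f) ψ] [h' : Elt T c x (.one k) χ] : Elt T c x (.one (c f k hk).f')
    (substRel (exFormula (exFormula (T.choice.relabel
      ![some (some (some 0)), some (some (some 1)), some none, some (some none), none])))
      ![ψ, χ]) := by
  refine of_substRel (z := ![.one f, .one k]) (Fin.forall_fin_two.2 ⟨h, h'⟩) fun m => ?_
  simp only [realize_exFormula, hT.realize_choice]
  refine (exists_congr fun _ => exists_congr fun _ => c.graph_iff hk).trans ?_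
  simp [push]

instance choice_ρ [h : Elt T c x (.one f) ψ] [h' : Elt T c x (.one k) χ] : Elt T c x (.two (c f k hk).ρ.hom)
    (substRel (exFormula (exFormula (T.choice.relabel
      ![some (some (some 0)), some (some (some 1)), some none, none, some (some none)])))
      ![ψ, χ]) := by
  refine of_substRel (z := ![.one f, .one k]) (Fin.forall_fin_two.2 ⟨h, h'⟩) fun m => ?_
  simp only [realize_exFormula, hT.realize_choice]
  refine (exists_congr fun _ => exists_congr fun _ => c.graph_iff hk).trans ?_
  simp [push]

/-- The object of a square has no variable of its own; it is recovered as the source of a leg. The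
next instance does the same for representatives. -/
instance square_obj {s : Square W f k} [h : Elt T c x (.one s.v') ψ] : Elt T c x (.obj s.obj)
    (substRel ((T.rel .src).relabel ![some 0, none]) ![ψ]) :=
  of_unary hT .src h fun _ => Symb.holds_src_iff

instance rep_obj {F G : Frac W A B} {r : Rep F G} [h : Elt T c x (.one r.v₁) ψ] :
    Elt T c x (.obj r.obj) (substRel ((T.rel .src).relabel ![some 0, none]) ![ψ]) :=
  of_unary hT .src h fun _ => Symb.holds_src_iff

end

end Elt

end Definability

/-! ### Formulas defining propositions. -/

section Rules

open FirstOrder Language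

variable {L : FirstOrder.Language.{0, 0}} (T : Interp L) {C : Type u} [Bicategory.{w, v} C]
  {W : MorphismProperty C} (c : Choices W) [L.Structure (Cell C)] {α : Type}

/-- The formula `φ` defines the proposition `P` in terms of the cells `x`. -/
structure Defines (T : Interp L) {C : Type u} [Bicategory.{w, v} C] {W : MorphismProperty C}
    (_c : Choices W) [L.Structure (Cell C)] {α : Type} (x : α → Cell C) (P : Prop) (φ : L.Formula α) : Prop where
  iff : φ.Realize x ↔ P

variable {T c} {x : α → Cell C} {P Q : Prop} {φ ψ χ : L.Formula α}

namespace Defines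

theorem congr (h : Defines T c x P φ) (e : Q ↔ P) : Defines T c x Q φ := ⟨h.iff.trans e.symm⟩

theorem and (h : Defines T c x P φ) (h' : Defines T c x Q ψ) : Defines T c x (P ∧ Q) (φ ⊓ ψ) :=
  ⟨by rw [Formula.realize_inf, h.iff, h'.iff]⟩

/-- Proofs are not coded by cells, so a quantifier over proofs of `Q` becomes a conjunction. -/
theorem exists_proof {P : Q → Prop} (h : Defines T c x Q φ) (h' : ∀ q, Defines T c x (P q) ψ) :
    Defines T c x (∃ q, P q) (φ ⊓ ψ) := ⟨by
  rw [Formula.realize_inf, h.iff]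
  exact ⟨fun ⟨q, hq⟩ => ⟨q, (h' q).iff.1 hq⟩, fun ⟨q, hq⟩ => ⟨q, (h' q).iff.2 hq⟩⟩⟩

/-- Quantification over a type coded by cells. -/
theorem exists_of_code {ι : Sort*} {code : ι → Cell C} {P : ι → Prop} {χ φ : L.Formula (Option α)}
    (hχ : ∀ m, χ.Realize (push m x) ↔ ∃ t, m = code t)
    (h : ∀ t x', Extends x' (code t) x → Defines T c x' (P t) φ) :
    Defines T c x (∃ t, P t) (exFormula (χ ⊓ φ)) := ⟨by
  simp only [realize_exFormula, Formula.realize_inf, hχ]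
  constructor
  · rintro ⟨_, ⟨t, rfl⟩, hm⟩
    exact ⟨t, (h t _ ⟨rfl⟩).iff.1 hm⟩
  · rintro ⟨t, ht⟩
    exact ⟨_, ⟨t, rfl⟩, (h t _ ⟨rfl⟩).iff.2 ht⟩⟩

variable {A B : C}

theorem eq_cell {y z : Cell C} {ψ χ : L.Formula (Option α)} [h : Elt T c x y ψ]
    [h' : Elt T c x z χ] : Defines T c x (y = z) (exFormula (ψ ⊓ χ)) := ⟨by
  simp [realize_exFormula, h.spec, h'.spec]⟩

theorem eq_two {f g : A ⟶ B} {η θ : f ⟶ g} {ψ χ : L.Formula (Option α)}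
    (h : Elt T c x (.two η) ψ) (h' : Elt T c x (.two θ) χ) :
    Defines T c x (η = θ) (exFormula (ψ ⊓ χ)) :=
  (eq_cell (h := h) (h' := h')).congr (by simp)

variable [hT : T.Models c]

theorem exists_obj {P : C → Prop} {φ : L.Formula (Option α)}
    (h : ∀ A x', Extends x' (.obj A) x → Defines T c x' (P A) φ) :
    Defines T c x (∃ A, P A)
      (exFormula (exFormula ((T.rel .id₁).relabel ![some none, none]) ⊓ φ)) :=
  exists_of_code (fun m => by
    rw [realize_exFormula, ← Symb.exists_obj_iff (W := W)]
    exact exists_congr fun n => hT.realize₂ _) h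

/-- The variable `none` has source and target defined by `ψ`, `χ`. -/
noncomputable def _root_.BicatFrac.homFormula (T : Interp L) (ψ χ : L.Formula (Option α)) :
    L.Formula (Option α) :=
  substRel ((T.rel .src).relabel ![none, some 0] ⊓ (T.rel .tgt).relabel ![none, some 1]) ![ψ, χ]

theorem realize_homFormula {y z : Cell C} {ψ χ : L.Formula (Option α)} (h : Elt T c x y ψ)
    (h' : Elt T c x z χ) (m : Cell C) : (homFormula T ψ χ).Realize (push m x) ↔
      Symb.Holds W .src ![m, y] ∧ Symb.Holds W .tgt ![m, z] := by
  rw [homFormula, realize_substRel (y := ![y, z]) (Fin.forall_fin_two.2 ⟨h.spec, h'.spec⟩),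
    Formula.realize_inf, hT.realize₂, hT.realize₂]
  rfl

theorem exists_one {P : (A ⟶ B) → Prop} {ψ χ φ : L.Formula (Option α)}
    [h : Elt T c x (.obj A) ψ] [h' : Elt T c x (.obj B) χ]
    (hP : ∀ f x', Extends x' (.one f) x → Defines T c x' (P f) φ) :
    Defines T c x (∃ f, P f) (exFormula (homFormula T ψ χ ⊓ φ)) :=
  exists_of_code (fun m => (realize_homFormula h h' m).trans Symb.exists_one_iff) hP

theorem exists_two {f g : A ⟶ B} {P : (f ⟶ g) → Prop} {ψ χ φ : L.Formula (Option α)}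
    [h : Elt T c x (.one f) ψ] [h' : Elt T c x (.one g) χ]
    (hP : ∀ η x', Extends x' (.two η) x → Defines T c x' (P η) φ) :
    Defines T c x (∃ η, P η) (exFormula (homFormula T ψ χ ⊓ φ)) :=
  exists_of_code (fun m => (realize_homFormula h h' m).trans Symb.exists_two_iff) hP

/-- The variable `none` is an invertible 2-cell with source and target defined by `ψ`, `χ`. -/
noncomputable def _root_.BicatFrac.isoFormula (T : Interp L) (ψ χ : L.Formula (Option α)) :
    L.Formula (Option α) :=
  substRel ((T.rel .src).relabel ![none, some 0] ⊓ (T.rel .tgt).relabel ![none, some 1] ⊓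
    exFormula (exFormula (exFormula (
      (T.rel .id₂).relabel ![some (some (some (some 0))), some none] ⊓
      (T.rel .id₂).relabel ![some (some (some (some 1))), none] ⊓
      (T.rel .vcomp).relabel ![some (some (some none)), some (some none), some none] ⊓
      (T.rel .vcomp).relabel ![some (some none), some (some (some none)), none])))) ![ψ, χ]

theorem realize_isoFormula {f g : A ⟶ B} {ψ χ : L.Formula (Option α)} (h : Elt T c x (.one f) ψ)
    (h' : Elt T c x (.one g) χ) (m : Cell C) : (isoFormula T ψ χ).Realize (push m x) ↔
      ∃ η : f ≅ g, m = .two η.hom := by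
  rw [isoFormula,
    realize_substRel (y := ![.one f, .one g]) (Fin.forall_fin_two.2 ⟨h.spec, h'.spec⟩)]
  simp only [realize_exFormula, Formula.realize_inf, hT.realize₂, hT.realize₃, and_assoc]
  rw [← and_assoc]
  exact Symb.exists_iso_iff

theorem exists_iso {f g : A ⟶ B} {P : (f ≅ g) → Prop} {ψ χ φ : L.Formula (Option α)}
    [h : Elt T c x (.one f) ψ] [h' : Elt T c x (.one g) χ]
    (hP : ∀ (η : f ≅ g) x', Extends x' (.two η.hom) x → Defines T c x' (P η) φ) :
    Defines T c x (∃ η, P η) (exFormula (isoFormula T ψ χ ⊓ φ)) :=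
  exists_of_code (realize_isoFormula h h') hP

theorem mem {f : A ⟶ B} {ψ : L.Formula (Option α)} [h : Elt T c x (.one f) ψ] :
    Defines T c x (W f) (substFormula (T.rel .inW) ![ψ]) := ⟨by
  rw [realize_substFormula (y := ![.one f]) (Fin.forall_fin_one.2 h.spec), hT.rel,
    Symb.holds_inW_iff]⟩

theorem exists_mem {f : A ⟶ B} {P : W f → Prop} {ψ : L.Formula (Option α)}
    [h : Elt T c x (.one f) ψ] (hP : ∀ hf, Defines T c x (P hf) φ) :
    Defines T c x (∃ hf, P hf) (substFormula (T.rel .inW) ![ψ] ⊓ φ) :=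
  mem.exists_proof hP

end Defines

end Rules

/-! ### The graphs of the operations as conditions on cells. -/

section Unpacking

variable {C : Type u} [Bicategory.{w, v} C] {W : MorphismProperty C}

theorem eq_elim_iff {α β γ : Type*} {x : α ⊕ β → γ} {y : α → γ} {z : β → γ} :
    x = Sum.elim y z ↔ (fun i => x (.inl i)) = y ∧ (fun i => x (.inr i)) = z := by
  simp [funext_iff, Sum.forall]

theorem eq_vec₁_iff {γ : Type*} {x : Fin 1 → γ} {a : γ} : x = ![a] ↔ x 0 = a := by
  simp [funext_iff]

theorem eq_vec₂_iff {γ : Type*} {x : Fin 2 → γ} {a b : γ} : x = ![a, b] ↔ x 0 = a ∧ x 1 = b := by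
  simp [funext_iff, Fin.forall_fin_succ]

theorem eq_vec₄_iff {γ : Type*} {x : Fin 4 → γ} {a b d e : γ} :
    x = ![a, b, d, e] ↔ x 0 = a ∧ x 1 = b ∧ x 2 = d ∧ x 3 = e := by
  simp [funext_iff, Fin.forall_fin_succ]

/-- A quantifier over a structure becomes a string of quantifiers over cells and proofs, for which
there are rules. The analogous lemmas for other structures serve the same end. -/
theorem Frac.exists_iff {A B : C} {P : Frac W A B → Prop} :
    (∃ F, P F) ↔ ∃ (X : C) (w : X ⟶ A) (h : W w) (f : X ⟶ B), P ⟨X, w, h, f⟩ :=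
  ⟨fun ⟨⟨X, w, h, f⟩, H⟩ => ⟨X, w, h, f, H⟩, fun ⟨X, w, h, f, H⟩ => ⟨⟨X, w, h, f⟩, H⟩⟩

theorem Rep.exists_iff {A B : C} {F G : Frac W A B} {P : Rep F G → Prop} :
    (∃ r, P r) ↔ ∃ (X : C) (v₁ : X ⟶ F.obj) (v₂ : X ⟶ G.obj) (h : W (v₁ ≫ F.w))
      (α : v₁ ≫ F.w ≅ v₂ ≫ G.w) (β : v₁ ≫ F.f ⟶ v₂ ≫ G.f), P ⟨X, v₁, v₂, h, α, β⟩ :=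
  ⟨fun ⟨⟨X, v₁, v₂, h, α, β⟩, H⟩ => ⟨X, v₁, v₂, h, α, β, H⟩,
    fun ⟨X, v₁, v₂, h, α, β, H⟩ => ⟨⟨X, v₁, v₂, h, α, β⟩, H⟩⟩

theorem VertData.exists_iff {A B : C} {F₁ F₂ F₃ : Frac W A B} {r : Rep F₁ F₂} {s : Rep F₂ F₃}
    {P : VertData r s → Prop} :
    (∃ d, P d) ↔ ∃ (X : C) (t₁ : X ⟶ r.obj) (t₂ : X ⟶ s.obj) (h : W t₁)
      (ρ : t₁ ≫ r.v₂ ≅ t₂ ≫ s.v₁), P ⟨X, t₁, t₂, h, ρ⟩ :=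
  ⟨fun ⟨⟨X, t₁, t₂, h, ρ⟩, H⟩ => ⟨X, t₁, t₂, h, ρ, H⟩,
    fun ⟨X, t₁, t₂, h, ρ, H⟩ => ⟨⟨X, t₁, t₂, h, ρ⟩, H⟩⟩

variable {hW : Bicalculus W} {c : Choices W}

theorem fracOps_id₂_eq_cls_iff {A B : C} {F : Frac W A B} {r : Rep F F} :
    (fracOps hW c).id₂ F = r.cls ↔ (Rep.id hW F).Equiv r := by
  rw [fracOps_isGivenByAnyData.id₂, Rep.cls_eq_cls_iff hW]

theorem fracOps_leftUnitor_eq_cls_iff {A B : C} {F : Frac W A B}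
    {r : Rep ((Frac.id hW A).comp hW c F) F} :
    (fracOps hW c).leftUnitor F = r.cls ↔ (Rep.leftUnitor hW c F).Equiv r := by
  rw [fracOps_isGivenByAnyData.leftUnitor, Rep.cls_eq_cls_iff hW]

theorem fracOps_rightUnitor_eq_cls_iff {A B : C} {F : Frac W A B}
    {r : Rep (F.comp hW c (Frac.id hW B)) F} :
    (fracOps hW c).rightUnitor F = r.cls ↔ (Rep.rightUnitor hW c F).Equiv r := by
  rw [fracOps_isGivenByAnyData.rightUnitor, Rep.cls_eq_cls_iff hW]

/-- Auxiliary data exist and all of them give the same class. This makes the graph of the operation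
an existential condition; the whiskerings and the associator are treated alike. -/
theorem fracOps_vcomp_eq_cls_iff {A B : C} {F G H : Frac W A B} {r : Rep F G} {s : Rep G H}
    {t : Rep F H} : (fracOps hW c).vcomp r.cls s.cls = t.cls ↔
      ∃ d : VertData r s, (d.rep hW).Equiv t := by
  obtain ⟨⟨d⟩, h⟩ := (fracOps_isGivenByAnyData (hW := hW) (c := c)).vcomp r s
  simp only [← Rep.cls_eq_cls_iff hW, ← h, exists_const_iff, and_iff_right (Nonempty.intro d)]

theorem fracOps_whiskerLeft_eq_cls_iff {A B D : C} {F : Frac W A B} {G₁ G₂ : Frac W B D}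
    {r : Rep G₁ G₂} {s : Rep (F.comp hW c G₁) (F.comp hW c G₂)} :
    (fracOps hW c).whiskerLeft F r.cls = s.cls ↔
      ∃ d : WhiskerLeftData F r (c F.f G₁.w G₁.mem) (c F.f G₂.w G₂.mem), (d.rep hW).Equiv s := by
  obtain ⟨⟨d⟩, h⟩ := (fracOps_isGivenByAnyData (hW := hW) (c := c)).whiskerLeft F r
  simp only [← Rep.cls_eq_cls_iff hW, ← h, exists_const_iff, and_iff_right (Nonempty.intro d)]

theorem fracOps_whiskerRight_eq_cls_iff {A B D : C} {F₁ F₂ : Frac W A B} {G : Frac W B D}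
    {r : Rep F₁ F₂} {s : Rep (F₁.comp hW c G) (F₂.comp hW c G)} :
    (fracOps hW c).whiskerRight r.cls G = s.cls ↔
      ∃ d : WhiskerRightData r G (c F₁.f G.w G.mem) (c F₂.f G.w G.mem), (d.rep hW).Equiv s := by
  obtain ⟨⟨d⟩, h⟩ := (fracOps_isGivenByAnyData (hW := hW) (c := c)).whiskerRight r G
  simp only [← Rep.cls_eq_cls_iff hW, ← h, exists_const_iff, and_iff_right (Nonempty.intro d)]

theorem fracOps_associator_eq_cls_iff {A B D E : C} {F : Frac W A B} {G : Frac W B D}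
    {H : Frac W D E} {r : Rep ((F.comp hW c G).comp hW c H) (F.comp hW c (G.comp hW c H))} :
    (fracOps hW c).associator F G H = r.cls ↔
      ∃ d : AssocData F G H (c F.f G.w G.mem) (c ((c F.f G.w G.mem).f' ≫ G.f) H.w H.mem)
        (c G.f H.w H.mem) (c F.f ((c G.f H.w H.mem).v' ≫ G.w)
          (hW.comp_mem _ _ (c G.f H.w H.mem).mem G.mem)),
        (AssocDataC.rep (hW := hW) (c := c) d).Equiv r := by
  obtain ⟨⟨d⟩, h⟩ := (fracOps_isGivenByAnyData (hW := hW) (c := c)).associator F G H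
  change _ ↔ ∃ d : AssocDataC hW c F G H, (AssocDataC.rep d).Equiv r
  simp only [← Rep.cls_eq_cls_iff hW, ← h, exists_const_iff, and_iff_right (Nonempty.intro d)]

theorem WhiskerLeftData.exists_iff {A B D : C} {F : Frac W A B} {G₁ G₂ : Frac W B D} {r : Rep G₁ G₂}
    {s₁ : Square W F.f G₁.w} {s₂ : Square W F.f G₂.w} {P : WhiskerLeftData F r s₁ s₂ → Prop} :
    (∃ d, P d) ↔ ∃ (X₃ : C) (t₁ : X₃ ⟶ s₁.obj) (m₁ : W t₁) (h₁ : X₃ ⟶ r.obj)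
      (σ₁ : t₁ ≫ s₁.f' ≅ h₁ ≫ r.v₁) (X₄ : C) (t₂ : X₄ ⟶ s₂.obj) (m₂ : W t₂) (h₂ : X₄ ⟶ r.obj)
      (σ₂ : t₂ ≫ s₂.f' ≅ h₂ ≫ r.v₂) (X₅ : C) (t₃ : X₅ ⟶ X₃) (m₃ : W t₃) (t₄ : X₅ ⟶ X₄)
      (φ : t₃ ≫ t₁ ≫ s₁.v' ≅ t₄ ≫ t₂ ≫ s₂.v') (δ : t₃ ≫ h₁ ≅ t₄ ≫ h₂) (e : δ.hom ▷ (r.v₁ ≫ G₁.w) =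
        𝟙 _ ⊗≫ t₃ ◁ (σ₁.inv ▷ G₁.w) ⊗≫ (t₃ ≫ t₁) ◁ s₁.ρ.inv ⊗≫ φ.hom ▷ F.f ⊗≫
          (t₄ ≫ t₂) ◁ s₂.ρ.hom ⊗≫ t₄ ◁ (σ₂.hom ▷ G₂.w) ⊗≫ (t₄ ≫ h₂) ◁ r.α.inv),
      P ⟨X₃, t₁, m₁, h₁, σ₁, X₄, t₂, m₂, h₂, σ₂, X₅, t₃, m₃, t₄, φ, δ, e⟩ :=
  ⟨fun ⟨⟨X₃, t₁, m₁, h₁, σ₁, X₄, t₂, m₂, h₂, σ₂, X₅, t₃, m₃, t₄, φ, δ, e⟩, H⟩ =>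
      ⟨X₃, t₁, m₁, h₁, σ₁, X₄, t₂, m₂, h₂, σ₂, X₅, t₃, m₃, t₄, φ, δ, e, H⟩,
    fun ⟨X₃, t₁, m₁, h₁, σ₁, X₄, t₂, m₂, h₂, σ₂, X₅, t₃, m₃, t₄, φ, δ, e, H⟩ =>
      ⟨⟨X₃, t₁, m₁, h₁, σ₁, X₄, t₂, m₂, h₂, σ₂, X₅, t₃, m₃, t₄, φ, δ, e⟩, H⟩⟩

theorem WhiskerRightData.exists_iff {A B D : C} {F₁ F₂ : Frac W A B} {r : Rep F₁ F₂}
    {G : Frac W B D} {s₁ : Square W F₁.f G.w} {s₂ : Square W F₂.f G.w}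
    {P : WhiskerRightData r G s₁ s₂ → Prop} :
    (∃ d, P d) ↔ ∃ (X₃ : C) (u₃ : X₃ ⟶ r.obj) (m₃ : W u₃) (u₄ : X₃ ⟶ s₁.obj)
      (η₁ : u₃ ≫ r.v₁ ≅ u₄ ≫ s₁.v') (X₄ : C) (u₅ : X₄ ⟶ r.obj) (m₅ : W u₅) (u₆ : X₄ ⟶ s₂.obj)
      (η₂ : u₅ ≫ r.v₂ ≅ u₆ ≫ s₂.v') (X₅ : C) (u₇ : X₅ ⟶ X₃) (m₇ : W u₇) (u₈ : X₅ ⟶ X₄)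
      (η₃ : u₇ ≫ u₃ ≅ u₈ ≫ u₅) (l : u₇ ≫ u₄ ≫ s₁.f' ⟶ u₈ ≫ u₆ ≫ s₂.f') (e : l ▷ G.w =
        𝟙 _ ⊗≫ (u₇ ≫ u₄) ◁ s₁.ρ.inv ⊗≫ u₇ ◁ (η₁.inv ▷ F₁.f) ⊗≫ η₃.hom ▷ (r.v₁ ≫ F₁.f) ⊗≫
          (u₈ ≫ u₅) ◁ r.β ⊗≫ u₈ ◁ (η₂.hom ▷ F₂.f) ⊗≫ (u₈ ≫ u₆) ◁ s₂.ρ.hom ⊗≫ 𝟙 _),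
      P ⟨X₃, u₃, m₃, u₄, η₁, X₄, u₅, m₅, u₆, η₂, X₅, u₇, m₇, u₈, η₃, l, e⟩ :=
  ⟨fun ⟨⟨X₃, u₃, m₃, u₄, η₁, X₄, u₅, m₅, u₆, η₂, X₅, u₇, m₇, u₈, η₃, l, e⟩, H⟩ =>
      ⟨X₃, u₃, m₃, u₄, η₁, X₄, u₅, m₅, u₆, η₂, X₅, u₇, m₇, u₈, η₃, l, e, H⟩,
    fun ⟨X₃, u₃, m₃, u₄, η₁, X₄, u₅, m₅, u₆, η₂, X₅, u₇, m₇, u₈, η₃, l, e, H⟩ =>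
      ⟨⟨X₃, u₃, m₃, u₄, η₁, X₄, u₅, m₅, u₆, η₂, X₅, u₇, m₇, u₈, η₃, l, e⟩, H⟩⟩

theorem AssocData.exists_iff {A B D E : C} {F : Frac W A B} {G : Frac W B D} {H : Frac W D E}
    {s₁ : Square W F.f G.w} {s₂ : Square W (s₁.f' ≫ G.f) H.w} {s₃ : Square W G.f H.w}
    {s₄ : Square W F.f (s₃.v' ≫ G.w)} {P : AssocData F G H s₁ s₂ s₃ s₄ → Prop} :
    (∃ d, P d) ↔ ∃ (X : C) (u₄ : X ⟶ s₂.obj) (u₅ : X ⟶ s₄.obj)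
      (m : W (u₄ ≫ s₂.v' ≫ s₁.v' ≫ F.w)) (γ : u₄ ≫ s₂.v' ≫ s₁.v' ≅ u₅ ≫ s₄.v')
      (ω : u₄ ≫ s₂.v' ≫ s₁.f' ≅ u₅ ≫ s₄.f' ≫ s₃.v') (e : ω.hom ▷ G.w =
        𝟙 _ ⊗≫ (u₄ ≫ s₂.v') ◁ s₁.ρ.inv ⊗≫ γ.hom ▷ F.f ⊗≫ u₅ ◁ s₄.ρ.hom ⊗≫ 𝟙 _)
      (ρ : u₄ ≫ s₂.f' ≅ u₅ ≫ s₄.f' ≫ s₃.f') (e' : ρ.hom ▷ H.w =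
        𝟙 _ ⊗≫ u₄ ◁ s₂.ρ.inv ⊗≫ ω.hom ▷ G.f ⊗≫ (u₅ ≫ s₄.f') ◁ s₃.ρ.hom ⊗≫ 𝟙 _),
      P ⟨X, u₄, u₅, m, γ, ω, e, ρ, e'⟩ :=
  ⟨fun ⟨⟨X, u₄, u₅, m, γ, ω, e, ρ, e'⟩, H⟩ => ⟨X, u₄, u₅, m, γ, ω, e, ρ, e', H⟩,
    fun ⟨X, u₄, u₅, m, γ, ω, e, ρ, e', H⟩ => ⟨⟨X, u₄, u₅, m, γ, ω, e, ρ, e'⟩, H⟩⟩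

end Unpacking

/-! ### Uniform definability of 1-morphisms, representatives and their equivalence. -/

section Definability

open FirstOrder Language

variable {L : FirstOrder.Language.{0, 0}} (T : Interp L)

/-- The formula `φ` defines a notion in all models of `T`. -/
def DefinesNotion (k : Notion) (φ : L.Formula k.Var) : Prop :=
  ∀ (C : Type u) [Bicategory.{w, v} C] (W : MorphismProperty C) (hW : Bicalculus W) (c : Choices W)
    [L.Structure (Cell C)] [T.Models c] (x : k.Var → Cell C),
    Defines T c x ((fracOps hW c).Graph k x) φ

theorem exists_definesNotion_one : ∃ φ, DefinesNotion.{w, v, u} T .one φ := by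
  -- The formula is left undetermined and is filled in by the rules. Since it is introduced before
  -- `C`, it cannot depend on the bicategory, the choices or the cells.
  apply Exists.intro
  intro C _ W hW c _ _ x
  simp only [Ops.Graph, Frac.exists_iff, Frac.code, eq_elim_iff, eq_vec₁_iff, eq_vec₂_iff]
  repeat' first
    | (apply Defines.exists_obj; intro _ _ _)
    | (apply Defines.exists_mem; intro)
    | (apply Defines.exists_one; intro _ _ _)
    | apply Defines.and
    | apply Defines.eq_cell

theorem exists_definesNotion_two : ∃ φ, DefinesNotion.{w, v, u} T .two φ := by
  apply Exists.intro
  intro C _ W hW c _ _ x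
  simp only [Ops.Graph, Frac.exists_iff, Rep.exists_iff, Frac.code, Rep.code, eq_elim_iff,
    eq_vec₂_iff, eq_vec₄_iff]
  repeat' first
    | (apply Defines.exists_obj; intro _ _ _)
    | (apply Defines.exists_mem; intro)
    | (apply Defines.exists_one; intro _ _ _)
    | (apply Defines.exists_iso; intro _ _ _)
    | (apply Defines.exists_two; intro _ _ _)
    | apply Defines.and
    | apply Defines.eq_cell

set_option synthInstance.maxSize 10000 in
set_option synthInstance.maxHeartbeats 0 in
set_option maxHeartbeats 0 in
theorem exists_definesNotion_same : ∃ φ, DefinesNotion.{w, v, u} T .same φ := by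
  apply Exists.intro
  intro C _ W hW c _ _ x
  simp only [Ops.Graph, Frac.exists_iff, Rep.exists_iff, Rep.cls_eq_cls_iff hW, Frac.code, Rep.code,
    eq_elim_iff, eq_vec₂_iff, eq_vec₄_iff, Rep.Equiv]
  dsimp only [bicategoricalComp, BicategoricalCoherence.iso, Iso.trans_hom, Iso.refl_hom,
    Iso.symm_hom, whiskerLeftIso, whiskerRightIso]
  repeat' first
    | (apply Defines.exists_obj; intro _ _ _)
    | (apply Defines.exists_mem; intro)
    | (apply Defines.exists_one; intro _ _ _)
    | (apply Defines.exists_iso; intro _ _ _)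
    | (apply Defines.exists_two; intro _ _ _)
    | apply Defines.and
    | apply Defines.mem
    | apply Defines.eq_cell
    | apply Defines.eq_two
    | infer_instance

variable {T}

/-- The graph only mentions some fractions and representatives with the given codes. Codes determine
them up to proofs, so the formula may be used for prescribed ones. -/
theorem DefinesNotion.realize_same {φ : L.Formula Notion.same.Var}
    (h : DefinesNotion.{w, v, u} T .same φ) {C : Type u} [Bicategory.{w, v} C]
    {W : MorphismProperty C} (hW : Bicalculus W) {c : Choices W} [L.Structure (Cell C)]
    [T.Models c] {A B : C} {F G : Frac W A B} (r r' : Rep F G) :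
    φ.Realize (Sum.elim F.code (Sum.elim G.code (Sum.elim r.code r'.code))) ↔ r.Equiv r' := by
  rw [(h C W hW c _).iff]
  constructor
  · rintro ⟨A', B', F', G', s, s', hx, hs⟩
    obtain ⟨X, w, _, f⟩ := F
    obtain ⟨Y, w', _, f'⟩ := G
    obtain ⟨Z, v₁, v₂, _, a, b⟩ := r
    obtain ⟨Z', v₁', v₂', _, a', b'⟩ := r'
    obtain ⟨X', k, _, g⟩ := F'
    obtain ⟨Y', k', _, g'⟩ := G'
    obtain ⟨U, u₁, u₂, _, d, e⟩ := s
    obtain ⟨U', u₁', u₂', _, d', e'⟩ := s'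
    simp only [Frac.code, Rep.code, eq_elim_iff, eq_vec₂_iff, eq_vec₄_iff, Sum.elim_inl,
      Sum.elim_inr] at hx
    obtain ⟨⟨h₁, h₂⟩, ⟨h₃, h₄⟩, ⟨h₅, h₆, h₇, h₈⟩, h₉, h₁₀, h₁₁, h₁₂⟩ := hx
    cases h₁
    cases h₂
    cases h₃
    cases h₄
    cases h₅
    cases h₆
    cases h₈
    cases h₉
    cases h₁₀
    cases h₁₂
    -- The code contains only the forward direction of an invertible 2-cell, which determines the
    -- whole.
    have h₇' : a = d := Iso.ext (by simpa using h₇)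
    have h₁₁' : a' = d' := Iso.ext (by simpa using h₁₁)
    subst h₇' h₁₁'
    exact (Rep.cls_eq_cls_iff hW).1 hs
  · intro hr
    exact ⟨A, B, F, G, r, r', rfl, (Rep.cls_eq_cls_iff hW).2 hr⟩

end Definability

/-! ### Rules using the formulas for fractions, representatives and equivalence as blocks. -/

section Definability

open FirstOrder Language

variable {L : FirstOrder.Language.{0, 0}} {T : Interp L}

theorem Defines.equiv {φ : L.Formula Notion.same.Var} (hφ : DefinesNotion.{w, v, u} T .same φ)
    {C : Type u} [Bicategory.{w, v} C] {W : MorphismProperty C} (hW : Bicalculus W) {c : Choices W}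
    [L.Structure (Cell C)] [T.Models c] {α : Type} {x : α → Cell C} {A B : C} {F G : Frac W A B}
    {r r' : Rep F G} {ψ₁ ψ₂ ψ₃ ψ₄ ψ₅ ψ₆ ψ₇ ψ₈ ψ₉ ψ₁₀ ψ₁₁ ψ₁₂ : L.Formula (Option α)}
    (h₁ : Elt T c x (.one F.w) ψ₁) (h₂ : Elt T c x (.one F.f) ψ₂)
    (h₃ : Elt T c x (.one G.w) ψ₃) (h₄ : Elt T c x (.one G.f) ψ₄)
    (h₅ : Elt T c x (.one r.v₁) ψ₅) (h₆ : Elt T c x (.one r.v₂) ψ₆)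
    (h₇ : Elt T c x (.two r.α.hom) ψ₇) (h₈ : Elt T c x (.two r.β) ψ₈)
    (h₉ : Elt T c x (.one r'.v₁) ψ₉) (h₁₀ : Elt T c x (.one r'.v₂) ψ₁₀)
    (h₁₁ : Elt T c x (.two r'.α.hom) ψ₁₁) (h₁₂ : Elt T c x (.two r'.β) ψ₁₂) :
    Defines T c x (r.Equiv r')
      (substFormula φ (Sum.elim ![ψ₁, ψ₂] (Sum.elim ![ψ₃, ψ₄] (Sum.elim ![ψ₅, ψ₆, ψ₇, ψ₈]
        ![ψ₉, ψ₁₀, ψ₁₁, ψ₁₂])))) := by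
  refine ⟨(realize_substFormula ?_).trans (hφ.realize_same hW (c := c) r r')⟩
  simp only [Sum.forall, Sum.elim_inl, Sum.elim_inr, Fin.forall_fin_succ]
  simp [Frac.code, Rep.code, h₁.spec, h₂.spec, h₃.spec, h₄.spec, h₅.spec, h₆.spec, h₇.spec, h₈.spec,
    h₉.spec, h₁₀.spec, h₁₁.spec, h₁₂.spec]

theorem DefinesNotion.realize_one {φ : L.Formula Notion.one.Var}
    (h : DefinesNotion.{w, v, u} T .one φ) {C : Type u} [Bicategory.{w, v} C]
    {W : MorphismProperty C} (hW : Bicalculus W) {c : Choices W} [L.Structure (Cell C)]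
    [T.Models c] {A B : C} {m₁ m₂ : Cell C} :
    φ.Realize (Sum.elim ![.obj A] (Sum.elim ![.obj B] ![m₁, m₂])) ↔
      ∃ F : Frac W A B, m₁ = .one F.w ∧ m₂ = .one F.f := by
  rw [(h C W hW c _).iff]
  simp only [Ops.Graph, Frac.code, eq_elim_iff, eq_vec₁_iff, eq_vec₂_iff, Sum.elim_inl, Sum.elim_inr]
  constructor
  · rintro ⟨A', B', F, h₁, h₂, h₃, h₄⟩
    cases h₁
    cases h₂
    exact ⟨F, h₃, h₄⟩
  · rintro ⟨F, rfl, rfl⟩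
    exact ⟨A, B, F, rfl, rfl, rfl, rfl⟩

theorem DefinesNotion.realize_two {φ : L.Formula Notion.two.Var}
    (h : DefinesNotion.{w, v, u} T .two φ) {C : Type u} [Bicategory.{w, v} C]
    {W : MorphismProperty C} (hW : Bicalculus W) {c : Choices W} [L.Structure (Cell C)]
    [T.Models c] {A B : C} {F G : Frac W A B} {m₁ m₂ m₃ m₄ : Cell C} :
    φ.Realize (Sum.elim F.code (Sum.elim G.code ![m₁, m₂, m₃, m₄])) ↔
      ∃ r : Rep F G, m₁ = .one r.v₁ ∧ m₂ = .one r.v₂ ∧ m₃ = .two r.α.hom ∧ m₄ = .two r.β := by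
  rw [(h C W hW c _).iff]
  constructor
  · rintro ⟨A', B', F', G', r, hx⟩
    obtain ⟨X, w, _, f⟩ := F
    obtain ⟨Y, w', _, f'⟩ := G
    obtain ⟨X', k, _, g⟩ := F'
    obtain ⟨Y', k', _, g'⟩ := G'
    simp only [Frac.code, Rep.code, eq_elim_iff, eq_vec₂_iff, eq_vec₄_iff, Sum.elim_inl,
      Sum.elim_inr] at hx
    obtain ⟨⟨h₁, h₂⟩, ⟨h₃, h₄⟩, h₅⟩ := hx
    cases h₁
    cases h₂
    cases h₃
    cases h₄
    exact ⟨r, h₅⟩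
  · rintro ⟨r, rfl, rfl, rfl, rfl⟩
    exact ⟨A, B, F, G, r, rfl⟩

namespace Defines

variable {C : Type u} [Bicategory.{w, v} C] {W : MorphismProperty C} {c : Choices W}
  [L.Structure (Cell C)] {α : Type} {x : α → Cell C} {A B D : C}

/-- The weakening of a formula defining a cell by four variables. -/
def _root_.BicatFrac.lift₄ (ψ : L.Formula (Option α)) :
    L.Formula (Option (Option (Option (Option (Option α))))) :=
  (((ψ.relabel (Option.map some)).relabel (Option.map some)).relabel (Option.map some)).relabel
    (Option.map some)

theorem spec_lift₄ {y : Cell C} {ψ : L.Formula (Option α)} (h : Elt T c x y ψ)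
    (m₁ m₂ m₃ m₄ m : Cell C) :
    (lift₄ ψ).Realize (push m (push m₄ (push m₃ (push m₂ (push m₁ x))))) ↔ m = y :=
  ((((h.lift ⟨rfl⟩).lift ⟨rfl⟩).lift ⟨rfl⟩).lift ⟨rfl⟩).spec m

variable [hT : T.Models c]

theorem exists_frac {φ₁ : L.Formula Notion.one.Var} (hφ : DefinesNotion.{w, v, u} T .one φ₁)
    (hW : Bicalculus W) {P : Frac W A B → Prop} {ψ χ : L.Formula (Option α)}
    {φ : L.Formula (Option (Option α))} [h : Elt T c x (.obj A) ψ] [h' : Elt T c x (.obj B) χ]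
    (hP : ∀ F x₁ x₂, Extends x₁ (.one F.w) x → Extends x₂ (.one F.f) x₁ →
      Defines T c x₂ (P F) φ) :
    Defines T c x (∃ F, P F) (exFormula (exFormula (substFormula φ₁ (Sum.elim
      ![(ψ.relabel (Option.map some)).relabel (Option.map some)] (Sum.elim
      ![(χ.relabel (Option.map some)).relabel (Option.map some)]
      ![Term.equal (Term.var none) (Term.var (some (some none))),
        Term.equal (Term.var none) (Term.var (some none))])) ⊓ φ))) := ⟨by
  have key : ∀ m₁ m₂, (substFormula φ₁ (Sum.elim
      ![(ψ.relabel (Option.map some)).relabel (Option.map some)] (Sum.elim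
      ![(χ.relabel (Option.map some)).relabel (Option.map some)]
      ![Term.equal (Term.var none) (Term.var (some (some none))),
        Term.equal (Term.var none) (Term.var (some none))]))).Realize (push m₂ (push m₁ x)) ↔
      ∃ F : Frac W A B, m₁ = .one F.w ∧ m₂ = .one F.f := fun m₁ m₂ => by
    refine (realize_substFormula ?_).trans (hφ.realize_one hW (c := c))
    simp only [Sum.forall, Sum.elim_inl, Sum.elim_inr, Fin.forall_fin_one, Fin.forall_fin_two]
    exact ⟨((h.lift ⟨rfl⟩).lift ⟨rfl⟩).spec, ((h'.lift ⟨rfl⟩).lift ⟨rfl⟩).spec,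
      (Elt.of_isVar (c := c) (T := T) _ (h := ⟨rfl⟩)).spec,
      (Elt.of_isVar (c := c) (T := T) _ (h := ⟨rfl⟩)).spec⟩
  simp only [realize_exFormula, Formula.realize_inf, key]
  constructor
  · rintro ⟨_, _, ⟨F, rfl, rfl⟩, hm⟩
    exact ⟨F, (hP F _ _ ⟨rfl⟩ ⟨rfl⟩).iff.1 hm⟩
  · rintro ⟨F, hF⟩
    exact ⟨_, _, ⟨F, rfl, rfl⟩, (hP F _ _ ⟨rfl⟩ ⟨rfl⟩).iff.2 hF⟩⟩

theorem exists_rep {φ₂ : L.Formula Notion.two.Var} (hφ : DefinesNotion.{w, v, u} T .two φ₂)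
    (hW : Bicalculus W) {F G : Frac W A B} {P : Rep F G → Prop}
    {ψ₁ ψ₂ ψ₃ ψ₄ : L.Formula (Option α)} {φ : L.Formula (Option (Option (Option (Option α))))}
    [h₁ : Elt T c x (.one F.w) ψ₁] [h₂ : Elt T c x (.one F.f) ψ₂]
    [h₃ : Elt T c x (.one G.w) ψ₃] [h₄ : Elt T c x (.one G.f) ψ₄]
    (hP : ∀ r x₁ x₂ x₃ x₄, Extends x₁ (.one r.v₁) x → Extends x₂ (.one r.v₂) x₁ →
      Extends x₃ (.two r.α.hom) x₂ → Extends x₄ (.two r.β) x₃ → Defines T c x₄ (P r) φ) :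
    Defines T c x (∃ r, P r) (exFormula (exFormula (exFormula (exFormula (substFormula φ₂
      (Sum.elim ![lift₄ ψ₁, lift₄ ψ₂] (Sum.elim ![lift₄ ψ₃, lift₄ ψ₄]
        ![Term.equal (Term.var none) (Term.var (some (some (some (some none))))),
          Term.equal (Term.var none) (Term.var (some (some (some none)))),
          Term.equal (Term.var none) (Term.var (some (some none))),
          Term.equal (Term.var none) (Term.var (some none))])) ⊓ φ))))) := ⟨by
  have key : ∀ m₁ m₂ m₃ m₄, (substFormula φ₂
      (Sum.elim ![lift₄ ψ₁, lift₄ ψ₂] (Sum.elim ![lift₄ ψ₃, lift₄ ψ₄]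
        ![Term.equal (Term.var none) (Term.var (some (some (some (some none))))),
          Term.equal (Term.var none) (Term.var (some (some (some none)))),
          Term.equal (Term.var none) (Term.var (some (some none))),
          Term.equal (Term.var none) (Term.var (some none))]))).Realize
          (push m₄ (push m₃ (push m₂ (push m₁ x)))) ↔
      ∃ r : Rep F G, m₁ = .one r.v₁ ∧ m₂ = .one r.v₂ ∧ m₃ = .two r.α.hom ∧ m₄ = .two r.β :=
    fun m₁ m₂ m₃ m₄ => by
    refine (realize_substFormula ?_).trans (hφ.realize_two hW (c := c))
    simp only [Sum.forall, Sum.elim_inl, Sum.elim_inr, Fin.forall_fin_two]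
    refine ⟨⟨spec_lift₄ h₁ m₁ m₂ m₃ m₄, spec_lift₄ h₂ m₁ m₂ m₃ m₄⟩,
      ⟨spec_lift₄ h₃ m₁ m₂ m₃ m₄, spec_lift₄ h₄ m₁ m₂ m₃ m₄⟩, fun i => ?_⟩
    fin_cases i <;> exact (Elt.of_isVar (c := c) (T := T) _ (h := ⟨rfl⟩)).spec
  simp only [realize_exFormula, Formula.realize_inf, key]
  constructor
  · rintro ⟨_, _, _, _, ⟨r, rfl, rfl, rfl, rfl⟩, hm⟩
    exact ⟨r, (hP r _ _ _ _ ⟨rfl⟩ ⟨rfl⟩ ⟨rfl⟩ ⟨rfl⟩).iff.1 hm⟩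
  · rintro ⟨r, hr⟩
    exact ⟨_, _, _, _, ⟨r, rfl, rfl, rfl, rfl⟩, (hP r _ _ _ _ ⟨rfl⟩ ⟨rfl⟩ ⟨rfl⟩ ⟨rfl⟩).iff.2 hr⟩⟩

/-- A chosen square may be replaced by an arbitrary one with the same code. -/
theorem choice {f : A ⟶ B} {k : D ⟶ B} {hk : W k} {P : Square W f k → Prop}
    {ψ χ : L.Formula (Option α)} {φ : L.Formula (Option (Option (Option α)))}
    [h : Elt T c x (.one f) ψ] [h' : Elt T c x (.one k) χ]
    (hP : ∀ s x₁ x₂ x₃, Extends x₁ (.one s.v') x → Extends x₂ (.one s.f') x₁ →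
      Extends x₃ (.two s.ρ.hom) x₂ → Defines T c x₃ (P s) φ) :
    Defines T c x (P (c f k hk)) (exFormula (exFormula (exFormula (substFormula T.choice
      ![((ψ.relabel (Option.map some)).relabel (Option.map some)).relabel (Option.map some),
        ((χ.relabel (Option.map some)).relabel (Option.map some)).relabel (Option.map some),
        Term.equal (Term.var none) (Term.var (some (some (some none)))),
        Term.equal (Term.var none) (Term.var (some (some none))),
        Term.equal (Term.var none) (Term.var (some none))] ⊓ φ)))) := ⟨by
  have key : ∀ m₁ m₂ m₃, (substFormula T.choice
      ![((ψ.relabel (Option.map some)).relabel (Option.map some)).relabel (Option.map some),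
        ((χ.relabel (Option.map some)).relabel (Option.map some)).relabel (Option.map some),
        Term.equal (Term.var none) (Term.var (some (some (some none)))),
        Term.equal (Term.var none) (Term.var (some (some none))),
        Term.equal (Term.var none) (Term.var (some none))]).Realize
          (push m₃ (push m₂ (push m₁ x))) ↔
      m₁ = .one (c f k hk).v' ∧ m₂ = .one (c f k hk).f' ∧ m₃ = .two (c f k hk).ρ.hom :=
    fun m₁ m₂ m₃ => by
    refine (realize_substFormula ?_).trans ((hT.choice _).trans (c.graph_iff hk))
    intro i
    fin_cases i
    · exact (((h.lift ⟨rfl⟩).lift ⟨rfl⟩).lift ⟨rfl⟩).spec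
    · exact (((h'.lift ⟨rfl⟩).lift ⟨rfl⟩).lift ⟨rfl⟩).spec
    all_goals exact (Elt.of_isVar (c := c) (T := T) _ (h := ⟨rfl⟩)).spec
  simp only [realize_exFormula, Formula.realize_inf, key]
  constructor
  · rintro ⟨_, _, _, ⟨rfl, rfl, rfl⟩, hm⟩
    exact (hP _ _ _ _ ⟨rfl⟩ ⟨rfl⟩ ⟨rfl⟩).iff.1 hm
  · intro hs
    exact ⟨_, _, _, ⟨rfl, rfl, rfl⟩, (hP _ _ _ _ ⟨rfl⟩ ⟨rfl⟩ ⟨rfl⟩).iff.2 hs⟩⟩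

end Defines

end Definability

/-! ### The operations formed with arbitrary squares in place of the chosen ones. -/

section Squares

variable {C : Type u} [Bicategory.{w, v} C] {W : MorphismProperty C} (hW : Bicalculus W)
  {A B D E : C}

/-- The composite of fractions formed with a given square. -/
def Frac.compWith {F : Frac W A B} {G : Frac W B D} (s : Square W F.f G.w) : Frac W A D where
  obj := s.obj
  w := s.v' ≫ F.w
  mem := hW.comp_mem _ _ s.mem F.mem
  f := s.f' ≫ G.f

/-- The diagram obtained from auxiliary data for whiskering with given squares. -/
def WhiskerLeftData.repWith {F : Frac W A B} {G₁ G₂ : Frac W B D} {r : Rep G₁ G₂}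
    {s₁ : Square W F.f G₁.w} {s₂ : Square W F.f G₂.w} (d : WhiskerLeftData F r s₁ s₂) :
    Rep (Frac.compWith hW s₁) (Frac.compWith hW s₂) where
  obj := d.obj₅
  v₁ := d.t₃ ≫ d.t₁
  v₂ := d.t₄ ≫ d.t₂
  mem := hW.comp_mem _ _ (hW.comp_mem _ _ d.mem₃ d.mem₁) (Frac.compWith hW s₁).mem
  α := d.α
  β := d.β

/-- The diagram obtained from auxiliary data for whiskering with given squares. -/
def WhiskerRightData.repWith {F₁ F₂ : Frac W A B} {r : Rep F₁ F₂} {G : Frac W B D}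
    {s₁ : Square W F₁.f G.w} {s₂ : Square W F₂.f G.w} (d : WhiskerRightData r G s₁ s₂) :
    Rep (Frac.compWith hW s₁) (Frac.compWith hW s₂) where
  obj := d.obj₅
  v₁ := d.u₇ ≫ d.u₄
  v₂ := d.u₈ ≫ d.u₆
  mem := by
    refine hW.iso_mem ?_ (hW.comp_mem _ _ d.mem₇ (hW.comp_mem _ _ d.mem₃ r.mem))
    exact α_ _ _ _ ≪≫ whiskerLeftIso d.u₇ ((α_ _ _ _).symm ≪≫
      whiskerRightIso d.η₁.symm F₁.w ≪≫ α_ _ _ _)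
  α := d.α
  β := d.β

/-- The composite of three fractions formed with given squares, starting with the first two. -/
def Frac.compLeft {F : Frac W A B} {G : Frac W B D} {H : Frac W D E} (s₁ : Square W F.f G.w)
    (s₂ : Square W (s₁.f' ≫ G.f) H.w) : Frac W A E where
  obj := s₂.obj
  w := s₂.v' ≫ s₁.v' ≫ F.w
  mem := hW.comp_mem _ _ s₂.mem (hW.comp_mem _ _ s₁.mem F.mem)
  f := s₂.f' ≫ H.f

/-- The composite of three fractions formed with given squares, starting with the last two. -/
def Frac.compRight {F : Frac W A B} {G : Frac W B D} {H : Frac W D E} (s₃ : Square W G.f H.w)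
    (s₄ : Square W F.f (s₃.v' ≫ G.w)) : Frac W A E where
  obj := s₄.obj
  w := s₄.v' ≫ F.w
  mem := hW.comp_mem _ _ s₄.mem F.mem
  f := s₄.f' ≫ s₃.f' ≫ H.f

/-- The diagram obtained from auxiliary data for the associator with given squares. -/
def AssocData.repWith {F : Frac W A B} {G : Frac W B D} {H : Frac W D E} {s₁ : Square W F.f G.w}
    {s₂ : Square W (s₁.f' ≫ G.f) H.w} {s₃ : Square W G.f H.w} {s₄ : Square W F.f (s₃.v' ≫ G.w)}
    (d : AssocData F G H s₁ s₂ s₃ s₄) :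
    Rep (Frac.compLeft hW s₁ s₂)
      (Frac.compRight hW s₃ s₄) where
  obj := d.obj
  v₁ := d.u₄
  v₂ := d.u₅
  mem := d.mem
  α := d.α
  β := d.β

/-- The graph of whiskering with a fraction on the left, for given squares. -/
def WhiskerLeftGraph (F : Frac W A B) {G₁ G₂ : Frac W B D} (r : Rep G₁ G₂)
    (x : Notion.whiskerLeft.Var → Cell C) (s₁ : Square W F.f G₁.w) (s₂ : Square W F.f G₂.w) : Prop :=
  ∃ s : Rep (Frac.compWith hW s₁) (Frac.compWith hW s₂),
    x = Sum.elim F.code (Sum.elim G₁.code (Sum.elim G₂.code (Sum.elim r.code s.code))) ∧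
      ∃ d : WhiskerLeftData F r s₁ s₂, (d.repWith hW).Equiv s

/-- The graph of whiskering with a fraction on the right, for given squares. -/
def WhiskerRightGraph {F₁ F₂ : Frac W A B} (r : Rep F₁ F₂) (G : Frac W B D)
    (x : Notion.whiskerRight.Var → Cell C) (s₁ : Square W F₁.f G.w) (s₂ : Square W F₂.f G.w) :
    Prop :=
  ∃ s : Rep (Frac.compWith hW s₁) (Frac.compWith hW s₂),
    x = Sum.elim F₁.code (Sum.elim F₂.code (Sum.elim G.code (Sum.elim r.code s.code))) ∧
      ∃ d : WhiskerRightData r G s₁ s₂, (d.repWith hW).Equiv s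

/-- The graph of the associator, for given squares. -/
def AssocGraph (F : Frac W A B) (G : Frac W B D) (H : Frac W D E)
    (x : Notion.associator.Var → Cell C) (s₁ : Square W F.f G.w)
    (s₂ : Square W (s₁.f' ≫ G.f) H.w) (s₃ : Square W G.f H.w) (s₄ : Square W F.f (s₃.v' ≫ G.w)) :
    Prop :=
  ∃ r : Rep (Frac.compLeft hW s₁ s₂)
      (Frac.compRight hW s₃ s₄),
    x = Sum.elim F.code (Sum.elim G.code (Sum.elim H.code r.code)) ∧
      ∃ d : AssocData F G H s₁ s₂ s₃ s₄, (d.repWith hW).Equiv r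

variable {hW} {c : Choices W}

/-- In this form the squares are free arguments of the condition, so `Defines.choice` can replace
each chosen square by three variables. For the chosen squares the two descriptions agree by
definition. -/
theorem fracOps_graph_whiskerLeft_iff {x : Notion.whiskerLeft.Var → Cell C} :
    (fracOps hW c).Graph .whiskerLeft x ↔ ∃ (A B D : C) (F : Frac W A B) (G₁ G₂ : Frac W B D)
      (r : Rep G₁ G₂), WhiskerLeftGraph hW F r x (c F.f G₁.w G₁.mem) (c F.f G₂.w G₂.mem) := by
  simp only [Ops.Graph, fracOps_whiskerLeft_eq_cls_iff]
  rfl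

theorem fracOps_graph_whiskerRight_iff {x : Notion.whiskerRight.Var → Cell C} :
    (fracOps hW c).Graph .whiskerRight x ↔ ∃ (A B D : C) (F₁ F₂ : Frac W A B) (G : Frac W B D)
      (r : Rep F₁ F₂), WhiskerRightGraph hW r G x (c F₁.f G.w G.mem) (c F₂.f G.w G.mem) := by
  simp only [Ops.Graph, fracOps_whiskerRight_eq_cls_iff]
  rfl

theorem fracOps_graph_associator_iff {x : Notion.associator.Var → Cell C} :
    (fracOps hW c).Graph .associator x ↔ ∃ (A B D E : C) (F : Frac W A B) (G : Frac W B D)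
      (H : Frac W D E), AssocGraph hW F G H x (c F.f G.w G.mem)
        (c ((c F.f G.w G.mem).f' ≫ G.f) H.w H.mem) (c G.f H.w H.mem)
        (c F.f ((c G.f H.w H.mem).v' ≫ G.w)
          (hW.comp_mem _ _ (c G.f H.w H.mem).mem G.mem)) := by
  simp only [Ops.Graph, fracOps_associator_eq_cls_iff]
  rfl

end Squares

/-! ### Definability of the whiskerings and of the associator. -/

section Definability

open FirstOrder Language

variable {L : FirstOrder.Language.{0, 0}} {T : Interp L}

namespace Elt

variable {C : Type u} [Bicategory.{w, v} C] {W : MorphismProperty C} {c : Choices W}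
  [L.Structure (Cell C)] {α : Type} {x : α → Cell C} {A B D E : C}
  {hW : Bicalculus W} {F : Frac W A B} {G : Frac W B D} {H : Frac W D E} {s : Square W F.f G.w}
  {t : Square W (s.f' ≫ G.f) H.w} {s' : Square W G.f H.w} {t' : Square W F.f (s'.v' ≫ G.w)}
  {ψ : L.Formula (Option α)}

instance compWith_w [h : Elt T c x (.one (s.v' ≫ F.w)) ψ] :
    Elt T c x (.one (Frac.compWith hW s).w) ψ := h

instance compWith_f [h : Elt T c x (.one (s.f' ≫ G.f)) ψ] :
    Elt T c x (.one (Frac.compWith hW s).f) ψ := h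

instance compLeft_w [h : Elt T c x (.one (t.v' ≫ s.v' ≫ F.w)) ψ] :
    Elt T c x (.one (Frac.compLeft hW s t).w) ψ := h

instance compLeft_f [h : Elt T c x (.one (t.f' ≫ H.f)) ψ] :
    Elt T c x (.one (Frac.compLeft hW s t).f) ψ := h

instance compRight_w [h : Elt T c x (.one (t'.v' ≫ F.w)) ψ] :
    Elt T c x (.one (Frac.compRight hW s' t').w) ψ := h

instance compRight_f [h : Elt T c x (.one (t'.f' ≫ s'.f' ≫ H.f)) ψ] :
    Elt T c x (.one (Frac.compRight hW s' t').f) ψ := h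

end Elt

set_option synthInstance.maxSize 10000 in
set_option synthInstance.maxHeartbeats 0 in
set_option maxHeartbeats 0 in
theorem exists_definesNotion_associator {φ₁ : L.Formula Notion.one.Var}
    {φ₂ : L.Formula Notion.two.Var} {φ₃ : L.Formula Notion.same.Var}
    (h₁ : DefinesNotion.{w, v, u} T .one φ₁) (h₂ : DefinesNotion.{w, v, u} T .two φ₂)
    (h₃ : DefinesNotion.{w, v, u} T .same φ₃) : ∃ φ, DefinesNotion.{w, v, u} T .associator φ := by
  apply Exists.intro
  intro C _ W hW c _ _ x
  rw [fracOps_graph_associator_iff]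
  iterate 4 (apply Defines.exists_obj; intro _ _ _)
  apply Defines.exists_frac h₁ hW
  intro F _ _ _ _
  apply Defines.exists_frac h₁ hW
  intro G _ _ _ _
  apply Defines.exists_frac h₁ hW
  intro H _ _ _ _
  -- The order matters: the pair for which `s₂` is chosen involves `s₁`, and that of `s₄` involves
  -- `s₃`.
  apply Defines.choice (P := fun s₁ => AssocGraph hW F G H x s₁ (c (s₁.f' ≫ G.f) H.w H.mem)
    (c G.f H.w H.mem) (c F.f ((c G.f H.w H.mem).v' ≫ G.w) _))
  intro s₁ _ _ _ _ _ _
  apply Defines.choice (P := fun s₂ => AssocGraph hW F G H x s₁ s₂ (c G.f H.w H.mem)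
    (c F.f ((c G.f H.w H.mem).v' ≫ G.w) _))
  intro s₂ _ _ _ _ _ _
  apply Defines.choice (P := fun s₃ => AssocGraph hW F G H x s₁ s₂ s₃
    (c F.f (s₃.v' ≫ G.w) (hW.comp_mem _ _ s₃.mem G.mem)))
  intro s₃ _ _ _ _ _ _
  apply Defines.choice (P := fun s₄ => AssocGraph hW F G H x s₁ s₂ s₃ s₄)
  intro s₄ _ _ _ _ _ _
  simp only [AssocGraph, eq_elim_iff, Frac.code, Rep.code, eq_vec₂_iff, eq_vec₄_iff,
    AssocData.exists_iff]
  apply Defines.exists_rep h₂ hW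
  intro _ _ _ _ _ _ _ _ _
  repeat' first
    | intro _
    | (with_reducible apply Defines.exists_obj; intro _ _ _)
    | (apply Defines.exists_mem; intro)
    | (apply Defines.exists_one; intro _ _ _)
    | (apply Defines.exists_iso; intro _ _ _)
    | apply Defines.and
    | apply Defines.eq_cell
    | apply Defines.eq_two
    | apply Defines.exists_proof
    | apply Defines.equiv h₃ hW
    | infer_instance
    | (dsimp only [AssocData.repWith, AssocData.α, AssocData.β, Frac.compLeft, Frac.compRight,
        bicategoricalComp, bicategoricalIsoComp, BicategoricalCoherence.iso, Iso.trans_hom, Iso.refl_hom, Iso.symm_hom,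
        whiskerLeftIso, whiskerRightIso]; infer_instance)

set_option synthInstance.maxSize 10000 in
set_option synthInstance.maxHeartbeats 0 in
set_option maxHeartbeats 0 in
theorem exists_definesNotion_whiskerLeft {φ₁ : L.Formula Notion.one.Var}
    {φ₂ : L.Formula Notion.two.Var} {φ₃ : L.Formula Notion.same.Var}
    (h₁ : DefinesNotion.{w, v, u} T .one φ₁) (h₂ : DefinesNotion.{w, v, u} T .two φ₂)
    (h₃ : DefinesNotion.{w, v, u} T .same φ₃) : ∃ φ, DefinesNotion.{w, v, u} T .whiskerLeft φ := by
  apply Exists.intro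
  intro C _ W hW c _ _ x
  rw [fracOps_graph_whiskerLeft_iff]
  iterate 3 (apply Defines.exists_obj; intro _ _ _)
  apply Defines.exists_frac h₁ hW
  intro F _ _ _ _
  apply Defines.exists_frac h₁ hW
  intro G₁ _ _ _ _
  apply Defines.exists_frac h₁ hW
  intro G₂ _ _ _ _
  apply Defines.exists_rep h₂ hW
  intro r _ _ _ _ _ _ _ _
  apply Defines.choice (P := fun s₁ => WhiskerLeftGraph hW F r x s₁ (c F.f G₂.w G₂.mem))
  intro s₁ _ _ _ _ _ _
  apply Defines.choice (P := fun s₂ => WhiskerLeftGraph hW F r x s₁ s₂)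
  intro s₂ _ _ _ _ _ _
  simp only [WhiskerLeftGraph, eq_elim_iff, Frac.code, Rep.code, eq_vec₂_iff, eq_vec₄_iff,
    WhiskerLeftData.exists_iff]
  apply Defines.exists_rep h₂ hW
  intro _ _ _ _ _ _ _ _ _
  repeat' first
    | intro _
    | (with_reducible apply Defines.exists_obj; intro _ _ _)
    | (apply Defines.exists_mem; intro)
    | (apply Defines.exists_one; intro _ _ _)
    | (apply Defines.exists_iso; intro _ _ _)
    | apply Defines.and
    | apply Defines.eq_cell
    | apply Defines.eq_two
    | apply Defines.exists_proof
    | apply Defines.equiv h₃ hW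
    | infer_instance
    | (dsimp only [WhiskerLeftData.repWith, WhiskerLeftData.α, WhiskerLeftData.β, Frac.compWith, bicategoricalComp,
        bicategoricalIsoComp, BicategoricalCoherence.iso, Iso.trans_hom, Iso.refl_hom, Iso.symm_hom,
        whiskerLeftIso, whiskerRightIso]; infer_instance)

set_option synthInstance.maxSize 10000 in
set_option synthInstance.maxHeartbeats 0 in
set_option maxHeartbeats 0 in
theorem exists_definesNotion_whiskerRight {φ₁ : L.Formula Notion.one.Var}
    {φ₂ : L.Formula Notion.two.Var} {φ₃ : L.Formula Notion.same.Var}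
    (h₁ : DefinesNotion.{w, v, u} T .one φ₁) (h₂ : DefinesNotion.{w, v, u} T .two φ₂)
    (h₃ : DefinesNotion.{w, v, u} T .same φ₃) : ∃ φ, DefinesNotion.{w, v, u} T .whiskerRight φ := by
  apply Exists.intro
  intro C _ W hW c _ _ x
  rw [fracOps_graph_whiskerRight_iff]
  iterate 3 (apply Defines.exists_obj; intro _ _ _)
  apply Defines.exists_frac h₁ hW
  intro F₁ _ _ _ _
  apply Defines.exists_frac h₁ hW
  intro F₂ _ _ _ _
  apply Defines.exists_frac h₁ hW
  intro G _ _ _ _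
  apply Defines.exists_rep h₂ hW
  intro r _ _ _ _ _ _ _ _
  apply Defines.choice (P := fun s₁ => WhiskerRightGraph hW r G x s₁ (c F₂.f G.w G.mem))
  intro s₁ _ _ _ _ _ _
  apply Defines.choice (P := fun s₂ => WhiskerRightGraph hW r G x s₁ s₂)
  intro s₂ _ _ _ _ _ _
  simp only [WhiskerRightGraph, eq_elim_iff, Frac.code, Rep.code, eq_vec₂_iff, eq_vec₄_iff,
    WhiskerRightData.exists_iff]
  apply Defines.exists_rep h₂ hW
  intro _ _ _ _ _ _ _ _ _
  repeat' first
    | intro _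
    | (with_reducible apply Defines.exists_obj; intro _ _ _)
    | (apply Defines.exists_mem; intro)
    | (apply Defines.exists_one; intro _ _ _)
    | (apply Defines.exists_iso; intro _ _ _)
    | (apply Defines.exists_two; intro _ _ _)
    | apply Defines.and
    | apply Defines.eq_cell
    | apply Defines.eq_two
    | apply Defines.exists_proof
    | apply Defines.equiv h₃ hW
    | infer_instance
    | (dsimp only [WhiskerRightData.repWith, WhiskerRightData.α, WhiskerRightData.β, Frac.compWith, bicategoricalComp,
        bicategoricalIsoComp, BicategoricalCoherence.iso, Iso.trans_hom, Iso.refl_hom, Iso.symm_hom,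
        whiskerLeftIso, whiskerRightIso]; infer_instance)

end Definability

/-! ### Definability of all the notions. -/

section Definability

open FirstOrder Language

variable {L : FirstOrder.Language.{0, 0}} (T : Interp L)

set_option synthInstance.maxSize 10000 in
set_option synthInstance.maxHeartbeats 0 in
set_option maxHeartbeats 0 in
theorem exists_definesNotion (k : Notion) : ∃ φ, DefinesNotion.{w, v, u} T k φ := by
  obtain ⟨φ₁, h₁⟩ := exists_definesNotion_one.{w, v, u} T
  obtain ⟨φ₂, h₂⟩ := exists_definesNotion_two.{w, v, u} T
  obtain ⟨φ₃, h₃⟩ := exists_definesNotion_same.{w, v, u} T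
  cases k
  case one => exact ⟨φ₁, h₁⟩
  case two => exact ⟨φ₂, h₂⟩
  case same => exact ⟨φ₃, h₃⟩
  case whiskerLeft => exact exists_definesNotion_whiskerLeft h₁ h₂ h₃
  case whiskerRight => exact exists_definesNotion_whiskerRight h₁ h₂ h₃
  case associator => exact exists_definesNotion_associator h₁ h₂ h₃
  all_goals
    apply Exists.intro
    intro C _ W hW c _ _ x
    simp only [Ops.Graph, Frac.exists_iff, Rep.exists_iff, fracOps_id₂_eq_cls_iff,
      fracOps_leftUnitor_eq_cls_iff, fracOps_rightUnitor_eq_cls_iff, fracOps_vcomp_eq_cls_iff,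
      VertData.exists_iff, Frac.code, Rep.code, eq_elim_iff, eq_vec₁_iff, eq_vec₂_iff, eq_vec₄_iff]
    try dsimp only [Frac.comp, Frac.id]
    repeat' first
      | (with_reducible apply Defines.exists_obj; intro _ _ _)
      | (apply Defines.exists_mem; intro)
      | (apply Defines.exists_one; intro _ _ _)
      | (apply Defines.exists_iso; intro _ _ _)
      | (apply Defines.exists_two; intro _ _ _)
      | apply Defines.and
      | apply Defines.eq_cell
      | apply Defines.equiv h₃ hW
      | infer_instance
      | (dsimp only [VertData.rep, Rep.id, Rep.leftUnitor, Rep.rightUnitor, Frac.comp, Frac.id,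
          bicategoricalIsoComp, bicategoricalComp, BicategoricalCoherence.iso, Iso.trans_hom,
          Iso.refl_hom, Iso.symm_hom, whiskerLeftIso, whiskerRightIso]; infer_instance)

/-- Formulas defining all the notions in all models of `T`. -/
theorem exists_definedBy : ∃ Φ : ∀ k : Notion, L.Formula k.Var,
    ∀ (C : Type u) [Bicategory.{w, v} C] (W : MorphismProperty C) (hW : Bicalculus W)
      (c : Choices W) (I : L.Structure (Cell C)), T.Models c → DefinedBy I Φ (fracOps hW c) := by
  choose Φ hΦ using exists_definesNotion.{w, v, u} T
  exact ⟨Φ, fun C _ W hW c I hT k x => (hΦ k C W hW c x).iff⟩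

end Definability

/-! ### Squares described without a symbol for the choices. -/

section Squares

variable {C : Type u} [Bicategory.{w, v} C] {W : MorphismProperty C}

namespace Symb

theorem exists_of_holds_comp {m₁ m₂ m₃ : Cell C} (h : Holds W .comp ![m₁, m₂, m₃]) :
    ∃ (A B D : C) (f : A ⟶ B) (g : B ⟶ D), m₁ = .one f ∧ m₂ = .one g ∧ m₃ = .one (f ≫ g) := by
  generalize hx : ![m₁, m₂, m₃] = x at h
  cases h
  exact ⟨_, _, _, _, _, congrFun hx 0, congrFun hx 1, congrFun hx 2⟩

theorem exists_of_holds_src {m : Cell C} {A B : C} {f : A ⟶ B} (h : Holds W .src ![m, .one f]) :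
    ∃ (g : A ⟶ B) (η : f ⟶ g), m = .two η := by
  generalize hx : ![m, .one f] = x at h
  cases h <;> cases congrFun hx 1
  exact ⟨_, _, congrFun hx 0⟩

theorem holds_tgt₂_iff {m : Cell C} {A B : C} {f g : A ⟶ B} {η : f ⟶ g} :
    Holds W .tgt ![.two η, m] ↔ m = .one g := by
  refine ⟨fun h => ?_, fun h => h ▸ .tgt₂ η⟩
  generalize hx : ![.two η, m] = x at h
  cases h <;> cases congrFun hx 0
  exact congrFun hx 1

/-- Expresses being a square by primitive notions only: `p`, `q` are the two composites, `n` is the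
inverse of the 2-cell, and `i`, `j` are identities. -/
theorem exists_square_iff {m₁ m₂ m₃ m₄ m₅ : Cell C} :
    (∃ p q n i j, Holds W .comp ![m₃, m₁, p] ∧ Holds W .comp ![m₄, m₂, q] ∧ Holds W .inW ![m₂] ∧
      Holds W .inW ![m₃] ∧ Holds W .src ![m₅, p] ∧ Holds W .tgt ![m₅, q] ∧ Holds W .id₂ ![p, i] ∧
      Holds W .id₂ ![q, j] ∧ Holds W .vcomp ![m₅, n, i] ∧ Holds W .vcomp ![n, m₅, j]) ↔
    ∃ (A' B B' : C) (f : A' ⟶ B) (v : B' ⟶ B) (s : Square W f v), W v ∧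
      ![m₁, m₂, m₃, m₄, m₅] = ![.one f, .one v, .one s.v', .one s.f', .two s.ρ.hom] := by
  constructor
  · rintro ⟨p, q, n, i, j, h₁, h₂, hv, hv', h₃, h₄, h₅⟩
    obtain ⟨D, A', B, v', f, rfl, rfl, rfl⟩ := exists_of_holds_comp h₁
    obtain ⟨D', B', B₁, f', v, rfl, rfl, rfl⟩ := exists_of_holds_comp h₂
    obtain ⟨g, η, rfl⟩ := exists_of_holds_src h₃
    have h₆ := holds_tgt₂_iff.1 h₄
    -- The target of the 2-cell is the second composite; comparing the two ways of seeing it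
    -- identifies the endpoints of both composites.
    injection h₆ with e₁ e₂ e₃
    subst e₁ e₂
    obtain rfl := eq_of_heq e₃
    obtain ⟨ρ, hρ⟩ := exists_iso_iff.1 ⟨⟨h₃, h₄⟩, n, i, j, h₅⟩
    rw [hρ]
    exact ⟨A', _, B', f, v, ⟨_, v', f', holds_inW_iff.1 hv', ρ⟩, holds_inW_iff.1 hv, rfl⟩
  · rintro ⟨A', B, B', f, v, s, hv, hx⟩
    obtain rfl : m₁ = _ := congrFun hx 0
    obtain rfl : m₂ = _ := congrFun hx 1
    obtain rfl : m₃ = _ := congrFun hx 2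
    obtain rfl : m₄ = _ := congrFun hx 3
    obtain rfl : m₅ = _ := congrFun hx 4
    obtain ⟨⟨h₁, h₂⟩, n, i, j, h₃⟩ := (exists_iso_iff (W := W)).2 ⟨s.ρ, rfl⟩
    exact ⟨_, _, n, i, j, .comp _ _, .comp _ _, .inW _ hv, .inW _ s.mem, h₁, h₂, h₃⟩

end Symb

end Squares

/-! ### The two interpretations of the primitive notions. -/

section Models

open FirstOrder Language

/-- The primitive notions, including the choices, as formulas. -/
def interpC : Interp LangC where
  rel s := Relations.formula (L := LangC) (SymbC.base s) Term.var
  choice := Relations.formula (L := LangC) SymbC.choice Term.var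

/-- A primitive notion as a formula. -/
def relFormula {n : ℕ} (s : Symb n) : Lang.Formula (Fin n) :=
  Relations.formula (L := Lang) s Term.var

/-- The primitive notions as formulas, where the choices are all squares. -/
noncomputable def interp : Interp Lang where
  rel := relFormula
  choice := Formula.iExs (Fin 5) (
    (relFormula .comp).relabel ![.inl 2, .inl 0, .inr 0] ⊓
    (relFormula .comp).relabel ![.inl 3, .inl 1, .inr 1] ⊓
    (relFormula .inW).relabel ![.inl 1] ⊓
    (relFormula .inW).relabel ![.inl 2] ⊓
    (relFormula .src).relabel ![.inl 4, .inr 0] ⊓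
    (relFormula .tgt).relabel ![.inl 4, .inr 1] ⊓
    (relFormula .id₂).relabel ![.inr 0, .inr 3] ⊓
    (relFormula .id₂).relabel ![.inr 1, .inr 4] ⊓
    (relFormula .vcomp).relabel ![.inl 4, .inr 2, .inr 3] ⊓
    (relFormula .vcomp).relabel ![.inr 2, .inl 4, .inr 4])

variable {C : Type u} [Bicategory.{w, v} C] {W : MorphismProperty C}

theorem models_interpC (c : Choices W) : @Interp.Models _ interpC _ _ _ c (strC c) := by
  let _ := strC c
  refine ⟨fun s x => ?_, fun x => ?_⟩
  · refine Formula.realize_rel.trans ⟨fun h => ?_, fun h => .base s x h⟩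
    cases h with
    | base _ _ h => exact h
  · refine Formula.realize_rel.trans ⟨fun h => ?_, ?_⟩
    · change SymbC.Holds c .choice x at h
      cases h with
      | choice f v h => exact ⟨_, _, _, f, v, h, rfl⟩
    · rintro ⟨A', B, B', f, v, h, rfl⟩
      exact .choice f v h

theorem realize_relFormula {n : ℕ} (s : Symb n) (x : Fin n → Cell C) :
    @Formula.Realize Lang (Cell C) (str W) _ (relFormula s) x ↔ s.Holds W x :=
  @Formula.realize_rel Lang (Cell C) (str W) _ _ _ _ _

/-- If every square is the chosen one, the relation of forming a square is the graph of `c`. -/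
theorem models_interp (c : Choices W) (hc : ∀ {A B D : C} (f : A ⟶ B) (k : D ⟶ B) (hk : W k)
    (s : Square W f k), s = c f k hk) : @Interp.Models _ interp _ _ _ c (str W) := by
  let _ := str W
  refine ⟨fun s x => realize_relFormula s x, fun x => ?_⟩
  have key : c.Graph x ↔ ∃ (A' B B' : C) (f : A' ⟶ B) (v : B' ⟶ B) (s : Square W f v), W v ∧
      ![x 0, x 1, x 2, x 3, x 4] = ![.one f, .one v, .one s.v', .one s.f', .two s.ρ.hom] := by
    have hx : ![x 0, x 1, x 2, x 3, x 4] = x := by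
      funext i
      fin_cases i <;> rfl
    rw [hx]
    constructor
    · rintro ⟨A', B, B', f, v, h, rfl⟩
      exact ⟨A', B, B', f, v, c f v h, h, rfl⟩
    · rintro ⟨A', B, B', f, v, s, h, rfl⟩
      refine ⟨A', B, B', f, v, h, ?_⟩
      rw [← hc f v h s]
  rw [key, ← Symb.exists_square_iff, interp, Formula.realize_iExs]
  simp only [Formula.realize_inf, Formula.realize_relabel, realize_relFormula, comp_vec₁, comp_vec₂,
    comp_vec₃, and_assoc, Sum.elim_inl, Sum.elim_inr]
  exact ⟨fun ⟨y, h⟩ => ⟨_, _, _, _, _, h⟩, fun ⟨p, q, n, i, j, h⟩ => ⟨![p, q, n, i, j], h⟩⟩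

end Models

end BicatFrac

/-! ### The theorem, for given and for unique choices. -/

namespace BicatFrac

theorem constructedBy {C : Type u} [Bicategory.{w, v} C] {W : MorphismProperty C}
    {L : FirstOrder.Language.{0, 0}} {I : L.Structure (Cell C)}
    {Φ : ∀ k : Notion, L.Formula k.Var} {hW : Bicalculus W} {c : Choices W}
    (h : DefinedBy I Φ (fracOps hW c)) : ConstructedBy I Φ hW c where
  equivalence := Rep.equivalence hW
  exists_ops := ⟨fracOps hW c, fracOps_isBicategory, fracOps_isGivenByAnyData,
    fun _ h' => h'.eq_of_any fracOps_isGivenByAnyData, h⟩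

end BicatFrac

theorem mainTheorem8 :
    (∃ Φ : ∀ k : BicatFrac.Notion, BicatFrac.LangC.Formula k.Var,
      ∀ (C : Type u) [Bicategory.{w, v} C] (W : MorphismProperty C)
        (hW : BicatFrac.Bicalculus W) (c : BicatFrac.Choices W),
        BicatFrac.ConstructedBy (BicatFrac.strC c) Φ hW c) ∧
    (∃ Φ : ∀ k : BicatFrac.Notion, BicatFrac.Lang.Formula k.Var,
      ∀ (C : Type u) [Bicategory.{w, v} C] (W : MorphismProperty C)
        (hW : BicatFrac.Bicalculus W),
        (∀ {A' B B' : C} (f : A' ⟶ B) (v : B' ⟶ B), W v →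
          Nonempty (Unique (BicatFrac.Square W f v))) →
        ∃ c : BicatFrac.Choices W, (∀ c' : BicatFrac.Choices W, c' = c) ∧
          BicatFrac.ConstructedBy (BicatFrac.str W) Φ hW c) := by
  refine ⟨?_, ?_⟩
  · obtain ⟨Φ, h⟩ := BicatFrac.exists_definedBy.{w, v, u} BicatFrac.interpC
    exact ⟨Φ, fun C _ W hW c => BicatFrac.constructedBy (h C W hW c _ (BicatFrac.models_interpC c))⟩
  · obtain ⟨Φ, h⟩ := BicatFrac.exists_definedBy.{w, v, u} BicatFrac.interp
    refine ⟨Φ, fun C _ W hW hu => ?_⟩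
    have hs : ∀ {A' B B' : C} (f : A' ⟶ B) (v : B' ⟶ B) (_ : W v)
        (s t : BicatFrac.Square W f v), s = t := fun f v hv s t => by
      obtain ⟨_⟩ := hu f v hv
      exact Subsingleton.elim s t
    -- Uniqueness of squares leaves this as the only set of choices.
    let c : BicatFrac.Choices W := fun A' B B' f v hv => (hu f v hv).some.default
    refine ⟨c, fun c' => ?_, BicatFrac.constructedBy (h C W hW c _
      (BicatFrac.models_interp c fun f v hv s => hs f v hv s _))⟩
    funext A' B B' f v hv
    exact hs f v hv _ _
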